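/- Let $p$ be a prime, let $S$ be an $\mathbb F_p$-scheme, let $V$ be a vector bundle of rank $3$ over $S$, and let $b\ge 0$ be an integer. Let $f:\mathbf P(V)\to S$ be the scheme of subbundles of rank $2$ of $V$ (a subbundle being a submodule that is locally free with locally free quotient), with tautological subbundle $\mathcal V_2\subset f^*V$. Let $F:\mathbf{Fl}(V)\to S$ be the scheme of complete flags of $V$, with tautological flag $0=\mathcal V_0\subset\mathcal V_1\subset\mathcal V_2\subset\mathcal V_3=F^*V$, and let $f_1:\mathbf{Fl}(V)\to\mathbf P(V)$ be the $S$-morphism that forgets $\mathcal V_1$. Put $\mathcal L_i=\mathcal V_i/\mathcal V_{i-1}$ and $\mathcal O(a_1,a_2,a_3)=\mathcal L_1^{\otimes a_1}\otimes\mathcal L_2^{\otimes a_2}\otimes\mathcal L_3^{\otimes a_3}$. For a vector bundle $E$ put $\Gamma^n(E)=\mathrm{Sym}^n(E^\vee)^\vee$, and for $E$ of rank $2$ put $\det^{-b}(E)=((\Lambda^2E)^\vee)^{\otimes b}$. For a local frame $(e_1,e_2)$ of $\mathcal V_2$ over an open $W\subset\mathbf P(V)$, let $(x,y)$ be the dual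 frame of $\mathcal V_2^\vee$ and let $\delta=(e_1\wedge e_2)^\vee$ be the section of $(\Lambda^2\mathcal V_2)^\vee$ dual to $e_1\wedge e_2$. Then: 1. There is a canonical isomorphism of $\mathcal O_{\mathbf P(V)}$-modules $$\theta:\ \Gamma^{2b}(\mathcal V_2)\otimes\det{}^{-b}(\mathcal V_2)\ \xrightarrow{\ \sim\ }\ R^1(f_1)_*\,\mathcal O(b+1,-b-1,0).$$ It is the unique isomorphism with the following property. Let $(e_1,e_2)$ be a frame of $\mathcal V_2$ over $W$, and let $f_1^{-1}(W)=A\cup B$ be an open covering such that $\mathcal L_1$ has a section $\ell_A=e_1+u\,e_2$ over $A$ and a section $\ell_B=w\,e_1+e_2$ over $B$ (with functions $u$ on $A$ and $w$ on $B$), and let $\lambda$ be the section of $\mathcal L_2^{\vee}$ over $A$ that takes the value $1$ on the image of $e_2$. Then, for $\gamma\in\Gamma^{2b}(\mathcal V_2)(W)$, $\theta$ sends $\gamma\otimes\delta^{b}$ to the class of the Čech $1$-cocycle $$\sum_{j=0}^{2b}\gamma(x^{2b-j}y^j)\,w^{j+1}\;\ell_A^{\,b+1}\otimes\lambda^{b+1}\qquad\text{on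 } A\cap B .$$ (Here a cocycle $t=\alpha-\beta$, with $\alpha$, $\beta$ sections over $A$, $B$ of the degree-$0$ term $I^0$ of an injective resolution $I^\bullet$, has as class that of the section of $I^1$ over $A\cup B$ glued from $d\alpha$ and $d\beta$.) 2. If $b+1$ is not of the form $p^s$ with $s\ge 0$, then $f_*\big(\Gamma^{2b}(\mathcal V_2)\otimes\det^{-b}(\mathcal V_2)\big)=0$. 3. If $b=p^s-1$ for some integer $s\ge 0$, then there is a canonical isomorphism of $\mathcal O_S$-modules $$\mathcal O_S\ \xrightarrow{\ \sim\ }\ f_*\big(\Gamma^{2b}(\mathcal V_2)\otimes\det{}^{-b}(\mathcal V_2)\big).$$ It is the unique isomorphism sending $1$ to the global section that, for every local frame $(e_1,e_2)$ of $\mathcal V_2$, equals $\gamma\otimes\delta^b$, where $\gamma$ is the linear form on $\mathrm{Sym}^{2b}(\mathcal V_2^\vee)$ that extracts the coefficient of $x^by^b$ (that is, $\gamma=[e_1]_b[e_2]_b$). -/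

import Mathlib

open CategoryTheory Limits AlgebraicGeometry TopologicalSpace Opposite
universe u
namespace FlagCohomology
section Ab5
variable {C : Type u} [SmallCategory C]

instance presheaf_ab5 (R : Cᵒᵖ ⥤ RingCat.{u}) : AB5OfSize.{u, u} (PresheafOfModules.{u} R) where
  ofShape J _ _ := by
    have : ReflectsFiniteLimits (PresheafOfModules.toPresheaf.{u} R) :=
      ⟨fun _ _ _ => inferInstance⟩
    exact HasExactColimitsOfShape.domain_of_functor J (PresheafOfModules.toPresheaf.{u} R)
end Ab5


/-- Sheafification of presheaves of modules. -/
noncomputable abbrev sheafify (X : Scheme.{u}) : X.PresheafOfModules ⥤ X.Modules :=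
  PresheafOfModules.sheafification (𝟙 X.ringCatSheaf.obj)

noncomputable abbrev sheafifyAdj (X : Scheme.{u}) :
    sheafify X ⊣ Scheme.Modules.toPresheafOfModules X ⋙
      PresheafOfModules.restrictScalars (𝟙 X.ringCatSheaf.obj) :=
  PresheafOfModules.sheafificationAdjunction (𝟙 X.ringCatSheaf.obj)

instance (X : Scheme.{u}) : AB5OfSize.{u, u} X.Modules where
  ofShape J _ _ := by
    exact (PresheafOfModules.sheafificationAdjunction
       (𝟙 X.ringCatSheaf.obj)).hasExactColimitsOfShape J
instance (X : Scheme.{u}) : HasSeparator X.Modules := by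
  have : ObjectProperty.IsSeparating (.ofObj (fun U : X.Opens =>
    (sheafify X).obj ((PresheafOfModules.free _).obj (yoneda.obj U)))) := by
    intro M N f g h
    apply (Scheme.Modules.toPresheafOfModules X).map_injective
    apply PresheafOfModules.freeYoneda.isSeparating
    rintro _ ⟨U⟩ a
    have := h _ (ObjectProperty.ofObj_apply _ U) (((PresheafOfModules.sheafificationAdjunction
       (𝟙 X.ringCatSheaf.obj)).homEquiv _ _).symm a)
    exact (Equiv.injective _ (((PresheafOfModules.sheafificationAdjunction
      (𝟙 X.ringCatSheaf.obj)).homEquiv_naturality_right_symm a f).trans (this.trans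
        ((PresheafOfModules.sheafificationAdjunction
          (𝟙 X.ringCatSheaf.obj)).homEquiv_naturality_right_symm a g).symm)))
  exact ⟨_, this.isSeparator_coproduct⟩

instance (X : Scheme.{u}) : IsGrothendieckAbelian.{u} X.Modules where


section
open TensorProduct
variable {R S : Type u} [CommRing R] [CommRing S] (σ : R →+* S)
  {M N : Type u} [AddCommGroup M] [Module R M] [AddCommGroup N] [Module S N]

theorem map_update {M N : Type u} {ι : Type*} [DecidableEq ι] (φ : M → N) (m : ι → M) (i : ι) (z : M) :
    (fun j => φ (Function.update m i z j)) = Function.update (fun j => φ (m j)) i (φ z) := by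
  ext j
  by_cases hj : j = i
  · subst hj; simp
  · simp [hj]

/-- The map induced on symmetric powers by a semilinear map. -/
noncomputable def symMap (ι : Type u) (φ : M →ₛₗ[σ] N) :
    SymmetricPower R ι M →+ SymmetricPower S ι N :=
  letI : Module R (SymmetricPower S ι N) := Module.compHom _ σ
  AddCon.lift _ (PiTensorProduct.lift (R := R)
    { toFun := fun m => SymmetricPower.tprod S fun i => φ (m i)
      map_update_add' := fun m i x y => by
        simp only [map_update, map_add, MultilinearMap.map_update_add]
      map_update_smul' := fun m i r x => by
        simp only [map_update, map_smulₛₗ, MultilinearMap.map_update_smul]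
        rfl } : (⨂[R] _, M) →ₗ[R] SymmetricPower S ι N).toAddMonoidHom
    (by
      refine AddCon.addConGen_le.2 ?_
      rintro _ _ ⟨e, f⟩
      simp only [AddCon.ker_rel, LinearMap.toAddMonoidHom_coe, PiTensorProduct.lift.tprod,
        MultilinearMap.coe_mk]
      exact (SymmetricPower.tprod_equiv e fun i => φ (f i)).symm)

theorem symMap_smul_tprod (ι : Type u) (φ : M →ₛₗ[σ] N) (r : R) (m : ι → M) :
    symMap σ ι φ (r • SymmetricPower.tprod R m) =
      σ r • SymmetricPower.tprod S fun i => φ (m i) := by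
  let _ : Module R (SymmetricPower S ι N) := Module.compHom _ σ
  change PiTensorProduct.lift (R := R) _ (r • PiTensorProduct.tprod R m) = _
  rw [map_smul, PiTensorProduct.lift.tprod]
  rfl

theorem sym_induction {ι : Type u} {P : SymmetricPower R ι M → Prop}
    (h₁ : ∀ (r : R) (m : ι → M), P (r • SymmetricPower.tprod R m))
    (h₂ : ∀ x y, P x → P y → P (x + y)) (x : SymmetricPower R ι M) : P x := by
  obtain ⟨y, rfl⟩ : ∃ y, SymmetricPower.mk R ι M y = x := by
    have := SymmetricPower.range_mk R ι M
    exact LinearMap.range_eq_top.1 this x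
  induction y using PiTensorProduct.induction_on with
  | smul_tprod r m => rw [map_smul]; exact h₁ r m
  | add x y hx hy => rw [map_add]; exact h₂ _ _ hx hy

theorem symMap_smul (ι : Type u) (φ : M →ₛₗ[σ] N) (r : R) (x : SymmetricPower R ι M) :
    symMap σ ι φ (r • x) = σ r • symMap σ ι φ x := by
  induction x using sym_induction with
  | h₁ s m => rw [smul_smul, symMap_smul_tprod, symMap_smul_tprod, map_mul, smul_smul]
  | h₂ x y hx hy => rw [smul_add, map_add, hx, hy, map_add, smul_add]

/-- The map induced on exterior powers by a semilinear map. -/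
noncomputable def extMap (n : ℕ) (φ : M →ₛₗ[σ] N) : (⋀[R]^n M) →+ (⋀[S]^n N) :=
  letI : Module R (⋀[S]^n N) := Module.compHom _ σ
  (exteriorPower.alternatingMapLinearEquiv (R := R) (N := ⋀[S]^n N)
    { toFun := fun m => exteriorPower.ιMulti S n fun i => φ (m i)
      map_update_add' := fun m i x y => by
        simp only [map_update, map_add, AlternatingMap.map_update_add]
      map_update_smul' := fun m i r x => by
        simp only [map_update, map_smulₛₗ, AlternatingMap.map_update_smul]
        rfl
      map_eq_zero_of_eq' := fun m i j h hij =>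
        AlternatingMap.map_eq_zero_of_eq _ _ (by simp [h]) hij }).toAddMonoidHom

theorem extMap_smul (n : ℕ) (φ : M →ₛₗ[σ] N) (r : R) (x : ⋀[R]^n M) :
    extMap σ n φ (r • x) = σ r • extMap σ n φ x := by
  let _ : Module R (⋀[S]^n N) := Module.compHom _ σ
  exact map_smul (exteriorPower.alternatingMapLinearEquiv (R := R) (N := ⋀[S]^n N) _) r x

theorem extMap_ιMulti (n : ℕ) (φ : M →ₛₗ[σ] N) (m : Fin n → M) :
    extMap σ n φ (exteriorPower.ιMulti R n m) = exteriorPower.ιMulti S n fun i => φ (m i) := by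
  let _ : Module R (⋀[S]^n N) := Module.compHom _ σ
  exact exteriorPower.alternatingMapLinearEquiv_apply_ιMulti (R := R) (N := ⋀[S]^n N) _ m

theorem ext_induction {n : ℕ} {P : (⋀[R]^n M) → Prop}
    (h₁ : ∀ (r : R) (m : Fin n → M), P (r • exteriorPower.ιMulti R n m))
    (h₂ : ∀ x y, P x → P y → P (x + y)) (x : ⋀[R]^n M) : P x := by
  have hx : x ∈ Submodule.span R (Set.range (exteriorPower.ιMulti R n (M := M))) := by
    rw [exteriorPower.ιMulti_span]; trivial
  suffices h : ∀ a : R, P (a • x) by simpa using h 1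
  induction hx using Submodule.span_induction with
  | mem x h => obtain ⟨m, rfl⟩ := h; exact fun a => h₁ a m
  | zero => intro a; simpa using h₁ 0 0
  | add x y _ _ hx hy => intro a; rw [smul_add]; exact h₂ _ _ (hx a) (hy a)
  | smul b x _ hx => intro a; rw [smul_smul]; exact hx _
end

open Scheme.Modules
variable {X : Scheme.{u}}

/-- Restriction of functions. -/
noncomputable def resO {U V : X.Opens} (h : U ≤ V) : Γ(X, V) →+* Γ(X, U) :=
  (X.presheaf.map (homOfLE h).op).hom

theorem resO_refl (U : X.Opens) (r : Γ(X, U)) : resO (le_refl U) r = r := by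
  simp [resO]

theorem resO_resO {U V W : X.Opens} (h : U ≤ V) (h' : V ≤ W) (r : Γ(X, W)) :
    resO h (resO h' r) = resO (h.trans h') r := by
  simp only [resO]
  rw [← CommRingCat.comp_apply, ← Functor.map_comp, ← op_comp, homOfLE_comp]

/-- Restriction of sections of a sheaf of modules. -/
noncomputable def res {M : X.Modules} {U V : X.Opens} (h : U ≤ V) : Γ(M, V) →ₛₗ[resO h] Γ(M, U) where
  toFun := M.presheaf.map (homOfLE h).op
  map_add' := map_add _
  map_smul' := Scheme.Modules.map_smul M (homOfLE h)

theorem res_refl {M : X.Modules} (U : X.Opens) (m : Γ(M, U)) : res (le_refl U) m = m := by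
  simp [res]

theorem res_res {M : X.Modules} {U V W : X.Opens} (h : U ≤ V) (h' : V ≤ W) (m : Γ(M, W)) :
    res h (res h' m) = res (h.trans h') m := by
  change (M.presheaf.map (homOfLE h).op) ((M.presheaf.map (homOfLE h').op) m) =
    (M.presheaf.map (homOfLE (h.trans h')).op) m
  rw [← AddCommGrpCat.comp_apply, ← Functor.map_comp, ← op_comp, homOfLE_comp]

/-- A presheaf of modules given by modules `F U` and semilinear restriction maps. -/
noncomputable def presheafOfRes (F : X.Opens → Type u) [∀ U, AddCommGroup (F U)]
    [hF : ∀ U, Module Γ(X, U) (F U)] (r : ∀ {U V : X.Opens}, U ≤ V → F V →+ F U)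
    (hid : ∀ U x, r (le_refl U) x = x)
    (hcomp : ∀ {U V W : X.Opens} (h : U ≤ V) (h' : V ≤ W) x, r h (r h' x) = r (h.trans h') x)
    (hsmul : ∀ {U V : X.Opens} (h : U ≤ V) (a : Γ(X, V)) (x : F V),
      r h (a • x) = resO h a • r h x) : X.PresheafOfModules :=
  @PresheafOfModules.ofPresheaf _ _ X.ringCatSheaf.obj
    { obj := fun U => AddCommGrpCat.of (F U.unop)
      map := fun f => AddCommGrpCat.ofHom (r (leOfHom f.unop))
      map_id := fun U => by ext x; exact hid _ x
      map_comp := fun f g => by ext x; exact (hcomp _ _ x).symm }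
    (fun U => hF U.unop) (fun _ _ f a x => hsmul (leOfHom f.unop) a x)

/-- The presheaf `U ↦ Sym^n M(U)`. -/
noncomputable def symPresheaf (M : X.Modules) (n : ℕ) : X.PresheafOfModules :=
  presheafOfRes (fun U => SymmetricPower Γ(X, U) (ULift.{u} (Fin n)) Γ(M, U))
    (fun h => symMap (resO h) _ (res h))
    (fun U x => by
      induction x using sym_induction with
      | h₁ r m => rw [symMap_smul_tprod]; simp only [resO_refl, res_refl]
      | h₂ x y hx hy => rw [map_add, hx, hy])
    (fun h h' x => by
      induction x using sym_induction with
      | h₁ r m => simp only [symMap_smul_tprod, resO_resO, res_res]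
      | h₂ x y hx hy => simp only [map_add, hx, hy])
    (fun h a x => symMap_smul _ _ _ a x)

/-- The presheaf `U ↦ Λ^n M(U)`. -/
noncomputable def extPresheaf (M : X.Modules) (n : ℕ) : X.PresheafOfModules :=
  presheafOfRes (fun U => ⋀[Γ(X, U)]^n Γ(M, U))
    (fun h => extMap (resO h) _ (res h))
    (fun U x => by
      induction x using ext_induction with
      | h₁ r m => rw [extMap_smul, extMap_ιMulti]; simp only [resO_refl, res_refl]
      | h₂ x y hx hy => rw [map_add, hx, hy])
    (fun h h' x => by
      induction x using ext_induction with
      | h₁ r m => simp only [extMap_smul, extMap_ιMulti, resO_resO, res_res]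
      | h₂ x y hx hy => simp only [map_add, hx, hy])
    (fun h a x => extMap_smul _ _ _ a x)

/-- The presheaf `U ↦ M(U) ⊗ N(U)`. -/
noncomputable def tensorPresheaf (M N : X.Modules) : X.PresheafOfModules :=
  PresheafOfModules.Monoidal.tensorObj (R := X.presheaf) M.val N.val


/-- The section of the associated sheaf defined by a section of a presheaf of modules. -/
noncomputable def toSh (P : X.PresheafOfModules) (U : X.Opens) (s : P.obj (op U)) :
    Γ((sheafify X).obj P, U) :=
  ((sheafifyAdj X).unit.app P).app (op U) s

/-- The structure sheaf as a module. -/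
noncomputable abbrev unitModule (X : Scheme.{u}) : X.Modules := SheafOfModules.unit X.ringCatSheaf

/-- The tensor product. -/
noncomputable def tensor (M N : X.Modules) : X.Modules := (sheafify X).obj (tensorPresheaf M N)

/-- The section `m ⊗ n`. -/
noncomputable def tmul {M N : X.Modules} {U : X.Opens} (m : Γ(M, U)) (n : Γ(N, U)) :
    Γ(tensor M N, U) :=
  toSh (tensorPresheaf M N) U (TensorProduct.tmul Γ(X, U) m n)

/-- The symmetric power `Sym^n(M)`. -/
noncomputable def symPow (M : X.Modules) (n : ℕ) : X.Modules := (sheafify X).obj (symPresheaf M n)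

/-- The product of `n` sections in `Sym^n(M)`. -/
noncomputable def symMul {M : X.Modules} {U : X.Opens} {n : ℕ} (m : Fin n → Γ(M, U)) :
    Γ(symPow M n, U) :=
  toSh (symPresheaf M n) U (SymmetricPower.tprod Γ(X, U) fun i => m i.down)

/-- The exterior power `Λ^n(M)`. -/
noncomputable def extPow (M : X.Modules) (n : ℕ) : X.Modules := (sheafify X).obj (extPresheaf M n)

/-- The section `m₁ ∧ ⋯ ∧ mₙ`. -/
noncomputable def wedge {M : X.Modules} {U : X.Opens} {n : ℕ} (m : Fin n → Γ(M, U)) :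
    Γ(extPow M n, U) :=
  toSh (extPresheaf M n) U (exteriorPower.ιMulti Γ(X, U) n m)

/-- The tensor power `M^(⊗ n)`. -/
noncomputable def tpow (M : X.Modules) : ℕ → X.Modules
  | 0 => unitModule X
  | n + 1 => tensor (tpow M n) M

/-- The section `m ⊗ ⋯ ⊗ m`. -/
noncomputable def tpowSec {M : X.Modules} {U : X.Opens} (m : Γ(M, U)) : ∀ n : ℕ, Γ(tpow M n, U)
  | 0 => (1 : Γ(X, U))
  | n + 1 => tmul (tpowSec m n) m

/-- Local sections of the dual. -/
structure DualSection (M : X.Modules) (U : X.Opens) where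
  toFun : ∀ W : X.Opens, W ≤ U → Γ(M, W) →ₗ[Γ(X, W)] Γ(X, W)
  compat : ∀ (W W' : X.Opens) (h : W ≤ U) (h' : W' ≤ W) (m : Γ(M, W)),
    toFun W' (h'.trans h) (res h' m) = resO h' (toFun W h m)

namespace DualSection
variable {M : X.Modules} {U V : X.Opens}

@[ext] theorem ext {φ ψ : DualSection M U} (h : ∀ W hW m, φ.toFun W hW m = ψ.toFun W hW m) : φ = ψ := by
  cases φ; cases ψ
  congr
  ext W hW m
  exact h W hW m

noncomputable instance : Zero (DualSection M U) := ⟨⟨fun _ _ => 0, by simp⟩⟩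
noncomputable instance : Add (DualSection M U) :=
  ⟨fun φ ψ => ⟨fun W h => φ.toFun W h + ψ.toFun W h, by
    intro W V h k m; simp [φ.compat W V h k m, ψ.compat W V h k m]⟩⟩
noncomputable instance : Neg (DualSection M U) :=
  ⟨fun φ => ⟨fun W h => -φ.toFun W h, by intro W V h k m; simp [φ.compat W V h k m]⟩⟩
noncomputable instance : SMul Γ(X, U) (DualSection M U) :=
  ⟨fun a φ => ⟨fun W h => resO h a • φ.toFun W h, by
    intro W V h k m; simp [φ.compat W V h k m, resO_resO]⟩⟩

@[simp] theorem zero_toFun (W : X.Opens) (h : W ≤ U) : (0 : DualSection M U).toFun W h = 0 := rfl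
@[simp] theorem add_toFun (φ ψ : DualSection M U) (W : X.Opens) (h : W ≤ U) :
    (φ + ψ).toFun W h = φ.toFun W h + ψ.toFun W h := rfl
@[simp] theorem neg_toFun (φ : DualSection M U) (W : X.Opens) (h : W ≤ U) :
    (-φ).toFun W h = -φ.toFun W h := rfl
@[simp] theorem smul_toFun (a : Γ(X, U)) (φ : DualSection M U) (W : X.Opens) (h : W ≤ U) :
    (a • φ).toFun W h = resO h a • φ.toFun W h := rfl

noncomputable instance : AddCommGroup (DualSection M U) where
  add_assoc _ _ _ := by ext; simp [add_assoc]
  zero_add _ := by ext; simp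
  add_zero _ := by ext; simp
  nsmul := nsmulRec
  zsmul := zsmulRec
  neg_add_cancel _ := by ext; simp
  add_comm _ _ := by ext; simp [add_comm]

noncomputable instance : Module Γ(X, U) (DualSection M U) where
  one_smul _ := by ext; simp
  mul_smul _ _ _ := by ext; simp [mul_assoc]
  smul_zero _ := by ext; simp
  smul_add _ _ _ := by ext; simp
  add_smul _ _ _ := by ext; simp [add_mul]
  zero_smul _ := by ext; simp

/-- Restriction. -/
noncomputable def restr (h : U ≤ V) : DualSection M V →+ DualSection M U where
  toFun φ := ⟨fun W hW => φ.toFun W (hW.trans h), fun W W' hW h' m => φ.compat W W' (hW.trans h) h' m⟩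
  map_zero' := rfl
  map_add' _ _ := rfl

end DualSection

noncomputable def dualPresheaf (M : X.Modules) : X.PresheafOfModules :=
  presheafOfRes (fun U => DualSection M U) DualSection.restr (fun _ _ => rfl) (fun _ _ _ => rfl)
    (fun h a φ => by ext W hW m; simp [DualSection.restr, resO_resO])

theorem eq_of_resO_eq {ι : Type u} (U : ι → X.Opens) {W : X.Opens} (hW : W ≤ iSup U)
    {a b : Γ(X, W)} (h : ∀ i, resO (inf_le_left : W ⊓ U i ≤ W) a = resO inf_le_left b) : a = b := by
  refine X.sheaf.eq_of_locally_eq' (fun i => W ⊓ U i) W (fun i => homOfLE inf_le_left) ?_ a b h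
  rw [← inf_iSup_eq]
  exact le_inf le_rfl hW

theorem exists_glue {ι : Type u} (U : ι → X.Opens) {W : X.Opens} (hW : W ≤ iSup U)
    (a : ∀ i, Γ(X, W ⊓ U i))
    (h : ∀ i j, resO (inf_le_inf_left W inf_le_left : W ⊓ (U i ⊓ U j) ≤ W ⊓ U i) (a i) =
      resO (inf_le_inf_left W inf_le_right) (a j)) :
    ∃ b : Γ(X, W), ∀ i, resO inf_le_left b = a i := by
  obtain ⟨b, hb, -⟩ := X.sheaf.existsUnique_gluing' (fun i => W ⊓ U i) W
    (fun i => homOfLE inf_le_left)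
    (by rw [← inf_iSup_eq]; exact le_inf le_rfl hW) a (by
      intro i j
      have := congrArg (resO (show (W ⊓ U i) ⊓ (W ⊓ U j) ≤ W ⊓ (U i ⊓ U j) from
        le_inf (inf_le_left.trans inf_le_left) (inf_le_inf inf_le_right inf_le_right))) (h i j)
      rwa [resO_resO, resO_resO] at this)
  exact ⟨b, hb⟩

theorem dualPresheaf_isSheaf (M : X.Modules) :
    TopCat.Presheaf.IsSheaf (dualPresheaf M).presheaf := by
  refine (TopCat.Presheaf.isSheaf_iff_isSheaf_comp (forget Ab) _).2 ?_
  refine TopCat.Presheaf.isSheaf_of_isSheafUniqueGluing_types _ ?_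
  intro ι U sf hsf
  change ∀ i, DualSection M (U i) at sf
  have hsf' : ∀ i j, DualSection.restr (inf_le_left : U i ⊓ U j ≤ U i) (sf i) =
    DualSection.restr inf_le_right (sf j) := hsf
  have key : ∀ W, W ≤ iSup U → ∀ m : Γ(M, W), ∃ b : Γ(X, W), ∀ i, resO inf_le_left b =
      (sf i).toFun (W ⊓ U i) inf_le_right (res inf_le_left m) := by
    intro W hW m
    refine exists_glue U hW _ fun i j => ?_
    rw [← (sf i).compat, ← (sf j).compat, res_res, res_res]
    have := congrArg (fun φ => φ.toFun (W ⊓ (U i ⊓ U j)) inf_le_right (res inf_le_left m))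
      (hsf' i j)
    exact this
  choose b hb using key
  refine ⟨⟨fun W hW => ⟨⟨b W hW, ?_⟩, ?_⟩, ?_⟩, ?_, ?_⟩
  · intro m n
    refine eq_of_resO_eq U hW fun i => ?_
    simp only [map_add, hb]
  · intro a m
    refine eq_of_resO_eq U hW fun i => ?_
    simp only [smul_eq_mul, map_mul, hb, RingHom.id_apply, map_smulₛₗ]
  · intro W W' h h' m
    refine eq_of_resO_eq U (h'.trans h) fun i => ?_
    change resO _ (b W' _ _) = resO _ (resO _ (b W _ _))
    rw [hb, resO_resO, ← resO_resO (inf_le_inf_right (U i) h') inf_le_left, hb, ← (sf i).compat,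
      res_res, res_res]
  · intro i
    change DualSection.restr (le_iSup U i) _ = _
    ext W hW m
    change b W _ m = _
    refine eq_of_resO_eq U (hW.trans (le_iSup U i)) fun j => ?_
    rw [hb, ← (sf i).compat]
    exact (congrArg (fun φ => φ.toFun (W ⊓ U j) (inf_le_inf_right _ hW) (res inf_le_left m))
      (hsf' i j)).symm
  · intro φ hφ
    change DualSection M (iSup U) at φ
    have hφ' : ∀ i, DualSection.restr (le_iSup U i) φ = sf i := hφ
    refine DualSection.ext fun W hW m => ?_
    change _ = b W _ m
    refine eq_of_resO_eq U hW fun i => ?_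
    rw [hb, ← φ.compat, ← hφ' i]
    rfl

/-- The dual `U ↦ Hom(M|_U, O_U)`. -/
noncomputable def dual (M : X.Modules) : X.Modules where
  val := dualPresheaf M
  isSheaf := dualPresheaf_isSheaf M

/-- The value of a section of the dual. -/
noncomputable def ev {M : X.Modules} {U : X.Opens} (φ : Γ(dual M, U)) (m : Γ(M, U)) : Γ(X, U) :=
  DualSection.toFun (M := M) (U := U) φ U le_rfl m

/-- The higher direct image `R¹f_*`: the first right derived functor of `f_*`. -/
noncomputable abbrev R1 {X Y : Scheme.{u}} (f : X ⟶ Y) : X.Modules ⥤ Y.Modules :=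
   (Scheme.Modules.pushforward f).rightDerived 1


/-- `ξ ∈ Γ(W, R¹f_* M)` is the image of the Čech 1-cocycle `t ∈ Γ(A ∩ B, M)` for the covering
`f⁻¹(W) = A ∪ B`: computing `R¹f_* M` by an injective resolution `M → I⁰ → I¹ → ⋯`, write
`t = a - b` with `a ∈ Γ(A, I⁰)`, `b ∈ Γ(B, I⁰)`; then `ξ` is the class of the cycle `z` of
`f_* I¹` over `W` obtained by gluing `da` and `db`. -/
def IsCechClass {X Y : Scheme.{u}} (f : X ⟶ Y) {M : X.Modules} {W : Y.Opens} {A B : X.Opens}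
    (hAB : A ⊔ B = f ⁻¹ᵁ W) (t : Γ(M, A ⊓ B)) (ξ : Γ((R1 f).obj M, W)) : Prop :=
  ∃ (I : InjectiveResolution M) (a : Γ(I.cocomplex.X 0, A)) (b : Γ(I.cocomplex.X 0, B))
    (z : Γ((((pushforward f).mapHomologicalComplex _).obj I.cocomplex).cycles 1, W)),
    Hom.app (I.ι.f 0) (A ⊓ B) t =
      res (M := I.cocomplex.X 0) inf_le_left a - res (M := I.cocomplex.X 0) inf_le_right b ∧
    Hom.app (I.cocomplex.d 0 1) A a = res (M := I.cocomplex.X 1) (hAB ▸ le_sup_left)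
      (Hom.app ((((pushforward f).mapHomologicalComplex _).obj I.cocomplex).iCycles 1) W z) ∧
    Hom.app (I.cocomplex.d 0 1) B b = res (M := I.cocomplex.X 1) (hAB ▸ le_sup_right)
      (Hom.app ((((pushforward f).mapHomologicalComplex _).obj I.cocomplex).iCycles 1) W z) ∧
    Hom.app (I.isoRightDerivedObj (pushforward f) 1).hom W ξ =
      Hom.app ((((pushforward f).mapHomologicalComplex _).obj I.cocomplex).homologyπ 1) W z

/-- `M` is locally free of rank `n`. -/
def HasRank (M : X.Modules) (n : ℕ) : Prop :=
  ∀ x : X, ∃ U : X.Opens, x ∈ U ∧ Nonempty (M.restrict U.ι ≅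
    SheafOfModules.free (R := (U : Scheme.{u}).ringCatSheaf) (ULift.{u} (Fin n)))

/-- `M` is locally free of finite rank. -/
def IsVectorBundle (M : X.Modules) : Prop :=
  ∀ x : X, ∃ (U : X.Opens) (n : ℕ), x ∈ U ∧ Nonempty (M.restrict U.ι ≅
    SheafOfModules.free (R := (U : Scheme.{u}).ringCatSheaf) (ULift.{u} (Fin n)))

/-- Flags `Z₀ ⊆ Z₁ ⊆ ⋯` of subbundles of `E`, of ranks `n₀, n₁, …`. -/
structure IsFlag {E : X.Modules} {k : ℕ} (n : Fin k → ℕ) (Z : Fin k → Subobject E) : Prop where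
  monotone : Monotone Z
  rank (i : Fin k) : HasRank (Z i : X.Modules) (n i)
  quotient (i : Fin k) : IsVectorBundle (cokernel (Z i).arrow)

section pull
variable {T X S : Scheme.{u}} {g : T ⟶ X} {π : X ⟶ S} {t : T ⟶ S}

/-- The canonical isomorphism `g^* π^* V ≅ t^* V`, where `t = π ∘ g`. -/
noncomputable def pullIso (h : g ≫ π = t) (V : S.Modules) :
    (Scheme.Modules.pullback g).obj ((Scheme.Modules.pullback π).obj V) ≅ (Scheme.Modules.pullback t).obj V :=
  (pullbackComp g π).app V ≪≫ (pullbackCongr h).app V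

/-- The pullback of a subobject of `π^* V` along `g`, as a subobject of `t^* V`. -/
noncomputable def pullSub (h : g ≫ π = t) {V : S.Modules} (Z : Subobject ((Scheme.Modules.pullback π).obj V)) :
    Subobject ((Scheme.Modules.pullback t).obj V) :=
  imageSubobject ((Scheme.Modules.pullback g).map Z.arrow ≫ (pullIso h V).hom)

/-- The pullback of a local section of `π^* V` along `g`, as a local section of `t^* V`. -/
noncomputable def pullSec (h : g ≫ π = t) {V : S.Modules} {W : X.Opens}
    (s : Γ((Scheme.Modules.pullback π).obj V, W)) : Γ((Scheme.Modules.pullback t).obj V, g ⁻¹ᵁ W) :=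
  Hom.app (pullIso h V).hom (g ⁻¹ᵁ W)
    (Hom.app ((pullbackPushforwardAdjunction g).unit.app ((Scheme.Modules.pullback π).obj V)) W s)
end pull

/-- The scheme `π : Fl(n₀, n₁, …; V) → S` of flags of subbundles of `V` of ranks `n₀, n₁, …`, with
its tautological flag in `π^* V`: for `t : T → S`, the `S`-morphisms `T → Fl` correspond to the
flags in `t^* V`, by pulling back the tautological flag. -/
structure FlagScheme {S : Scheme.{u}} (V : S.Modules) {k : ℕ} (n : Fin k → ℕ) where
  X : Scheme.{u}
  π : X ⟶ S
  taut : Fin k → Subobject ((Scheme.Modules.pullback π).obj V)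
  isFlag : IsFlag n taut
  universal {T : Scheme.{u}} (t : T ⟶ S) (Z : Fin k → Subobject ((Scheme.Modules.pullback t).obj V))
    (hZ : IsFlag n Z) : ∃! g : T ⟶ X, ∃ h : g ≫ π = t, ∀ i, pullSub h (taut i) = Z i

/-- A frame `(e₁, e₂)` of `M` over `W`, with its dual frame `(x, y)`. -/
structure Frame (M : X.Modules) (W : X.Opens) where
  e₁ : Γ(M, W)
  e₂ : Γ(M, W)
  x : Γ(dual M, W)
  y : Γ(dual M, W)
  x_e₁ : ev x e₁ = 1
  x_e₂ : ev x e₂ = 0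
  y_e₁ : ev y e₁ = 0
  y_e₂ : ev y e₂ = 1
  span {U : X.Opens} (h : U ≤ W) (m : Γ(M, U)) :
    m = ev (res h x) m • res h e₁ + ev (res h y) m • res h e₂

/-- The product `x^(n-j) y^j` in `Sym^n(M^∨)`. -/
noncomputable def Frame.monomial {M : X.Modules} {W : X.Opens} (φ : Frame M W) (n j : ℕ) :
    Γ(symPow (dual M) n, W) :=
  symMul fun k => if (k : ℕ) < j then φ.y else φ.x

/-- Divided powers of a vector bundle: `Γ^n(M) = Sym^n(M^∨)^∨`. -/
noncomputable def divPow (M : X.Modules) (n : ℕ) : X.Modules := dual (symPow (dual M) n)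

/-- The negative tensor power `L^(-n)` of a line bundle. -/
noncomputable def negPow (L : X.Modules) (n : ℕ) : X.Modules := tpow (dual L) n

section rankThree
variable {S : Scheme.{u}} {V : S.Modules} (Fl : FlagScheme V ![1, 2, 3]) (P : FlagScheme V ![2])

/-- `f₁ : Fl(V) → P(V) = Fl(2, V)`, forgetting the pieces of ranks `1` and `3`. -/
noncomputable def forgetFlag : Fl.X ⟶ P.X :=
  (P.universal Fl.π (fun _ => Fl.taut 1)
    ⟨monotone_const, fun i => by fin_cases i; exact Fl.isFlag.rank 1,
      fun _ => Fl.isFlag.quotient 1⟩).choose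

theorem forgetFlag_comp : forgetFlag Fl P ≫ P.π = Fl.π :=
  (P.universal Fl.π (fun _ => Fl.taut 1)
    ⟨monotone_const, fun i => by fin_cases i; exact Fl.isFlag.rank 1,
      fun _ => Fl.isFlag.quotient 1⟩).choose_spec.1.choose

/-- The tautological subbundle `𝒱₂` of rank `2` over `P(V)`. -/
noncomputable def tautTwo : P.X.Modules := (P.taut 0 : P.X.Modules)

/-- The bundle `Γ^n(𝒱₂) ⊗ det^(-b)(𝒱₂)` over `P(V)`. -/
noncomputable def gammaDet (n b : ℕ) : P.X.Modules :=
  tensor (divPow (tautTwo P) n) (negPow (extPow (tautTwo P) 2) b)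

/-- `ℒ₁ = 𝒱₁` (as `𝒱₀ = 0`). -/
noncomputable def lineOne : Fl.X.Modules := (Fl.taut 0 : Fl.X.Modules)

/-- `ℒ₂ = 𝒱₂ / 𝒱₁`. -/
noncomputable def lineTwo : Fl.X.Modules :=
  cokernel (Subobject.ofLE (Fl.taut 0) (Fl.taut 1) (Fl.isFlag.monotone (by decide)))

/-- `ℒ₃ = 𝒱₃ / 𝒱₂`. -/
noncomputable def lineThree : Fl.X.Modules :=
  cokernel (Subobject.ofLE (Fl.taut 1) (Fl.taut 2) (Fl.isFlag.monotone (by decide)))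

/-- The projection `𝒱₂ → ℒ₂`. -/
noncomputable def projTwo : (Fl.taut 1 : Fl.X.Modules) ⟶ lineTwo Fl := cokernel.π _

/-- `𝒪(m, -n, k) = ℒ₁^m ⊗ ℒ₂^(-n) ⊗ ℒ₃^k`. -/
noncomputable def flagLine (m n k : ℕ) : Fl.X.Modules :=
  tensor (tpow (lineOne Fl) m) (tensor (negPow (lineTwo Fl) n) (tpow (lineThree Fl) k))

/-- A section of `𝒱₂` over `W ⊆ P(V)`, seen as a section of the pullback of `V` to `Fl(V)`. -/
noncomputable def pullTaut {W : P.X.Opens} (s : Γ(tautTwo P, W)) :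
    Γ((Scheme.Modules.pullback Fl.π).obj V, forgetFlag Fl P ⁻¹ᵁ W) :=
  pullSec (forgetFlag_comp Fl P) (Hom.app (P.taut 0).arrow W s)

/-- The two standard charts of the `ℙ¹`-bundle `f₁` attached to a frame `(e₁, e₂)` of `𝒱₂` over `W`:
over `A` the line `ℒ₁` is spanned by `ℓA = e₁ + u e₂`, and over `B` by `ℓB = w e₁ + e₂`.
The section `ε` of `𝒱₂` is `e₂`, and `lam` is the section of `ℒ₂^(-1)` dual to its image in `ℒ₂`. -/
structure FrameChart {W : P.X.Opens} (φ : Frame (tautTwo P) W) where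
  A : Fl.X.Opens
  B : Fl.X.Opens
  cover : A ⊔ B = forgetFlag Fl P ⁻¹ᵁ W
  u : Γ(Fl.X, A)
  w : Γ(Fl.X, B)
  ℓA : Γ(lineOne Fl, A)
  ℓB : Γ(lineOne Fl, B)
  ε : Γ((Fl.taut 1 : Fl.X.Modules), A)
  lam : Γ(dual (lineTwo Fl), A)
  ℓA_eq : Hom.app (Fl.taut 0).arrow A ℓA =
    res (cover ▸ le_sup_left) (pullTaut Fl P φ.e₁) +
      u • res (cover ▸ le_sup_left) (pullTaut Fl P φ.e₂)
  ℓB_eq : Hom.app (Fl.taut 0).arrow B ℓB =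
    w • res (cover ▸ le_sup_right) (pullTaut Fl P φ.e₁) +
      res (cover ▸ le_sup_right) (pullTaut Fl P φ.e₂)
  ε_eq : Hom.app (Fl.taut 1).arrow A ε = res (cover ▸ le_sup_left) (pullTaut Fl P φ.e₂)
  lam_ε : ev lam (Hom.app (projTwo Fl) A ε) = 1

variable {Fl P}

theorem FrameChart.inf_le {W : P.X.Opens} {φ : Frame (tautTwo P) W} (c : FrameChart Fl P φ) :
    c.A ⊓ c.B ≤ forgetFlag Fl P ⁻¹ᵁ W :=
  inf_le_left.trans (c.cover ▸ le_sup_left)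

/-- The cocycle `∑ⱼ γ(x^(2b-j) y^j) w^(j+1) · ℓA^(b+1) ⊗ lam^(b+1)` with values in
`𝒪(b+1, -b-1, 0)`, for a section `γ` of `Γ^(2b)(𝒱₂)`. -/
noncomputable def FrameChart.cocycle {W : P.X.Opens} {φ : Frame (tautTwo P) W}
    (c : FrameChart Fl P φ) (b : ℕ) (γ : Γ(divPow (tautTwo P) (2 * b), W)) :
    Γ(flagLine Fl (b + 1) (b + 1) 0, c.A ⊓ c.B) :=
  (∑ j ∈ Finset.range (2 * b + 1),
    resO c.inf_le ((forgetFlag Fl P).app W (ev γ (φ.monomial (2 * b) j))) *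
      resO inf_le_right c.w ^ (j + 1)) •
  tmul (tpowSec (res inf_le_left c.ℓA) (b + 1))
    (tmul (tpowSec (res inf_le_left c.lam) (b + 1)) (tpowSec (0 : Γ(lineThree Fl, c.A ⊓ c.B)) 0))

/-- The isomorphism `Γ^(2b)(𝒱₂) ⊗ det^(-b)(𝒱₂) ≅ R¹(f₁)_* 𝒪(b+1, -b-1, 0)` is the canonical one:
for every frame `(e₁, e₂)` of `𝒱₂`, it sends `γ ⊗ (e₁ ∧ e₂)^(-b)` to the class of the
cocycle above. Here `d` is the section of `det^(-1)` dual to `e₁ ∧ e₂`. -/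
def IsCanonicalR1 (b : ℕ)
    (θ : gammaDet P (2 * b) b ≅ (R1 (forgetFlag Fl P)).obj (flagLine Fl (b + 1) (b + 1) 0)) :
    Prop :=
  ∀ (W : P.X.Opens) (φ : Frame (tautTwo P) W) (d : Γ(dual (extPow (tautTwo P) 2), W)),
    ev d (wedge ![φ.e₁, φ.e₂]) = 1 →
    ∀ (γ : Γ(divPow (tautTwo P) (2 * b), W)) (c : FrameChart Fl P φ),
      IsCechClass (forgetFlag Fl P) c.cover (c.cocycle b γ)
        (Hom.app θ.hom W (tmul γ (tpowSec d b)))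

/-- The isomorphism `𝒪_S ≅ f_*(Γ^(2b)(𝒱₂) ⊗ det^(-b)(𝒱₂))` is the canonical one: it sends `1` to
the section which is `[e₁]_b [e₂]_b ⊗ (e₁ ∧ e₂)^(-b)` for every frame `(e₁, e₂)` of `𝒱₂`, where
`[e₁]_b [e₂]_b` is the form `γ` on `Sym^(2b)(𝒱₂^∨)` extracting the coefficient of `x^b y^b`. -/
def IsCanonicalUnit (b : ℕ)
    (η : unitModule S ≅ (pushforward P.π).obj (gammaDet P (2 * b) b)) : Prop :=
  ∀ (W : P.X.Opens) (φ : Frame (tautTwo P) W) (d : Γ(dual (extPow (tautTwo P) 2), W)),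
    ev d (wedge ![φ.e₁, φ.e₂]) = 1 →
    ∀ γ : Γ(divPow (tautTwo P) (2 * b), W),
      (∀ j ≤ 2 * b, ev γ (φ.monomial (2 * b) j) = if j = b then 1 else 0) →
      res (M := gammaDet P (2 * b) b) (le_top : W ≤ P.π ⁻¹ᵁ ⊤)
        (Hom.app η.hom ⊤ (1 : Γ(S, ⊤))) = tmul γ (tpowSec d b)

end rankThree

end FlagCohomology

open FlagCohomology

/-!
All three assertions are local on `P(V)` or on `S`, and they are reduced to computations with
polynomials in explicit coordinates.

*Coordinates.* The schemes `P(V)` and `Fl(V)` are given by their universal properties. A subbundle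
complementary to the span of a part of a basis is the graph of a matrix; the locus where this
holds is a largest open set (`exists_graph`), and the universal property shows that it is an affine
space over the base, the entries of the matrix being its coordinates (`isAffineOpen_and_bijective`).
So `P(V)` is covered by affine planes over the affine open sets of `S` on which `V` has a basis
(`nonempty_planeChart`), and `Fl(V)` over `P(V)` by two affine lines, with coordinates `u` and `w`
such that `w u = 1` on the intersection, whose functions are the Laurent polynomials in `u`
(`exists_full_chart`).

*The first direct image.* An injective sheaf of modules is flasque, so that every cocycle on a
covering by two open sets has a class in the first direct image; this class does not depend on the
resolution, it vanishes only if the cocycle is locally a coboundary, and on two affine open sets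
trivializing the line bundle every class is that of a cocycle
(`exists_isCechClass`, `IsCechClass.exists_coboundary`, `exists_isCechClass_of_isAffineOpen`). For
`𝒪(b + 1, -b - 1, 0)` the coboundaries are, after division by a generator over `A`, the sum of
`R[u]` and `w ^ (2b + 2) R[w]` inside `R[u, w]`, and `w, …, w ^ (2b + 1)` is a basis of a complement
(`laurent_eq_zero`, `exists_laurent`). Hence the formula for `θ` gives an isomorphism for each frame
of the tautological plane. It does not depend on the frame: locally, any two frames are connected by
exchanges of the two vectors and by shears `(e₁, e₂) ↦ (e₁, β (e₂ + κ e₁))`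
(`Frame.rel_of_swap_shear`). An exchange reverses the covering, and a shear changes the cocycle by
a function that is regular on `A`; the latter is an identity of divided differences
(`shear_identity`).

*Global sections.* Over the plane with coordinates `a`, `c`, whose frame is `e₁ = v₀ + a v₂`,
`e₂ = v₁ + c v₂`, a section `γ ⊗ δ ^ b` is described by the functions
`C(j, k) = γ(x ^ (2b - j - k) y ^ j z ^ k)`, where `z = a x + c y` is the third coordinate of `V`, so
that `C(j, k + 1) = a C(j, k) + c C(j + 1, k)`. In the adjacent plane `y` and `z` are exchanged and
`δ` is multiplied by `c`; comparing the two shows that `C(j, k)` is a polynomial in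
`a`, `c` of total degree at most `b`. These conditions are elementary linear relations between the
coefficients. With `r` the constant coefficient of `γ(x ^ b y ^ b)`, they imply that `r` is
annihilated by the binomial coefficients `(b + 1).choose i`, `0 < i < b + 1`, and that `r = 0` only
for the zero section (`coefficients_eq_zero`). If `b + 1` is not a power of `p`, one of these
binomial coefficients is prime to `p`, and there are no sections. If `b + 1 = p ^ s`, the binomial
coefficients `m.choose b` with `b < m ≤ 2b` vanish in characteristic `p`, so that the section
`[e₁]_b [e₂]_b ⊗ δ ^ b` is invariant under exchanges and shears (`Frame.unitVec_eq_unitVec`); these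
sections glue to a global section `σ`, and every section is `r σ`.
-/

namespace FlagCohomology

open Scheme.Modules

/-! ### Sections of sheaves of modules -/

section sheafLemmas
variable {X : Scheme.{u}} {M N K : X.Modules} {U V W : X.Opens}

theorem app_res (φ : M ⟶ N) (h : U ≤ V) (m : Γ(M, V)) :
    Hom.app φ U (res h m) = res h (Hom.app φ V m) :=
  congr($(φ.mapPresheaf.naturality (homOfLE h).op) m)

theorem eq_of_locally {s t : Γ(M, U)}
    (H : ∀ x ∈ U, ∃ (V : X.Opens) (h : V ≤ U), x ∈ V ∧ res h s = res h t) : s = t := by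
  choose V hV hxV e using H
  let F : TopCat.Sheaf Ab X := ⟨M.presheaf, M.isSheaf⟩
  refine F.eq_of_locally_eq' (fun x : U => V x x.2) U (fun x => homOfLE (hV x x.2)) ?_ s t
    fun x => e x x.2
  intro x hx
  exact TopologicalSpace.Opens.mem_iSup.2 ⟨⟨x, hx⟩, hxV x hx⟩

theorem resO_eq_of_locally {s t : Γ(X, U)}
    (H : ∀ x ∈ U, ∃ (V : X.Opens) (h : V ≤ U), x ∈ V ∧ resO h s = resO h t) : s = t :=
  eq_of_locally (M := unitModule X) H

/-- Sections satisfying a local condition which determines them uniquely glue. -/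
theorem exists_of_locally (P : ∀ V : X.Opens, Γ(M, V) → Prop)
    (hP : ∀ {V V'} (h : V' ≤ V) s, P V s → P V' (res h s))
    (hu : ∀ {V} s t, V ≤ U → P V s → P V t → s = t)
    (H : ∀ x ∈ U, ∃ V : X.Opens, V ≤ U ∧ x ∈ V ∧ ∃ s, P V s) :
    ∃ s : Γ(M, U), ∀ x ∈ U, ∃ (V : X.Opens) (h : V ≤ U), x ∈ V ∧ P V (res h s) := by
  choose V hV hxV s hs using H
  let F : TopCat.Sheaf Ab X := ⟨M.presheaf, M.isSheaf⟩
  obtain ⟨t, ht, -⟩ := F.existsUnique_gluing' (fun x : U => V x x.2) U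
    (fun x => homOfLE (hV x x.2)) (fun x hx => TopologicalSpace.Opens.mem_iSup.2 ⟨⟨x, hx⟩, hxV x hx⟩)
    (fun x => s x x.2) (by
      intro x y
      exact hu (V := V x x.2 ⊓ V y y.2) _ _ (inf_le_left.trans (hV _ _)) (hP inf_le_left _ (hs _ _)) (hP inf_le_right _ (hs _ _)))
  refine ⟨t, fun x hx => ⟨V x hx, hV x hx, hxV x hx, ?_⟩⟩
  have : res (hV x hx) t = s x hx := ht ⟨x, hx⟩
  rw [this]; exact hs x hx

theorem app_injective_of_mono (φ : M ⟶ N) [Mono φ] (U : X.Opens) :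
    Function.Injective (Hom.app φ U) := by
  have : Mono ((toPresheaf X).map φ) := inferInstance
  have := (NatTrans.mono_iff_mono_app _).1 this (op U)
  exact (AddCommGrpCat.mono_iff_injective _).1 this

/-- A section of `N` killed by `ψ` comes from a kernel. -/
theorem exists_of_kernel {φ : M ⟶ N} {ψ : N ⟶ K} (w : φ ≫ ψ = 0)
    (hk : IsLimit (KernelFork.ofι φ w)) (s : Γ(N, U)) (hs : Hom.app ψ U s = 0) :
    ∃ m, Hom.app φ U m = s := by
  let S : ShortComplex X.Modules := ShortComplex.mk φ ψ w
  have : Mono φ := mono_of_isLimit_fork hk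
  have hS : S.Exact := ShortComplex.exact_of_f_is_kernel S hk
  let F := (toPresheaf X ⋙ (evaluation _ _).obj (op U))
  have : PreservesLimitsOfShape WalkingParallelPair F := by
    have : PreservesLimitsOfShape WalkingParallelPair ((evaluation (Opens X)ᵒᵖ Ab.{u}).obj (op U)) :=
      Limits.evaluation_preservesLimitsOfShape _
    exact @comp_preservesLimitsOfShape _ _ _ _ _ _ _ _ _ _ inferInstance this
  have hF : F.PreservesZeroMorphisms := ⟨fun _ _ => rfl⟩
  have : (S.map F).Exact := by
    have h2 := KernelFork.mapIsLimit _ hk F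
    exact ShortComplex.exact_of_f_is_kernel (S.map F) h2
  exact (ShortComplex.ab_exact_iff _).1 this s hs


/-- Sections of the associated sheaf are locally sections of the presheaf. -/
theorem exists_toSh_eq {P : X.PresheafOfModules} (s : Γ((sheafify X).obj P, U)) {x : X} (hx : x ∈ U) :
    ∃ (V : X.Opens) (h : V ≤ U) (t : P.obj (op V)), x ∈ V ∧ toSh P V t = res h s := by
  have : Presheaf.IsLocallySurjective (Opens.grothendieckTopology X)
    (CategoryTheory.toSheafify (Opens.grothendieckTopology X) P.presheaf) := inferInstance
  obtain ⟨V, h, ⟨t, ht⟩, hxV⟩ := this.imageSieve_mem s x hx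
  exact ⟨V, leOfHom h, t, hxV, ht⟩

theorem toSh_map {P : X.PresheafOfModules} (h : V ≤ U) (s : P.obj (op U)) :
    toSh P V (P.presheaf.map (homOfLE h).op s) = res h (toSh P U s) :=
  PresheafOfModules.naturality_apply ((sheafifyAdj X).unit.app P) (homOfLE h).op s

theorem exists_eq_of_toSh_eq {P : X.PresheafOfModules} (s t : P.obj (op U))
    (hst : toSh P U s = toSh P U t) {x : X} (hx : x ∈ U) :
    ∃ (V : X.Opens) (h : V ≤ U), x ∈ V ∧
      P.presheaf.map (homOfLE h).op s = P.presheaf.map (homOfLE h).op t := by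
  have : Presheaf.IsLocallyInjective (Opens.grothendieckTopology X)
    (CategoryTheory.toSheafify (Opens.grothendieckTopology X) P.presheaf) := inferInstance
  obtain ⟨V, h, e, hxV⟩ := this.equalizerSieve_mem s t hst x hx
  exact ⟨V, leOfHom h, hxV, e⟩

theorem toSh_add {P : X.PresheafOfModules} (s t : P.obj (op U)) :
    toSh P U (s + t) = toSh P U s + toSh P U t :=
  map_add (((sheafifyAdj X).unit.app P).app (op U)).hom s t

theorem toSh_smul {P : X.PresheafOfModules} (a : Γ(X, U)) (s : P.obj (op U)) :
    toSh P U ((show X.ringCatSheaf.obj.obj (op U) from a) • s) = a • toSh P U s :=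
  LinearMap.map_smul (((sheafifyAdj X).unit.app P).app (op U)).hom
    (show X.ringCatSheaf.obj.obj (op U) from a) s

/-- Epimorphisms of sheaves of modules are locally surjective. -/
theorem exists_of_epi (φ : M ⟶ N) [Epi φ] (s : Γ(N, U)) {x : X} (hx : x ∈ U) :
    ∃ (V : X.Opens) (h : V ≤ U) (t : Γ(M, V)), x ∈ V ∧ Hom.app φ V t = res h s := by
  let R := Scheme.Modules.toPresheafOfModules X ⋙
      PresheafOfModules.restrictScalars (𝟙 X.ringCatSheaf.obj)
  let f := R.map φ
  have h1 : Epi ((sheafify X).map f) := by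
    have : IsIso ((sheafifyAdj X).counit) :=
      inferInstanceAs (IsIso (PresheafOfModules.sheafificationAdjunction (𝟙 X.ringCatSheaf.obj)).counit)
    have e : (sheafify X).map f = (sheafifyAdj X).counit.app M ≫ φ ≫ inv ((sheafifyAdj X).counit.app N) := by
      rw [← Category.assoc, IsIso.eq_comp_inv]
      exact (sheafifyAdj X).counit.naturality φ
    rw [e]; infer_instance
  have h2 : (sheafify X).map (cokernel.π f) = 0 := by
    rw [← cancel_epi ((sheafify X).map f), ← Functor.map_comp, cokernel.condition, comp_zero]
    have : (sheafify X).PreservesZeroMorphisms :=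
      have := (sheafifyAdj X).isLeftAdjoint
      Functor.preservesZeroMorphisms_of_isLeftAdjoint _
    exact (sheafify X).map_zero _ _
  have h3 : toSh (cokernel f) U ((cokernel.π f).app (op U) s) = toSh (cokernel f) U 0 := by
    have := (sheafifyAdj X).unit.naturality (cokernel.π f)
    have := congrArg (fun g => g.app (op U) s) this
    refine Eq.trans this ?_
    simp only [Functor.comp_map, h2]
    exact (map_zero (((sheafifyAdj X).unit.app (cokernel f)).app (op U)).hom).symm
  obtain ⟨V, h, hxV, e⟩ := exists_eq_of_toSh_eq _ _ h3 hx
  have e' : (cokernel.π f).app (op V) (res h s) = 0 := by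
    have e1 := PresheafOfModules.naturality_apply (cokernel.π f) (homOfLE h).op s
    exact Eq.trans e1 (Eq.trans e (map_zero _))
  have hS : (ShortComplex.mk f (cokernel.π f) (cokernel.condition f)).Exact :=
    ShortComplex.exact_cokernel f
  have := hS.map (PresheafOfModules.evaluation _ (op V))
  obtain ⟨t, ht⟩ := (ShortComplex.moduleCat_exact_iff _).1 this _ e'
  exact ⟨V, h, t, hxV, ht⟩

/-- Exactness of sheaves of modules, on sections. -/
theorem exists_of_exact {S : ShortComplex X.Modules} (hS : S.Exact) (s : Γ(S.X₂, U))
    (hs : Hom.app S.g U s = 0) {x : X} (hx : x ∈ U) :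
    ∃ (V : X.Opens) (h : V ≤ U) (t : Γ(S.X₁, V)), x ∈ V ∧ Hom.app S.f V t = res h s := by
  have : Epi (kernel.lift S.g S.f S.zero) := (S.exact_iff_epi_kernel_lift).1 hS
  obtain ⟨m, rfl⟩ := exists_of_kernel (kernel.condition S.g) (kernelIsKernel S.g) s hs
  obtain ⟨V, h, t, hxV, e⟩ := exists_of_epi (kernel.lift S.g S.f S.zero) m hx
  refine ⟨V, h, t, hxV, ?_⟩
  rw [← app_res, ← e]
  have : S.f = kernel.lift S.g S.f S.zero ≫ kernel.ι S.g := (kernel.lift_ι _ _ _).symm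
  conv_lhs => rw [this]
  rfl

theorem isIso_of_bijective (φ : M ⟶ N) (H : ∀ U, Function.Bijective (Hom.app φ U)) : IsIso φ := by
  rw [Hom.isIso_iff_isIso_app]
  intro U
  exact (ConcreteCategory.isIso_iff_bijective _).2 (H U)

theorem app_sum {κ : Type*} (S : Finset κ) (φ : κ → (M ⟶ N)) (m : Γ(M, U)) :
    Hom.app (∑ j ∈ S, φ j) U m = ∑ j ∈ S, Hom.app (φ j) U m := by
  classical
  induction S using Finset.induction_on with
  | empty => rfl
  | insert k s hk ih => rw [Finset.sum_insert hk, Finset.sum_insert hk, ← ih]; rfl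

/-- A morphism of sheaves of modules from compatible additive maps on sections. -/
noncomputable def mkHom (f : ∀ U : X.Opens, Γ(M, U) → Γ(N, U))
    (hadd : ∀ U s t, f U (s + t) = f U s + f U t)
    (hsmul : ∀ U (a : Γ(X, U)) s, f U (a • s) = a • f U s)
    (hres : ∀ {U V : X.Opens} (h : U ≤ V) s, f U (res h s) = res h (f V s)) : M ⟶ N :=
  ⟨{ app := fun U => ModuleCat.ofHom (X := M.val.obj U) (Y := N.val.obj U)
        { toFun := f U.unop
          map_add' := hadd _
          map_smul' := hsmul _ }
     naturality := fun {U V} i => by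
        ext s
        exact hres (leOfHom i.unop) s }⟩

/-- A morphism of sheaves of modules defined by a functional relation which is local. -/
theorem exists_hom_of_rel (Rel : ∀ U : X.Opens, Γ(M, U) → Γ(N, U) → Prop)
    (hres : ∀ {U V : X.Opens} (h : U ≤ V) s t, Rel V s t → Rel U (res h s) (res h t))
    (hloc : ∀ {U : X.Opens} s t, (∀ x ∈ U, ∃ (V : X.Opens) (h : V ≤ U), x ∈ V ∧
      Rel V (res h s) (res h t)) → Rel U s t)
    (hu : ∀ {U : X.Opens} s t t', Rel U s t → Rel U s t' → t = t')
    (hex : ∀ {U : X.Opens} s, ∀ x ∈ U, ∃ (V : X.Opens) (h : V ≤ U), x ∈ V ∧ ∃ t, Rel V (res h s) t)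
    (hadd : ∀ {U : X.Opens} s t s' t', Rel U s t → Rel U s' t' → Rel U (s + s') (t + t'))
    (hsmul : ∀ {U : X.Opens} (a : Γ(X, U)) s t, Rel U s t → Rel U (a • s) (a • t)) :
    ∃ φ : M ⟶ N, ∀ U s, Rel U s (Hom.app φ U s) := by
  have key : ∀ (U : X.Opens) (s : Γ(M, U)), ∃ t, Rel U s t := by
    intro U s
    obtain ⟨t, ht⟩ := exists_of_locally (M := N) (U := U)
      (fun V t => ∃ h : V ≤ U, Rel V (res h s) t)
      (by
        rintro V V' h t ⟨h', ht⟩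
        refine ⟨h.trans h', ?_⟩
        rw [← res_res h h']; exact hres h _ _ ht)
      (by rintro V t t' _ ⟨_, ht⟩ ⟨_, ht'⟩; exact hu _ _ _ ht ht')
      (by
        intro x hx
        obtain ⟨V, h, hxV, t, ht⟩ := hex s x hx
        exact ⟨V, h, hxV, t, h, ht⟩)
    refine ⟨t, hloc _ _ fun x hx => ?_⟩
    obtain ⟨V, h, hxV, _, h'⟩ := ht x hx
    exact ⟨V, h, hxV, h'⟩
  choose f hf using key
  exact ⟨mkHom f (fun U s t => hu _ _ _ (hf _ _) (hadd _ _ _ _ (hf _ _) (hf _ _)))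
    (fun U a s => hu _ _ _ (hf _ _) (hsmul _ _ _ (hf _ _)))
    (fun h s => hu _ _ _ (hf _ _) (hres h _ _ (hf _ _))), fun U s => hf U s⟩

end sheafLemmas

/-! ### Bases of sheaves of modules -/

section bases
variable {X : Scheme.{u}} {M N K : X.Modules} {U V W : X.Opens} {ι : Type*} [Fintype ι]

/-- The linear combination of the restrictions of the sections `e i` with coefficients `a i`. -/
noncomputable def linComb (e : ι → Γ(M, W)) (h : U ≤ W) (a : ι → Γ(X, U)) : Γ(M, U) :=
  ∑ i, a i • res h (e i)

theorem linComb_add (e : ι → Γ(M, W)) (h : U ≤ W) (a b : ι → Γ(X, U)) :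
    linComb e h (a + b) = linComb e h a + linComb e h b := by
  simp [linComb, add_smul, Finset.sum_add_distrib]

theorem linComb_smul (e : ι → Γ(M, W)) (h : U ≤ W) (r : Γ(X, U)) (a : ι → Γ(X, U)) :
    linComb e h (r • a) = r • linComb e h a := by
  simp [linComb, mul_smul, Finset.smul_sum]

theorem res_linComb (e : ι → Γ(M, W)) (h : U ≤ W) (h' : V ≤ U) (a : ι → Γ(X, U)) :
    res h' (linComb e h a) = linComb e (h'.trans h) (fun i => resO h' (a i)) := by
  simp [linComb, res_res]

theorem linComb_res (e : ι → Γ(M, W)) (h : U ≤ W) (h' : V ≤ U) (a : ι → Γ(X, V)) :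
    linComb (fun i => res h (e i)) h' a = linComb e (h'.trans h) a := by
  simp [linComb, res_res]

theorem app_linComb (φ : M ⟶ N) (e : ι → Γ(M, W)) (h : U ≤ W) (a : ι → Γ(X, U)) :
    Hom.app φ U (linComb e h a) = linComb (fun i => Hom.app φ W (e i)) h a := by
  simp [linComb, app_res]

theorem linComb_single [DecidableEq ι] (e : ι → Γ(M, W)) (h : U ≤ W) (i : ι) (r : Γ(X, U)) :
    linComb e h (Pi.single i r) = r • res h (e i) := by
  simp [linComb, Pi.single_apply]

/-- The family of sections `e` is a basis of `M` over `W`. -/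
def IsBasis (e : ι → Γ(M, W)) : Prop :=
  ∀ (U : X.Opens) (h : U ≤ W), Function.Bijective (linComb e h)

/-- A family which is linearly independent and spans locally is a basis. -/
theorem IsBasis.of_locally_surjective (e : ι → Γ(M, W))
    (hinj : ∀ (U : X.Opens) (h : U ≤ W), Function.Injective (linComb e h))
    (hsurj : ∀ (U : X.Opens) (h : U ≤ W) (s : Γ(M, U)), ∀ x ∈ U, ∃ (V : X.Opens) (h' : V ≤ U),
      x ∈ V ∧ ∃ a, linComb e (h'.trans h) a = res h' s) : IsBasis e := by
  intro U h
  refine ⟨hinj U h, fun s => ?_⟩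
  have key : ∀ i, ∃ t : Γ(X, U), ∀ (V : X.Opens) (h' : V ≤ U) a,
      linComb e (h'.trans h) a = res h' s → resO h' t = a i := by
    intro i
    obtain ⟨t, ht⟩ := exists_of_locally (M := unitModule X) (U := U)
      (fun V t => ∃ (h' : V ≤ U) (a : ι → Γ(X, V)), a i = t ∧ linComb e (h'.trans h) a = res h' s)
      (by
        rintro V V' hV t ⟨h', a, hat, ha⟩
        refine ⟨hV.trans h', fun i => resO hV (a i), congrArg (resO hV) hat, ?_⟩
        rw [← res_res hV h', ← ha, res_linComb])
      (by
        rintro V t t' _ ⟨h', a, rfl, ha⟩ ⟨_, a', rfl, ha'⟩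
        rw [hinj _ _ (ha.trans ha'.symm)])
      (by
        intro x hx
        obtain ⟨V, h', hxV, a, ha⟩ := hsurj U h s x hx
        exact ⟨V, h', hxV, a i, h', a, rfl, ha⟩)
    refine ⟨t, fun V h' a ha => resO_eq_of_locally fun x hx => ?_⟩
    obtain ⟨V', hV', hxV', h'', a', hat, ha'⟩ := ht x (h' hx)
    refine ⟨V ⊓ V', inf_le_left, ⟨hx, hxV'⟩, ?_⟩
    have h1 : (fun i => resO (inf_le_left : V ⊓ V' ≤ V) (a i)) =
        fun i => resO (inf_le_right : V ⊓ V' ≤ V') (a' i) := by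
      apply hinj _ (inf_le_left.trans (h'.trans h))
      rw [← res_linComb e (h'.trans h) inf_le_left, ha, ← res_linComb e (h''.trans h) inf_le_right,
        ha', res_res, res_res]
    have h2 : resO _ (a i) = resO _ (a' i) := congrFun h1 i
    rw [h2]
    refine Eq.trans ?_ (congrArg (resO inf_le_right) hat).symm
    exact (res_res (M := unitModule X) _ _ _).trans (res_res (M := unitModule X) _ _ _).symm
  choose t ht using key
  refine ⟨t, eq_of_locally fun x hx => ?_⟩
  obtain ⟨V, h', hxV, a, ha⟩ := hsurj U h s x hx
  refine ⟨V, h', hxV, ?_⟩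
  rw [res_linComb, ← ha]
  congr 1
  ext i
  rw [ht i V h' a ha]

theorem IsBasis.of_locally (e : ι → Γ(M, W))
    (H : ∀ x ∈ W, ∃ (V : X.Opens) (h : V ≤ W), x ∈ V ∧ IsBasis fun i => res h (e i)) :
    IsBasis e := by
  refine IsBasis.of_locally_surjective e (fun U h a b hab => ?_) fun U h s x hx => ?_
  · ext i
    refine resO_eq_of_locally fun x hx => ?_
    obtain ⟨V, hV, hxV, hb⟩ := H x (h hx)
    refine ⟨U ⊓ V, inf_le_left, ⟨hx, hxV⟩, ?_⟩
    refine congrFun ((hb (U ⊓ V) inf_le_right).1 (a₁ := fun i => resO inf_le_left (a i))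
      (a₂ := fun i => resO inf_le_left (b i)) ?_) i
    rw [linComb_res, linComb_res, ← res_linComb e h, ← res_linComb e h, hab]
  · obtain ⟨V, hV, hxV, hb⟩ := H x (h hx)
    obtain ⟨a, ha⟩ := (hb (U ⊓ V) inf_le_right).2 (res inf_le_left s)
    refine ⟨U ⊓ V, inf_le_left, ⟨hx, hxV⟩, a, ?_⟩
    rw [linComb_res] at ha
    exact ha

namespace IsBasis
variable {e : ι → Γ(M, W)} (he : IsBasis e)
include he

theorem res (h : V ≤ W) : IsBasis fun i => res h (e i) := by
  intro U h'
  have := he U (h'.trans h)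
  rwa [show linComb (fun i => FlagCohomology.res h (e i)) h' = linComb e (h'.trans h) from
    funext fun a => linComb_res _ _ _ _]

/-- The coordinates of a section in a basis. -/
noncomputable def coord (h : U ≤ W) : Γ(M, U) →ₗ[Γ(X, U)] (ι → Γ(X, U)) :=
  (LinearEquiv.ofBijective
    { toFun := linComb e h, map_add' := linComb_add e h, map_smul' := linComb_smul e h }
    (he U h)).symm.toLinearMap

theorem linComb_coord (h : U ≤ W) (m : Γ(M, U)) : linComb e h (he.coord h m) = m :=
  LinearEquiv.apply_symm_apply (LinearEquiv.ofBijective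
    { toFun := linComb e h, map_add' := linComb_add e h, map_smul' := linComb_smul e h }
    (he U h)) m

theorem coord_linComb (h : U ≤ W) (a : ι → Γ(X, U)) : he.coord h (linComb e h a) = a :=
  (he U h).1 (he.linComb_coord h _)

theorem coord_res (h : U ≤ W) (h' : V ≤ U) (m : Γ(M, U)) (i : ι) :
    he.coord (h'.trans h) (FlagCohomology.res h' m) i = resO h' (he.coord h m i) := by
  conv_lhs => rw [← he.linComb_coord h m, res_linComb, coord_linComb]

theorem coord_self [DecidableEq ι] (h : U ≤ W) (i : ι) :
    he.coord h (FlagCohomology.res h (e i)) = Pi.single i 1 := by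
  rw [← he.coord_linComb h (Pi.single i 1), linComb_single, one_smul]

theorem ext_coord (h : U ≤ W) {m m' : Γ(M, U)} (H : ∀ i, he.coord h m i = he.coord h m' i) :
    m = m' := by
  rw [← he.linComb_coord h m, ← he.linComb_coord h m', funext H]

theorem map (φ : M ⟶ N) (H : ∀ U ≤ W, Function.Bijective (Hom.app φ U)) :
    IsBasis fun i => Hom.app φ W (e i) := by
  intro U h
  rw [show linComb (fun i => Hom.app φ W (e i)) h = Hom.app φ U ∘ linComb e h from
    funext fun a => (app_linComb _ _ _ _).symm]
  exact (H U h).comp (he U h)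

theorem reindex {κ : Type*} [Fintype κ] (σ : κ ≃ ι) : IsBasis fun k => e (σ k) := by
  intro U h
  rw [show linComb (fun k => e (σ k)) h = linComb e h ∘ (fun a i => a (σ.symm i)) from
    funext fun a => by
      simp only [linComb, Function.comp]
      exact Fintype.sum_equiv σ _ _ (by simp)]
  exact (he U h).comp (Equiv.arrowCongr σ (Equiv.refl _)).bijective

/-- A family obtained from a basis by an invertible matrix is a basis. -/
theorem of_matrix [DecidableEq ι] {f : ι → Γ(M, W)} (A : Matrix ι ι Γ(X, W)) (hA : IsUnit A.det)
    (hf : ∀ i, f i = ∑ j, A i j • e j) : IsBasis f := by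
  intro U h
  let A' := A.map (resO h)
  have hA' : IsUnit A' := by
    rw [Matrix.isUnit_iff_isUnit_det, show A' = (resO h).mapMatrix A from rfl, ← RingHom.map_det]
    exact hA.map _
  have hfc : linComb f h = linComb e h ∘ (fun a => Matrix.vecMul a A') := by
    funext a
    simp only [linComb, Function.comp, hf, map_sum, map_smulₛₗ, Finset.smul_sum, Matrix.vecMul,
      dotProduct, Finset.sum_smul, smul_smul]
    exact Finset.sum_comm
  rw [hfc]
  refine (he U h).comp ?_
  obtain ⟨B, hB⟩ := hA'
  rw [← hB]
  refine Function.bijective_iff_has_inverse.2 ⟨fun a => Matrix.vecMul a (↑B⁻¹ : Matrix _ _ _), ?_, ?_⟩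
  · intro a; simp [Matrix.vecMul_vecMul]
  · intro a; simp [Matrix.vecMul_vecMul]
end IsBasis

instance presheafModule (P : X.PresheafOfModules) (U : X.Opens) : Module Γ(X, U) (P.obj (op U)) :=
  (P.obj (op U)).isModule

/-- Restriction of sections of a presheaf of modules. -/
noncomputable def pres (P : X.PresheafOfModules) (h : U ≤ V) (s : P.obj (op V)) : P.obj (op U) :=
  P.presheaf.map (homOfLE h).op s

theorem toSh_pres {P : X.PresheafOfModules} (h : V ≤ U) (s : P.obj (op U)) :
    toSh P V (pres P h s) = FlagCohomology.res h (toSh P U s) := toSh_map h s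

/-- A basis of a presheaf of modules gives a basis of the associated sheaf. -/
theorem isBasis_toSh {P : X.PresheafOfModules} (e : ι → P.obj (op W))
    (H : ∀ (U : X.Opens) (h : U ≤ W), Function.Bijective fun a : ι → Γ(X, U) =>
      ∑ i, a i • pres P h (e i)) : IsBasis fun i => toSh P W (e i) := by
  have key : ∀ (U : X.Opens) (h : U ≤ W) (a : ι → Γ(X, U)),
      toSh P U (∑ i, a i • pres P h (e i)) =
        linComb (fun i => toSh P W (e i)) h a := by
    intro U h a
    have : ∀ s : Finset ι, toSh P U (∑ i ∈ s, a i • pres P h (e i)) =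
        ∑ i ∈ s, a i • res h (toSh P W (e i)) := by
      classical
      intro s
      induction s using Finset.induction_on with
      | empty => exact map_zero (((sheafifyAdj X).unit.app P).app (op U)).hom
      | insert i s hi ih =>
        rw [Finset.sum_insert hi, Finset.sum_insert hi, toSh_add, ih, ← toSh_pres h (e i)]
        congr 1
        exact toSh_smul _ _
    exact this _
  have hmap : ∀ (U V : X.Opens) (h : U ≤ W) (h' : V ≤ U) (a : ι → Γ(X, U)),
      pres P h' (∑ i, a i • pres P h (e i)) =
      ∑ i, resO h' (a i) • pres P (h'.trans h) (e i) := by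
    intro U V h h' a
    refine (map_sum (P.presheaf.map (homOfLE h').op).hom _ _).trans ?_
    refine Finset.sum_congr rfl fun i _ => ?_
    refine (PresheafOfModules.map_smul P (homOfLE h').op (a i) _).trans ?_
    congr 1
    have := ConcreteCategory.congr_hom (P.presheaf.map_comp (homOfLE h).op (homOfLE h').op) (e i)
    exact this.symm
  refine IsBasis.of_locally_surjective _ (fun U h a b hab => ?_) fun U h s x hx => ?_
  · rw [← key, ← key] at hab
    ext i
    refine resO_eq_of_locally fun x hx => ?_
    obtain ⟨V, h', hxV, hV⟩ := exists_eq_of_toSh_eq _ _ hab hx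
    refine ⟨V, h', hxV, ?_⟩
    replace hV := (hmap U V h h' a).symm.trans (hV.trans (hmap U V h h' b))
    exact congrFun ((H V (h'.trans h)).1 hV) i
  · obtain ⟨V, h', t, hxV, ht⟩ := exists_toSh_eq s hx
    obtain ⟨a, rfl⟩ := (H V (h'.trans h)).2 t
    exact ⟨V, h', hxV, a, by rw [← ht, ← key]⟩

end bases

/-! ### Locally free sheaves -/

section locallyFree
variable {X : Scheme.{u}} {M N K : X.Modules} {U V W : X.Opens} {ι : Type*} [Fintype ι]

/-- A function, as a section of the structure sheaf as a module. -/
def funSec (a : Γ(X, U)) : Γ(unitModule X, U) := a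

theorem res_funSec (h : U ≤ V) (a : Γ(X, V)) : res h (funSec a) = funSec (resO h a) := rfl

theorem smul_funSec (a b : Γ(X, U)) : a • funSec b = funSec (a * b) := rfl

theorem isBasis_one : IsBasis (M := unitModule X) (W := W) fun _ : Unit => funSec 1 := by
  intro U h
  have : linComb (M := unitModule X) (W := W) (fun _ : Unit => funSec 1) h =
      (Equiv.funUnique Unit Γ(X, U)) := by
    funext a
    simp only [linComb, Finset.univ_unique, Finset.sum_singleton, res_funSec, smul_funSec, map_one, mul_one]
    rfl
  rw [this]
  exact Equiv.bijective _

/-- The free module on `J`. -/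
noncomputable abbrev freeModule (X : Scheme.{u}) (J : Type u) : X.Modules :=
  SheafOfModules.free (R := X.ringCatSheaf) J

/-- A finite free sheaf of modules has a basis. -/
theorem exists_basis_free (J : Type u) [Fintype J] :
    ∃ e : J → Γ(freeModule X J, ⊤), IsBasis e := by
  classical
  let F : X.Modules := ∐ fun _ : J => unitModule X
  let i (j : J) : unitModule X ⟶ F := Sigma.ι (fun _ : J => unitModule X) j
  let p (j : J) : F ⟶ unitModule X := Sigma.desc fun k => if k = j then 𝟙 _ else 0
  have hip : ∀ k j, i k ≫ p j = if k = j then 𝟙 _ else 0 := fun k j => Sigma.ι_desc _ _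
  have hsum : ∑ j, p j ≫ i j = 𝟙 F := by
    refine Sigma.hom_ext _ _ fun k => ?_
    rw [Preadditive.comp_sum, Category.comp_id]
    change ∑ j, i k ≫ p j ≫ i j = i k
    rw [Finset.sum_congr rfl fun j _ => (Category.assoc _ _ _).symm]
    simp [hip, ite_comp]
  refine ⟨fun j => Hom.app (i j) ⊤ (funSec 1), ?_⟩
  change IsBasis (M := F) _
  have hl : ∀ (U : X.Opens) (h : U ≤ ⊤) (a : J → Γ(X, U)),
      linComb (M := F) (fun j => Hom.app (i j) ⊤ (funSec 1)) h a =
        ∑ j, Hom.app (i j) U (funSec (a j)) := by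
    intro U h a
    refine Finset.sum_congr rfl fun j _ => ?_
    dsimp only
    rw [← app_res, ← Hom.app_smul, res_funSec, smul_funSec, map_one, mul_one]
  have happ : ∀ (U : X.Opens) k j (a : Γ(X, U)), Hom.app (p j) U (Hom.app (i k) U (funSec a)) =
      funSec (if k = j then a else 0) := by
    intro U k j a
    have : Hom.app (i k ≫ p j) U (funSec a) = Hom.app (p j) U (Hom.app (i k) U (funSec a)) := rfl
    rw [← this, hip]
    split_ifs <;> rfl
  intro U h
  rw [show linComb _ h = _ from funext (hl U h)]
  refine Function.bijective_iff_has_inverse.2 ⟨fun m j => Hom.app (p j) U m, fun a => ?_, fun m => ?_⟩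
  · funext j
    change Hom.app (p j) U (∑ k, Hom.app (i k) U (funSec (a k))) = funSec (a j)
    rw [map_sum, Finset.sum_congr rfl fun k _ => happ U k j (a k), Finset.sum_eq_single j]
    · rw [if_pos rfl]
    · intro k _ hk; rw [if_neg hk]; rfl
    · simp
  · have := app_sum Finset.univ (fun j => p j ≫ i j) m
    change ∑ j, Hom.app (p j ≫ i j) U m = m
    rw [← this, hsum]; rfl

/-- A sheaf of modules with a global basis is free. -/
theorem nonempty_iso_free {J : Type u} [Fintype J] {e : J → Γ(M, ⊤)} (he : IsBasis e) :
    Nonempty (M ≅ SheafOfModules.free (R := X.ringCatSheaf) J) := by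
  classical
  obtain ⟨f, hf⟩ := exists_basis_free (X := X) J
  let φ : freeModule X J ⟶ M := mkHom (M := freeModule X J) (fun U m => linComb e le_top (hf.coord le_top m))
    (fun U s t => by rw [map_add, linComb_add]) (fun U a s => by rw [LinearMap.map_smul, linComb_smul])
    (fun {U V} h s => by
      rw [res_linComb]
      congr 1
      funext i
      exact hf.coord_res le_top h s i)
  have : IsIso φ := isIso_of_bijective φ fun U => by
    have : (Hom.app φ U : Γ(freeModule X J, U) → Γ(M, U)) = linComb e le_top ∘ hf.coord le_top := rfl
    rw [this]
    refine (he U le_top).comp ?_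
    exact Function.bijective_iff_has_inverse.2 ⟨_, hf.linComb_coord le_top, hf.coord_linComb le_top⟩
  exact ⟨(asIso φ).symm⟩

theorem restrict_smul_def (U : X.Opens) (V : (U : Scheme.{u}).Opens) (a : Γ(U, V))
    (m : Γ(M.restrict U.ι, V)) :
    a • m = ((show Γ(X, U.ι ''ᵁ V) from a) • (show Γ(M, U.ι ''ᵁ V) from m) : Γ(M, U.ι ''ᵁ V)) := by
  have h : (U.ι.appIso V).inv a = a := by rw [Scheme.Opens.ι_appIso]; rfl
  exact congrArg (fun r : Γ(X, U.ι ''ᵁ V) => r • (show Γ(M, U.ι ''ᵁ V) from m)) h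

theorem image_preimage_of_le (h : V ≤ U) : U.ι ''ᵁ (U.ι ⁻¹ᵁ V) = V := by
  rw [Scheme.Hom.image_preimage_eq_opensRange_inf, Scheme.Opens.opensRange_ι]
  exact inf_eq_right.2 h

theorem image_le (U : X.Opens) (V : (U : Scheme.{u}).Opens) : U.ι ''ᵁ V ≤ U := by
  rintro _ ⟨x, -, rfl⟩
  exact x.2

theorem le_image_top (U : X.Opens) : U ≤ U.ι ''ᵁ ⊤ := by
  rw [Scheme.Opens.ι_image_top]

/-- A section over `U`, as a global section of the restriction to `U`. -/
noncomputable def toRestrict (m : Γ(M, U)) : Γ(M.restrict U.ι, ⊤) :=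
  (res (M := M) (image_le U ⊤) m : Γ(M, U.ι ''ᵁ ⊤))

/-- A global section of the restriction to `U`, as a section over `U`. -/
noncomputable def ofRestrict (m : Γ(M.restrict U.ι, ⊤)) : Γ(M, U) :=
  res (M := M) (U := U) (V := U.ι ''ᵁ ⊤) (le_image_top U) m

theorem toRestrict_ofRestrict (m : Γ(M.restrict U.ι, ⊤)) : toRestrict (ofRestrict m) = m :=
  (res_res (M := M) _ _ _).trans (res_refl (M := M) _ _)

theorem smul_toRestrict (V : (U : Scheme.{u}).Opens) (a : Γ(U, V)) (m : Γ(M, U)) :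
    a • res (le_top : V ≤ ⊤) (toRestrict m) =
      ((show Γ(X, U.ι ''ᵁ V) from a) • res (image_le U V) m : Γ(M, U.ι ''ᵁ V)) := by
  rw [restrict_smul_def]
  have : res (M := M) (Scheme.Hom.image_mono U.ι (le_top : V ≤ ⊤)) (res (M := M) (image_le U ⊤) m) =
    res (image_le U V) m := res_res (M := M) _ _ _
  exact congrArg (fun r : Γ(M, U.ι ''ᵁ V) => (show Γ(X, U.ι ''ᵁ V) from a) • r) this

theorem linComb_toRestrict (e : ι → Γ(M, U)) (V : (U : Scheme.{u}).Opens) (a : ι → Γ(U, V)) :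
    linComb (fun i => toRestrict (e i)) (le_top : V ≤ ⊤) a =
      linComb e (image_le U V) (fun i => (a i : Γ(X, U.ι ''ᵁ V))) := by
  have h := fun i => smul_toRestrict V (a i) (e i)
  unfold linComb
  simp_rw [h]
  rfl

/-- Bases over an open subscheme. -/
theorem isBasis_restrict_iff (e : ι → Γ(M, U)) :
    IsBasis (fun i => toRestrict (e i)) ↔ IsBasis e := by
  constructor
  · intro H V h
    obtain ⟨V, rfl⟩ : ∃ V' : (U : Scheme.{u}).Opens, V = U.ι ''ᵁ V' := ⟨_, (image_preimage_of_le h).symm⟩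
    have := H V le_top
    have h2 := funext (linComb_toRestrict e V)
    rw [h2] at this
    exact this
  · intro H V h
    have h2 := funext (linComb_toRestrict e V)
    rw [h2]
    exact H _ _

theorem exists_basis_of_iso {n : ℕ} (h : Nonempty (M.restrict U.ι ≅
    SheafOfModules.free (R := (U : Scheme.{u}).ringCatSheaf) (ULift.{u} (Fin n)))) :
    ∃ e : Fin n → Γ(M, U), IsBasis e := by
  obtain ⟨φ⟩ := h
  let ψ : freeModule U (ULift.{u} (Fin n)) ≅ M.restrict U.ι := φ.symm
  obtain ⟨f, hf⟩ := exists_basis_free (X := U) (ULift.{u} (Fin n))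
  have h1 := (hf.map ψ.hom fun V _ => (ConcreteCategory.isIso_iff_bijective _).1
    (inferInstanceAs (IsIso (Hom.app ψ.hom V)))).reindex (Equiv.ulift.symm)
  refine ⟨fun i => ofRestrict (Hom.app ψ.hom ⊤ (f ⟨i⟩)), ?_⟩
  rw [← isBasis_restrict_iff]
  simp only [toRestrict_ofRestrict]
  exact h1

theorem nonempty_iso_of_basis {n : ℕ} {e : Fin n → Γ(M, U)} (he : IsBasis e) :
    Nonempty (M.restrict U.ι ≅
    SheafOfModules.free (R := (U : Scheme.{u}).ringCatSheaf) (ULift.{u} (Fin n))) :=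
  nonempty_iso_free (((isBasis_restrict_iff e).2 he).reindex Equiv.ulift)

theorem hasRank_iff {n : ℕ} : HasRank M n ↔
    ∀ x : X, ∃ U : X.Opens, x ∈ U ∧ ∃ e : Fin n → Γ(M, U), IsBasis e :=
  forall_congr' fun _ => exists_congr fun _ => and_congr_right fun _ =>
    ⟨exists_basis_of_iso, fun ⟨_, he⟩ => nonempty_iso_of_basis he⟩

theorem isVectorBundle_iff : IsVectorBundle M ↔
    ∀ x : X, ∃ (U : X.Opens) (n : ℕ), x ∈ U ∧ ∃ e : Fin n → Γ(M, U), IsBasis e :=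
  forall_congr' fun _ => exists_congr fun _ => exists_congr fun _ => and_congr_right fun _ =>
    ⟨exists_basis_of_iso, fun ⟨_, he⟩ => nonempty_iso_of_basis he⟩

end locallyFree

/-! ### Exterior and symmetric powers of a free module of rank two -/

section algebra
open Polynomial
variable {R : Type u} [CommRing R] {M N : Type u} [AddCommGroup M] [Module R M] [AddCommGroup N]
  [Module R N]

theorem alternating_two (f : M [⋀^Fin 2]→ₗ[R] N) (x y : M) (a b c d : R) :
    f ![a • x + b • y, c • x + d • y] = (a * d - b * c) • f ![x, y] := by
  have hs : ∀ x y, f ![x, y] = - f ![y, x] := by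
    intro x y
    have := f.map_swap ![y, x] (i := 0) (j := 1) (by decide)
    rw [← this]; congr 1; funext i; fin_cases i <;> simp
  have h0 : ∀ x, f ![x, x] = 0 := fun x =>
    f.map_eq_zero_of_eq _ (i := 0) (j := 1) (by simp) (by decide)
  have ha : ∀ x y z, f ![x + y, z] = f ![x, z] + f ![y, z] := fun x y z =>
    f.toMultilinearMap.cons_add ![z] x y
  have hm : ∀ (c : R) x z, f ![c • x, z] = c • f ![x, z] := fun c x z =>
    f.toMultilinearMap.cons_smul ![z] c x
  have ha' : ∀ x y z, f ![z, x + y] = f ![z, x] + f ![z, y] := fun x y z => by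
    rw [hs, ha, neg_add, ← hs, ← hs]
  have hm' : ∀ (c : R) x z, f ![z, c • x] = c • f ![z, x] := fun c x z => by
    rw [hs, hm, hs x z, smul_neg, neg_neg]
  simp only [ha, ha', hm, hm', h0, hs y x, smul_zero, smul_neg, zero_add, add_zero, smul_smul]
  module

theorem bijective_wedge (b : Module.Basis (Fin 2) R M) :
    Function.Bijective fun a : Unit → R => ∑ i, a i • exteriorPower.ιMulti R 2 ![b 0, b 1] := by
  have hb : ![b 0, b 1] = b := by funext i; fin_cases i <;> rfl
  simp only [Finset.univ_unique, Finset.sum_singleton, hb]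
  constructor
  · intro a a' h
    have := congrArg (exteriorPower.alternatingMapLinearEquiv (R := R) (N := R) b.det) h
    rw [_root_.map_smul, _root_.map_smul, exteriorPower.alternatingMapLinearEquiv_apply_ιMulti,
      b.det_self, smul_eq_mul, smul_eq_mul, mul_one, mul_one] at this
    exact funext fun _ => this
  · intro x
    induction x using ext_induction with
    | h₁ r m =>
      refine ⟨fun _ => r * b.det m, ?_⟩
      have : m = ![b.repr (m 0) 0 • b 0 + b.repr (m 0) 1 • b 1,
          b.repr (m 1) 0 • b 0 + b.repr (m 1) 1 • b 1] := by
        funext i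
        fin_cases i
        · exact ((Fin.sum_univ_two _).symm.trans (b.sum_repr (m 0))).symm
        · exact ((Fin.sum_univ_two _).symm.trans (b.sum_repr (m 1))).symm
      have h1 := alternating_two (exteriorPower.ιMulti R 2) (b 0) (b 1) (b.repr (m 0) 0) (b.repr (m 0) 1)
        (b.repr (m 1) 0) (b.repr (m 1) 1)
      rw [← this, hb] at h1
      change (r * b.det m) • exteriorPower.ιMulti R 2 b = _
      rw [h1, mul_smul, b.det_apply, Matrix.det_fin_two]
      simp only [Module.Basis.toMatrix_apply]
      congr 2
      ring
    | h₂ x y hx hy =>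
      obtain ⟨a, rfl⟩ := hx
      obtain ⟨a', rfl⟩ := hy
      exact ⟨a + a', add_smul _ _ _⟩

/-- The product of the linear forms `aᵢ + bᵢ Y`, where `aᵢ`, `bᵢ` are the coordinates of `mᵢ`. -/
noncomputable def symPoly (b : Module.Basis (Fin 2) R M) (ι : Type u) [Fintype ι] :
    MultilinearMap R (fun _ : ι => M) R[X] :=
  (MultilinearMap.mkPiAlgebra R ι R[X]).compLinearMap fun _ =>
    (monomial 0).comp (b.coord 0) + (monomial 1).comp (b.coord 1)

theorem symPoly_apply (b : Module.Basis (Fin 2) R M) (ι : Type u) [Fintype ι] (m : ι → M) :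
    symPoly b ι m = ∏ i, (C (b.coord 0 (m i)) + C (b.coord 1 (m i)) * X) := by
  simp [symPoly, C_mul_X_eq_monomial]

/-- The monomials of degree `n` in the basis `b`. -/
noncomputable def symMono (b : Fin 2 → M) (n j : ℕ) : SymmetricPower R (ULift.{u} (Fin n)) M :=
  SymmetricPower.tprod R fun k => if (k.down : ℕ) < j then b 1 else b 0

/-- The linear map sending `Y ^ j` to the monomial of bidegree `(n - j, j)`. -/
noncomputable def polySym (b : Fin 2 → M) (n : ℕ) : R[X] →ₗ[R] SymmetricPower R (ULift.{u} (Fin n)) M :=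
  ∑ j : Fin (n + 1), ((LinearMap.toSpanSingleton R _ (symMono b n j)).comp (lcoeff R j))

theorem polySym_apply (b : Fin 2 → M) (n : ℕ) (p : R[X]) :
    polySym (R := R) b n p = ∑ j : Fin (n + 1), p.coeff j • symMono b n j := by
  simp [polySym]

theorem exists_perm_of_fin_two {n : ℕ} (v : ULift.{u} (Fin n) → Fin 2) :
    ∃ (k : ℕ) (σ : Equiv.Perm (ULift.{u} (Fin n))), k ≤ n ∧ (Finset.univ.filter fun i => v i = 1).card = k ∧
      ∀ i, v (σ i) = if (i.down : ℕ) < k then 1 else 0 := by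
  classical
  let k := (Finset.univ.filter fun i => v i = 1).card
  have hk : k ≤ n := (Finset.card_le_univ _).trans (by simp)
  have hcard : Fintype.card {i : ULift.{u} (Fin n) // (i.down : ℕ) < k} = Fintype.card {i // v i = 1} := by
    rw [Fintype.card_subtype, Fintype.card_subtype]
    change _ = k
    have : (Finset.univ.filter fun i : ULift.{u} (Fin n) => (i.down : ℕ) < k) =
        (Finset.univ.filter fun i : Fin n => (i : ℕ) < k).map Equiv.ulift.symm.toEmbedding := by
      ext ⟨i⟩; simp
    rw [this, Finset.card_map, Fin.card_filter_val_lt]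
    exact min_eq_right hk
  let e := Fintype.equivOfCardEq hcard
  refine ⟨k, e.extendSubtype, hk, rfl, fun i => ?_⟩
  split_ifs with h
  · exact e.extendSubtype_mem i h
  · have := e.extendSubtype_not_mem i h
    omega

theorem tprod_eq_polySym (b : Module.Basis (Fin 2) R M) (n : ℕ) (m : ULift.{u} (Fin n) → M) :
    SymmetricPower.tprod R m = polySym b n (symPoly b _ m) := by
  have : SymmetricPower.tprod R = (polySym b n).compMultilinearMap (symPoly b (ULift.{u} (Fin n))) := by
    refine Module.Basis.ext_multilinear (fun _ => b) fun v => ?_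
    obtain ⟨k, σ, hk, hcard, hσ⟩ := exists_perm_of_fin_two v
    have h1 : (SymmetricPower.tprod R fun i => b (v i)) = symMono b n k := by
      rw [← SymmetricPower.tprod_equiv σ, symMono]
      congr 1
      funext i
      rw [hσ]; split_ifs <;> rfl
    have h2 : symPoly b _ (fun i => b (v i)) = (X : R[X]) ^ k := by
      rw [symPoly_apply, ← hcard, ← Finset.prod_const, Finset.prod_filter]
      refine Finset.prod_congr rfl fun i _ => ?_
      have : v i = 0 ∨ v i = 1 := by omega
      rcases this with h | h <;> simp [h]
    rw [LinearMap.compMultilinearMap_apply, h1, h2, polySym_apply,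
      Finset.sum_eq_single (⟨k, Nat.lt_succ_of_le hk⟩ : Fin (n + 1))]
    · simp
    · intro j _ hj
      rw [coeff_X_pow, if_neg, zero_smul]
      intro h; exact hj (Fin.ext h)
    · simp
  exact congrArg (fun f => f m) this

theorem bijective_symMono (b : Module.Basis (Fin 2) R M) (n : ℕ) :
    Function.Bijective fun a : Fin (n + 1) → R => ∑ j, a j • symMono (R := R) b n j := by
  constructor
  · let Φ : SymmetricPower R (ULift.{u} (Fin n)) M →+ R[X] := AddCon.lift _
      (PiTensorProduct.lift (symPoly b (ULift.{u} (Fin n)))).toAddMonoidHom (by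
        refine AddCon.addConGen_le.2 ?_
        rintro _ _ ⟨e, f⟩
        simp only [AddCon.ker_rel, LinearMap.toAddMonoidHom_coe, PiTensorProduct.lift.tprod]
        rw [symPoly_apply, symPoly_apply]
        exact (Equiv.prod_comp e fun i => (C (b.coord 0 (f i)) + C (b.coord 1 (f i)) * X)).symm)
    have hΦ : ∀ (r : R) m, Φ (r • SymmetricPower.tprod R m) = C r * symPoly b _ m := by
      intro r m
      change PiTensorProduct.lift _ (r • PiTensorProduct.tprod R m) = _
      rw [_root_.map_smul, PiTensorProduct.lift.tprod, smul_eq_C_mul]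
    have hmono : ∀ (r : R) (j : Fin (n + 1)), Φ (r • symMono (R := R) b n j) = C r * X ^ (j : ℕ) := by
      intro r j
      rw [symMono, hΦ, symPoly_apply]
      congr 1
      have hj : (j : ℕ) ≤ n := Nat.le_of_lt_succ j.2
      have : (Finset.univ.filter fun i : ULift.{u} (Fin n) => (i.down : ℕ) < j) =
        (Finset.univ.filter fun i : Fin n => (i : ℕ) < j).map Equiv.ulift.symm.toEmbedding := by
        ext ⟨i⟩; simp
      have hcard : (Finset.univ.filter fun i : ULift.{u} (Fin n) => (i.down : ℕ) < j).card = j := by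
        rw [this, Finset.card_map, Fin.card_filter_val_lt]
        exact min_eq_right hj
      conv_rhs => rw [← hcard, ← Finset.prod_const, Finset.prod_filter]
      refine Finset.prod_congr rfl fun i _ => ?_
      split_ifs <;> simp
    intro a a' h
    have h := congrArg Φ h
    simp only [map_sum, hmono] at h
    funext j
    have := congrArg (fun p => coeff p j) h
    simpa [finsetSum_coeff, coeff_X_pow, Fin.val_inj] using this
  · intro x
    induction x using sym_induction with
    | h₁ r m =>
      refine ⟨fun j => r * (symPoly b _ m).coeff j, ?_⟩
      simp only [mul_smul, ← Finset.smul_sum]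
      rw [← polySym_apply, ← tprod_eq_polySym]
    | h₂ x y hx hy =>
      obtain ⟨a, rfl⟩ := hx
      obtain ⟨a', rfl⟩ := hy
      exact ⟨a + a', by simp [add_smul, Finset.sum_add_distrib]⟩

end algebra

/-! ### Bases of duals and of tensor constructions -/

section basesOfConstructions
variable {X : Scheme.{u}} {M N K : X.Modules} {U V W : X.Opens} {ι : Type*} [Fintype ι]

/-- The basis of the module of sections over `U` given by a basis of the sheaf. -/
noncomputable def IsBasis.toBasis {e : ι → Γ(M, W)} (he : IsBasis e) (h : U ≤ W) :
    Module.Basis ι Γ(X, U) Γ(M, U) :=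
  Module.Basis.ofEquivFun (LinearEquiv.ofBijective
    { toFun := linComb e h, map_add' := linComb_add e h, map_smul' := linComb_smul e h }
    (he U h)).symm

theorem IsBasis.toBasis_apply {e : ι → Γ(M, W)} (he : IsBasis e) (h : U ≤ W) (i : ι) :
    he.toBasis h i = FlagCohomology.res h (e i) := by
  classical
  simp only [IsBasis.toBasis, Module.Basis.coe_ofEquivFun, LinearEquiv.symm_symm,
    LinearEquiv.ofBijective_apply, LinearMap.coe_mk, AddHom.coe_mk]
  change linComb e h (Pi.single i 1) = _
  rw [linComb_single, one_smul]

/-! ### Duals -/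

theorem ev_add (φ : Γ(dual M, U)) (m m' : Γ(M, U)) : ev φ (m + m') = ev φ m + ev φ m' :=
  map_add (DualSection.toFun (M := M) (U := U) φ U le_rfl) m m'

theorem ev_smul (φ : Γ(dual M, U)) (a : Γ(X, U)) (m : Γ(M, U)) : ev φ (a • m) = a * ev φ m :=
  LinearMap.map_smul (DualSection.toFun (M := M) (U := U) φ U le_rfl) a m

theorem add_ev (φ ψ : Γ(dual M, U)) (m : Γ(M, U)) : ev (φ + ψ) m = ev φ m + ev ψ m := rfl

theorem smul_ev (a : Γ(X, U)) (φ : Γ(dual M, U)) (m : Γ(M, U)) : ev (a • φ) m = a * ev φ m := by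
  have : ev (a • φ) m = resO le_rfl a * ev φ m := rfl
  rw [this, resO_refl]

/-- Evaluation, as a linear form. -/
noncomputable def evLin (φ : Γ(dual M, U)) : Γ(M, U) →ₗ[Γ(X, U)] Γ(X, U) where
  toFun := ev φ
  map_add' := ev_add φ
  map_smul' := ev_smul φ

theorem ev_sum {κ : Type*} (φ : Γ(dual M, U)) (s : Finset κ) (m : κ → Γ(M, U)) :
    ev φ (∑ i ∈ s, m i) = ∑ i ∈ s, ev φ (m i) :=
  map_sum (evLin φ) m s

theorem resO_ev (h : V ≤ U) (φ : Γ(dual M, U)) (m : Γ(M, U)) :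
    resO h (ev φ m) = ev (res h φ) (res h m) :=
  (DualSection.compat (M := M) (U := U) φ U V le_rfl h m).symm

theorem dual_ext {φ ψ : Γ(dual M, U)}
    (H : ∀ (V : X.Opens) (h : V ≤ U) (m : Γ(M, V)), ev (res h φ) m = ev (res h ψ) m) : φ = ψ :=
  DualSection.ext (M := M) (U := U) (φ := φ) (ψ := ψ) H

theorem ev_linComb {e : ι → Γ(M, W)} (h : U ≤ W) (φ : Γ(dual M, U)) (a : ι → Γ(X, U)) :
    ev φ (linComb e h a) = ∑ i, a i * ev φ (res h (e i)) := by
  rw [linComb, ev_sum]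
  exact Finset.sum_congr rfl fun i _ => ev_smul _ _ _

theorem IsBasis.dual_ext {e : ι → Γ(M, W)} (he : IsBasis e) (h : U ≤ W) {φ ψ : Γ(dual M, U)}
    (H : ∀ i, ev φ (FlagCohomology.res h (e i)) = ev ψ (FlagCohomology.res h (e i))) : φ = ψ := by
  refine FlagCohomology.dual_ext fun V h' m => ?_
  rw [← he.linComb_coord (h'.trans h) m, ev_linComb, ev_linComb]
  refine Finset.sum_congr rfl fun i _ => ?_
  rw [← res_res h' h, ← resO_ev, H, resO_ev]

/-- The linear form with prescribed values on a basis. -/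
noncomputable def IsBasis.form {e : ι → Γ(M, W)} (he : IsBasis e) (a : ι → Γ(X, W)) : Γ(dual M, W) :=
  show DualSection M W from
  { toFun := fun U h => ∑ i, resO h (a i) • (LinearMap.proj i).comp (he.coord h)
    compat := fun U V h h' m => by
      simp [he.coord_res h h', resO_resO] }

theorem IsBasis.ev_form {e : ι → Γ(M, W)} (he : IsBasis e) (a : ι → Γ(X, W)) (h : U ≤ W) (m : Γ(M, U)) :
    ev (FlagCohomology.res h (he.form a)) m = ∑ i, resO h (a i) * he.coord h m i := by
  change (∑ i, resO h (a i) • (LinearMap.proj i).comp (he.coord h)) m = _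
  simp

theorem IsBasis.ev_form_self {e : ι → Γ(M, W)} (he : IsBasis e) (a : ι → Γ(X, W)) (i : ι) :
    ev (he.form a) (e i) = a i := by
  classical
  have := he.ev_form a le_rfl (e i)
  rw [res_refl] at this
  rw [this, ← res_refl W (e i), he.coord_self]
  simp [Pi.single_apply, resO_refl]

/-- The dual basis. -/
noncomputable def IsBasis.dualVec [DecidableEq ι] {e : ι → Γ(M, W)} (he : IsBasis e) (i : ι) :
    Γ(dual M, W) := he.form (Pi.single i 1)

theorem IsBasis.ev_dualVec [DecidableEq ι] {e : ι → Γ(M, W)} (he : IsBasis e) (i : ι) (h : U ≤ W)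
    (m : Γ(M, U)) : ev (FlagCohomology.res h (he.dualVec i)) m = he.coord h m i := by
  rw [dualVec, he.ev_form]
  simp [Pi.single_apply]

theorem add_ev_sum {κ : Type*} (s : Finset κ) (φ : κ → Γ(dual M, U)) (m : Γ(M, U)) :
    ev (∑ i ∈ s, φ i) m = ∑ i ∈ s, ev (φ i) m :=
  map_sum (⟨⟨fun φ => ev φ m, rfl⟩, fun _ _ => rfl⟩ : Γ(dual M, U) →+ Γ(X, U)) φ s

/-- A family dual to a basis is a basis of the dual. -/
theorem IsBasis.dual [DecidableEq ι] {e : ι → Γ(M, W)} (he : IsBasis e) {f : ι → Γ(dual M, W)}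
    (hf : ∀ i j, ev (f i) (e j) = if i = j then 1 else 0) : IsBasis f := by
  have hev : ∀ (U : X.Opens) (h : U ≤ W) (a : ι → Γ(X, U)) j,
      ev (linComb f h a) (FlagCohomology.res h (e j)) = a j := by
    intro U h a j
    rw [linComb, add_ev_sum, Finset.sum_eq_single j]
    · rw [smul_ev, ← resO_ev, hf, if_pos rfl, map_one, mul_one]
    · intro i _ hi
      rw [smul_ev, ← resO_ev, hf, if_neg hi, map_zero, mul_zero]
    · simp
  intro U h
  refine ⟨fun a b hab => funext fun j => ?_, fun φ => ⟨fun j => ev φ (FlagCohomology.res h (e j)), ?_⟩⟩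
  · rw [← hev U h a, ← hev U h b, hab]
  · exact he.dual_ext h fun j => hev _ _ _ _

/-! ### Exterior, symmetric and tensor powers -/

theorem res_wedge {n : ℕ} (h : V ≤ U) (m : Fin n → Γ(M, U)) :
    res h (wedge m) = wedge fun i => res h (m i) := by
  refine (toSh_pres (P := extPresheaf M n) h _).symm.trans ?_
  exact congrArg (fun z : ⋀[Γ(X, V)]^n Γ(M, V) => toSh (extPresheaf M n) V z)
    (extMap_ιMulti (resO h) n (res h) m)

theorem wedge_two (x y : Γ(M, U)) (a b c d : Γ(X, U)) :
    wedge ![a • x + b • y, c • x + d • y] = (a * d - b * c) • wedge ![x, y] := by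
  have := alternating_two (exteriorPower.ιMulti Γ(X, U) 2) x y a b c d
  refine (congrArg (fun z : ⋀[Γ(X, U)]^2 Γ(M, U) => toSh (extPresheaf M 2) U z) this).trans ?_
  let w : ⋀[Γ(X, U)]^2 Γ(M, U) := exteriorPower.ιMulti Γ(X, U) 2 ![x, y]
  exact toSh_smul (P := extPresheaf M 2) (a * d - b * c) w

theorem res_vec2 (h : V ≤ U) (x y : Γ(M, U)) :
    (fun i => res h (![x, y] i)) = ![res h x, res h y] := by
  funext i; fin_cases i <;> rfl

theorem IsBasis.wedge {e : Fin 2 → Γ(M, W)} (he : IsBasis e) :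
    IsBasis fun _ : Unit => wedge ![e 0, e 1] := by
  refine isBasis_toSh (P := extPresheaf M 2)
    (fun _ : Unit => exteriorPower.ιMulti Γ(X, W) 2 ![e 0, e 1]) fun U h => ?_
  have := bijective_wedge (he.toBasis h)
  rw [he.toBasis_apply, he.toBasis_apply, ← res_vec2] at this
  rw [← extMap_ιMulti] at this
  exact this

theorem res_symMul {n : ℕ} (h : V ≤ U) (m : Fin n → Γ(M, U)) :
    res h (symMul m) = symMul fun i => res h (m i) := by
  refine (toSh_pres (P := symPresheaf M n) h _).symm.trans ?_
  refine congrArg (toSh (symPresheaf M n) V) ?_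
  have := symMap_smul_tprod (resO h) (ULift.{u} (Fin n)) (res h) 1 fun i => m i.down
  rw [one_smul, map_one, one_smul] at this
  exact this

/-- The monomial `e₀ ^ (n - j) e₁ ^ j`. -/
noncomputable def monoSec (e : Fin 2 → Γ(M, W)) (n j : ℕ) : Γ(symPow M n, W) :=
  symMul fun k : Fin n => if (k : ℕ) < j then e 1 else e 0

theorem IsBasis.mono {e : Fin 2 → Γ(M, W)} (he : IsBasis e) (n : ℕ) :
    IsBasis fun j : Fin (n + 1) => monoSec e n j := by
  refine isBasis_toSh (P := symPresheaf M n)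
    (fun j : Fin (n + 1) => symMono (R := Γ(X, W)) e n j) fun U h => ?_
  have := bijective_symMono (he.toBasis h) n
  rw [show (he.toBasis h : Fin 2 → Γ(M, U)) = fun i => FlagCohomology.res h (e i) from
    funext fun i => he.toBasis_apply h i] at this
  have h2 : ∀ j, symMono (R := Γ(X, U)) (fun i => FlagCohomology.res h (e i)) n j =
      pres (symPresheaf M n) h (symMono (R := Γ(X, W)) e n j) := by
    intro j
    have := symMap_smul_tprod (resO h) (ULift.{u} (Fin n)) (FlagCohomology.res h) 1
      fun k => if (k.down : ℕ) < j then e 1 else e 0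
    rw [one_smul, map_one, one_smul] at this
    refine Eq.trans ?_ this.symm
    simp only [apply_ite (FlagCohomology.res h)]
    rfl
  simp only [h2] at this
  exact this

/-- Expansion of a product of linear forms into monomials. -/
theorem symMul_eq {e : Fin 2 → Γ(M, W)} (he : IsBasis e) {n : ℕ} (a b : Fin n → Γ(X, W)) :
    symMul (fun i => a i • e 0 + b i • e 1) = ∑ j : Fin (n + 1),
      (∏ i, (Polynomial.C (a i) + Polynomial.C (b i) * Polynomial.X)).coeff j • monoSec e n j := by
  have hb : (he.toBasis le_rfl : Fin 2 → Γ(M, W)) = e := funext fun i => by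
    rw [he.toBasis_apply, res_refl]
  have h := tprod_eq_polySym (he.toBasis le_rfl) n fun i => a i.down • e 0 + b i.down • e 1
  rw [symPoly_apply, polySym_apply, hb] at h
  have hc : ∀ i, (he.toBasis le_rfl).coord 0 (a i • e 0 + b i • e 1) = a i := by
    intro i
    have : (he.toBasis le_rfl).coord 0 (a i • he.toBasis le_rfl 0 + b i • he.toBasis le_rfl 1) = a i := by
      simp [Module.Basis.repr_self]
    rwa [he.toBasis_apply, he.toBasis_apply, res_refl, res_refl] at this
  have hc' : ∀ i, (he.toBasis le_rfl).coord 1 (a i • e 0 + b i • e 1) = b i := by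
    intro i
    have : (he.toBasis le_rfl).coord 1 (a i • he.toBasis le_rfl 0 + b i • he.toBasis le_rfl 1) = b i := by
      simp [Module.Basis.repr_self]
    rwa [he.toBasis_apply, he.toBasis_apply, res_refl, res_refl] at this
  simp only [hc, hc'] at h
  rw [Fintype.prod_equiv Equiv.ulift
    (fun x : ULift.{u} (Fin n) => Polynomial.C (a x.down) + Polynomial.C (b x.down) * Polynomial.X)
    (fun i => Polynomial.C (a i) + Polynomial.C (b i) * Polynomial.X) (fun i => rfl)] at h
  refine (congrArg (toSh (symPresheaf M n) W) h).trans ?_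
  refine (map_sum (((sheafifyAdj X).unit.app (symPresheaf M n)).app (op W)).hom _ _).trans ?_
  exact Finset.sum_congr rfl fun j _ => toSh_smul (P := symPresheaf M n) _ _

theorem res_tmul (h : V ≤ U) (m : Γ(M, U)) (n : Γ(N, U)) :
    res h (tmul m n) = tmul (res h m) (res h n) :=
  (toSh_pres (P := tensorPresheaf M N) h _).symm

theorem add_tmul (m m' : Γ(M, U)) (n : Γ(N, U)) : tmul (m + m') n = tmul m n + tmul m' n :=
  (congrArg (toSh (tensorPresheaf M N) U) (TensorProduct.add_tmul (R := Γ(X, U)) m m' n)).trans (toSh_add _ _)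

theorem smul_tmul (a : Γ(X, U)) (m : Γ(M, U)) (n : Γ(N, U)) : tmul (a • m) n = a • tmul m n :=
  (congrArg (toSh (tensorPresheaf M N) U) (TensorProduct.smul_tmul' (R := Γ(X, U)) a m n).symm).trans
    (toSh_smul (P := tensorPresheaf M N) a _)

theorem tmul_smul (a : Γ(X, U)) (m : Γ(M, U)) (n : Γ(N, U)) : tmul m (a • n) = a • tmul m n :=
  (congrArg (toSh (tensorPresheaf M N) U) (TensorProduct.tmul_smul (R := Γ(X, U)) a m n)).trans
    (toSh_smul (P := tensorPresheaf M N) a _)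

theorem IsBasis.tmul {e : ι → Γ(M, W)} (he : IsBasis e) {f : Γ(N, W)}
    (hf : IsBasis fun _ : Unit => f) : IsBasis fun i => tmul (e i) f := by
  refine isBasis_toSh (P := tensorPresheaf M N)
    (fun i => TensorProduct.tmul Γ(X, W) (e i) f) fun U h => ?_
  let b := ((he.toBasis h).tensorProduct (hf.toBasis h)).reindex (Equiv.prodPUnit ι)
  have hb : ∀ i, b i = TensorProduct.tmul Γ(X, U) (FlagCohomology.res h (e i)) (FlagCohomology.res h f) := by
    intro i
    simp only [b, Module.Basis.reindex_apply, Equiv.prodPUnit_symm_apply,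
      Module.Basis.tensorProduct_apply]
    rw [he.toBasis_apply, hf.toBasis_apply]
  have := b.equivFun.symm.bijective
  rw [show (b.equivFun.symm : (ι → Γ(X, U)) → _) = fun a => ∑ i, a i • b i from
    funext fun a => b.equivFun_symm_apply a] at this
  simp only [hb] at this
  exact this

theorem res_tpowSec (h : V ≤ U) (m : Γ(M, U)) (n : ℕ) :
    res h (tpowSec m n) = tpowSec (res h m) n := by
  induction n with
  | zero => exact map_one (resO h)
  | succ n ih =>
    change res h (tmul _ _) = tmul _ _
    rw [res_tmul, ih]

theorem tpowSec_smul (a : Γ(X, U)) (m : Γ(M, U)) (n : ℕ) :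
    tpowSec (a • m) n = a ^ n • tpowSec m n := by
  induction n with
  | zero => rw [pow_zero, one_smul]; rfl
  | succ n ih =>
    change tmul _ _ = a ^ (n + 1) • tmul _ _
    rw [ih, smul_tmul, tmul_smul, smul_smul, pow_succ]
    rfl

theorem IsBasis.tpow {m : Γ(M, W)} (hm : IsBasis fun _ : Unit => m) (n : ℕ) :
    IsBasis fun _ : Unit => tpowSec m n := by
  induction n with
  | zero => exact isBasis_one
  | succ n ih => exact ih.tmul hm

end basesOfConstructions

/-! ### Membership in a subobject -/

section members
variable {X : Scheme.{u}} {E : X.Modules} {U V W : X.Opens} {ι : Type*} [Fintype ι]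

/-- The section `s` belongs to the subobject `Z`. -/
def Mem (Z : Subobject E) (s : Γ(E, U)) : Prop := ∃ z : Γ((Z : X.Modules), U), Hom.app Z.arrow U z = s

variable {Z Z' : Subobject E}

theorem mem_arrow (z : Γ((Z : X.Modules), U)) : Mem Z (Hom.app Z.arrow U z) := ⟨z, rfl⟩

theorem Mem.res {s : Γ(E, U)} (hs : Mem Z s) (h : V ≤ U) : Mem Z (res h s) := by
  obtain ⟨z, rfl⟩ := hs
  exact ⟨FlagCohomology.res h z, app_res _ _ _⟩

theorem Mem.add {s t : Γ(E, U)} (hs : Mem Z s) (ht : Mem Z t) : Mem Z (s + t) := by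
  obtain ⟨z, rfl⟩ := hs
  obtain ⟨w, rfl⟩ := ht
  exact ⟨z + w, map_add _ _ _⟩

theorem Mem.smul {s : Γ(E, U)} (hs : Mem Z s) (a : Γ(X, U)) : Mem Z (a • s) := by
  obtain ⟨z, rfl⟩ := hs
  exact ⟨a • z, Hom.app_smul _ _ _⟩

theorem Mem.zero : Mem Z (0 : Γ(E, U)) := ⟨0, map_zero _⟩

theorem Mem.sum {κ : Type*} (s : Finset κ) {f : κ → Γ(E, U)} (h : ∀ i ∈ s, Mem Z (f i)) :
    Mem Z (∑ i ∈ s, f i) := by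
  classical
  induction s using Finset.induction_on with
  | empty => exact Mem.zero
  | insert i s hi ih =>
    rw [Finset.sum_insert hi]
    exact (h i (Finset.mem_insert_self _ _)).add (ih fun j hj => h j (Finset.mem_insert_of_mem hj))

theorem mem_of_locally {s : Γ(E, U)} (H : ∀ x ∈ U, ∃ (V : X.Opens) (h : V ≤ U), x ∈ V ∧
    Mem Z (res h s)) : Mem Z s := by
  obtain ⟨z, hz⟩ := exists_of_locally (M := (Z : X.Modules)) (U := U)
    (fun V z => ∃ h : V ≤ U, Hom.app Z.arrow V z = res h s)
    (by
      rintro V V' h z ⟨h', e⟩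
      exact ⟨h.trans h', by rw [app_res, e, res_res]⟩)
    (by
      rintro V z z' _ ⟨_, e⟩ ⟨_, e'⟩
      exact app_injective_of_mono Z.arrow V (e.trans e'.symm))
    (by
      intro x hx
      obtain ⟨V, h, hxV, z, hz⟩ := H x hx
      exact ⟨V, h, hxV, z, h, hz⟩)
  refine ⟨z, eq_of_locally fun x hx => ?_⟩
  obtain ⟨V, h, hxV, _, e⟩ := hz x hx
  exact ⟨V, h, hxV, by rw [← app_res, e]⟩

theorem exists_lift_of_mem {A : X.Modules} (φ : A ⟶ E) (H : ∀ (U : X.Opens) (s : Γ(A, U)), Mem Z (Hom.app φ U s)) :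
    ∃ ψ : A ⟶ (Z : X.Modules), ψ ≫ Z.arrow = φ := by
  choose f hf using H
  have hi := fun U => app_injective_of_mono Z.arrow U
  refine ⟨mkHom f (fun U s t => hi U ?_) (fun U a s => hi U ?_) (fun {U V} h s => hi U ?_), ?_⟩
  · rw [hf, map_add, map_add, hf, hf]
  · rw [hf, Hom.app_smul, Hom.app_smul, hf]
  · rw [hf, app_res, app_res, hf]
  · ext U s
    exact hf U s

theorem le_iff_mem : Z ≤ Z' ↔ ∀ (U : X.Opens) (s : Γ(E, U)), Mem Z s → Mem Z' s := by
  constructor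
  · rintro h U _ ⟨z, rfl⟩
    refine ⟨Hom.app (Subobject.ofLE Z Z' h) U z, ?_⟩
    exact congrArg (fun f => Hom.app f U z) (Subobject.ofLE_arrow h)
  · intro H
    obtain ⟨ψ, hψ⟩ := exists_lift_of_mem (Z := Z') Z.arrow fun U z => H U _ ⟨z, rfl⟩
    exact Subobject.le_of_comm ψ hψ

theorem mem_kernelSubobject {N : X.Modules} (φ : E ⟶ N) (s : Γ(E, U)) :
    Mem (kernelSubobject φ) s ↔ Hom.app φ U s = 0 := by
  constructor
  · rintro ⟨z, rfl⟩
    exact congrArg (fun f => Hom.app f U z) (kernelSubobject_arrow_comp φ)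
  · intro hs
    obtain ⟨m, rfl⟩ := exists_of_kernel (kernel.condition φ) (kernelIsKernel φ) s hs
    refine ⟨Hom.app (kernelSubobjectIso φ).inv U m, ?_⟩
    exact congrArg (fun f => Hom.app f U m) (kernelSubobject_arrow' φ)

/-- The extension `j_* j^* N`, where `j` is the inclusion of the open subscheme `D`. -/
noncomputable def extRes (D : X.Opens) (N : X.Modules) : X.Modules :=
  (pushforward D.ι).obj (N.restrict D.ι)

theorem ext_le_left (D U : X.Opens) : D.ι ''ᵁ (D.ι ⁻¹ᵁ U) ≤ U := D.ι.image_preimage_le U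
theorem ext_le_right (D U : X.Opens) : D.ι ''ᵁ (D.ι ⁻¹ᵁ U) ≤ D := image_le D _

theorem le_ext {D U : X.Opens} (h : V ≤ U) (h' : V ≤ D) : V ≤ D.ι ''ᵁ (D.ι ⁻¹ᵁ U) := by
  rw [Scheme.Hom.image_preimage_eq_opensRange_inf, Scheme.Opens.opensRange_ι]
  exact le_inf h' h

/-- A section over `U ∩ D` as a section of the extension. -/
def toExt {N : X.Modules} (D U : X.Opens) (m : Γ(N, D.ι ''ᵁ (D.ι ⁻¹ᵁ U))) : Γ(extRes D N, U) := m

theorem res_toExt {N : X.Modules} (D : X.Opens) (h : V ≤ U) (m : Γ(N, D.ι ''ᵁ (D.ι ⁻¹ᵁ U))) :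
    res h (toExt D U m) = toExt D V (res (Scheme.Hom.image_mono D.ι (Scheme.Hom.preimage_mono D.ι h)) m) := rfl

theorem smul_toExt {N : X.Modules} (D U : X.Opens) (a : Γ(X, U)) (m : Γ(N, D.ι ''ᵁ (D.ι ⁻¹ᵁ U))) :
    a • toExt D U m = toExt D U (resO (ext_le_left D U) a • m) := by
  have h1 : a • toExt D U m = ((D.ι.app U a : Γ(D, D.ι ⁻¹ᵁ U)) • (show Γ(N.restrict D.ι, D.ι ⁻¹ᵁ U) from m)) := rfl
  rw [h1, restrict_smul_def]
  rfl

theorem IsBasis.ext_app {N : X.Modules} {e : ι → Γ(E, W)} (he : IsBasis e) (φ ψ : E ⟶ N)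
    (H : ∀ i, Hom.app φ W (e i) = Hom.app ψ W (e i)) (h : U ≤ W) (m : Γ(E, U)) :
    Hom.app φ U m = Hom.app ψ U m := by
  rw [← he.linComb_coord h m, app_linComb, app_linComb, funext H]

/-- The coordinates in a basis over `D`, as a morphism of sheaves on the whole scheme. -/
noncomputable def coordHom {D : X.Opens} {e : ι → Γ(E, D)} (he : IsBasis e) (i : ι) :
    E ⟶ extRes D (unitModule X) :=
  mkHom (fun U s => toExt D U (funSec (he.coord (ext_le_right D U) (res (ext_le_left D U) s) i)))
    (fun U s t => by rw [map_add, map_add]; rfl)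
    (fun U a s => by
      rw [smul_toExt, map_smulₛₗ, LinearMap.map_smul, smul_funSec]; rfl)
    (fun {U V} h s => by
      rw [res_toExt, res_funSec, ← he.coord_res, res_res, res_res])

theorem coordHom_eq_zero {D : X.Opens} {e : ι → Γ(E, D)} (he : IsBasis e) (i : ι) (h : U ≤ D)
    (s : Γ(E, U)) : Hom.app (coordHom he i) U s = 0 ↔ he.coord h s i = 0 := by
  have h2 : Hom.app (coordHom he i) U s =
    toExt D U (funSec (he.coord (ext_le_right D U) (res (ext_le_left D U) s) i)) := rfl
  rw [h2, he.coord_res h (ext_le_left D U)]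
  constructor
  · intro h3
    have h4 : resO (ext_le_left D U) (he.coord h s i) = 0 := h3
    have := congrArg (resO (le_ext le_rfl h)) h4
    rwa [resO_resO, resO_refl, map_zero] at this
  · intro h3
    rw [h3, map_zero]; rfl

end members

/-! ### Pullback of sections and of bases -/

section pulling
variable {T X : Scheme.{u}} (g : T ⟶ X) {E F : X.Modules} {U V W : X.Opens} {ι : Type*} [Fintype ι]

/-- The pullback of a section. -/
noncomputable def unitSec (s : Γ(E, W)) : Γ((Scheme.Modules.pullback g).obj E, g ⁻¹ᵁ W) :=
  Hom.app ((pullbackPushforwardAdjunction g).unit.app E) W s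

theorem unitSec_add (s t : Γ(E, W)) : unitSec g (s + t) = unitSec g s + unitSec g t :=
  map_add (Hom.app ((pullbackPushforwardAdjunction g).unit.app E) W).hom s t

theorem unitSec_smul (a : Γ(X, W)) (s : Γ(E, W)) : unitSec g (a • s) = g.app W a • unitSec g s :=
  Hom.app_smul ((pullbackPushforwardAdjunction g).unit.app E) a s

theorem unitSec_res (h : U ≤ W) (s : Γ(E, W)) :
    unitSec g (res h s) = res (Scheme.Hom.preimage_mono g h) (unitSec g s) :=
  app_res ((pullbackPushforwardAdjunction g).unit.app E) h s

theorem map_unitSec (φ : E ⟶ F) (s : Γ(E, W)) :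
    Hom.app ((Scheme.Modules.pullback g).map φ) (g ⁻¹ᵁ W) (unitSec g s) = unitSec g (Hom.app φ W s) :=
  congrArg (fun f => Hom.app f W s) ((pullbackPushforwardAdjunction g).unit.naturality φ).symm

variable {g}

theorem pullback_hom_ext {N : T.Modules} {φ ψ : (Scheme.Modules.pullback g).obj E ⟶ N}
    (H : ∀ (W : X.Opens) (s : Γ(E, W)),
      Hom.app φ (g ⁻¹ᵁ W) (unitSec g s) = Hom.app ψ (g ⁻¹ᵁ W) (unitSec g s)) : φ = ψ := by
  apply ((pullbackPushforwardAdjunction g).homEquiv E N).injective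
  rw [Adjunction.homEquiv_unit, Adjunction.homEquiv_unit]
  ext W s
  exact H W s

theorem exists_pullback_hom {N : T.Modules} (f : E ⟶ (pushforward g).obj N) :
    ∃ φ : (Scheme.Modules.pullback g).obj E ⟶ N, ∀ (W : X.Opens) (s : Γ(E, W)),
      Hom.app φ (g ⁻¹ᵁ W) (unitSec g s) = Hom.app f W s := by
  refine ⟨((pullbackPushforwardAdjunction g).homEquiv E N).symm f, fun W s => ?_⟩
  have := ((pullbackPushforwardAdjunction g).homEquiv E N).apply_symm_apply f
  rw [Adjunction.homEquiv_unit] at this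
  exact congrArg (fun f => Hom.app f W s) this

theorem resO_app (h : U ≤ W) (a : Γ(X, W)) :
    resO (Scheme.Hom.preimage_mono g h) (g.app W a) = g.app U (resO h a) :=
  (congr($(g.naturality (homOfLE h).op) a)).symm

theorem unitSec_linComb (e : ι → Γ(E, W)) (h : U ≤ W) (a : ι → Γ(X, U)) :
    unitSec g (linComb e h a) =
      linComb (fun i => unitSec g (e i)) (Scheme.Hom.preimage_mono g h) fun i => g.app U (a i) := by
  refine (map_sum (Hom.app ((pullbackPushforwardAdjunction g).unit.app E) U).hom _ _).trans ?_
  refine Finset.sum_congr rfl fun i _ => ?_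
  refine (unitSec_smul g _ _).trans ?_
  rw [unitSec_res]

/-- Multiplication of a section over `D` by functions. -/
noncomputable def mulHom {N : T.Modules} {D : T.Opens} (n : Γ(N, D)) :
    extRes D (unitModule T) ⟶ extRes D N :=
  mkHom (M := extRes D (unitModule T)) (N := extRes D N)
    (fun U a => toExt D U ((show Γ(T, D.ι ''ᵁ (D.ι ⁻¹ᵁ U)) from a) • res (ext_le_right D U) n))
    (fun U s t => add_smul (M := Γ(N, D.ι ''ᵁ (D.ι ⁻¹ᵁ U))) (show Γ(T, D.ι ''ᵁ (D.ι ⁻¹ᵁ U)) from s)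
      (show Γ(T, D.ι ''ᵁ (D.ι ⁻¹ᵁ U)) from t) _)
    (fun U a s => by
      rw [smul_toExt, smul_smul]
      have : a • s = toExt D U (funSec (resO (ext_le_left D U) a * (show Γ(T, D.ι ''ᵁ (D.ι ⁻¹ᵁ U)) from s))) :=
        smul_toExt D U a (N := unitModule T) (funSec s)
      rw [this]; rfl)
    (fun {U V} h s => by
      rw [res_toExt, map_smulₛₗ, res_res]; rfl)

/-- Pulling back sections preserves bases. -/
theorem IsBasis.unitSec {e : ι → Γ(E, W)} (he : IsBasis e) : IsBasis fun i => unitSec g (e i) := by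
  classical
  let D := g ⁻¹ᵁ W
  let f : ι → Γ((Scheme.Modules.pullback g).obj E, D) := fun i => FlagCohomology.unitSec g (e i)
  have hle : ∀ U : X.Opens, D.ι ''ᵁ (D.ι ⁻¹ᵁ (g ⁻¹ᵁ U)) ≤ g ⁻¹ᵁ (U ⊓ W) := fun U =>
    le_inf (ext_le_left _ _) (ext_le_right _ _)
  let c (i : ι) : E ⟶ (pushforward g).obj (extRes D (unitModule T)) :=
    mkHom (N := (pushforward g).obj (extRes D (unitModule T)))
      (fun U s => toExt D (g ⁻¹ᵁ U) (funSec (resO (hle U)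
        (g.app (U ⊓ W) (he.coord inf_le_right (FlagCohomology.res inf_le_left s) i)))))
      (fun U s t => by simp only [map_add, Pi.add_apply]; rfl)
      (fun U a s => by
        rw [map_smulₛₗ, LinearMap.map_smul, Pi.smul_apply, smul_eq_mul, map_mul, map_mul, ← resO_app,
          resO_resO]
        refine Eq.trans ?_ (smul_toExt D (g ⁻¹ᵁ U) (g.app U a) _).symm
        rfl)
      (fun {U V} h s => by
        refine Eq.trans ?_ (res_toExt D (Scheme.Hom.preimage_mono g h) _).symm
        rw [res_funSec, resO_resO]
        congr 2
        rw [res_res, ← res_res (inf_le_inf_right W h) inf_le_left, he.coord_res inf_le_right,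
          ← resO_app, resO_resO])
  choose l hl using fun i => exists_pullback_hom (c i)
  have hlf : ∀ i j, Hom.app (l i) D (f j) = toExt D D (funSec (if j = i then 1 else 0)) := by
    intro i j
    refine (hl i W (e j)).trans ?_
    change toExt D (g ⁻¹ᵁ W) (funSec (resO (hle W)
        (g.app (W ⊓ W) (he.coord inf_le_right (FlagCohomology.res inf_le_left (e j)) i)))) = _
    have h1 := he.coord_self (inf_le_left : W ⊓ W ≤ W) j
    rw [show he.coord (inf_le_right : W ⊓ W ≤ W) = he.coord inf_le_left from rfl, h1]
    simp only [Pi.single_apply, eq_comm (a := i)]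
    split_ifs <;> (simp; rfl)
  have h1 : ∀ (U : T.Opens) (h : U ≤ D) (a : ι → Γ(T, U)) i,
      Hom.app (l i) U (linComb f h a) = toExt D U (funSec (resO (ext_le_left D U) (a i))) := by
    intro U h a i
    rw [app_linComb]
    have : ∀ j, a j • FlagCohomology.res h (Hom.app (l i) D (f j)) =
        toExt D U (if j = i then funSec (resO (ext_le_left D U) (a j)) else 0) := by
      intro j
      rw [hlf, res_toExt, smul_toExt]
      split_ifs <;> rw [res_funSec, smul_funSec] <;> simp <;> rfl
    unfold linComb
    simp only [this]
    rw [Finset.sum_eq_single i]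
    · rw [if_pos rfl]
    · intro j _ hj; rw [if_neg hj]; rfl
    · simp
  have h2 : (restrictAdjunction D.ι).unit.app ((Scheme.Modules.pullback g).obj E) =
      ∑ i, l i ≫ mulHom (f i) := by
    refine pullback_hom_ext fun U s => ?_
    have h3 : Hom.app (∑ i, l i ≫ mulHom (f i)) (g ⁻¹ᵁ U) (FlagCohomology.unitSec g s) =
        ∑ i, Hom.app (mulHom (f i)) (g ⁻¹ᵁ U) (Hom.app (l i) (g ⁻¹ᵁ U) (FlagCohomology.unitSec g s)) := by
      exact app_sum _ _ _
    refine Eq.trans ?_ h3.symm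
    have h4 : FlagCohomology.res (ext_le_left D (g ⁻¹ᵁ U)) (FlagCohomology.unitSec g s) =
        linComb f (ext_le_right D (g ⁻¹ᵁ U)) fun i => resO (hle U)
        (g.app (U ⊓ W) (he.coord inf_le_right (FlagCohomology.res inf_le_left s) i)) := by
      rw [← res_linComb f (Scheme.Hom.preimage_mono g (inf_le_right : U ⊓ W ≤ W)) (hle U),
        ← unitSec_linComb e (inf_le_right : U ⊓ W ≤ W),
        he.linComb_coord, unitSec_res, res_res]
    refine Eq.trans h4 ?_
    have h5 : ∀ i, Hom.app (mulHom (f i)) (g ⁻¹ᵁ U) (Hom.app (l i) (g ⁻¹ᵁ U) (FlagCohomology.unitSec g s)) =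
        toExt D _ ((resO (hle U)
        (g.app (U ⊓ W) (he.coord inf_le_right (FlagCohomology.res inf_le_left s) i))) •
          FlagCohomology.res (ext_le_right D (g ⁻¹ᵁ U)) (f i)) := by
      intro i
      rw [hl]; rfl
    simp only [h5]
    rfl
  intro U h
  refine ⟨fun a b hab => funext fun i => ?_, fun s => ?_⟩
  · have := congrArg (Hom.app (l i) U) hab
    rw [h1, h1] at this
    have h4 : resO (ext_le_left D U) (a i) = resO (ext_le_left D U) (b i) := this
    have := congrArg (resO (le_ext le_rfl h)) h4
    rwa [resO_resO, resO_resO, resO_refl, resO_refl] at this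
  · refine ⟨fun i => resO (le_ext le_rfl h) (show Γ(T, D.ι ''ᵁ (D.ι ⁻¹ᵁ U)) from Hom.app (l i) U s), ?_⟩
    have h3 : Hom.app (∑ i, l i ≫ mulHom (f i)) U s =
        ∑ i, Hom.app (mulHom (f i)) U (Hom.app (l i) U s) := by
      exact app_sum _ _ _
    rw [← h2] at h3
    have h4 : FlagCohomology.res (ext_le_left D U) s = linComb f (ext_le_right D U)
      fun i => (show Γ(T, D.ι ''ᵁ (D.ι ⁻¹ᵁ U)) from Hom.app (l i) U s) := h3
    have := congrArg (FlagCohomology.res (le_ext le_rfl h)) h4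
    rw [res_res, res_refl, res_linComb] at this
    exact this.symm

end pulling

/-! ### Images of subobjects -/

section images
variable {T X : Scheme.{u}} {g : T ⟶ X} {E : X.Modules} {N N' : T.Modules} {W : X.Opens}
  {ι : Type*} [Fintype ι]

theorem IsBasis.map_iso {D : T.Opens} {e : ι → Γ(N, D)} (he : IsBasis e) (k : N ≅ N') :
    IsBasis fun i => Hom.app k.hom D (e i) :=
  he.map k.hom fun U _ => (ConcreteCategory.isIso_iff_bijective _).1
    (inferInstanceAs (IsIso (Hom.app k.hom U)))

variable (k : (Scheme.Modules.pullback g).obj E ⟶ N)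

theorem mem_imageSubobject {Z : Subobject E} {s : Γ(E, W)} (hs : Mem Z s) :
    Mem (imageSubobject ((Scheme.Modules.pullback g).map Z.arrow ≫ k))
      (Hom.app k (g ⁻¹ᵁ W) (unitSec g s)) := by
  obtain ⟨z, rfl⟩ := hs
  refine ⟨Hom.app (factorThruImageSubobject _) _ (unitSec g z), ?_⟩
  refine (congrArg (fun f => Hom.app f (g ⁻¹ᵁ W) (unitSec g z)) (imageSubobject_arrow_comp
    ((Scheme.Modules.pullback g).map Z.arrow ≫ k))).trans ?_
  change Hom.app k _ (Hom.app ((Scheme.Modules.pullback g).map Z.arrow) _ (unitSec g z)) = _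
  rw [map_unitSec]

theorem imageSubobject_le_of_mem {Z : Subobject E} {Z' : Subobject N}
    (H : ∀ (W : X.Opens) (s : Γ(E, W)), Mem Z s → Mem Z' (Hom.app k (g ⁻¹ᵁ W) (unitSec g s))) :
    imageSubobject ((Scheme.Modules.pullback g).map Z.arrow ≫ k) ≤ Z' := by
  have H' : ∀ (W : X.Opens) (z : Γ((Z : X.Modules), W)),
      Mem Z' (Hom.app k (g ⁻¹ᵁ W) (unitSec g (Hom.app Z.arrow W z))) :=
    fun W z => H W _ ⟨z, rfl⟩
  choose f hf using H'
  have hi := fun U => app_injective_of_mono Z'.arrow U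
  let c : (Z : X.Modules) ⟶ (pushforward g).obj (Z' : T.Modules) :=
    mkHom (N := (pushforward g).obj (Z' : T.Modules)) f
      (fun U s t => hi _ (by
        rw [hf, map_add, unitSec_add, map_add, ← hf, ← hf]; exact (map_add _ _ _).symm))
      (fun U a s => hi _ (by
        rw [hf, Hom.app_smul, unitSec_smul, Hom.app_smul, ← hf]; exact (Hom.app_smul _ _ _).symm))
      (fun {U V} hUV s => hi _ (by
        rw [hf, app_res, unitSec_res, app_res, ← hf, ← app_res]; rfl))
  obtain ⟨φ, hφ⟩ := exists_pullback_hom c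
  refine imageSubobject_le _ φ (pullback_hom_ext fun W s => ?_)
  change Hom.app Z'.arrow _ (Hom.app φ _ (unitSec g s)) =
    Hom.app k _ (Hom.app ((Scheme.Modules.pullback g).map Z.arrow) _ (unitSec g s))
  rw [hφ, map_unitSec]
  exact hf W s

end images

/-! ### Pullback of subobjects -/

section pullSec
variable {T X S : Scheme.{u}} {g : T ⟶ X} {π : X ⟶ S} {t : T ⟶ S} {V : S.Modules}
  {U W : X.Opens} {ι κ : Type*} [Fintype ι] [Fintype κ]

theorem pullSec_eq (h : g ≫ π = t) (s : Γ((Scheme.Modules.pullback π).obj V, W)) :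
    pullSec h s = Hom.app (pullIso h V).hom (g ⁻¹ᵁ W) (unitSec g s) := rfl

theorem pullSec_add (h : g ≫ π = t) (s s' : Γ((Scheme.Modules.pullback π).obj V, W)) :
    pullSec h (s + s') = pullSec h s + pullSec h s' := by
  rw [pullSec_eq, pullSec_eq, pullSec_eq, unitSec_add, map_add]

theorem pullSec_smul (h : g ≫ π = t) (a : Γ(X, W)) (s : Γ((Scheme.Modules.pullback π).obj V, W)) :
    pullSec h (a • s) = g.app W a • pullSec h s := by
  rw [pullSec_eq, pullSec_eq, unitSec_smul, Hom.app_smul]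

theorem pullSec_res (h : g ≫ π = t) (hU : U ≤ W) (s : Γ((Scheme.Modules.pullback π).obj V, W)) :
    pullSec h (res hU s) = res (Scheme.Hom.preimage_mono g hU) (pullSec h s) := by
  rw [pullSec_eq, pullSec_eq, unitSec_res, app_res]

theorem pullSec_linComb (h : g ≫ π = t) (e : ι → Γ((Scheme.Modules.pullback π).obj V, W)) (hU : U ≤ W)
    (a : ι → Γ(X, U)) : pullSec h (linComb e hU a) =
      linComb (fun i => pullSec h (e i)) (Scheme.Hom.preimage_mono g hU) fun i => g.app U (a i) := by
  rw [funext fun i => pullSec_eq h (e i), pullSec_eq, unitSec_linComb, app_linComb]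

theorem IsBasis.pullSec (h : g ≫ π = t) {e : ι → Γ((Scheme.Modules.pullback π).obj V, W)}
    (he : IsBasis e) : IsBasis fun i => pullSec h (e i) := by
  rw [funext fun i => pullSec_eq h (e i)]
  exact (he.unitSec (g := g)).map_iso (pullIso h V)

theorem coord_pullSec (h : g ≫ π = t) {e : ι → Γ((Scheme.Modules.pullback π).obj V, W)}
    (he : IsBasis e) (hU : U ≤ W) (s : Γ((Scheme.Modules.pullback π).obj V, U)) (i : ι) :
    (he.pullSec h).coord (Scheme.Hom.preimage_mono g hU) (FlagCohomology.pullSec h s) i =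
      g.app U (he.coord hU s i) := by
  conv_lhs => rw [← he.linComb_coord hU s, pullSec_linComb, IsBasis.coord_linComb]

/-- Pulling back a section of `V` in two steps. -/
theorem pullSec_unitSec (h : g ≫ π = t) {O : S.Opens} (v : Γ(V, O)) :
    pullSec h (unitSec π v) = res (by rw [← h]; rfl) (unitSec t v) := by
  subst h
  refine Eq.trans ?_ (res_refl (g ⁻¹ᵁ π ⁻¹ᵁ O) (unitSec (g ≫ π) v)).symm
  have h1 := unit_conjugateEquiv ((pullbackPushforwardAdjunction π).comp (pullbackPushforwardAdjunction g))
    (pullbackPushforwardAdjunction (g ≫ π)) (pullbackComp g π).inv V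
  rw [conjugateEquiv_pullbackComp_inv] at h1
  have h2 : unitSec g (unitSec π v) =
      Hom.app ((pullbackComp g π).inv.app V) (g ⁻¹ᵁ π ⁻¹ᵁ O) (unitSec (g ≫ π) v) :=
    congrArg (fun f => Hom.app f O v) h1
  rw [pullSec_eq, h2]
  have h3 : (pullbackComp g π).inv.app V ≫ (pullIso rfl V).hom = 𝟙 _ := by
    simp [pullIso, pullbackCongr]
  exact congrArg (fun f => Hom.app f (g ⁻¹ᵁ π ⁻¹ᵁ O) (unitSec (g ≫ π) v)) h3

theorem mem_pullSub (h : g ≫ π = t) {Z : Subobject ((Scheme.Modules.pullback π).obj V)}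
    {s : Γ((Scheme.Modules.pullback π).obj V, W)} (hs : Mem Z s) : Mem (pullSub h Z) (pullSec h s) := by
  rw [pullSec_eq]
  exact mem_imageSubobject (pullIso h V).hom hs

/-- The pullback of a subobject is the smallest subobject which contains the pullbacks of its
sections. -/
theorem pullSub_le (h : g ≫ π = t) {Z : Subobject ((Scheme.Modules.pullback π).obj V)}
    {Z' : Subobject ((Scheme.Modules.pullback t).obj V)}
    (H : ∀ (W : X.Opens) (s : Γ((Scheme.Modules.pullback π).obj V, W)), Mem Z s → Mem Z' (pullSec h s)) :
    pullSub h Z ≤ Z' := by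
  have H' (W : X.Opens) (s : Γ((Scheme.Modules.pullback π).obj V, W)) (hs : Mem Z s) :
      Mem Z' (Hom.app (pullIso h V).hom (g ⁻¹ᵁ W) (unitSec g s)) := by
    rw [← pullSec_eq]
    exact H W s hs
  exact imageSubobject_le_of_mem (pullIso h V).hom H'

end pullSec

/-! ### Bases adapted to a subbundle -/

section adapted
variable {X : Scheme.{u}} {E : X.Modules} {U V W : X.Opens} {ι κ : Type*} [Fintype ι] [Fintype κ]

/-- A basis of `E` over `W` is adapted to the subobject `Z` if the sections of `Z` are those whose
coordinates of index in `κ` vanish. -/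
structure Adapted (Z : Subobject E) (e : ι ⊕ κ → Γ(E, W)) : Prop where
  basis : IsBasis e
  mem_iff {U : X.Opens} (h : U ≤ W) (s : Γ(E, U)) :
    Mem Z s ↔ ∀ k, basis.coord h s (Sum.inr k) = 0

theorem Adapted.of_mem {Z : Subobject E} {e : ι ⊕ κ → Γ(E, W)} (he : IsBasis e)
    (hi : ∀ i, Mem Z (e (Sum.inl i)))
    (H : ∀ (U : X.Opens) (h : U ≤ W) (s : Γ(E, U)), Mem Z s → ∀ k, he.coord h s (Sum.inr k) = 0) :
    Adapted Z e := by
  refine ⟨he, fun {U} h s => ⟨H U h s, fun hs => ?_⟩⟩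
  rw [← he.linComb_coord h s, linComb, Fintype.sum_sum_type]
  simp only [hs, zero_smul, Finset.sum_const_zero, add_zero]
  exact Mem.sum _ fun i _ => ((hi i).res h).smul _

variable {Z : Subobject E} {e : ι ⊕ κ → Γ(E, W)}

theorem Adapted.mem (he : Adapted Z e) (i : ι) : Mem Z (e (Sum.inl i)) := by
  classical
  rw [he.mem_iff le_rfl]
  intro k
  rw [← res_refl W (e (Sum.inl i)), he.basis.coord_self]
  simp

theorem Adapted.res (he : Adapted Z e) (h : V ≤ W) : Adapted Z fun i => res h (e i) := by
  refine ⟨he.basis.res h, fun {U} h' s => (he.mem_iff (h'.trans h) s).trans (forall_congr' fun k => ?_)⟩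
  have : (he.basis.res h).coord h' s = he.basis.coord (h'.trans h) s := by
    apply ((he.basis.res h) U h').1
    rw [IsBasis.linComb_coord, linComb_res, IsBasis.linComb_coord]
  rw [this]

theorem Adapted.pull {T S : Scheme.{u}} {g : T ⟶ X} {π : X ⟶ S} {t : T ⟶ S} {V : S.Modules}
    {Z : Subobject ((Scheme.Modules.pullback π).obj V)}
    {e : ι ⊕ κ → Γ((Scheme.Modules.pullback π).obj V, W)} (h : g ≫ π = t) (he : Adapted Z e) :
    Adapted (pullSub h Z) fun i => pullSec h (e i) := by
  refine Adapted.of_mem (he.basis.pullSec h) (fun i => mem_pullSub h (he.mem i)) ?_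
  intro U hU s hs k
  rw [← coordHom_eq_zero (he.basis.pullSec h) (Sum.inr k) hU, ← mem_kernelSubobject]
  refine le_iff_mem.1 (pullSub_le h fun O s hs => ?_) U s hs
  rw [mem_kernelSubobject]
  refine congrArg (fun a => toExt (g ⁻¹ᵁ W) (g ⁻¹ᵁ O) (funSec a)) (?_ : _ = (0 : Γ(T, _)))
  have hle : (g ⁻¹ᵁ W).ι ''ᵁ ((g ⁻¹ᵁ W).ι ⁻¹ᵁ (g ⁻¹ᵁ O)) ≤ g ⁻¹ᵁ (O ⊓ W) :=
    le_inf (ext_le_left _ _) (ext_le_right _ _)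
  have h1 : FlagCohomology.res (ext_le_left (g ⁻¹ᵁ W) (g ⁻¹ᵁ O)) (pullSec h s) =
      FlagCohomology.res hle (pullSec h (FlagCohomology.res (inf_le_left : O ⊓ W ≤ O) s)) := by
    rw [pullSec_res]
    exact (res_res _ _ _).symm
  have h3 := (he.basis.pullSec h).coord_res (Scheme.Hom.preimage_mono g (inf_le_right : O ⊓ W ≤ W))
    hle (pullSec h (FlagCohomology.res (inf_le_left : O ⊓ W ≤ O) s)) (Sum.inr k)
  rw [coord_pullSec h he.basis inf_le_right, (he.mem_iff inf_le_right _).1 (hs.res inf_le_left) k, map_zero, map_zero,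
    ← h1] at h3
  exact h3

/-- The basis of a subobject given by an adapted basis. -/
theorem Adapted.exists_basis (he : Adapted Z e) : ∃ z : ι → Γ((Z : X.Modules), W), IsBasis z ∧
    ∀ i, Hom.app Z.arrow W (z i) = e (Sum.inl i) := by
  choose z hz using he.mem
  refine ⟨z, fun U h => ?_, hz⟩
  have key : ∀ a : ι → Γ(X, U), Hom.app Z.arrow U (linComb z h a) = linComb e h (Sum.elim a 0) := by
    intro a
    rw [app_linComb, linComb, linComb, Fintype.sum_sum_type]
    simp [hz]
  constructor
  · intro a b hab
    have := congrArg (Hom.app Z.arrow U) hab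
    rw [key, key] at this
    have := (he.basis U h).1 this
    funext i
    exact congrFun this (Sum.inl i)
  · intro s
    refine ⟨fun i => he.basis.coord h (Hom.app Z.arrow U s) (Sum.inl i), app_injective_of_mono Z.arrow U ?_⟩
    rw [key]
    conv_rhs => rw [← he.basis.linComb_coord h (Hom.app Z.arrow U s)]
    congr 1
    funext i
    cases i with
    | inl i => rfl
    | inr k => exact ((he.mem_iff h _).1 ⟨s, rfl⟩ k).symm

theorem mem_iff_cokernel (s : Γ(E, U)) : Mem Z s ↔ Hom.app (cokernel.π Z.arrow) U s = 0 := by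
  constructor
  · rintro ⟨z, rfl⟩
    exact congrArg (fun f => Hom.app f U z) (cokernel.condition Z.arrow)
  · intro hs
    exact exists_of_kernel (cokernel.condition Z.arrow) (Abelian.monoIsKernelOfCokernel _ (colimit.isColimit _)) s hs

/-- The basis of a quotient given by an adapted basis. -/
theorem Adapted.isBasis_cokernel (he : Adapted Z e) :
    IsBasis fun k => Hom.app (cokernel.π Z.arrow) W (e (Sum.inr k)) := by
  have key : ∀ (U : X.Opens) (h : U ≤ W) (a : ι ⊕ κ → Γ(X, U)),
      Hom.app (cokernel.π Z.arrow) U (linComb e h a) =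
      linComb (fun k => Hom.app (cokernel.π Z.arrow) W (e (Sum.inr k))) h fun k => a (Sum.inr k) := by
    intro U h a
    rw [app_linComb, linComb, linComb, Fintype.sum_sum_type]
    simp [(mem_iff_cokernel _).1 (he.mem _)]
  refine IsBasis.of_locally_surjective _ (fun U h a b hab => ?_) fun U h s x hx => ?_
  · have h1 := key U h (Sum.elim 0 (a - b))
    have h2 : Hom.app (cokernel.π Z.arrow) U (linComb e h (Sum.elim 0 (a - b))) = 0 := by
      rw [h1]
      simp only [Sum.elim_inr]
      have := linComb_add (fun k => Hom.app (cokernel.π Z.arrow) W (e (Sum.inr k))) h (a - b) b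
      rw [sub_add_cancel, hab] at this
      exact add_eq_right.1 this.symm
    rw [← mem_iff_cokernel, he.mem_iff h] at h2
    funext k
    have := h2 k
    rw [he.basis.coord_linComb] at this
    exact sub_eq_zero.1 this
  · obtain ⟨V, h', m, hxV, hm⟩ := exists_of_epi (cokernel.π Z.arrow) s hx
    refine ⟨V, h', hxV, fun k => he.basis.coord (h'.trans h) m (Sum.inr k), ?_⟩
    rw [← key, he.basis.linComb_coord, hm]

theorem exists_common_nhd {κ : Type*} [Finite κ] {x : X} (P : κ → X.Opens → Prop)
    (hP : ∀ k {V V'}, V' ≤ V → P k V → P k V') (H : ∀ k, ∃ V, x ∈ V ∧ P k V) :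
    ∃ V, x ∈ V ∧ ∀ k, P k V := by
  choose V hV hPV using H
  refine ⟨⟨⋂ k, V k, isOpen_iInter_of_finite fun k => (V k).2⟩, Set.mem_iInter.2 hV, fun k => ?_⟩
  exact hP k (fun y hy => Set.mem_iInter.1 hy k) (hPV k)

/-- Subbundles have local adapted bases. -/
theorem exists_adapted {n : ℕ} (hr : HasRank (Z : X.Modules) n) (hq : IsVectorBundle (cokernel Z.arrow))
    (x : X) : ∃ (W : X.Opens) (m : ℕ) (e : Fin n ⊕ Fin m → Γ(E, W)), x ∈ W ∧ Adapted Z e := by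
  obtain ⟨W₁, hx₁, z, hz⟩ := hasRank_iff.1 hr x
  obtain ⟨W₂, m, hx₂, q, hq⟩ := isVectorBundle_iff.1 hq x
  obtain ⟨W₀, hxW, hl⟩ := exists_common_nhd (x := x) (fun (k : Fin m) V => ∃ t : Γ(E, V ⊓ (W₁ ⊓ W₂)),
      Hom.app (cokernel.π Z.arrow) _ t = res (inf_le_right.trans inf_le_right) (q k))
    (by
      rintro k V V' hV ⟨t, ht⟩
      exact ⟨FlagCohomology.res (inf_le_inf_right _ hV) t, by rw [app_res, ht, res_res]⟩)
    (by
      intro k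
      obtain ⟨V, h, t, hxV, ht⟩ := exists_of_epi (cokernel.π Z.arrow) (q k) hx₂
      refine ⟨V, hxV, FlagCohomology.res inf_le_left t, ?_⟩
      rw [app_res, ht, res_res])
  let W := W₀ ⊓ (W₁ ⊓ W₂)
  have hW₁ : W ≤ W₁ := inf_le_right.trans inf_le_left
  have hW₂ : W ≤ W₂ := inf_le_right.trans inf_le_right
  choose t ht using hl
  let e : Fin n ⊕ Fin m → Γ(E, W) :=
    Sum.elim (fun i => Hom.app Z.arrow W (FlagCohomology.res hW₁ (z i))) t
  have key : ∀ (U : X.Opens) (h : U ≤ W) (a : Fin n ⊕ Fin m → Γ(X, U)),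
      linComb e h a = Hom.app Z.arrow U (linComb z (h.trans hW₁) fun i => a (Sum.inl i)) +
        linComb t h fun k => a (Sum.inr k) := by
    intro U h a
    rw [app_linComb, linComb, linComb, linComb, Fintype.sum_sum_type]
    simp only [e, Sum.elim_inl, Sum.elim_inr, app_res, res_res]
  have key₂ : ∀ (U : X.Opens) (h : U ≤ W) (a : Fin m → Γ(X, U)),
      Hom.app (cokernel.π Z.arrow) U (linComb t h a) = linComb q (h.trans hW₂) a := by
    intro U h a
    rw [app_linComb, linComb, linComb]
    simp only [ht, res_res]
  have key₃ : ∀ (U : X.Opens) (h : U ≤ W) (a : Fin n ⊕ Fin m → Γ(X, U)),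
      Hom.app (cokernel.π Z.arrow) U (linComb e h a) =
        linComb q (h.trans hW₂) fun k => a (Sum.inr k) := by
    intro U h a
    rw [key, map_add, key₂, (mem_iff_cokernel _).1 ⟨_, rfl⟩, zero_add]
  have he : IsBasis e := by
    intro U h
    constructor
    · intro a b hab
      have h1 := congrArg (Hom.app (cokernel.π Z.arrow) U) hab
      rw [key₃, key₃] at h1
      have h2 := (hq U _).1 h1
      rw [key, key, h2] at hab
      have h3 := (hz U _).1 (app_injective_of_mono Z.arrow U (add_right_cancel hab))
      funext i
      cases i with
      | inl i => exact congrFun h3 i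
      | inr k => exact congrFun h2 k
    · intro s
      obtain ⟨c, hc⟩ := (hq U (h.trans hW₂)).2 (Hom.app (cokernel.π Z.arrow) U s)
      have h1 : Mem Z (s - linComb t h c) := by
        rw [mem_iff_cokernel, map_sub, key₂, hc, sub_self]
      obtain ⟨y, hy⟩ := h1
      obtain ⟨a, ha⟩ := (hz U (h.trans hW₁)).2 y
      refine ⟨Sum.elim a c, ?_⟩
      rw [key]
      simp only [Sum.elim_inl, Sum.elim_inr]
      rw [ha, hy, sub_add_cancel]
  refine ⟨W, m, e, ⟨hxW, hx₁, hx₂⟩, Adapted.of_mem he (fun i => ⟨_, rfl⟩) fun U h s hs k => ?_⟩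
  rw [mem_iff_cokernel, ← he.linComb_coord h s, key₃] at hs
  have h0 : linComb q (h.trans hW₂) (0 : Fin m → Γ(X, U)) = 0 := by simp [linComb]
  exact congrFun ((hq U _).1 (hs.trans h0.symm)) k

end adapted

/-! ### Subbundles that are graphs -/

section graphs
variable {X : Scheme.{u}} {E : X.Modules} {U V W : X.Opens} {n : ℕ} {κ : Type*} [Fintype κ]
  {Z : Subobject E}

theorem coord_res_basis {ι : Type*} [Fintype ι] {e : ι → Γ(E, W)} (he : IsBasis e) (h : V ≤ W)
    (h' : U ≤ V) (s : Γ(E, U)) : (he.res h).coord h' s = he.coord (h'.trans h) s := by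
  apply ((he.res h) U h').1
  rw [IsBasis.linComb_coord, linComb_res, IsBasis.linComb_coord]

/-- The vectors `e_i + ∑ k, u_ik e_k`, spanning the graph of the matrix `u`. -/
noncomputable def graphVec (e : Fin n ⊕ κ → Γ(E, U)) (u : Fin n → κ → Γ(X, U)) (i : Fin n) : Γ(E, U) :=
  e (Sum.inl i) + ∑ k, u i k • e (Sum.inr k)

theorem res_graphVec (h : V ≤ U) (e : Fin n ⊕ κ → Γ(E, U)) (u : Fin n → κ → Γ(X, U)) (i : Fin n) :
    res h (graphVec e u i) = graphVec (fun j => res h (e j)) (fun i k => resO h (u i k)) i := by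
  simp [graphVec, map_sum, map_smulₛₗ]

theorem graphVec_eq (e : Fin n ⊕ κ → Γ(E, U)) (u : Fin n → κ → Γ(X, U)) (i : Fin n) :
    graphVec e u i = linComb e le_rfl (Sum.elim (Pi.single i 1) (u i)) := by
  simp [graphVec, linComb, res_refl, Pi.single_apply]

theorem IsBasis.graph {e : Fin n ⊕ κ → Γ(E, U)} (he : IsBasis e) (u : Fin n → κ → Γ(X, U)) :
    IsBasis (Sum.elim (graphVec e u) fun k => e (Sum.inr k)) := by
  classical
  refine he.of_matrix (Matrix.fromBlocks 1 (Matrix.of u) 0 1) (by simp) fun i => ?_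
  cases i with
  | inl i => simp [graphVec, Matrix.one_apply]
  | inr k => simp [Matrix.one_apply]

/-- A section of a subbundle of rank `n` whose first `n` coordinates vanish is zero, if the
subbundle contains a graph over the first `n` basis vectors. -/
theorem eq_zero_of_graph (hr : HasRank (Z : X.Modules) n) {e : Fin n ⊕ κ → Γ(E, U)} (he : IsBasis e)
    {u : Fin n → κ → Γ(X, U)} (hZ : ∀ i, Mem Z (graphVec e u i)) (h : V ≤ U) {s : Γ(E, V)}
    (hs : Mem Z s) (H : ∀ i, he.coord h s (Sum.inl i) = 0) : s = 0 := by
  refine eq_of_locally fun x hx => ?_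
  obtain ⟨W₀, hxW, f, hf⟩ := hasRank_iff.1 hr x
  obtain ⟨z, rfl⟩ := hs
  choose y hy using hZ
  let O := V ⊓ W₀
  have hO : O ≤ U := inf_le_left.trans h
  refine ⟨O, inf_le_left, ⟨hx, hxW⟩, ?_⟩
  have hi := app_injective_of_mono Z.arrow O
  let A : Matrix (Fin n) (Fin n) Γ(X, O) := fun j i =>
    he.coord hO (Hom.app Z.arrow O (res inf_le_right (f j))) (Sum.inl i)
  have key (m : Γ((Z : X.Modules), O)) (i : Fin n) : he.coord hO (Hom.app Z.arrow O m) (Sum.inl i) =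
      ∑ j, hf.coord inf_le_right m j * A j i := by
    conv_lhs => rw [← hf.linComb_coord inf_le_right m, linComb, map_sum, map_sum, Finset.sum_apply]
    simp only [Hom.app_smul, LinearMap.map_smul, Pi.smul_apply, smul_eq_mul, A]
  let C : Matrix (Fin n) (Fin n) Γ(X, O) := fun i j => hf.coord inf_le_right (res hO (y i)) j
  have hCA : C * A = 1 := by
    ext i j
    rw [Matrix.mul_apply, ← key, app_res, hy, graphVec_eq, he.coord_res le_rfl hO,
      he.coord_linComb]
    simp only [Sum.elim_inl, Pi.single_apply, Matrix.one_apply, eq_comm (a := j), apply_ite (resO hO),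
      map_one, map_zero]
  have hAC : A * C = 1 := mul_eq_one_comm.1 hCA
  have h0 : Matrix.vecMul (hf.coord inf_le_right (res inf_le_left z)) A = 0 := by
    ext i
    rw [Matrix.vecMul, dotProduct, ← key, app_res, he.coord_res h inf_le_left, H, map_zero]; rfl
  have h1 : hf.coord inf_le_right (res (inf_le_left : O ≤ V) z) = 0 := by
    rw [← Matrix.vecMul_one (hf.coord _ _), ← hAC, ← Matrix.vecMul_vecMul, h0, Matrix.zero_vecMul]
  have h2 : res (inf_le_left : O ≤ V) z = 0 := by
    rw [← hf.linComb_coord inf_le_right (res (inf_le_left : O ≤ V) z), h1]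
    simp [linComb]
  rw [← app_res, h2, map_zero, map_zero]

theorem adapted_graph (hr : HasRank (Z : X.Modules) n) {e : Fin n ⊕ κ → Γ(E, U)} (he : IsBasis e)
    {u : Fin n → κ → Γ(X, U)} (hZ : ∀ i, Mem Z (graphVec e u i)) :
    Adapted Z (Sum.elim (graphVec e u) fun k => e (Sum.inr k)) := by
  refine Adapted.of_mem (he.graph u) hZ fun V h s hs k => ?_
  let c := (he.graph u).coord h s
  have h1 : s = linComb (graphVec e u) h (fun i => c (Sum.inl i)) +
      linComb e h (Sum.elim 0 fun k => c (Sum.inr k)) := by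
    conv_lhs => rw [← (he.graph u).linComb_coord h s]
    simp [linComb, c]
  have h2 : Mem Z (linComb (graphVec e u) h (fun i => c (Sum.inl i))) :=
    Mem.sum _ fun i _ => ((hZ i).res h).smul _
  have h3 : linComb e h (Sum.elim 0 fun k => c (Sum.inr k)) = 0 := by
    refine eq_zero_of_graph hr he hZ h ?_ fun i => by rw [he.coord_linComb]; rfl
    rw [← sub_eq_of_eq_add' h1, sub_eq_add_neg, ← neg_one_smul Γ(X, V)]
    exact hs.add (h2.smul _)
  have h4 := congrFun (congrArg (he.coord h) h3) (Sum.inr k)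
  rw [he.coord_linComb, map_zero] at h4
  exact h4

/-- The matrix of a graph is determined by the subbundle. -/
theorem graph_unique (hr : HasRank (Z : X.Modules) n) {e : Fin n ⊕ κ → Γ(E, U)} (he : IsBasis e)
    {u u' : Fin n → κ → Γ(X, U)} (hZ : ∀ i, Mem Z (graphVec e u i))
    (hZ' : ∀ i, Mem Z (graphVec e u' i)) : u = u' := by
  funext i k
  have h1 : graphVec e u i - graphVec e u' i = 0 := by
    refine eq_zero_of_graph hr he hZ le_rfl ?_ fun j => ?_
    · rw [sub_eq_add_neg, ← neg_one_smul Γ(X, U)]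
      exact (hZ i).add ((hZ' i).smul _)
    · rw [map_sub, graphVec_eq, graphVec_eq, Pi.sub_apply, he.coord_linComb, he.coord_linComb]
      simp
  have h2 := congrFun (congrArg (he.coord le_rfl) (sub_eq_zero.1 h1)) (Sum.inr k)
  rwa [graphVec_eq, graphVec_eq, he.coord_linComb, he.coord_linComb] at h2

/-- There is a largest open set over which a subbundle is a graph. -/
theorem exists_graph (hr : HasRank (Z : X.Modules) n) {e : Fin n ⊕ κ → Γ(E, W)} (he : IsBasis e) :
    ∃ (D : X.Opens) (hD : D ≤ W) (u : Fin n → κ → Γ(X, D)),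
      (∀ i, Mem Z (graphVec (fun j => res hD (e j)) u i)) ∧
      ∀ (V : X.Opens) (hV : V ≤ W) (u' : Fin n → κ → Γ(X, V)),
        (∀ i, Mem Z (graphVec (fun j => res hV (e j)) u' i)) → V ≤ D := by
  let P (V : X.Opens) : Prop := ∃ (hV : V ≤ W) (u' : Fin n → κ → Γ(X, V)),
        (∀ i, Mem Z (graphVec (fun j => res hV (e j)) u' i))
  let D : X.Opens := sSup {V | P V}
  have hD : D ≤ W := sSup_le fun V hV => hV.1
  have hP {V V'} (h : V' ≤ V) (hV : P V) : P V' := by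
    obtain ⟨hVW, u, hu⟩ := hV
    refine ⟨h.trans hVW, fun i k => resO h (u i k), fun i => ?_⟩
    have := (hu i).res h
    rw [res_graphVec] at this
    simpa only [res_res] using this
  have hglue (i : Fin n) (k : κ) := exists_of_locally (M := unitModule X) (U := D)
    (fun V s => ∃ (hV : V ≤ W) (u' : Fin n → κ → Γ(X, V)),
      (∀ i, Mem Z (graphVec (fun j => res hV (e j)) u' i)) ∧ s = funSec (u' i k))
    (by
      rintro V V' h s ⟨hVW, u, hu, rfl⟩
      refine ⟨h.trans hVW, fun i k => resO h (u i k), fun i => ?_, rfl⟩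
      have := (hu i).res h
      rw [res_graphVec] at this
      simpa only [res_res] using this)
    (by
      rintro V s t - ⟨hV, u, hu, rfl⟩ ⟨_, u', hu', rfl⟩
      rw [graph_unique hr (he.res hV) hu hu'])
    (by
      intro x hx
      obtain ⟨V, hV, hxV⟩ := Opens.mem_sSup.1 hx
      obtain ⟨hVW, u, hu⟩ := id hV
      exact ⟨V, le_sSup hV, hxV, _, hVW, u, hu, rfl⟩)
  choose u hu using hglue
  let v : Fin n → κ → Γ(X, D) := u
  refine ⟨D, hD, v, fun i => ?_, fun V hV u' hu' =>
    le_sSup ⟨hV, u', hu'⟩⟩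
  refine mem_of_locally fun x hx => ?_
  obtain ⟨V, hV, hxV⟩ := Opens.mem_sSup.1 hx
  obtain ⟨hVW, u₀, hu₀⟩ := id hV
  refine ⟨V, le_sSup hV, hxV, ?_⟩
  rw [res_graphVec]
  simp only [res_res]
  convert hu₀ i using 2
  funext i k
  refine resO_eq_of_locally fun y hy => ?_
  obtain ⟨V', hV', hyV', hV'W, u₁, hu₁, hu₂⟩ := hu i k y (le_sSup hV hy)
  have h1 : V' ⊓ V ≤ W := inf_le_right.trans hVW
  have e1 : ∀ i, Mem Z (graphVec (fun j => res h1 (e j)) (fun i k => resO inf_le_right (u₀ i k)) i) := by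
    intro i
    have := (hu₀ i).res (inf_le_right : V' ⊓ V ≤ V)
    rw [res_graphVec] at this
    simpa only [res_res] using this
  have e2 : ∀ i, Mem Z (graphVec (fun j => res h1 (e j)) (fun i k => resO inf_le_left (u₁ i k)) i) := by
    intro i
    have := (hu₁ i).res (inf_le_left : V' ⊓ V ≤ V')
    rw [res_graphVec] at this
    simpa only [res_res] using this
  have h2 := congrFun (congrFun (graph_unique hr (he.res h1) e1 e2) i) k
  refine ⟨V' ⊓ V, inf_le_right, ⟨hyV', hy⟩, ?_⟩
  have h3 : resO hV' (v i k) = u₁ i k := hu₂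
  rw [h2, ← h3]
  exact (resO_resO _ _ (v i k)).trans (resO_resO _ _ (v i k)).symm

/-- If `Z` has a local basis whose first `n` coordinates form an invertible matrix, then `Z` is
a graph. -/
theorem exists_graph_of_isUnit {e : Fin n ⊕ κ → Γ(E, U)} (he : IsBasis e) {f : Fin n → Γ(E, U)}
    (hf : ∀ i, Mem Z (f i))
    (hA : IsUnit (Matrix.of fun i j => he.coord le_rfl (f i) (Sum.inl j)).det) :
    ∃ u : Fin n → κ → Γ(X, U), ∀ i, Mem Z (graphVec e u i) := by
  let A : Matrix (Fin n) (Fin n) Γ(X, U) := Matrix.of fun i j => he.coord le_rfl (f i) (Sum.inl j)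
  refine ⟨fun i k => ∑ j, A⁻¹ i j * he.coord le_rfl (f j) (Sum.inr k), fun i => ?_⟩
  have : graphVec e (fun i k => ∑ j, A⁻¹ i j * he.coord le_rfl (f j) (Sum.inr k)) i =
      ∑ j, A⁻¹ i j • f j := by
    refine he.ext_coord le_rfl fun l => ?_
    rw [graphVec_eq, he.coord_linComb, map_sum, Finset.sum_apply]
    simp only [LinearMap.map_smul, Pi.smul_apply, smul_eq_mul]
    cases l with
    | inr k => rfl
    | inl l =>
      have := congrFun (congrFun (Matrix.nonsing_inv_mul A hA) i) l
      rw [Matrix.mul_apply] at this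
      rw [Sum.elim_inl, Pi.single_apply]
      refine Eq.trans ?_ this.symm
      simp [Matrix.one_apply, eq_comm]
  rw [this]
  exact Mem.sum _ fun j _ => (hf j).smul _

end graphs

section pullGraphs
variable {T X S : Scheme.{u}} {g : T ⟶ X} {π : X ⟶ S} {t : T ⟶ S} {V : S.Modules}
  {U W : X.Opens} {n : ℕ} {κ : Type*} [Fintype κ]
  {Z : Subobject ((Scheme.Modules.pullback π).obj V)}

theorem pullSec_graphVec (h : g ≫ π = t) (e : Fin n ⊕ κ → Γ((Scheme.Modules.pullback π).obj V, U))
    (u : Fin n → κ → Γ(X, U)) (i : Fin n) : pullSec h (graphVec e u i) =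
      graphVec (fun j => pullSec h (e j)) (fun i k => g.app U (u i k)) i := by
  rw [graphVec_eq, pullSec_linComb, graphVec_eq]
  congr 1
  funext j
  cases j with
  | inl j => simp only [Sum.elim_inl, Pi.single_apply, apply_ite (g.app U), map_one, map_zero]
  | inr k => rfl

theorem preimage_basicOpen_le {O : X.Opens} (a : Γ(X, O)) (O' : T.Opens) (h : O' ≤ g ⁻¹ᵁ O)
    (ha : IsUnit (resO h (g.app O a))) : O' ≤ g ⁻¹ᵁ (X.basicOpen a) := by
  rw [Scheme.preimage_basicOpen]
  have h1 : T.basicOpen (resO h (g.app O a)) = O' := Scheme.basicOpen_of_isUnit _ ha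
  rw [← h1]
  refine (T.basicOpen_res (g.app O a) (homOfLE h).op).le.trans inf_le_right

theorem isUnit_resO_basicOpen {O : X.Opens} (a : Γ(X, O)) :
    IsUnit (resO (X.basicOpen_le a) a) := RingedSpace.isUnit_res_basicOpen _ _

/-- If the pullback of a subbundle is a graph, then the map sends the points into the locus where
the subbundle is a graph. -/
theorem le_preimage_of_graph (h : g ≫ π = t) (hr : HasRank (Z : X.Modules) n)
    (hq : IsVectorBundle (cokernel Z.arrow))
    {e : Fin n ⊕ κ → Γ((Scheme.Modules.pullback π).obj V, W)} (he : IsBasis e) {D : X.Opens}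
    (hD : ∀ (O : X.Opens) (hO : O ≤ W) (u' : Fin n → κ → Γ(X, O)),
        (∀ i, Mem Z (graphVec (fun j => res hO (e j)) u' i)) → O ≤ D)
    {T' : T.Opens} (hT' : T' ≤ g ⁻¹ᵁ W) (u : Fin n → κ → Γ(T, T'))
    (hu : ∀ i, Mem (pullSub h Z) (graphVec (fun j => res hT' (pullSec h (e j))) u i)) :
    T' ≤ g ⁻¹ᵁ D := by
  classical
  intro x hx
  obtain ⟨W₁, m, f, hxW₁, hf⟩ := exists_adapted hr hq (g x)
  let O := W₁ ⊓ W
  let f' (i : Fin n) : Γ((Scheme.Modules.pullback π).obj V, O) := res inf_le_left (f (Sum.inl i))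
  let e' (i : Fin n ⊕ κ) : Γ((Scheme.Modules.pullback π).obj V, O) := res inf_le_right (e i)
  have he' : IsBasis e' := he.res inf_le_right
  have hf' : Adapted Z fun i => res (inf_le_left : O ≤ W₁) (f i) := hf.res inf_le_left
  let A : Matrix (Fin n) (Fin n) Γ(X, O) := Matrix.of fun i j => he'.coord le_rfl (f' i) (Sum.inl j)
  let T₁ : T.Opens := T' ⊓ g ⁻¹ᵁ O
  have hT₁ : T₁ ≤ g ⁻¹ᵁ O := inf_le_right
  have hA : IsUnit (resO hT₁ (g.app O A.det)) := by
    have hp := hf'.pull h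
    let C : Matrix (Fin n) (Fin n) Γ(T, T₁) := fun i j => hp.basis.coord hT₁
      (res inf_le_left (graphVec (fun j => res hT' (pullSec h (e j))) u i)) (Sum.inl j)
    have h1 : C * A.map (fun a => resO hT₁ (g.app O a)) = 1 := by
      ext i j
      have h2 := hp.basis.linComb_coord hT₁
        (res inf_le_left (graphVec (fun j => res hT' (pullSec h (e j))) u i))
      have h3 := ((hp.mem_iff hT₁ _).1 ((hu i).res inf_le_left))
      rw [linComb, Fintype.sum_sum_type] at h2
      simp only [h3, zero_smul, Finset.sum_const_zero, add_zero] at h2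
      have h4 := congrFun (congrArg ((he'.pullSec h).coord hT₁) h2) (Sum.inl j)
      rw [map_sum, Finset.sum_apply] at h4
      simp only [LinearMap.map_smul, Pi.smul_apply, smul_eq_mul] at h4
      rw [Matrix.mul_apply]
      refine Eq.trans (Finset.sum_congr rfl fun l _ => ?_) (h4.trans ?_)
      · rw [(he'.pullSec h).coord_res le_rfl hT₁, coord_pullSec h he' le_rfl]
        rfl
      · rw [res_graphVec, graphVec]
        have h5 (l) : res (inf_le_left : T₁ ≤ T') (res hT' (pullSec h (e l))) =
            res hT₁ (pullSec h (e' l)) := by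
          simp only [e']
          rw [pullSec_res, res_res, res_res]
        simp only [h5]
        rw [map_add, map_sum, Pi.add_apply, Finset.sum_apply]
        simp only [LinearMap.map_smul, Pi.smul_apply, (he'.pullSec h).coord_self]
        simp [Matrix.one_apply, Pi.single_apply, eq_comm]
    have h2 : IsUnit (A.map (fun a => resO hT₁ (g.app O a))).det :=
      (Matrix.isUnit_iff_isUnit_det _).1 (IsUnit.of_mul_eq_one_right _ h1)
    have h3 := RingHom.map_det ((resO hT₁).comp (g.app O).hom) A
    change resO hT₁ (g.app O A.det) = _ at h3
    rw [h3]
    exact h2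
  have hx₁ : x ∈ T₁ := ⟨hx, hxW₁, hT' hx⟩
  have h1 := preimage_basicOpen_le A.det T₁ hT₁ hA hx₁
  have hB : X.basicOpen A.det ≤ O := X.basicOpen_le _
  obtain ⟨u', hu'⟩ := exists_graph_of_isUnit (Z := Z) (he'.res hB) (f := fun i => res hB (f' i))
    (fun i => ((hf.mem i).res inf_le_left).res hB) (by
      have h3 := RingHom.map_det (resO hB) A
      have h4 := isUnit_resO_basicOpen A.det
      rw [show resO hB A.det = _ from h3] at h4
      convert h4 using 2
      ext i j
      simp only [Matrix.of_apply, RingHom.mapMatrix_apply, Matrix.map_apply, A]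
      rw [coord_res_basis he' hB, he'.coord_res le_rfl hB])
  refine hD (X.basicOpen A.det) (hB.trans inf_le_right) u' (fun i => ?_) h1
  have := hu' i
  simp only [e', res_res] at this
  exact this

end pullGraphs

/-! ### Recognition of affine spaces by their functor of points -/

section affineCharts
variable {X Y : Scheme.{u}}

theorem resO_app_comp {T : Scheme.{u}} (g : T ⟶ X) (f : X ⟶ Y) {O : Y.Opens} {D : X.Opens}
    (hD : D ≤ f ⁻¹ᵁ O) {T' : T.Opens} (hT : T' ≤ g ⁻¹ᵁ D) (a : Γ(Y, O)) :
    resO hT (g.app D (resO hD (f.app O a))) =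
      resO (hT.trans (Scheme.Hom.preimage_mono g hD) : T' ≤ (g ≫ f) ⁻¹ᵁ O) ((g ≫ f).app O a) := by
  rw [← resO_app, resO_resO, Scheme.Hom.comp_app]
  rfl

theorem app_congr {T : Scheme.{u}} {g g' : T ⟶ X} (h : g = g') {D : X.Opens} {T' : T.Opens}
    (hT : T' ≤ g ⁻¹ᵁ D) (a : Γ(X, D)) :
    resO hT (g.app D a) = resO (h ▸ hT : T' ≤ g' ⁻¹ᵁ D) (g'.app D a) := by
  subst h; rfl

/-- An open set `D` representing the functor "maps to `O` together with functions indexed by `J`"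
is the affine space over `O`. -/
theorem isAffineOpen_and_bijective (f : X ⟶ Y) {O : Y.Opens} (hO : IsAffineOpen O) {D : X.Opens}
    (hD : D ≤ f ⁻¹ᵁ O) {J : Type u} (u : J → Γ(X, D))
    (ex : ∀ (T : Scheme.{u}) (τ : T ⟶ Y) (_ : ⊤ ≤ τ ⁻¹ᵁ O) (a : J → Γ(T, ⊤)), ∃ g : T ⟶ X,
      g ≫ f = τ ∧ ∃ hg : ⊤ ≤ g ⁻¹ᵁ D, ∀ j, resO hg (g.app D (u j)) = a j)
    (uniq : ∀ (T : Scheme.{u}) (g₁ g₂ : T ⟶ X) (h₁ : ⊤ ≤ g₁ ⁻¹ᵁ D) (h₂ : ⊤ ≤ g₂ ⁻¹ᵁ D),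
      g₁ ≫ f = g₂ ≫ f → (∀ j, resO h₁ (g₁.app D (u j)) = resO h₂ (g₂.app D (u j))) → g₁ = g₂) :
    IsAffineOpen D ∧
      Function.Bijective (MvPolynomial.eval₂Hom ((resO hD).comp (f.app O).hom) u) := by
  have : IsAffine O := hO
  let o : (AffineSpace J (O : Scheme.{u})) ⟶ O := (AffineSpace J (O : Scheme.{u})) ↘ (O : Scheme.{u})
  obtain ⟨g, hgf, hg, hgu⟩ := ex (AffineSpace J (O : Scheme.{u})) (o ≫ O.ι) (fun x _ => (o x).2) (AffineSpace.coord _)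
  let g' : (AffineSpace J (O : Scheme.{u})) ⟶ D := IsOpenImmersion.lift D.ι g (by
    rintro _ ⟨x, rfl⟩
    simpa using hg (Set.mem_univ x))
  have hg' : g' ≫ D.ι = g := IsOpenImmersion.lift_fac _ _ _
  let r : (D : Scheme.{u}) ⟶ O := f.resLE O D hD
  have hr : r ≫ O.ι = D.ι ≫ f := Scheme.Hom.resLE_comp_ι _ _
  have hι : (⊤ : (D : Scheme.{u}).Opens) ≤ D.ι ⁻¹ᵁ D := fun x _ => x.2
  let v (j : J) : Γ(D, ⊤) := resO hι (D.ι.app D (u j))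
  let h : (D : Scheme.{u}) ⟶ (AffineSpace J (O : Scheme.{u})) := AffineSpace.homOfVector r v
  have hho : h ≫ o = r := AffineSpace.homOfVector_over _ _
  have hhc (j) : h.appTop (AffineSpace.coord _ j) = v j :=
    AffineSpace.homOfVector_appTop_coord _ _ j
  have h1 : h ≫ g = D.ι := by
    refine uniq _ _ _ (fun x _ => hg (Set.mem_univ (h x))) hι ?_ fun j => ?_
    · rw [Category.assoc, hgf, ← Category.assoc, hho, hr]
    · refine (resO_app_comp h g hg (T' := ⊤) (fun x _ => trivial) (u j)).symm.trans ?_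
      rw [hgu]
      exact (resO_refl _ _).trans (hhc j)
  have hhg' : h ≫ g' = 𝟙 _ := by
    rw [← cancel_mono D.ι, Category.assoc, hg', h1, Category.id_comp]
  have hg'h : g' ≫ h = 𝟙 _ := by
    have e1 : (g' ≫ h) ≫ o = 𝟙 _ ≫ o := by
      rw [← cancel_mono O.ι, Category.assoc, Category.assoc, Category.assoc, reassoc_of% hho, hr,
        reassoc_of% hg', hgf, Category.id_comp]
    have e2 (j) : (g' ≫ h).appTop (AffineSpace.coord _ j) =
        (𝟙 (AffineSpace J (O : Scheme.{u})) : (AffineSpace J (O : Scheme.{u})) ⟶ (AffineSpace J (O : Scheme.{u}))).appTop (AffineSpace.coord _ j) := by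
      rw [Scheme.Hom.comp_appTop, CommRingCat.comp_apply, hhc]
      refine Eq.trans ?_ (hgu j)
      refine ((resO_refl _ _).symm.trans (resO_app_comp g' D.ι hι (T' := ⊤) (fun x _ => trivial)
        (u j))).trans ?_
      exact app_congr hg' _ _
    exact AffineSpace.hom_ext e1 e2
  have : IsIso h := ⟨g', hhg', hg'h⟩
  have : IsAffine D := IsAffine.of_isIso h
  refine ⟨this, ?_⟩
  let e₁ := (Scheme.Γ.mapIso (AffineSpace.isoOfIsAffine J (O : Scheme.{u})).op)
  let e₂ := (Scheme.Γ.mapIso (asIso h).op)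
  let Φ : CommRingCat.of (MvPolynomial J Γ(O, ⊤)) ≅ Γ(D, ⊤) :=
    (Scheme.ΓSpecIso (.of (MvPolynomial J Γ(O, ⊤)))).symm ≪≫ e₁ ≪≫ e₂
  have hΦ : Φ.hom.hom = MvPolynomial.eval₂Hom r.appTop.hom v := by
    have h2 : Φ.hom = CommRingCat.ofHom (MvPolynomial.eval₂Hom o.appTop.hom (AffineSpace.coord _)) ≫
        h.appTop := by
      change _ ≫ (AffineSpace.isoOfIsAffine J (O : Scheme.{u})).hom.appTop ≫ h.appTop = _
      rw [AffineSpace.isoOfIsAffine_hom_appTop]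
      simp [o]
    rw [h2]
    refine MvPolynomial.ringHom_ext (fun a => ?_) fun j => ?_
    · have := congrArg (fun q => q.appTop a) hho
      simp only [Scheme.Hom.comp_appTop] at this
      simpa using this
    · simpa using hhc j
  let α := MvPolynomial.mapEquiv J O.topIso.commRingCatIsoToRingEquiv
  have hbij : Function.Bijective (D.topIso.hom.hom.comp (Φ.hom.hom.comp α.symm.toRingHom)) := by
    rw [RingHom.coe_comp, RingHom.coe_comp]
    exact (ConcreteCategory.bijective_of_isIso D.topIso.hom).comp
      ((ConcreteCategory.bijective_of_isIso Φ.hom).comp α.symm.bijective)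
  convert hbij using 2
  rw [hΦ]
  have hvu (j) : D.topIso.hom (v j) = u j := by
    have h3 : v j = D.topIso.inv (u j) := by
      simp only [v, Scheme.Opens.ι_app, Scheme.Opens.topIso_inv]
      exact resO_resO (Scheme.Hom.image_mono D.ι hι) (D.ι.image_preimage_le D) (u j)
    rw [h3]
    exact Iso.inv_hom_id_apply D.topIso (u j)
  have hr' : r.appTop = O.topIso.hom ≫ f.appLE O D hD ≫ D.topIso.inv := Scheme.Hom.resLE_app_top f hD
  refine MvPolynomial.ringHom_ext (fun a => ?_) fun j => ?_
  · have h4 : D.topIso.hom (r.appTop (O.topIso.inv a)) = resO hD (f.app O a) := by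
      rw [hr']
      simp only [CommRingCat.comp_apply, Iso.inv_hom_id_apply]
      rfl
    simp only [MvPolynomial.coe_eval₂Hom, MvPolynomial.eval₂_C, RingHom.comp_apply]
    refine h4.symm.trans (congrArg _ ?_)
    change _ = MvPolynomial.eval₂Hom r.appTop.hom v (α.symm (MvPolynomial.C a))
    rw [show α.symm (MvPolynomial.C a) = MvPolynomial.C (O.topIso.inv a) from
      (RingEquiv.symm_apply_eq α).2 (by
        simp [α, -Scheme.Opens.topIso_inv, -Scheme.Opens.topIso_hom]), MvPolynomial.coe_eval₂Hom, MvPolynomial.eval₂_C]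
  · simp only [MvPolynomial.coe_eval₂Hom, MvPolynomial.eval₂_X, RingHom.comp_apply]
    refine (hvu j).symm.trans (congrArg _ ?_)
    change _ = MvPolynomial.eval₂Hom r.appTop.hom v (α.symm (MvPolynomial.X j))
    rw [show α.symm (MvPolynomial.X j) = MvPolynomial.X j by simp [α],
      MvPolynomial.coe_eval₂Hom, MvPolynomial.eval₂_X]
end affineCharts

/-! ### Pullback along a composition -/

section composition
variable {T Y X S : Scheme.{u}} {q : T ⟶ Y} {f : Y ⟶ X} {π : X ⟶ S} {π' : Y ⟶ S} {t : T ⟶ S}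
  {V : S.Modules} {U W : X.Opens}

theorem pullSec_pullSec (h₁ : f ≫ π = π') (h₂ : q ≫ π' = t) (h₃ : (q ≫ f) ≫ π = t)
    (s : Γ((Scheme.Modules.pullback π).obj V, W)) :
    pullSec h₂ (pullSec h₁ s) = pullSec h₃ s := by
  let N := (pushforward (q ≫ f)).obj ((Scheme.Modules.pullback t).obj V)
  let c₁ : (Scheme.Modules.pullback π).obj V ⟶ N :=
    mkHom (N := N) (fun U s => pullSec h₃ s) (fun U s s' => pullSec_add h₃ s s')
      (fun U a s => pullSec_smul h₃ a s) (fun h s => pullSec_res h₃ h s)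
  let c₂ : (Scheme.Modules.pullback π).obj V ⟶ N :=
    mkHom (N := N) (fun U s => pullSec h₂ (pullSec h₁ s))
      (fun U s s' => by rw [pullSec_add, pullSec_add]; rfl)
      (fun U a s => by
        rw [pullSec_smul, pullSec_smul, ← CommRingCat.comp_apply, ← Scheme.Hom.comp_app]; rfl)
      (fun h s => by rw [pullSec_res, pullSec_res]; rfl)
  have h : c₂ = c₁ := by
    refine pullback_hom_ext fun O v => ?_
    have e1 : pullSec h₂ (pullSec h₁ (unitSec π v)) = res (by rw [← h₂, ← h₁]; rfl) (unitSec t v) := by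
      rw [pullSec_unitSec h₁, pullSec_res, pullSec_unitSec h₂]
      exact res_res _ _ _
    have e2 := pullSec_unitSec h₃ v
    exact e1.trans e2.symm
  exact congrArg (fun c => Hom.app c W s) h

/-- Subbundles pull back functorially. -/
theorem pullSub_pullSub (h₁ : f ≫ π = π') (h₂ : q ≫ π' = t) (h₃ : (q ≫ f) ≫ π = t)
    (Z : Subobject ((Scheme.Modules.pullback π).obj V)) :
    pullSub h₂ (pullSub h₁ Z) = pullSub h₃ Z := by
  apply le_antisymm
  · let N := (pushforward q).obj (cokernel (pullSub h₃ Z).arrow)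
    let c : (Scheme.Modules.pullback π').obj V ⟶ N :=
      mkHom (N := N) (fun U s => Hom.app (cokernel.π (pullSub h₃ Z).arrow) _ (pullSec h₂ s))
        (fun U s s' => by rw [pullSec_add, map_add]; rfl)
        (fun U a s => by rw [pullSec_smul, Hom.app_smul]; rfl)
        (fun h s => by rw [pullSec_res, app_res]; rfl)
    have hle : pullSub h₁ Z ≤ kernelSubobject c := by
      refine pullSub_le h₁ fun W s hs => ?_
      rw [mem_kernelSubobject]
      change Hom.app (cokernel.π (pullSub h₃ Z).arrow) _ (pullSec h₂ (pullSec h₁ s)) = 0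
      rw [← mem_iff_cokernel, pullSec_pullSec h₁ h₂ h₃]
      exact mem_pullSub h₃ hs
    refine pullSub_le h₂ fun W s hs => ?_
    have := le_iff_mem.1 hle W s hs
    rw [mem_kernelSubobject] at this
    rw [mem_iff_cokernel]
    exact this
  · refine pullSub_le h₃ fun W s hs => ?_
    rw [← pullSec_pullSec h₁ h₂ h₃]
    exact mem_pullSub h₂ (mem_pullSub h₁ hs)

end composition

/-! ### Subbundles spanned by a part of a basis -/

section spans
variable {X : Scheme.{u}} {E : X.Modules} {U V W : X.Opens} {ι κ : Type*} [Fintype ι] [Fintype κ]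

/-- The subbundle spanned by a part of a global basis. -/
theorem exists_adapted_subobject {κ : Type} [Fintype κ] {e : ι ⊕ κ → Γ(E, ⊤)} (he : IsBasis e) :
    ∃ Z : Subobject E, Adapted Z e := by
  classical
  have : HasFiniteBiproducts X.Modules := HasFiniteBiproducts.of_hasFiniteProducts
  let c (k : κ) := coordHom he (Sum.inr k)
  obtain ⟨B, L, p, q, hp, hq⟩ : ∃ (B : X.Modules) (L : E ⟶ B) (p : κ → (B ⟶ extRes ⊤ (unitModule X)))
      (q : κ → (extRes ⊤ (unitModule X) ⟶ B)), (∀ k, L ≫ p k = c k) ∧ L = ∑ k, c k ≫ q k :=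
    ⟨⨁ fun _ : κ => extRes ⊤ (unitModule X), biproduct.lift c,
      biproduct.π fun _ : κ => extRes ⊤ (unitModule X), biproduct.ι fun _ : κ => extRes ⊤ (unitModule X),
      biproduct.lift_π c, biproduct.lift_eq⟩
  let Z : Subobject E := kernelSubobject L
  have hZ (U : X.Opens) (s : Γ(E, U)) : Mem Z s ↔ ∀ k, Hom.app (c k) U s = 0 := by
    rw [mem_kernelSubobject]
    constructor
    · intro h k
      rw [← hp k]
      change Hom.app (p k) U (Hom.app L U s) = 0
      rw [h, map_zero]
    · intro h
      rw [hq, app_sum]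
      refine Finset.sum_eq_zero fun k _ => ?_
      change Hom.app (q k) U (Hom.app (c k) U s) = 0
      rw [h, map_zero]
  refine ⟨Z, he, fun {U} h s => (hZ U s).trans (forall_congr' fun k => coordHom_eq_zero he _ h s)⟩

theorem Adapted.eq {Z Z' : Subobject E} {e : ι ⊕ κ → Γ(E, ⊤)} (h : Adapted Z e) (h' : Adapted Z' e) :
    Z = Z' :=
  le_antisymm (le_iff_mem.2 fun _ s hs => (h'.mem_iff le_top s).2 ((h.mem_iff le_top s).1 hs))
    (le_iff_mem.2 fun _ s hs => (h.mem_iff le_top s).2 ((h'.mem_iff le_top s).1 hs))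

theorem hasRank_of_adapted {n : ℕ} {Z : Subobject E}
    (H : ∀ x : X, ∃ (W : X.Opens) (e : Fin n ⊕ κ → Γ(E, W)), x ∈ W ∧ Adapted Z e) :
    HasRank (Z : X.Modules) n :=
  hasRank_iff.2 fun x => by
    obtain ⟨W, e, hx, he⟩ := H x
    obtain ⟨z, hz, -⟩ := he.exists_basis
    exact ⟨W, hx, z, hz⟩

theorem isVectorBundle_of_adapted {Z : Subobject E}
    (H : ∀ x : X, ∃ (W : X.Opens) (e : ι ⊕ κ → Γ(E, W)), x ∈ W ∧ Adapted Z e) :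
    IsVectorBundle (cokernel Z.arrow) :=
  isVectorBundle_iff.2 fun x => by
    obtain ⟨W, e, hx, he⟩ := H x
    exact ⟨W, _, hx, _, he.isBasis_cokernel.reindex (Fintype.equivFin κ).symm⟩

theorem card_eq_of_isBasis {e : ι → Γ(E, U)} (he : IsBasis e) {f : κ → Γ(E, V)} (hf : IsBasis f)
    {x : X} (hU : x ∈ U) (hV : x ∈ V) : Fintype.card ι = Fintype.card κ := by
  have : Nonempty (U ⊓ V : X.Opens) := ⟨⟨x, hU, hV⟩⟩
  exact Fintype.card_congr
    ((he.toBasis (inf_le_left : U ⊓ V ≤ U)).indexEquiv (hf.toBasis (inf_le_right : U ⊓ V ≤ V)))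

theorem eq_top_of_mem {Z : Subobject E} (H : ∀ (U : X.Opens) (s : Γ(E, U)), Mem Z s) : Z = ⊤ :=
  top_le_iff.1 (le_iff_mem.2 fun U s _ => H U s)

theorem mem_top (s : Γ(E, U)) : Mem (⊤ : Subobject E) s := by
  rw [mem_iff_cokernel]
  have : cokernel.π (⊤ : Subobject E).arrow = 0 := by
    rw [← cancel_epi (⊤ : Subobject E).arrow]; simp
  rw [this]; rfl

theorem adapted_top {e : ι → Γ(E, W)} (he : IsBasis e) :
    Adapted (⊤ : Subobject E) (Sum.elim e (fun k : Empty => k.elim) : ι ⊕ Empty → Γ(E, W)) :=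
  have h : IsBasis (Sum.elim e (fun k : Empty => k.elim) : ι ⊕ Empty → Γ(E, W)) := by
    convert he.reindex (Equiv.sumEmpty ι Empty) using 1
    funext i
    rcases i with i | i
    · rfl
    · exact i.elim
  ⟨h, fun _ s => ⟨fun _ k => k.elim, fun _ => mem_top s⟩⟩

/-- A subbundle of full rank is everything. -/
theorem eq_top_of_rank {n : ℕ} {Z : Subobject E} (hE : HasRank E n) (hr : HasRank (Z : X.Modules) n)
    (hq : IsVectorBundle (cokernel Z.arrow)) : Z = ⊤ := by
  refine eq_top_of_mem fun U s => mem_of_locally fun x hx => ?_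
  obtain ⟨W, m, e, hxW, he⟩ := exists_adapted hr hq x
  obtain ⟨W', hxW', f, hf⟩ := hasRank_iff.1 hE x
  have hm : m = 0 := by
    have := card_eq_of_isBasis he.basis hf hxW hxW'
    simpa using this
  subst hm
  exact ⟨U ⊓ W, inf_le_left, ⟨hx, hxW⟩, (he.mem_iff inf_le_right _).2 fun k => k.elim0⟩

/-- A subbundle of rank `n` in a bundle of rank `n + m` has local adapted bases. -/
theorem exists_adapted_of_rank {n m : ℕ} {Z : Subobject E} (hE : HasRank E (n + m))
    (hr : HasRank (Z : X.Modules) n) (hq : IsVectorBundle (cokernel Z.arrow)) (x : X) :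
    ∃ (W : X.Opens) (e : Fin n ⊕ Fin m → Γ(E, W)), x ∈ W ∧ Adapted Z e := by
  obtain ⟨W, m', e, hxW, he⟩ := exists_adapted hr hq x
  obtain ⟨W', hxW', f, hf⟩ := hasRank_iff.1 hE x
  have hm : m' = m := by
    have := card_eq_of_isBasis he.basis hf hxW hxW'
    simpa using this
  subst hm
  exact ⟨W, e, hxW, he⟩

theorem hasRank_pullSub {T S : Scheme.{u}} {g : T ⟶ X} {π : X ⟶ S} {t : T ⟶ S} {V : S.Modules}
    (h : g ≫ π = t) {n : ℕ} {Z : Subobject ((Scheme.Modules.pullback π).obj V)}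
    (hr : HasRank (Z : X.Modules) n) (hq : IsVectorBundle (cokernel Z.arrow)) :
    HasRank (pullSub h Z : T.Modules) n ∧ IsVectorBundle (cokernel (pullSub h Z).arrow) := by
  refine ⟨hasRank_iff.2 fun x => ?_, isVectorBundle_iff.2 fun x => ?_⟩
  all_goals obtain ⟨W, m, e, hxW, he⟩ := exists_adapted hr hq (g x)
  · obtain ⟨z, hz, -⟩ := (he.pull h).exists_basis
    exact ⟨g ⁻¹ᵁ W, hxW, z, hz⟩
  · exact ⟨g ⁻¹ᵁ W, m, hxW, _, (he.pull h).isBasis_cokernel⟩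

theorem HasRank.pullback {T : Scheme.{u}} {n : ℕ} (hE : HasRank E n) (g : T ⟶ X) :
    HasRank ((Scheme.Modules.pullback g).obj E) n :=
  hasRank_iff.2 fun x => by
    obtain ⟨W, hx, e, he⟩ := hasRank_iff.1 hE (g x)
    exact ⟨g ⁻¹ᵁ W, hx, _, he.unitSec⟩

end spans

/-! ### The affine charts of the bundle of planes -/

section chartsGeneral
variable {T X S : Scheme.{u}} {g : T ⟶ X} {π : X ⟶ S} {t : T ⟶ S} {V : S.Modules}
  {W D : X.Opens} {n : ℕ} {κ : Type*} [Fintype κ]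

/-- Graphs pull back to graphs. -/
theorem mem_pullSub_graphVec (h : g ≫ π = t) {Z : Subobject ((Scheme.Modules.pullback π).obj V)}
    {e : Fin n ⊕ κ → Γ((Scheme.Modules.pullback π).obj V, W)} (hD : D ≤ W)
    {u : Fin n → κ → Γ(X, D)} (hu : ∀ i, Mem Z (graphVec (fun j => res hD (e j)) u i))
    {T' : T.Opens} (hT : T' ≤ g ⁻¹ᵁ D) (i : Fin n) :
    Mem (pullSub h Z) (graphVec
      (fun j => res (hT.trans (Scheme.Hom.preimage_mono g hD)) (pullSec h (e j)))
      (fun i k => resO hT (g.app D (u i k))) i) := by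
  have h1 := (mem_pullSub h (hu i)).res hT
  rw [pullSec_graphVec, res_graphVec] at h1
  convert h1 using 2
  funext j
  rw [pullSec_res]
  exact (res_res _ _ _).symm

end chartsGeneral

section planeCharts
variable {S : Scheme.{u}} {V : S.Modules} (P : FlagScheme V ![2])

theorem FlagScheme.hasRank_taut : HasRank (P.taut 0 : P.X.Modules) 2 := P.isFlag.rank 0

theorem isFlag_of_adapted_two {T : Scheme.{u}} {E : T.Modules} {κ : Type*} [Fintype κ]
    {e : Fin 2 ⊕ κ → Γ(E, ⊤)} {Z : Subobject E} (h : Adapted Z e) :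
    IsFlag ![2] (fun _ : Fin 1 => Z) where
  monotone := monotone_const
  rank i := by
    fin_cases i
    exact hasRank_of_adapted fun x => ⟨⊤, e, trivial, h⟩
  quotient _ := isVectorBundle_of_adapted fun x => ⟨⊤, e, trivial, h⟩

/-- The standard charts of the bundle of planes: over an affine open set on which `V` has a basis,
the planes that are graphs over the first two basis vectors form an affine plane. -/
theorem FlagScheme.exists_chart {O : S.Opens} (hO : IsAffineOpen O)
    {v : Fin 2 ⊕ Fin 1 → Γ(V, O)} (hv : IsBasis v) :
    ∃ (D : P.X.Opens) (hD : D ≤ P.π ⁻¹ᵁ O) (u : Fin 2 → Γ(P.X, D)),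
      (∀ i, Mem (P.taut 0) (graphVec (fun j => res hD (unitSec P.π (v j))) (fun i _ => u i) i)) ∧
      (∀ (D' : P.X.Opens) (hD' : D' ≤ P.π ⁻¹ᵁ O) (u' : Fin 2 → Fin 1 → Γ(P.X, D')),
        (∀ i, Mem (P.taut 0) (graphVec (fun j => res hD' (unitSec P.π (v j))) u' i)) → D' ≤ D) ∧
      IsAffineOpen D ∧ Function.Bijective (MvPolynomial.eval₂Hom
        ((resO hD).comp (P.π.app O).hom) fun j : ULift.{u} (Fin 2) => u j.down) := by
  let e (j) := unitSec P.π (v j)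
  have he : IsBasis e := hv.unitSec
  obtain ⟨D, hD, u, hu, hmax⟩ := exists_graph P.hasRank_taut he
  have hu0 : (fun i _ => u i 0) = u := by
    funext i k; rw [Subsingleton.elim k 0]
  refine ⟨D, hD, fun i => u i 0, by rw [hu0]; exact hu, hmax,
    isAffineOpen_and_bijective P.π hO hD _ ?_ ?_⟩
  · intro T τ hτ a
    let eT (j) : Γ((Scheme.Modules.pullback τ).obj V, ⊤) := res hτ (unitSec τ (v j))
    have heT : IsBasis eT := hv.unitSec.res hτ
    let a' (i : Fin 2) (_ : Fin 1) : Γ(T, ⊤) := a ⟨i⟩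
    obtain ⟨Z, hZ⟩ := exists_adapted_subobject (heT.graph a')
    obtain ⟨g, ⟨hg, hgZ⟩, -⟩ := P.universal τ (fun _ => Z) (isFlag_of_adapted_two hZ)
    have hgZ0 : pullSub hg (P.taut 0) = Z := hgZ 0
    have heq (j) : res (by rw [← hg] at hτ; exact hτ) (pullSec hg (e j)) = eT j := by
      simp only [e, eT]
      rw [pullSec_unitSec]
      exact res_res _ _ _
    have hmem (i) : Mem (pullSub hg (P.taut 0))
        (graphVec (fun j => res (by rw [← hg] at hτ; exact hτ) (pullSec hg (e j))) a' i) := by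
      rw [hgZ0]
      simp only [heq]
      exact hZ.mem i
    have hgD : ⊤ ≤ g ⁻¹ᵁ D := le_preimage_of_graph hg P.hasRank_taut (P.isFlag.quotient 0) he hmax
      (by rw [← hg] at hτ; exact hτ) a' hmem
    refine ⟨g, hg, hgD, fun j => ?_⟩
    have h1 := mem_pullSub_graphVec hg hD hu hgD
    rw [hgZ0] at h1 hmem
    have hr : HasRank (Z : T.Modules) 2 := (isFlag_of_adapted_two hZ).rank 0
    exact congrFun (congrFun (graph_unique hr ((he.pullSec hg).res _) h1 hmem) j.down) 0
  · intro T g₁ g₂ h₁ h₂ hg hgu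
    have h₁' := mem_pullSub_graphVec (rfl : g₁ ≫ P.π = _) hD hu h₁
    have h₂' := mem_pullSub_graphVec hg.symm hD hu h₂
    have hT : ⊤ ≤ (g₁ ≫ P.π) ⁻¹ᵁ O := h₁.trans (Scheme.Hom.preimage_mono g₁ hD)
    let eT (j) : Γ((Scheme.Modules.pullback (g₁ ≫ P.π)).obj V, ⊤) := res hT (unitSec (g₁ ≫ P.π) (v j))
    have heT : IsBasis eT := hv.unitSec.res hT
    have q₁ (j) : res (h₁.trans (Scheme.Hom.preimage_mono g₁ hD)) (pullSec (rfl : g₁ ≫ P.π = _) (e j)) = eT j := by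
      simp only [e, eT]
      rw [pullSec_unitSec]
      exact res_res _ _ _
    have q₂ (j) : res (h₂.trans (Scheme.Hom.preimage_mono g₂ hD)) (pullSec hg.symm (e j)) = eT j := by
      simp only [e, eT]
      rw [pullSec_unitSec]
      exact res_res _ _ _
    simp only [q₁] at h₁'
    simp only [q₂] at h₂'
    let a (i : Fin 2) (k : Fin 1) : Γ(T, ⊤) := resO h₁ (g₁.app D (u i k))
    have ha : (fun i k => resO h₂ (g₂.app D (u i k))) = a := by
      funext i k
      rw [Subsingleton.elim k 0]
      exact (hgu ⟨i⟩).symm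
    rw [ha] at h₂'
    have r₁ : HasRank (pullSub (rfl : g₁ ≫ P.π = _) (P.taut 0) : T.Modules) 2 :=
      (hasRank_pullSub _ P.hasRank_taut (P.isFlag.quotient 0)).1
    have r₂ : HasRank (pullSub hg.symm (P.taut 0) : T.Modules) 2 :=
      (hasRank_pullSub _ P.hasRank_taut (P.isFlag.quotient 0)).1
    have A₁ := adapted_graph r₁ heT h₁'
    have A₂ := adapted_graph r₂ heT h₂'
    have := A₁.eq A₂
    obtain ⟨g, -, huniq⟩ := P.universal (g₁ ≫ P.π) (fun _ => pullSub (rfl : g₁ ≫ P.π = _) (P.taut 0))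
      (isFlag_of_adapted_two A₁)
    rw [huniq g₁ ⟨rfl, fun i => by rw [Subsingleton.elim i 0]⟩,
      huniq g₂ ⟨hg.symm, fun i => by rw [Subsingleton.elim i 0]; exact this.symm⟩]
end planeCharts

/-! ### The affine charts of the bundle of flags over the bundle of planes -/

section
variable {T Y X S : Scheme.{u}} {q : T ⟶ Y} {f : Y ⟶ X} {π : X ⟶ S} {π' : Y ⟶ S} {t : T ⟶ S}
  {V : S.Modules} {W : X.Opens}

theorem res_pullSec_pullSec (h₁ : f ≫ π = π') (h₂ : q ≫ π' = t) {τ : T ⟶ X} (hτ : q ≫ f = τ)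
    (h₃ : τ ≫ π = t) {T' : T.Opens} (hT : T' ≤ q ⁻¹ᵁ f ⁻¹ᵁ W) (hT' : T' ≤ τ ⁻¹ᵁ W)
    (s : Γ((Scheme.Modules.pullback π).obj V, W)) :
    res hT (pullSec h₂ (pullSec h₁ s)) = res hT' (pullSec h₃ s) := by
  subst hτ
  rw [pullSec_pullSec h₁ h₂ h₃]
  rfl

theorem pullSub_pullSub_of_eq (h₁ : f ≫ π = π') (h₂ : q ≫ π' = t) {τ : T ⟶ X} (hτ : q ≫ f = τ)
    (h₃ : τ ≫ π = t) (Z : Subobject ((Scheme.Modules.pullback π).obj V)) :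
    pullSub h₂ (pullSub h₁ Z) = pullSub h₃ Z := by
  subst hτ
  exact pullSub_pullSub h₁ h₂ h₃ Z

theorem IsFlag.pull (h : f ≫ π = π') {k : ℕ} {n : Fin k → ℕ}
    {Z : Fin k → Subobject ((Scheme.Modules.pullback π).obj V)} (hZ : IsFlag n Z) :
    IsFlag n fun i => pullSub h (Z i) where
  monotone _ _ hij := pullSub_le h fun W s hs =>
    mem_pullSub h (le_iff_mem.1 (hZ.monotone hij) W s hs)
  rank i := (hasRank_pullSub h (hZ.rank i) (hZ.quotient i)).1
  quotient i := (hasRank_pullSub h (hZ.rank i) (hZ.quotient i)).2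

end

section
variable {X : Scheme.{u}} {E : X.Modules} {W : X.Opens} {ι κ ι' κ' : Type*} [Fintype ι] [Fintype κ]
  [Fintype ι'] [Fintype κ']

theorem Adapted.le_of_mem {Z Z' : Subobject E} {e : ι ⊕ κ → Γ(E, ⊤)} (he : Adapted Z e)
    (h : ∀ i, Mem Z' (e (Sum.inl i))) : Z ≤ Z' := by
  refine le_iff_mem.2 fun U s hs => ?_
  rw [he.mem_iff le_top] at hs
  rw [← he.basis.linComb_coord le_top s, linComb, Fintype.sum_sum_type]
  simp only [hs, zero_smul, Finset.sum_const_zero, add_zero]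
  exact Mem.sum _ fun i _ => ((h i).res le_top).smul _

theorem coord_reindex {e : ι → Γ(E, W)} (he : IsBasis e) (σ : κ ≃ ι) {U : X.Opens} (h : U ≤ W)
    (s : Γ(E, U)) (k : κ) : (he.reindex σ).coord h s k = he.coord h s (σ k) := by
  have : (he.reindex σ).coord h s = fun k => he.coord h s (σ k) := by
    apply ((he.reindex σ) U h).1
    rw [IsBasis.linComb_coord]
    conv_lhs => rw [← he.linComb_coord h s]
    exact (Equiv.sum_comp σ fun i => he.coord h s i • res h (e i)).symm
  rw [this]

theorem Adapted.reindex {Z : Subobject E} {e : ι ⊕ κ → Γ(E, W)} (he : Adapted Z e) (α : ι' ≃ ι)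
    (β : κ' ≃ κ) : Adapted Z fun j => e (Equiv.sumCongr α β j) :=
  ⟨he.basis.reindex _, fun {U} h s => (he.mem_iff h s).trans
    ⟨fun H k => (coord_reindex he.basis (Equiv.sumCongr α β) h s (Sum.inr k)).trans (H (β k)),
      fun H k => by
        have := H (β.symm k)
        rw [coord_reindex] at this
        simpa using this⟩⟩

end

section lineCharts
variable {S : Scheme.{u}} {V : S.Modules} (Fl : FlagScheme V ![1, 2, 3]) (P : FlagScheme V ![2])

theorem pullSub_tautTwo : pullSub (forgetFlag_comp Fl P) (P.taut 0) = Fl.taut 1 :=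
  (P.universal Fl.π (fun _ => Fl.taut 1)
    ⟨monotone_const, fun i => by fin_cases i; exact Fl.isFlag.rank 1,
      fun _ => Fl.isFlag.quotient 1⟩).choose_spec.1.choose_spec 0

theorem FlagScheme.hasRank_line : HasRank (Fl.taut 0 : Fl.X.Modules) 1 := Fl.isFlag.rank 0

/-- The reordering of a basis putting a line in front of the other vectors. -/
def lineEquiv : Fin 1 ⊕ Fin 2 ≃ Fin 2 ⊕ Fin 1 where
  toFun := Sum.elim (fun _ => Sum.inl 0) ![Sum.inl 1, Sum.inr 0]
  invFun := Sum.elim ![Sum.inl 0, Sum.inr 0] fun _ => Sum.inr 1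
  left_inv := by decide
  right_inv := by decide

variable {Fl P}

/-- A section of the pullback of `V` to `P(V)`, pulled back to `Fl(V)`. -/
noncomputable def toFl {W : P.X.Opens} (s : Γ((Scheme.Modules.pullback P.π).obj V, W)) :
    Γ((Scheme.Modules.pullback Fl.π).obj V, forgetFlag Fl P ⁻¹ᵁ W) :=
  pullSec (forgetFlag_comp Fl P) s

theorem graphVec_line {U W : Fl.X.Opens} (hU : U ≤ W)
    (e : Fin 2 ⊕ Fin 1 → Γ((Scheme.Modules.pullback Fl.π).obj V, W)) (u : Fin 1 → Fin 2 → Γ(Fl.X, U)) :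
    graphVec (fun j => res hU (e (lineEquiv j))) u 0 =
      res hU (e (Sum.inl 0)) + (u 0 0 • res hU (e (Sum.inl 1)) + u 0 1 • res hU (e (Sum.inr 0))) := by
  rw [graphVec, Fin.sum_univ_two]; rfl

theorem isFlag_three (hV : HasRank V 3) {T : Scheme.{u}} {t : T ⟶ S}
    {Z₀ Z₁ : Subobject ((Scheme.Modules.pullback t).obj V)} (hle : Z₀ ≤ Z₁)
    (h₀ : HasRank (Z₀ : T.Modules) 1) (h₀' : IsVectorBundle (cokernel Z₀.arrow))
    (h₁ : HasRank (Z₁ : T.Modules) 2) (h₁' : IsVectorBundle (cokernel Z₁.arrow)) :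
    IsFlag ![1, 2, 3] ![Z₀, Z₁, ⊤] := by
  have H (x : T) : ∃ (W : T.Opens) (e : Fin 3 ⊕ Empty → Γ((Scheme.Modules.pullback t).obj V, W)),
      x ∈ W ∧ Adapted ⊤ e := by
    obtain ⟨W, hx, e, he⟩ := hasRank_iff.1 (hV.pullback t) x
    exact ⟨W, _, hx, adapted_top he⟩
  refine ⟨?_, fun i => ?_, fun i => ?_⟩
  · refine Fin.monotone_iff_le_succ.2 fun i => ?_
    fin_cases i
    · exact hle
    · exact le_top
  · fin_cases i
    · exact h₀
    · exact h₁
    · exact hasRank_of_adapted H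
  · fin_cases i
    · exact h₀'
    · exact h₁'
    · exact isVectorBundle_of_adapted H

variable (Fl) in
/-- The standard charts of the bundle of flags over the bundle of planes: over an affine open set
on which the tautological plane has a basis, the lines that are graphs over the first basis vector
form an affine line. -/
theorem exists_line_chart (hV : HasRank V 3) {O : P.X.Opens} (hO : IsAffineOpen O)
    {e : Fin 2 ⊕ Fin 1 → Γ((Scheme.Modules.pullback P.π).obj V, O)} (he : Adapted (P.taut 0) e) :
    ∃ (D : Fl.X.Opens) (hD : D ≤ forgetFlag Fl P ⁻¹ᵁ O) (u : Γ(Fl.X, D)),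
      Mem (Fl.taut 0) (res hD (toFl (e (Sum.inl 0))) + u • res hD (toFl (e (Sum.inl 1)))) ∧
      (∀ (D' : Fl.X.Opens) (hD' : D' ≤ forgetFlag Fl P ⁻¹ᵁ O) (u' : Γ(Fl.X, D')),
        Mem (Fl.taut 0) (res hD' (toFl (e (Sum.inl 0))) + u' • res hD' (toFl (e (Sum.inl 1)))) →
          D' ≤ D) ∧
      IsAffineOpen D ∧ Function.Bijective (MvPolynomial.eval₂Hom
        ((resO hD).comp ((forgetFlag Fl P).app O).hom) fun _ : PUnit.{u + 1} => u) := by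
  let f := forgetFlag Fl P
  have hf : f ≫ P.π = Fl.π := forgetFlag_comp Fl P
  have he' : Adapted (Fl.taut 1) fun j => toFl (Fl := Fl) (e j) := by
    rw [← pullSub_tautTwo Fl P]; exact he.pull hf
  let b (j) := toFl (Fl := Fl) (e (lineEquiv j))
  have hb : IsBasis b := he'.basis.reindex lineEquiv
  have hr : HasRank (Fl.taut 0 : Fl.X.Modules) 1 := Fl.isFlag.rank 0
  obtain ⟨D, hD, u, hu, hmax⟩ := exists_graph hr hb
  have hu1 : u 0 1 = 0 := by
    have h1 := (he'.mem_iff hD _).1 (le_iff_mem.1 (Fl.isFlag.monotone (by decide : (0 : Fin 3) ≤ 1)) _ _ (hu 0)) 0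
    rw [graphVec_line hD (fun j => toFl (e j))] at h1
    simp only [map_add, LinearMap.map_smul, he'.basis.coord_self, Pi.add_apply, Pi.smul_apply] at h1
    simpa [Pi.single_apply] using h1
  have hmem (D' : Fl.X.Opens) (hD' : D' ≤ f ⁻¹ᵁ O) (u' : Fin 1 → Fin 2 → Γ(Fl.X, D')) (h1 : u' 0 1 = 0) :
      (∀ i, Mem (Fl.taut 0) (graphVec (fun j => res hD' (b j)) u' i)) ↔
      Mem (Fl.taut 0) (res hD' (toFl (e (Sum.inl 0))) + u' 0 0 • res hD' (toFl (e (Sum.inl 1)))) := by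
    have := graphVec_line hD' (fun j => toFl (e j)) u'
    rw [h1, zero_smul, add_zero] at this
    rw [← this]
    exact ⟨fun H => H 0, fun H i => by rw [Subsingleton.elim i 0]; exact H⟩
  refine ⟨D, hD, u 0 0, (hmem D hD u hu1).1 hu, fun D' hD' u' hu' => ?_, ?_⟩
  · exact hmax D' hD' (fun _ => ![u', 0]) ((hmem D' hD' (fun _ => ![u', 0]) rfl).2 hu')
  refine isAffineOpen_and_bijective f hO hD _ ?_ ?_
  · intro T τ hτ a
    let eT (j) : Γ((Scheme.Modules.pullback (τ ≫ P.π)).obj V, ⊤) :=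
      res hτ (pullSec (rfl : τ ≫ P.π = _) (e j))
    have heT : Adapted (pullSub (rfl : τ ≫ P.π = _) (P.taut 0)) eT := (he.pull rfl).res hτ
    let a' (_ : Fin 1) : Fin 2 → Γ(T, ⊤) := ![a ⟨⟩, 0]
    obtain ⟨Z, hZ⟩ := exists_adapted_subobject ((heT.basis.reindex lineEquiv).graph a')
    have hle : Z ≤ pullSub (rfl : τ ≫ P.π = _) (P.taut 0) := hZ.le_of_mem fun i => by
      rw [Subsingleton.elim i 0, Sum.elim_inl, graphVec, Fin.sum_univ_two]
      exact (heT.mem 0).add (((heT.mem 1).smul _).add (by simpa [a'] using Mem.zero))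
    have hrZ : HasRank (Z : T.Modules) 1 := hasRank_of_adapted fun x => ⟨⊤, _, trivial, hZ⟩
    obtain ⟨g, ⟨hg, hgZ⟩, -⟩ := Fl.universal (τ ≫ P.π) ![Z, pullSub rfl (P.taut 0), ⊤]
      (isFlag_three hV hle hrZ
        (isVectorBundle_of_adapted fun x => ⟨⊤, _, trivial, hZ⟩)
        (hasRank_pullSub _ P.hasRank_taut (P.isFlag.quotient 0)).1
        (hasRank_pullSub _ P.hasRank_taut (P.isFlag.quotient 0)).2)
    have hg0 : pullSub hg (Fl.taut 0) = Z := hgZ 0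
    have hg1 : pullSub hg (Fl.taut 1) = pullSub rfl (P.taut 0) := hgZ 1
    -- the map forgetting the line is determined by the plane that it classifies
    have hgf : g ≫ f = τ := by
      have h3 : (g ≫ f) ≫ P.π = τ ≫ P.π := by rw [Category.assoc, hf, hg]
      have h1 : pullSub h3 (P.taut 0) = pullSub rfl (P.taut 0) := by
        rw [← hg1, ← pullSub_tautTwo Fl P]
        exact (pullSub_pullSub hf hg h3 _).symm
      obtain ⟨g', -, huniq⟩ := P.universal (τ ≫ P.π) (fun _ => pullSub rfl (P.taut 0))
        (P.isFlag.pull rfl |> fun h => by convert h using 2 with i; rw [Subsingleton.elim i 0])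
      rw [huniq (g ≫ f) ⟨h3, fun i => by rw [Subsingleton.elim i 0]; exact h1⟩,
        huniq τ ⟨rfl, fun i => by rw [Subsingleton.elim i 0]⟩]
    have hT : ⊤ ≤ g ⁻¹ᵁ f ⁻¹ᵁ O := by rw [← hgf] at hτ; exact hτ
    have heq (j) : res hT (pullSec hg (b j)) = eT (lineEquiv j) :=
      res_pullSec_pullSec hf hg hgf rfl hT hτ _
    have hmemT (i) : Mem (pullSub hg (Fl.taut 0))
        (graphVec (fun j => res hT (pullSec hg (b j))) a' i) := by
      rw [hg0]
      simp only [heq]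
      exact hZ.mem i
    have hgD : ⊤ ≤ g ⁻¹ᵁ D := le_preimage_of_graph hg hr (Fl.isFlag.quotient 0) hb hmax hT a' hmemT
    refine ⟨g, hgf, hgD, fun j => ?_⟩
    have h1 := mem_pullSub_graphVec hg hD hu hgD
    rw [hg0] at h1 hmemT
    exact congrFun (congrFun (graph_unique hrZ ((hb.pullSec hg).res _) h1 hmemT) 0) 0
  · intro T g₁ g₂ h₁ h₂ hg hgu
    have k₁ : g₁ ≫ Fl.π = (g₁ ≫ f) ≫ P.π := by rw [Category.assoc, hf]
    have k₂ : g₂ ≫ Fl.π = (g₁ ≫ f) ≫ P.π := by rw [hg, Category.assoc, hf]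
    have l₁ : ⊤ ≤ g₁ ⁻¹ᵁ f ⁻¹ᵁ O := h₁.trans (Scheme.Hom.preimage_mono g₁ hD)
    have l₂ : ⊤ ≤ g₂ ⁻¹ᵁ f ⁻¹ᵁ O := h₂.trans (Scheme.Hom.preimage_mono g₂ hD)
    let eT (j) : Γ((Scheme.Modules.pullback ((g₁ ≫ f) ≫ P.π)).obj V, ⊤) :=
      res (show ⊤ ≤ (g₁ ≫ f) ⁻¹ᵁ O from l₁) (pullSec (rfl : (g₁ ≫ f) ≫ P.π = _) (e j))
    have heT : Adapted (pullSub (rfl : (g₁ ≫ f) ≫ P.π = _) (P.taut 0)) eT := (he.pull rfl).res _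
    have q₁ (j) : res l₁ (pullSec k₁ (b j)) = eT (lineEquiv j) :=
      res_pullSec_pullSec hf k₁ rfl rfl l₁ l₁ _
    have q₂ (j) : res l₂ (pullSec k₂ (b j)) = eT (lineEquiv j) :=
      res_pullSec_pullSec hf k₂ hg.symm rfl l₂ l₁ _
    have h₁' := mem_pullSub_graphVec k₁ hD hu h₁
    have h₂' := mem_pullSub_graphVec k₂ hD hu h₂
    simp only [q₁] at h₁'
    simp only [q₂] at h₂'
    let a (i : Fin 1) (k : Fin 2) : Γ(T, ⊤) := resO h₁ (g₁.app D (u i k))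
    have ha : (fun i k => resO h₂ (g₂.app D (u i k))) = a := by
      funext i k
      rw [Subsingleton.elim i 0]
      fin_cases k
      · exact (hgu ⟨⟩).symm
      · simp only [a, Fin.mk_one, hu1, map_zero]
    rw [ha] at h₂'
    have r (g : T ⟶ Fl.X) (k : g ≫ Fl.π = (g₁ ≫ f) ≫ P.π) (i : Fin 3) :=
      hasRank_pullSub k (Fl.isFlag.rank i) (Fl.isFlag.quotient i)
    have hb' := heT.basis.reindex lineEquiv
    have E₀ : pullSub k₁ (Fl.taut 0) = pullSub k₂ (Fl.taut 0) :=
      (adapted_graph (r _ k₁ 0).1 hb' h₁').eq (adapted_graph (r _ k₂ 0).1 hb' h₂')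
    have E₁ : pullSub k₁ (Fl.taut 1) = pullSub k₂ (Fl.taut 1) := by
      rw [← pullSub_tautTwo Fl P]
      exact (pullSub_pullSub_of_eq hf k₁ rfl rfl _).trans
        (pullSub_pullSub_of_eq hf k₂ hg.symm rfl _).symm
    have E₂ : pullSub k₁ (Fl.taut 2) = pullSub k₂ (Fl.taut 2) := by
      rw [eq_top_of_rank (hV.pullback _) (r _ k₁ 2).1 (r _ k₁ 2).2,
        eq_top_of_rank (hV.pullback _) (r _ k₂ 2).1 (r _ k₂ 2).2]
    obtain ⟨g', -, huniq⟩ := Fl.universal _ (fun i => pullSub k₁ (Fl.taut i)) (Fl.isFlag.pull k₁)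
    rw [huniq g₁ ⟨k₁, fun i => rfl⟩, huniq g₂ ⟨k₂, fun i => by fin_cases i <;> [exact E₀.symm; exact E₁.symm; exact E₂.symm]⟩]

/-- The locus where one of two functions generating the unit ideal is invertible. -/
theorem mem_basicOpen_or {X : Scheme.{u}} {U : X.Opens} {a b p q : Γ(X, U)} (h : p * a + q * b = 1)
    {x : X} (hx : x ∈ U) : x ∈ X.basicOpen a ∨ x ∈ X.basicOpen b := by
  rw [X.mem_basicOpen a x hx, X.mem_basicOpen b x hx]
  have h1 := congrArg (X.presheaf.germ U x hx) h
  rw [map_add, map_mul, map_mul, map_one] at h1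
  rcases IsLocalRing.isUnit_or_isUnit_of_add_one h1 with h2 | h2
  · exact Or.inl (isUnit_of_mul_isUnit_right h2)
  · exact Or.inr (isUnit_of_mul_isUnit_right h2)

/-- Every line in the tautological plane is a graph over one of the two basis vectors. -/
theorem mem_or_mem_of_line {O : P.X.Opens} {e : Fin 2 ⊕ Fin 1 → Γ((Scheme.Modules.pullback P.π).obj V, O)}
    (he : Adapted (P.taut 0) e) {D D' : Fl.X.Opens}
    (hD : ∀ (U : Fl.X.Opens) (hU : U ≤ forgetFlag Fl P ⁻¹ᵁ O) (u' : Γ(Fl.X, U)),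
        Mem (Fl.taut 0) (res hU (toFl (e (Sum.inl 0))) + u' • res hU (toFl (e (Sum.inl 1)))) → U ≤ D)
    (hD' : ∀ (U : Fl.X.Opens) (hU : U ≤ forgetFlag Fl P ⁻¹ᵁ O) (u' : Γ(Fl.X, U)),
        Mem (Fl.taut 0) (u' • res hU (toFl (e (Sum.inl 0))) + res hU (toFl (e (Sum.inl 1)))) → U ≤ D')
    {x : Fl.X} (hx : x ∈ forgetFlag Fl P ⁻¹ᵁ O) : x ∈ D ∨ x ∈ D' := by
  have he' : Adapted (Fl.taut 1) fun j => toFl (Fl := Fl) (e j) := by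
    rw [← pullSub_tautTwo Fl P]; exact he.pull _
  obtain ⟨W, m, ℓ, hxW, hℓ⟩ := exists_adapted Fl.hasRank_line
    (Fl.isFlag.quotient 0) x
  let U := W ⊓ forgetFlag Fl P ⁻¹ᵁ O
  have hU : U ≤ forgetFlag Fl P ⁻¹ᵁ O := inf_le_right
  let z : Γ((Scheme.Modules.pullback Fl.π).obj V, U) := res inf_le_left (ℓ (Sum.inl 0))
  have hz : Mem (Fl.taut 0) z := (hℓ.mem 0).res _
  let c := he'.basis.coord hU z
  have hc (k) : c (Sum.inr k) = 0 :=
    (he'.mem_iff hU _).1 (le_iff_mem.1 (Fl.isFlag.monotone (by decide : (0 : Fin 3) ≤ 1)) _ _ hz) k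
  have hzc : z = c (Sum.inl 0) • res hU (toFl (e (Sum.inl 0))) +
      c (Sum.inl 1) • res hU (toFl (e (Sum.inl 1))) := by
    conv_lhs => rw [← he'.basis.linComb_coord hU z, linComb, Fintype.sum_sum_type, Fin.sum_univ_two]
    simp only [Finset.univ_unique, Fin.default_eq_zero, Finset.sum_singleton, c] at hc ⊢
    rw [hc, zero_smul, add_zero]
  have h1 := congrFun (congrArg (hℓ.basis.coord inf_le_left) hzc) (Sum.inl 0)
  rw [map_add, LinearMap.map_smul, LinearMap.map_smul, hℓ.basis.coord_self] at h1
  simp only [Pi.single_eq_same, Pi.add_apply, Pi.smul_apply, smul_eq_mul] at h1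
  rw [mul_comm (c _), mul_comm (c _)] at h1
  rcases mem_basicOpen_or h1.symm (⟨hxW, hx⟩ : x ∈ U) with h | h
  · have hB : Fl.X.basicOpen (c (Sum.inl 0)) ≤ U := Fl.X.basicOpen_le _
    obtain ⟨r, hr⟩ := isUnit_iff_exists_inv'.1 (isUnit_resO_basicOpen (c (Sum.inl 0)))
    refine Or.inl (hD (Fl.X.basicOpen (c (Sum.inl 0))) (hB.trans hU) (r * resO hB (c (Sum.inl 1))) ?_ h)
    convert (hz.res hB).smul r using 1
    rw [hzc]
    simp only [map_add, map_smulₛₗ, smul_add, smul_smul, hr, one_smul, res_res]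
  · have hB : Fl.X.basicOpen (c (Sum.inl 1)) ≤ U := Fl.X.basicOpen_le _
    obtain ⟨r, hr⟩ := isUnit_iff_exists_inv'.1 (isUnit_resO_basicOpen (c (Sum.inl 1)))
    refine Or.inr (hD' (Fl.X.basicOpen (c (Sum.inl 1))) (hB.trans hU) (r * resO hB (c (Sum.inl 0))) ?_ h)
    convert (hz.res hB).smul r using 1
    rw [hzc]
    simp only [map_add, map_smulₛₗ, smul_add, smul_smul, hr, one_smul, res_res]

/-- Two sections of a line that project isomorphically are related by the inverse coordinate. -/
theorem mul_eq_one_of_line {O : P.X.Opens} {e : Fin 2 ⊕ Fin 1 → Γ((Scheme.Modules.pullback P.π).obj V, O)}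
    (he : Adapted (P.taut 0) e) {U : Fl.X.Opens} (hU : U ≤ forgetFlag Fl P ⁻¹ᵁ O) {u w : Γ(Fl.X, U)}
    (hu : Mem (Fl.taut 0) (res hU (toFl (e (Sum.inl 0))) + u • res hU (toFl (e (Sum.inl 1)))))
    (hw : Mem (Fl.taut 0) (w • res hU (toFl (e (Sum.inl 0))) + res hU (toFl (e (Sum.inl 1))))) :
    w * u = 1 := by
  have he' : Adapted (Fl.taut 1) fun j => toFl (Fl := Fl) (e j) := by
    rw [← pullSub_tautTwo Fl P]; exact he.pull _
  let b (j) := toFl (Fl := Fl) (e (lineEquiv j))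
  have hb : IsBasis b := he'.basis.reindex lineEquiv
  have h0 := graphVec_line hU (fun j => toFl (Fl := Fl) (e j)) fun _ => ![u, 0]
  simp only [Matrix.cons_val_zero, Matrix.cons_val_one, zero_smul, add_zero] at h0
  have h1 : (w • res hU (toFl (Fl := Fl) (e (Sum.inl 0))) + res hU (toFl (e (Sum.inl 1)))) +
      (-w) • (res hU (toFl (e (Sum.inl 0))) + u • res hU (toFl (e (Sum.inl 1)))) =
      (1 - w * u) • res hU (toFl (e (Sum.inl 1))) := by module
  have hs : hb.coord hU (res hU (toFl (e (Sum.inl 1)))) = Pi.single (Sum.inr 0) 1 :=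
    hb.coord_self hU (Sum.inr 0)
  have h2 := eq_zero_of_graph Fl.hasRank_line (hb.res hU)
    (u := fun _ => ![u, 0]) (fun i => by rw [Subsingleton.elim i 0]; exact h0 ▸ hu) le_rfl
    (hw.add (hu.smul (-w))) (fun i => by
      rw [h1, coord_res_basis hb, LinearMap.map_smul, hs]
      simp)
  rw [h1] at h2
  have h3 := congrFun (congrArg (hb.coord hU) h2) (Sum.inr 0)
  rw [LinearMap.map_smul, hs, map_zero] at h3
  simp only [Pi.smul_apply, Pi.single_eq_same, smul_eq_mul, mul_one, Pi.zero_apply] at h3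
  exact (sub_eq_zero.1 h3).symm

end lineCharts

/-! ### Injective sheaves of modules are flasque -/

section flasque
variable {X : Scheme.{u}} {U V : X.Opens}

/-- The free presheaf of modules functor preserves injections. -/
instance mono_free_yoneda {C : Type u} [SmallCategory C] (R : Cᵒᵖ ⥤ RingCat.{u}) {F G : Cᵒᵖ ⥤ Type u} (α : F ⟶ G)
    [∀ Y, Mono (α.app Y)] : Mono ((PresheafOfModules.free R).map α) := by
  have : Mono ((PresheafOfModules.toPresheaf R).map ((PresheafOfModules.free R).map α)) := by
    have : ∀ Y, Mono (((PresheafOfModules.toPresheaf R).map ((PresheafOfModules.free R).map α)).app Y) := by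
      intro Y
      rw [AddCommGrpCat.mono_iff_injective]
      have h1 : Function.Injective (α.app Y) := (mono_iff_injective _).1 inferInstance
      exact Finsupp.mapDomain_injective h1
    exact NatTrans.mono_of_mono_app _
  exact (PresheafOfModules.toPresheaf R).mono_of_mono_map this

/-- The universal section over `U` of the free presheaf of modules on the functor represented by `U`:
morphisms out of this presheaf correspond to sections over `U`. -/
noncomputable def oneYoneda (R : X.Opensᵒᵖ ⥤ RingCat.{u}) (U : X.Opens) : ((PresheafOfModules.free R).obj (yoneda.obj U)).obj (op U) :=
  ModuleCat.freeMk (R := R.obj (op U)) (𝟙 U)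
theorem map_oneYoneda (R : X.Opensᵒᵖ ⥤ RingCat.{u}) (h : U ≤ V) :
   ((PresheafOfModules.free R).map (yoneda.map (homOfLE h))).app (op U) (oneYoneda R U) = ((PresheafOfModules.free R).obj (yoneda.obj V)).map (homOfLE h).op (oneYoneda R V) := by
  have h1 : ((PresheafOfModules.free R).map (yoneda.map (homOfLE h))).app (op U) (oneYoneda R U) = ModuleCat.freeMk (R := R.obj (op U)) (X := U ⟶ V) (homOfLE h) := by
    refine (ModuleCat.free_map_apply _ _).trans ?_
    rfl
  have h2 : ((PresheafOfModules.free R).obj (yoneda.obj V)).map (homOfLE h).op (oneYoneda R V) = ModuleCat.freeMk (R := R.obj (op U)) (X := U ⟶ V) (homOfLE h) := by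
    refine (ModuleCat.freeDesc_apply (R := R.obj (op V)) (M := (ModuleCat.restrictScalars (R.map (homOfLE h).op).hom).obj ((ModuleCat.free (R.obj (op U))).obj (U ⟶ V))) (↾fun x => ModuleCat.freeMk (R := R.obj (op U)) ((yoneda.obj V).map (homOfLE h).op x)) (𝟙 V)).trans ?_
    rfl
  exact h1.trans h2.symm

/-- The inclusion of `U` in `V` induces a monomorphism between the sheaves of modules which represent
sections over `U` and over `V`; so every section of an injective sheaf over `U` extends to `V`. -/
theorem exists_extension_of_injective (J : X.Modules) [Injective J] (h : U ≤ V) (s : Γ(J, U)) :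
    ∃ t : Γ(J, V), res h t = s := by
  let i : (PresheafOfModules.free X.ringCatSheaf.obj).obj (yoneda.obj U) ⟶
      (PresheafOfModules.free X.ringCatSheaf.obj).obj (yoneda.obj V) :=
    (PresheafOfModules.free X.ringCatSheaf.obj).map (yoneda.map (homOfLE h))
  have hm : Mono i := by
    have : ∀ Y, Mono ((yoneda.map (homOfLE h)).app Y) := by
      intro Y; infer_instance
    exact mono_free_yoneda _ _
  have : Mono ((sheafify X).map i) := by
    have h₁ : Mono ((PresheafOfModules.sheafification (R := X.ringCatSheaf)
        (𝟙 X.ringCatSheaf.obj)).map i) := inferInstance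
    exact h₁
  let M := (Scheme.Modules.toPresheafOfModules X ⋙
      PresheafOfModules.restrictScalars (𝟙 X.ringCatSheaf.obj)).obj J
  let s' := (PresheafOfModules.freeYonedaEquiv (M := M) (X := U)).symm s
  have hs : s'.app (op U) (oneYoneda X.ringCatSheaf.obj U) = s :=
    PresheafOfModules.freeYonedaEquiv_symm_app M U s
  let β := Injective.factorThru (((sheafifyAdj X).homEquiv _ _).symm s') ((sheafify X).map i)
  have hβ : (sheafify X).map i ≫ β = ((sheafifyAdj X).homEquiv _ _).symm s' :=
    Injective.comp_factorThru _ _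
  let b : (PresheafOfModules.free X.ringCatSheaf.obj).obj (yoneda.obj V) ⟶ M :=
    ((sheafifyAdj X).homEquiv _ _) β
  have h2 : i ≫ b = s' := by
    change i ≫ ((sheafifyAdj X).homEquiv _ _) β = s'
    rw [← Adjunction.homEquiv_naturality_left, hβ]
    exact Equiv.apply_symm_apply _ _
  refine ⟨b.app (op V) (oneYoneda X.ringCatSheaf.obj V), ?_⟩
  rw [← h2] at hs
  refine Eq.trans ?_ hs
  refine (PresheafOfModules.naturality_apply b (homOfLE h).op _).symm.trans ?_
  rw [← map_oneYoneda]
  rfl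
end flasque

/-! ### Cohomology classes of cocycles on a covering by two open sets -/

section cech
variable {X Y : Scheme.{u}} (f : X ⟶ Y) {M : X.Modules} {W W' : Y.Opens} {A B : X.Opens}

/-- The complex `f_* I` attached to an injective resolution `I` of `M`. -/
noncomputable abbrev pushCx (I : InjectiveResolution M) : CochainComplex Y.Modules ℕ :=
  ((pushforward f).mapHomologicalComplex _).obj I.cocomplex

variable {f} {I I' : InjectiveResolution M}

theorem app_sub {N N' : X.Modules} (φ : N ⟶ N') {U : X.Opens} (s t : Γ(N, U)) :
    Hom.app φ U (s - t) = Hom.app φ U s - Hom.app φ U t :=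
  map_sub (Hom.app φ U).hom s t

/-- The section of `I¹` underlying a cycle of `f_* I`. -/
noncomputable def cycleSec (z : Γ((pushCx f I).cycles 1, W)) : Γ(I.cocomplex.X 1, f ⁻¹ᵁ W) :=
  Hom.app ((pushCx f I).iCycles 1) W z

theorem cycleSec_injective : Function.Injective (cycleSec (f := f) (I := I) (W := W)) :=
  app_injective_of_mono ((pushCx f I).iCycles 1) W

theorem cycleSec_res (h : W' ≤ W) (z : Γ((pushCx f I).cycles 1, W)) :
    cycleSec (res h z) = res (Scheme.Hom.preimage_mono f h) (cycleSec z) :=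
  app_res ((pushCx f I).iCycles 1) h z

theorem cycleSec_add (z z' : Γ((pushCx f I).cycles 1, W)) :
    cycleSec (z + z') = cycleSec z + cycleSec z' :=
  map_add (Hom.app ((pushCx f I).iCycles 1) W).hom z z'

theorem cycleSec_smul (r : Γ(Y, W)) (z : Γ((pushCx f I).cycles 1, W)) :
    cycleSec (r • z) = f.app W r • cycleSec z :=
  Hom.app_smul ((pushCx f I).iCycles 1) r z

theorem d_cycleSec (z : Γ((pushCx f I).cycles 1, W)) :
    Hom.app (I.cocomplex.d 1 2) (f ⁻¹ᵁ W) (cycleSec z) = 0 := by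
  have h := congrArg (fun k => Hom.app k W z) ((pushCx f I).iCycles_d 1 2)
  exact h

theorem exists_cycle (ζ : Γ(I.cocomplex.X 1, f ⁻¹ᵁ W))
    (h : Hom.app (I.cocomplex.d 1 2) (f ⁻¹ᵁ W) ζ = 0) :
    ∃ z : Γ((pushCx f I).cycles 1, W), cycleSec z = ζ :=
  exists_of_kernel _ ((pushCx f I).cyclesIsKernel 1 2 (by simp)) ζ h

theorem homologyπ_eq_zero (z : Γ((pushCx f I).cycles 1, W)) (c : Γ(I.cocomplex.X 0, f ⁻¹ᵁ W))
    (h : cycleSec z = Hom.app (I.cocomplex.d 0 1) (f ⁻¹ᵁ W) c) :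
    Hom.app ((pushCx f I).homologyπ 1) W z = 0 := by
  have h₁ : z = Hom.app ((pushCx f I).toCycles 0 1) W c := by
    apply cycleSec_injective
    rw [h]
    exact (congrArg (fun k => Hom.app k W c) ((pushCx f I).toCycles_i 0 1)).symm
  rw [h₁]
  exact congrArg (fun k => Hom.app k W c) ((pushCx f I).toCycles_comp_homologyπ 0 1)

theorem exists_of_homologyπ_eq_zero (z : Γ((pushCx f I).cycles 1, W))
    (h : Hom.app ((pushCx f I).homologyπ 1) W z = 0) {y : Y} (hy : y ∈ W) :
    ∃ (W' : Y.Opens) (hW : W' ≤ W) (c : Γ(I.cocomplex.X 0, f ⁻¹ᵁ W')), y ∈ W' ∧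
      res (Scheme.Hom.preimage_mono f hW) (cycleSec z) =
        Hom.app (I.cocomplex.d 0 1) (f ⁻¹ᵁ W') c := by
  have hex : (ShortComplex.mk _ _ ((pushCx f I).toCycles_comp_homologyπ 0 1)).Exact :=
    ShortComplex.exact_of_g_is_cokernel _ ((pushCx f I).homologyIsCokernel 0 1 (by simp))
  obtain ⟨W', hW, c, hy', hc⟩ := exists_of_exact hex z h hy
  refine ⟨W', hW, c, hy', ?_⟩
  rw [← cycleSec_res]
  have h₂ := congrArg (cycleSec (f := f) (I := I)) hc
  refine h₂.symm.trans ?_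
  exact (congrArg (fun k => Hom.app k W' c) ((pushCx f I).toCycles_i 0 1))

theorem exists_homologyπ_eq (ξ : Γ((pushCx f I).homology 1, W)) {y : Y} (hy : y ∈ W) :
    ∃ (W' : Y.Opens) (hW : W' ≤ W) (z : Γ((pushCx f I).cycles 1, W')), y ∈ W' ∧
      Hom.app ((pushCx f I).homologyπ 1) W' z = res hW ξ :=
  exists_of_epi ((pushCx f I).homologyπ 1) ξ hy

/-- The augmentation `M → I⁰`. -/
noncomputable def augHom (I : InjectiveResolution M) : M ⟶ I.cocomplex.X 0 := I.ι.f 0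

instance (I : InjectiveResolution M) : Mono (augHom I) := inferInstanceAs (Mono (I.ι.f 0))

variable (f) in
/-- The isomorphism of `R¹f_* M` with the first cohomology of `f_* I`. -/
noncomputable def classIso (I : InjectiveResolution M) :
    (R1 f).obj M ≅ (pushCx f I).homology 1 := I.isoRightDerivedObj (pushforward f) 1

/-- The cycle `z` is obtained by gluing `da` and `db` for a decomposition `t = a - b`. -/
def IsCechCycle (I : InjectiveResolution M) (hA : A ≤ f ⁻¹ᵁ W) (hB : B ≤ f ⁻¹ᵁ W)
    (t : Γ(M, A ⊓ B)) (z : Γ((pushCx f I).cycles 1, W)) : Prop :=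
  ∃ (a : Γ(I.cocomplex.X 0, A)) (b : Γ(I.cocomplex.X 0, B)),
    Hom.app (augHom I) (A ⊓ B) t =
      res (M := I.cocomplex.X 0) inf_le_left a - res (M := I.cocomplex.X 0) inf_le_right b ∧
    Hom.app (I.cocomplex.d 0 1) A a = res (M := I.cocomplex.X 1) hA (cycleSec z) ∧
    Hom.app (I.cocomplex.d 0 1) B b = res (M := I.cocomplex.X 1) hB (cycleSec z)

theorem isCechClass_iff_exists (hAB : A ⊔ B = f ⁻¹ᵁ W) (t : Γ(M, A ⊓ B))
    (ξ : Γ((R1 f).obj M, W)) : IsCechClass f hAB t ξ ↔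
    ∃ (I : InjectiveResolution M) (z : Γ((pushCx f I).cycles 1, W)),
      IsCechCycle I (hAB ▸ le_sup_left) (hAB ▸ le_sup_right) t z ∧
      Hom.app (classIso f I).hom W ξ =
        Hom.app ((pushCx f I).homologyπ 1) W z := by
  constructor
  · rintro ⟨I, a, b, z, h₁, h₂, h₃, h₄⟩
    exact ⟨I, z, ⟨a, b, h₁, h₂, h₃⟩, h₄⟩
  · rintro ⟨I, z, ⟨a, b, h₁, h₂, h₃⟩, h₄⟩
    exact ⟨I, a, b, z, h₁, h₂, h₃, h₄⟩

/-- A morphism of resolutions carries Čech cycles to Čech cycles. -/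
theorem IsCechCycle.map (φ : I.cocomplex ⟶ I'.cocomplex) (hφ : augHom I ≫ φ.f 0 = augHom I')
    {hA : A ≤ f ⁻¹ᵁ W} {hB : B ≤ f ⁻¹ᵁ W} {t : Γ(M, A ⊓ B)} {z : Γ((pushCx f I).cycles 1, W)}
    (h : IsCechCycle I hA hB t z) : IsCechCycle I' hA hB t (Hom.app (HomologicalComplex.cyclesMap
      (((pushforward f).mapHomologicalComplex _).map φ) 1) W z) := by
  obtain ⟨a, b, h₁, h₂, h₃⟩ := h
  have hc : cycleSec (I := I') (Hom.app (HomologicalComplex.cyclesMap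
      (((pushforward f).mapHomologicalComplex _).map φ) 1) W z) =
      Hom.app (φ.f 1) (f ⁻¹ᵁ W) (cycleSec z) :=
    congrArg (fun k => Hom.app k W z) (HomologicalComplex.cyclesMap_i
      (((pushforward f).mapHomologicalComplex _).map φ) 1)
  have hd : ∀ (U : X.Opens) (s : Γ(I.cocomplex.X 0, U)),
      Hom.app (I'.cocomplex.d 0 1) U (Hom.app (φ.f 0) U s) =
        Hom.app (φ.f 1) U (Hom.app (I.cocomplex.d 0 1) U s) := fun U s =>
    congrArg (fun k => Hom.app k U s) (φ.comm 0 1)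
  refine ⟨Hom.app (φ.f 0) A a, Hom.app (φ.f 0) B b, ?_, ?_, ?_⟩
  · rw [← hφ]
    have h₄ := congrArg (Hom.app (φ.f 0) (A ⊓ B)) h₁
    rw [app_sub, app_res, app_res] at h₄
    exact h₄
  · rw [hd, h₂, hc, app_res]
  · rw [hd, h₃, hc, app_res]

/-- The class of a cocycle can be computed with any given resolution. -/
theorem isCechClass_iff (I : InjectiveResolution M) (hAB : A ⊔ B = f ⁻¹ᵁ W) (t : Γ(M, A ⊓ B))
    (ξ : Γ((R1 f).obj M, W)) : IsCechClass f hAB t ξ ↔ ∃ z : Γ((pushCx f I).cycles 1, W),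
      IsCechCycle I (hAB ▸ le_sup_left) (hAB ▸ le_sup_right) t z ∧
      Hom.app (classIso f I).hom W ξ =
        Hom.app ((pushCx f I).homologyπ 1) W z := by
  rw [isCechClass_iff_exists]
  refine ⟨?_, fun h => ⟨I, h⟩⟩
  rintro ⟨J, z, hz, hξ⟩
  let φ := InjectiveResolution.desc (𝟙 M) I J
  have hφ : J.ι.f 0 ≫ φ.f 0 = 𝟙 M ≫ I.ι.f 0 :=
    InjectiveResolution.desc_commutes_zero _ _ _
  refine ⟨_, hz.map φ (hφ.trans (Category.id_comp _)), ?_⟩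
  have h := InjectiveResolution.isoRightDerivedObj_hom_naturality (𝟙 M) J I φ hφ (pushforward f) 1
  rw [CategoryTheory.Functor.map_id, Category.id_comp] at h
  have h' : (classIso f I).hom = (classIso f J).hom ≫ HomologicalComplex.homologyMap
    (((pushforward f).mapHomologicalComplex (ComplexShape.up ℕ)).map φ) 1 := h
  rw [h']
  have h₂ := congrArg (fun k => Hom.app k W z) (HomologicalComplex.homologyπ_naturality
    (((pushforward f).mapHomologicalComplex (ComplexShape.up ℕ)).map φ) 1)
  refine Eq.trans ?_ h₂
  exact congrArg (Hom.app (HomologicalComplex.homologyMap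
    (((pushforward f).mapHomologicalComplex (ComplexShape.up ℕ)).map φ) 1) W) hξ

theorem isoRightDerivedObj_injective (I : InjectiveResolution M) {ξ ξ' : Γ((R1 f).obj M, W)}
    (h : Hom.app (classIso f I).hom W ξ =
      Hom.app (classIso f I).hom W ξ') : ξ = ξ' :=
  app_injective_of_mono (classIso f I).hom W h

/-- Every section of `I⁰` over `A ∪ B` is glued from its restrictions. -/
theorem exists_glue_two {N : X.Modules} {U : X.Opens} (hAB : A ⊔ B = U) (a : Γ(N, A)) (b : Γ(N, B))
    (h : res (inf_le_left : A ⊓ B ≤ A) a = res inf_le_right b) :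
    ∃ c : Γ(N, U), res (hAB ▸ le_sup_left) c = a ∧ res (hAB ▸ le_sup_right) c = b := by
  have hA : A ≤ U := hAB ▸ le_sup_left
  have hB : B ≤ U := hAB ▸ le_sup_right
  let P : ∀ V : X.Opens, Γ(N, V) → Prop := fun V s =>
    ∀ V' : X.Opens, ∀ hV : V' ≤ V, (∀ hA : V' ≤ A, res hV s = res hA a) ∧
      (∀ hB : V' ≤ B, res hV s = res hB b)
  have hab : ∀ (V : X.Opens) (hA : V ≤ A) (hB : V ≤ B), res hA a = res hB b := by
    intro V hA hB
    have := congrArg (res (le_inf hA hB)) h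
    rwa [res_res, res_res] at this
  have hmem : ∀ x ∈ U, x ∈ A ∨ x ∈ B := fun x hx => by
    rw [← hAB] at hx
    exact hx
  have hu : ∀ {V : X.Opens} (s t : Γ(N, V)), V ≤ U → P V s → P V t → s = t := by
    intro V s t hV hs ht
    refine eq_of_locally fun x hx => ?_
    rcases hmem x (hV hx) with h' | h'
    · exact ⟨V ⊓ A, inf_le_left, ⟨hx, h'⟩, ((hs _ _).1 inf_le_right).trans
        ((ht _ _).1 inf_le_right).symm⟩
    · exact ⟨V ⊓ B, inf_le_left, ⟨hx, h'⟩, ((hs _ _).2 inf_le_right).trans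
        ((ht _ _).2 inf_le_right).symm⟩
  obtain ⟨c, hc⟩ := exists_of_locally (U := U) P (fun {V V'} h s hs V'' hV'' => by
    rw [res_res]
    exact hs V'' (hV''.trans h)) hu (fun x hx => by
      rcases hmem x hx with h' | h'
      · exact ⟨A, hA, h', a, fun V' hV => ⟨fun _ => rfl, fun hB => hab V' hV hB⟩⟩
      · exact ⟨B, hB, h', b, fun V' hV => ⟨fun hA => (hab V' hA hV).symm, fun _ => rfl⟩⟩)
  refine ⟨c, ?_, ?_⟩
  · refine eq_of_locally fun x hx => ?_
    obtain ⟨V, hV, hxV, hP⟩ := hc x (hA hx)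
    refine ⟨V ⊓ A, inf_le_right, ⟨hxV, hx⟩, ?_⟩
    have := (hP (V ⊓ A) inf_le_left).1 inf_le_right
    rwa [res_res] at this ⊢
  · refine eq_of_locally fun x hx => ?_
    obtain ⟨V, hV, hxV, hP⟩ := hc x (hB hx)
    refine ⟨V ⊓ B, inf_le_right, ⟨hxV, hx⟩, ?_⟩
    have := (hP (V ⊓ B) inf_le_left).2 inf_le_right
    rwa [res_res] at this ⊢

theorem d_comp_ι (I : InjectiveResolution M) {U : X.Opens} (m : Γ(M, U)) :
    Hom.app (I.cocomplex.d 0 1) U (Hom.app (augHom I) U m) = 0 :=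
  congrArg (fun k => Hom.app k U m) I.ι_f_zero_comp_complex_d

theorem exists_of_d_eq_zero (I : InjectiveResolution M) {U : X.Opens} (a : Γ(I.cocomplex.X 0, U))
    (h : Hom.app (I.cocomplex.d 0 1) U a = 0) : ∃ m : Γ(M, U), Hom.app (augHom I) U m = a :=
  exists_of_kernel (φ := augHom I) I.ι_f_zero_comp_complex_d I.isLimitKernelFork a h

/-- Cohomologous cocycles have the same class. -/
theorem IsCechClass.eq_of_coboundary {hAB : A ⊔ B = f ⁻¹ᵁ W} {t t' : Γ(M, A ⊓ B)}
    {ξ ξ' : Γ((R1 f).obj M, W)} (h : IsCechClass f hAB t ξ) (h' : IsCechClass f hAB t' ξ')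
    (mA : Γ(M, A)) (mB : Γ(M, B)) (hm : t - t' = res inf_le_left mA - res inf_le_right mB) :
    ξ = ξ' := by
  let I : InjectiveResolution M := injectiveResolution M
  obtain ⟨z, ⟨a, b, h₁, h₂, h₃⟩, h₄⟩ := (isCechClass_iff I hAB t ξ).1 h
  obtain ⟨z', ⟨a', b', h₁', h₂', h₃'⟩, h₄'⟩ := (isCechClass_iff I hAB t' ξ').1 h'
  obtain ⟨c, hcA, hcB⟩ := exists_glue_two hAB (a - a' - Hom.app (augHom I) A mA)
    (b - b' - Hom.app (augHom I) B mB) (by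
      have h₅ := congrArg (Hom.app (augHom I) (A ⊓ B)) hm
      rw [app_sub, app_sub, h₁, h₁', app_res, app_res] at h₅
      simp only [map_sub]
      rw [← sub_eq_zero] at h₅ ⊢
      rw [← h₅]
      abel)
  have hc : cycleSec (z - z') = Hom.app (I.cocomplex.d 0 1) (f ⁻¹ᵁ W) c := by
    have hzz : cycleSec (z - z') = cycleSec z - cycleSec z' := app_sub _ z z'
    have hA : A ≤ f ⁻¹ᵁ W := hAB ▸ le_sup_left
    have hB : B ≤ f ⁻¹ᵁ W := hAB ▸ le_sup_right
    refine eq_of_locally fun x hx => ?_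
    have hx' : x ∈ A ⊔ B := by rw [hAB]; exact hx
    rcases hx' with h | h
    · refine ⟨A, hA, h, ?_⟩
      rw [hzz, map_sub, ← app_res, hcA, app_sub, app_sub, h₂, h₂', d_comp_ι, sub_zero]
    · refine ⟨B, hB, h, ?_⟩
      rw [hzz, map_sub, ← app_res, hcB, app_sub, app_sub, h₃, h₃', d_comp_ι, sub_zero]
  apply isoRightDerivedObj_injective I
  refine h₄.trans (Eq.trans ?_ h₄'.symm)
  rw [← sub_eq_zero, ← app_sub]
  exact homologyπ_eq_zero _ c hc

theorem IsCechClass.unique {hAB : A ⊔ B = f ⁻¹ᵁ W} {t : Γ(M, A ⊓ B)} {ξ ξ' : Γ((R1 f).obj M, W)}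
    (h : IsCechClass f hAB t ξ) (h' : IsCechClass f hAB t ξ') : ξ = ξ' :=
  h.eq_of_coboundary h' 0 0 (by simp)

/-- Classes are compatible with restriction and with refinement of the covering. -/
theorem IsCechClass.res {hAB : A ⊔ B = f ⁻¹ᵁ W} {t : Γ(M, A ⊓ B)} {ξ : Γ((R1 f).obj M, W)}
    (h : IsCechClass f hAB t ξ) {A' B' : X.Opens} (hW : W' ≤ W) (hA : A' ≤ A) (hB : B' ≤ B)
    (hAB' : A' ⊔ B' = f ⁻¹ᵁ W') :
    IsCechClass f hAB' (FlagCohomology.res (inf_le_inf hA hB) t) (FlagCohomology.res hW ξ) := by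
  let I : InjectiveResolution M := injectiveResolution M
  obtain ⟨z, ⟨a, b, h₁, h₂, h₃⟩, h₄⟩ := (isCechClass_iff I hAB t ξ).1 h
  refine (isCechClass_iff I hAB' _ _).2 ⟨FlagCohomology.res hW z,
    ⟨FlagCohomology.res hA a, FlagCohomology.res hB b, ?_, ?_, ?_⟩, ?_⟩
  · rw [app_res, h₁, map_sub, res_res, res_res, res_res, res_res]
  · rw [app_res, h₂, cycleSec_res, res_res, res_res]
  · rw [app_res, h₃, cycleSec_res, res_res, res_res]
  · rw [app_res, h₄, app_res]

theorem IsCechClass.add {hAB : A ⊔ B = f ⁻¹ᵁ W} {t t' : Γ(M, A ⊓ B)}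
    {ξ ξ' : Γ((R1 f).obj M, W)} (h : IsCechClass f hAB t ξ) (h' : IsCechClass f hAB t' ξ') :
    IsCechClass f hAB (t + t') (ξ + ξ') := by
  let I : InjectiveResolution M := injectiveResolution M
  obtain ⟨z, ⟨a, b, h₁, h₂, h₃⟩, h₄⟩ := (isCechClass_iff I hAB t ξ).1 h
  obtain ⟨z', ⟨a', b', h₁', h₂', h₃'⟩, h₄'⟩ := (isCechClass_iff I hAB t' ξ').1 h'
  refine (isCechClass_iff I hAB _ _).2 ⟨z + z', ⟨a + a', b + b', ?_, ?_, ?_⟩, ?_⟩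
  · rw [map_add, h₁, h₁', map_add, map_add]
    abel
  · rw [map_add, h₂, h₂', cycleSec_add, map_add]
  · rw [map_add, h₃, h₃', cycleSec_add, map_add]
  · rw [map_add, h₄, h₄', map_add]

theorem IsCechClass.smul {hAB : A ⊔ B = f ⁻¹ᵁ W} {t : Γ(M, A ⊓ B)} {ξ : Γ((R1 f).obj M, W)}
    (h : IsCechClass f hAB t ξ) (r : Γ(Y, W)) (hU : A ⊓ B ≤ f ⁻¹ᵁ W) :
    IsCechClass f hAB (resO hU (f.app W r) • t) (r • ξ) := by
  let I : InjectiveResolution M := injectiveResolution M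
  obtain ⟨z, ⟨a, b, h₁, h₂, h₃⟩, h₄⟩ := (isCechClass_iff I hAB t ξ).1 h
  have hA : A ≤ f ⁻¹ᵁ W := hAB ▸ le_sup_left
  have hB : B ≤ f ⁻¹ᵁ W := hAB ▸ le_sup_right
  refine (isCechClass_iff I hAB _ _).2 ⟨r • z, ⟨resO hA (f.app W r) • a,
    resO hB (f.app W r) • b, ?_, ?_, ?_⟩, ?_⟩
  · rw [Hom.app_smul, h₁, map_smulₛₗ, map_smulₛₗ, resO_resO, resO_resO, smul_sub]
  · rw [Hom.app_smul, h₂, cycleSec_smul, map_smulₛₗ]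
  · rw [Hom.app_smul, h₃, cycleSec_smul, map_smulₛₗ]
  · rw [Hom.app_smul, h₄, Hom.app_smul]

/-- Exchanging the two members of the covering changes the sign. -/
theorem IsCechClass.symm {hAB : A ⊔ B = f ⁻¹ᵁ W} {t : Γ(M, A ⊓ B)} {ξ : Γ((R1 f).obj M, W)}
    (h : IsCechClass f hAB t ξ) (hBA : B ⊔ A = f ⁻¹ᵁ W) :
    IsCechClass f hBA (-FlagCohomology.res (le_of_eq (inf_comm B A)) t) ξ := by
  let I : InjectiveResolution M := injectiveResolution M
  obtain ⟨z, ⟨a, b, h₁, h₂, h₃⟩, h₄⟩ := (isCechClass_iff I hAB t ξ).1 h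
  refine (isCechClass_iff I hBA _ _).2 ⟨z, ⟨b, a, ?_, h₃, h₂⟩, h₄⟩
  rw [map_neg, app_res, h₁, map_sub, res_res, res_res, neg_sub]

/-- Every cocycle has a class. -/
theorem exists_isCechClass (hAB : A ⊔ B = f ⁻¹ᵁ W) (t : Γ(M, A ⊓ B)) :
    ∃ ξ, IsCechClass f hAB t ξ := by
  let I : InjectiveResolution M := injectiveResolution M
  -- injective modules are flasque, so `t` extends to a section of `I⁰` over `A`
  obtain ⟨a, ha⟩ := exists_extension_of_injective (I.cocomplex.X 0) (inf_le_left : A ⊓ B ≤ A)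
    (Hom.app (augHom I) (A ⊓ B) t)
  obtain ⟨ζ, hA, hB⟩ := exists_glue_two hAB (Hom.app (I.cocomplex.d 0 1) A a) 0 (by
    rw [← app_res, ha, d_comp_ι, map_zero])
  obtain ⟨z, hz⟩ := exists_cycle (f := f) (I := I) (W := W) ζ (by
    refine eq_of_locally fun x hx => ?_
    have hx' : x ∈ A ⊔ B := by rw [hAB]; exact hx
    rcases hx' with h | h
    · refine ⟨A, hAB ▸ le_sup_left, h, ?_⟩
      rw [← app_res, hA, map_zero]
      exact congrArg (fun k => Hom.app k A a) (I.cocomplex.d_comp_d 0 1 2)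
    · refine ⟨B, hAB ▸ le_sup_right, h, ?_⟩
      rw [← app_res, hB, map_zero, map_zero])
  refine ⟨Hom.app (classIso f I).inv W
    (Hom.app ((pushCx f I).homologyπ 1) W z), (isCechClass_iff I hAB _ _).2
      ⟨z, ⟨a, 0, ?_, ?_, ?_⟩, ?_⟩⟩
  · rw [map_zero, sub_zero, ha]
  · rw [hz, hA]
  · rw [hz, hB, map_zero]
  · exact congrArg (fun k => Hom.app k W (Hom.app ((pushCx f I).homologyπ 1) W z))
      (classIso f I).inv_hom_id

/-- A cocycle whose class vanishes is locally a coboundary. -/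
theorem IsCechClass.exists_coboundary {hAB : A ⊔ B = f ⁻¹ᵁ W} {t : Γ(M, A ⊓ B)}
    (h : IsCechClass f hAB t 0) {y : Y} (hy : y ∈ W) :
    ∃ (W' : Y.Opens) (_ : W' ≤ W) (mA : Γ(M, A ⊓ f ⁻¹ᵁ W')) (mB : Γ(M, B ⊓ f ⁻¹ᵁ W')), y ∈ W' ∧
      FlagCohomology.res (inf_le_left : A ⊓ B ⊓ f ⁻¹ᵁ W' ≤ _) t =
        FlagCohomology.res (inf_le_inf_right _ inf_le_left) mA -
          FlagCohomology.res (inf_le_inf_right _ inf_le_right) mB := by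
  let I : InjectiveResolution M := injectiveResolution M
  obtain ⟨z, ⟨a, b, h₁, h₂, h₃⟩, h₄⟩ := (isCechClass_iff I hAB t 0).1 h
  rw [map_zero] at h₄
  obtain ⟨W', hW, c, hy', hc⟩ := exists_of_homologyπ_eq_zero z h₄.symm hy
  obtain ⟨mA, hmA⟩ := exists_of_d_eq_zero I
    (FlagCohomology.res (inf_le_left : A ⊓ f ⁻¹ᵁ W' ≤ A) a - FlagCohomology.res inf_le_right c) (by
      rw [app_sub, app_res, app_res, h₂, ← hc, res_res, res_res, sub_self])
  obtain ⟨mB, hmB⟩ := exists_of_d_eq_zero I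
    (FlagCohomology.res (inf_le_left : B ⊓ f ⁻¹ᵁ W' ≤ B) b - FlagCohomology.res inf_le_right c) (by
      rw [app_sub, app_res, app_res, h₃, ← hc, res_res, res_res, sub_self])
  refine ⟨W', hW, mA, mB, hy', app_injective_of_mono (augHom I) _ ?_⟩
  rw [app_sub, app_res, app_res, app_res, hmA, hmB, h₁]
  simp only [map_sub, res_res]
  abel

end cech

/-! ### Vanishing of the first cohomology on affine open sets -/

section affineVanishing
variable {X : Scheme.{u}} {M N K : X.Modules} {A U : X.Opens}

theorem linComb_unit (e : Unit → Γ(M, A)) (h : U ≤ A) (a : Unit → Γ(X, U)) :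
    linComb e h a = a () • res h (e ()) := by
  simp [linComb]

/-- A section of a trivial line bundle over a basic open subset of an affine open set extends after
multiplication by a power of the function. -/
theorem exists_pow_smul_extension {e : Unit → Γ(M, A)} (he : IsBasis e) (hU : IsAffineOpen U)
    (hUA : U ≤ A) (g : Γ(X, U)) (m : Γ(M, X.basicOpen g)) : ∃ (n : ℕ) (s : Γ(M, U)),
      res (X.basicOpen_le g) s = resO (X.basicOpen_le g) g ^ n • m := by
  obtain ⟨a, ha⟩ := (he _ ((X.basicOpen_le g).trans hUA)).2 m
  obtain ⟨n, r, hr⟩ := exists_eq_pow_mul_of_isAffineOpen X U hU g (a ())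
  refine ⟨n, r • res hUA (e ()), ?_⟩
  rw [map_smulₛₗ, res_res, ← ha, linComb_unit, smul_smul]
  congr 1

theorem exists_pow_smul_eq_zero {e : Unit → Γ(M, A)} (he : IsBasis e) (hU : IsAffineOpen U)
    (hUA : U ≤ A) (g : Γ(X, U)) (m : Γ(M, U)) (hm : res (X.basicOpen_le g) m = 0) :
    ∃ n : ℕ, g ^ n • m = 0 := by
  obtain ⟨a, ha⟩ := (he _ hUA).2 m
  rw [← ha, res_linComb] at hm
  have h0 : resO (X.basicOpen_le g) (a ()) = 0 := by
    have := (he _ ((X.basicOpen_le g).trans hUA)).1 (a₁ := fun i => resO (X.basicOpen_le g) (a i))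
      (a₂ := 0) (by rw [hm]; simp [linComb])
    exact congrFun this ()
  obtain ⟨n, hn⟩ := exists_pow_mul_eq_zero_of_res_basicOpen_eq_zero_of_isAffineOpen X hU (a ()) g h0
  refine ⟨n, ?_⟩
  rw [← ha, linComb_unit, smul_smul, hn, zero_smul]

/-- Gluing of sections over a covering. -/
theorem exists_glue_sections {ι : Type*} (V : ι → X.Opens) (hV : ∀ x ∈ A, ∃ i, x ∈ V i) (hVA : ∀ i, V i ≤ A)
    (s : ∀ i, Γ(N, V i)) (h : ∀ i j, res (inf_le_left : V i ⊓ V j ≤ _) (s i) =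
      res inf_le_right (s j)) : ∃ t : Γ(N, A), ∀ i, res (hVA i) t = s i := by
  let P : ∀ O : X.Opens, Γ(N, O) → Prop := fun O t =>
    ∀ (i : ι) (O' : X.Opens) (hO : O' ≤ O) (hi : O' ≤ V i), res hO t = res hi (s i)
  obtain ⟨t, ht⟩ := exists_of_locally (U := A) P
    (fun {O O'} h t ht i O'' hO hi => by rw [res_res]; exact ht i O'' (hO.trans h) hi)
    (fun {O} t t' hO ht ht' => eq_of_locally fun x hx => by
      obtain ⟨i, hi⟩ := hV x (hO hx)
      exact ⟨O ⊓ V i, inf_le_left, ⟨hx, hi⟩, (ht i _ _ inf_le_right).trans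
        (ht' i _ _ inf_le_right).symm⟩)
    (fun x hx => by
      obtain ⟨i, hi⟩ := hV x hx
      refine ⟨V i, hVA i, hi, s i, fun j O' hO hj => ?_⟩
      have := congrArg (res (le_inf hO hj)) (h i j)
      rwa [res_res, res_res] at this)
  refine ⟨t, fun i => eq_of_locally fun x hx => ?_⟩
  obtain ⟨O, hO, hxO, hP⟩ := ht x (hVA i hx)
  refine ⟨O ⊓ V i, inf_le_right, ⟨hxO, hx⟩, ?_⟩
  have := hP i (O ⊓ V i) inf_le_left inf_le_right
  rwa [res_res] at this ⊢

variable {φ : M ⟶ N} {ψ : N ⟶ K}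

/-- If `ζ` lies in the image of `ψ` over the members of a finite affine covering of `A` and over the
basic open set of `g`, then so does a multiple of `ζ` by a power of `g` over `A`. -/
theorem exists_pow_smul_primitive (hφ : ∀ U, Function.Injective (Hom.app φ U))
    (hψφ : ∀ (U : X.Opens) (m : Γ(M, U)), Hom.app ψ U (Hom.app φ U m) = 0)
    (hφψ : ∀ (U : X.Opens) (n : Γ(N, U)), Hom.app ψ U n = 0 → ∃ m, Hom.app φ U m = n)
    {e : Unit → Γ(M, A)} (he : IsBasis e) {ι : Type*} [Finite ι] (V : ι → X.Opens)
    (hV : ∀ x ∈ A, ∃ i, x ∈ V i) (hVA : ∀ i, V i ≤ A) (hVa : ∀ i, IsAffineOpen (V i))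
    (hVa' : ∀ i j, IsAffineOpen (V i ⊓ V j)) {ζ : Γ(K, A)} (a : ∀ i, Γ(N, V i))
    (ha : ∀ i, Hom.app ψ (V i) (a i) = res (hVA i) ζ) (g : Γ(X, A)) (a' : Γ(N, X.basicOpen g))
    (ha' : Hom.app ψ _ a' = res (X.basicOpen_le g) ζ) :
    ∃ (n : ℕ) (b : Γ(N, A)), Hom.app ψ A b = g ^ n • ζ := by
  classical
  cases nonempty_fintype ι
  have hb : ∀ U : X.Opens, ∀ hU : U ≤ A, X.basicOpen (resO hU g) = U ⊓ X.basicOpen g :=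
    fun U hU => X.basicOpen_res g (homOfLE hU).op
  have hbg : ∀ U : X.Opens, ∀ hU : U ≤ A, X.basicOpen (resO hU g) ≤ X.basicOpen g :=
    fun U hU => (hb U hU).le.trans inf_le_right
  have h₁ : ∀ i, ∃ (n : ℕ) (s : Γ(M, V i)), res (X.basicOpen_le (resO (hVA i) g)) (Hom.app φ _ s) =
      resO (X.basicOpen_le (resO (hVA i) g)) (resO (hVA i) g) ^ n •
        (res (X.basicOpen_le (resO (hVA i) g)) (a i) - res (hbg _ (hVA i)) a') := by
    intro i
    obtain ⟨m, hm⟩ := hφψ _ (res (X.basicOpen_le (resO (hVA i) g)) (a i) - res (hbg _ (hVA i)) a')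
      (by rw [app_sub, app_res, app_res, ha, ha', res_res, res_res, sub_self])
    obtain ⟨n, s, hs⟩ := exists_pow_smul_extension he (hVa i) (hVA i) (resO (hVA i) g) m
    refine ⟨n, s, ?_⟩
    rw [← app_res, hs, Hom.app_smul, hm]
  choose n s hs using h₁
  let k := Finset.univ.sup n
  have hk : ∀ i, n i ≤ k := fun i => Finset.le_sup (Finset.mem_univ i)
  -- the corrected local primitives of `g ^ k • ζ`
  let c : ∀ i, Γ(N, V i) := fun i =>
    resO (hVA i) g ^ k • a i - resO (hVA i) g ^ (k - n i) • Hom.app φ _ (s i)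
  have hc : ∀ i, Hom.app ψ _ (c i) = resO (hVA i) g ^ k • res (hVA i) ζ := by
    intro i
    rw [app_sub, Hom.app_smul, Hom.app_smul, ha, hψφ, smul_zero, sub_zero]
  have hc' : ∀ i, res (X.basicOpen_le (resO (hVA i) g)) (c i) =
      resO (X.basicOpen_le (resO (hVA i) g)) (resO (hVA i) g) ^ k • res (hbg _ (hVA i)) a' := by
    intro i
    rw [map_sub, map_smulₛₗ, map_smulₛₗ, hs, smul_smul, map_pow, map_pow, ← pow_add,
      Nat.sub_add_cancel (hk i), ← smul_sub, sub_sub_cancel]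
  have h₂ : ∀ i j, ∃ n : ℕ, resO (inf_le_left.trans (hVA i) : V i ⊓ V j ≤ A) g ^ n •
      (res (inf_le_left : V i ⊓ V j ≤ _) (c i) - res inf_le_right (c j)) = 0 := by
    intro i j
    obtain ⟨m, hm⟩ := hφψ _ (res (inf_le_left : V i ⊓ V j ≤ _) (c i) - res inf_le_right (c j))
      (by rw [app_sub, app_res, app_res, hc, hc, map_smulₛₗ, map_smulₛₗ, map_pow, map_pow,
        resO_resO, resO_resO, res_res, res_res, sub_self])
    obtain ⟨n, hn⟩ := exists_pow_smul_eq_zero he (hVa' i j) (inf_le_left.trans (hVA i))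
      (resO (inf_le_left.trans (hVA i)) g) m (by
        apply hφ
        rw [app_res, hm, map_zero, map_sub, res_res, res_res]
        have hi := congrArg (res (show X.basicOpen (resO (inf_le_left.trans (hVA i) :
          V i ⊓ V j ≤ A) g) ≤ X.basicOpen (resO (hVA i) g) by
            rw [hb, hb]; exact inf_le_inf_right _ inf_le_left)) (hc' i)
        have hj := congrArg (res (show X.basicOpen (resO (inf_le_left.trans (hVA i) :
          V i ⊓ V j ≤ A) g) ≤ X.basicOpen (resO (hVA j) g) by
            rw [hb, hb]; exact inf_le_inf_right _ inf_le_right)) (hc' j)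
        rw [res_res, map_smulₛₗ, map_pow, resO_resO, resO_resO, res_res] at hi hj
        rw [hi, hj, sub_self])
    refine ⟨n, ?_⟩
    rw [← hm, ← Hom.app_smul, hn, map_zero]
  choose n' hn' using h₂
  let l := Finset.univ.sup fun p : ι × ι => n' p.1 p.2
  have hl : ∀ i j, n' i j ≤ l := fun i j =>
    Finset.le_sup (f := fun p : ι × ι => n' p.1 p.2) (Finset.mem_univ (i, j))
  obtain ⟨b, hb'⟩ := exists_glue_sections V hV hVA (fun i => resO (hVA i) g ^ l • c i) (fun i j => by
    rw [map_smulₛₗ, map_smulₛₗ, map_pow, map_pow, resO_resO, resO_resO, ← sub_eq_zero, ← smul_sub,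
      ← Nat.sub_add_cancel (hl i j), pow_add, mul_smul, hn', smul_zero])
  refine ⟨l + k, b, eq_of_locally fun x hx => ?_⟩
  obtain ⟨i, hi⟩ := hV x hx
  refine ⟨V i, hVA i, hi, ?_⟩
  rw [← app_res, hb', Hom.app_smul, hc, smul_smul, map_smulₛₗ, map_pow, pow_add]

/-- Vanishing of the first cohomology of a trivial line bundle on an affine open set: a section
which lies locally in the image of `ψ` lies in the image of `ψ`. -/
theorem exists_primitive (hφ : ∀ U, Function.Injective (Hom.app φ U))
    (hψφ : ∀ (U : X.Opens) (m : Γ(M, U)), Hom.app ψ U (Hom.app φ U m) = 0)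
    (hφψ : ∀ (U : X.Opens) (n : Γ(N, U)), Hom.app ψ U n = 0 → ∃ m, Hom.app φ U m = n)
    (hA : IsAffineOpen A) {e : Unit → Γ(M, A)} (he : IsBasis e) (ζ : Γ(K, A))
    (hζ : ∀ x ∈ A, ∃ (U : X.Opens) (h : U ≤ A) (a : Γ(N, U)), x ∈ U ∧
      Hom.app ψ U a = res h ζ) : ∃ b : Γ(N, A), Hom.app ψ A b = ζ := by
  let I : Ideal Γ(X, A) :=
    { carrier := {r | ∃ b : Γ(N, A), Hom.app ψ A b = r • ζ}
      zero_mem' := ⟨0, by rw [map_zero, zero_smul]⟩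
      add_mem' := fun {r r'} ⟨b, hb⟩ ⟨b', hb'⟩ => ⟨b + b', by rw [map_add, hb, hb', add_smul]⟩
      smul_mem' := fun r r' ⟨b, hb⟩ => ⟨r • b, by rw [Hom.app_smul, hb, smul_smul, smul_eq_mul]⟩ }
  let T : Set Γ(X, A) := {g | ∃ a : Γ(N, X.basicOpen g), Hom.app ψ _ a = res (X.basicOpen_le g) ζ}
  have hT : Ideal.span T = ⊤ := by
    rw [← hA.iSup_basicOpen_eq_self_iff]
    refine le_antisymm (iSup_le fun g => X.basicOpen_le _) fun x hx => ?_
    obtain ⟨U, h, a, hxU, ha⟩ := hζ x hx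
    obtain ⟨g, hg, hxg⟩ := hA.exists_basicOpen_le ⟨x, hxU⟩ hx
    refine Opens.mem_iSup.2 ⟨⟨g, res hg a, ?_⟩, hxg⟩
    rw [app_res, ha, res_res]
  obtain ⟨s, hsT, hs⟩ := (Ideal.span_eq_top_iff_finite T).1 hT
  choose a ha using fun g : s => hsT g.2
  have hI : I = ⊤ := by
    -- the functions `g` such that `ζ` has a primitive over `D(g)` generate the unit ideal
    rw [← Ideal.radical_eq_top, eq_top_iff, ← hs, Ideal.span_le]
    intro g hg
    obtain ⟨n, b, hb⟩ := exists_pow_smul_primitive hφ hψφ hφψ he (fun g : s => X.basicOpen g.1)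
      (fun x hx => by
        have : x ∈ ⨆ g : (s : Set Γ(X, A)), X.basicOpen (g : Γ(X, A)) := by
          rw [hA.iSup_basicOpen_eq_self_iff.2 hs]
          exact hx
        exact Opens.mem_iSup.1 this) (fun g => X.basicOpen_le _) (fun g => hA.basicOpen _)
      (fun g g' => by rw [← X.basicOpen_mul]; exact hA.basicOpen _) a ha g (a ⟨g, hg⟩) (ha ⟨g, hg⟩)
    exact ⟨n, b, hb⟩
  obtain ⟨b, hb⟩ := (Ideal.eq_top_iff_one I).1 hI
  exact ⟨b, by rw [hb, one_smul]⟩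

end affineVanishing

/-! ### Classes that come from cocycles -/

section surjectivity
variable {X Y : Scheme.{u}} {f : X ⟶ Y} {M : X.Modules} {W : Y.Opens} {A B : X.Opens}

theorem exists_homologyπ_eq_classIso (I : InjectiveResolution M) (ξ : Γ((R1 f).obj M, W)) {y : Y}
    (hy : y ∈ W) : ∃ (W' : Y.Opens) (hW : W' ≤ W) (z : Γ((pushCx f I).cycles 1, W')), y ∈ W' ∧
      Hom.app (classIso f I).hom W' (res hW ξ) = Hom.app ((pushCx f I).homologyπ 1) W' z := by
  obtain ⟨W', hW, z, hy', hz⟩ := exists_homologyπ_eq (Hom.app (classIso f I).hom W ξ) hy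
  exact ⟨W', hW, z, hy', by rw [app_res, hz]⟩

/-- For a covering by two affine open sets over which `M` is a trivial line bundle, every class
represented by a cycle of `f_* I` is the class of a cocycle. -/
theorem exists_isCechClass_of_isAffineOpen (hAB : A ⊔ B = f ⁻¹ᵁ W) (hA : IsAffineOpen A)
    {eA : Unit → Γ(M, A)} (heA : IsBasis eA) (hB : IsAffineOpen B) {eB : Unit → Γ(M, B)}
    (heB : IsBasis eB) (I : InjectiveResolution M) {ξ : Γ((R1 f).obj M, W)}
    {z : Γ((pushCx f I).cycles 1, W)}
    (hz : Hom.app (classIso f I).hom W ξ = Hom.app ((pushCx f I).homologyπ 1) W z) :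
    ∃ t, IsCechClass f hAB t ξ := by
  have hζ : ∀ {U : X.Opens} (hU : U ≤ f ⁻¹ᵁ W), ∀ x ∈ U, ∃ (U' : X.Opens) (h : U' ≤ U)
      (a : Γ(I.cocomplex.X 0, U')), x ∈ U' ∧
        Hom.app (I.cocomplex.d 0 1) U' a = res h (res hU (cycleSec z)) := by
    intro U hU x hx
    have h := exists_of_exact (S := ShortComplex.mk _ _ (I.cocomplex.d_comp_d 0 1 2))
      (I.exact_succ 0) (res hU (cycleSec z)) ((app_res (I.cocomplex.d 1 2) hU _).trans (by
        rw [d_cycleSec, map_zero])) hx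
    obtain ⟨U', h, a, hx', ha⟩ := h
    exact ⟨U', h, a, hx', ha⟩
  obtain ⟨a, ha⟩ := exists_primitive (φ := augHom I) (ψ := I.cocomplex.d 0 1)
    (fun U => app_injective_of_mono _ U) (fun U m => d_comp_ι I m)
    (fun U n => exists_of_d_eq_zero I n) hA heA _ (hζ (hAB ▸ le_sup_left))
  obtain ⟨b, hb⟩ := exists_primitive (φ := augHom I) (ψ := I.cocomplex.d 0 1)
    (fun U => app_injective_of_mono _ U) (fun U m => d_comp_ι I m)
    (fun U n => exists_of_d_eq_zero I n) hB heB _ (hζ (hAB ▸ le_sup_right))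
  obtain ⟨t, ht⟩ := exists_of_d_eq_zero I
    (res (inf_le_left : A ⊓ B ≤ A) a - res inf_le_right b) (by
      rw [app_sub, app_res, app_res, ha, hb, res_res, res_res, sub_self])
  exact ⟨t, (isCechClass_iff I hAB t ξ).2 ⟨z, ⟨a, b, ht, ha, hb⟩, hz⟩⟩

end surjectivity

/-! ### Frames of a bundle of rank two -/

section frames
variable {X : Scheme.{u}} {M N : X.Modules} {U V W : X.Opens}

theorem linComb_two (e : Fin 2 → Γ(M, W)) (h : U ≤ W) (a : Fin 2 → Γ(X, U)) :
    linComb e h a = a 0 • res h (e 0) + a 1 • res h (e 1) := by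
  simp [linComb]

theorem Frame.isBasis (φ : Frame M W) : IsBasis ![φ.e₁, φ.e₂] := by
  intro U h
  have hx₁ : ev (res h φ.x) (res h φ.e₁) = 1 := by rw [← resO_ev, φ.x_e₁, map_one]
  have hx₂ : ev (res h φ.x) (res h φ.e₂) = 0 := by rw [← resO_ev, φ.x_e₂, map_zero]
  have hy₁ : ev (res h φ.y) (res h φ.e₁) = 0 := by rw [← resO_ev, φ.y_e₁, map_zero]
  have hy₂ : ev (res h φ.y) (res h φ.e₂) = 1 := by rw [← resO_ev, φ.y_e₂, map_one]
  constructor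
  · intro a b hab
    rw [linComb_two, linComb_two] at hab
    have h₁ := congrArg (ev (res h φ.x)) hab
    have h₂ := congrArg (ev (res h φ.y)) hab
    simp only [Matrix.cons_val_zero, Matrix.cons_val_one, ev_add, ev_smul, hx₁, hx₂, hy₁, hy₂,
      mul_one, mul_zero, add_zero, zero_add] at h₁ h₂
    funext i
    fin_cases i
    · exact h₁
    · exact h₂
  · intro m
    refine ⟨![ev (res h φ.x) m, ev (res h φ.y) m], ?_⟩
    rw [linComb_two]
    exact (φ.span h m).symm

/-- The frame given by a basis. -/
noncomputable def IsBasis.frame {e : Fin 2 → Γ(M, W)} (he : IsBasis e) : Frame M W where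
  e₁ := e 0
  e₂ := e 1
  x := he.dualVec 0
  y := he.dualVec 1
  x_e₁ := by simp [dualVec, ev_form_self]
  x_e₂ := by simp [dualVec, ev_form_self]
  y_e₁ := by simp [dualVec, ev_form_self]
  y_e₂ := by simp [dualVec, ev_form_self]
  span {U} h m := by
    rw [he.ev_dualVec, he.ev_dualVec]
    conv_lhs => rw [← he.linComb_coord h m, linComb_two]

theorem Frame.dual_isBasis (φ : Frame M W) : IsBasis ![φ.x, φ.y] := by
  refine φ.isBasis.dual fun i j => ?_
  fin_cases i <;> fin_cases j <;> simp [φ.x_e₁, φ.x_e₂, φ.y_e₁, φ.y_e₂]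

/-- The dual frame is determined by the frame. -/
theorem Frame.ext_of_eq {φ ψ : Frame M W} (h₁ : φ.e₁ = ψ.e₁) (h₂ : φ.e₂ = ψ.e₂) : φ = ψ := by
  have hx : φ.x = ψ.x := φ.isBasis.dual_ext le_rfl fun i => by
    rw [res_refl]
    fin_cases i
    · exact φ.x_e₁.trans (h₁ ▸ ψ.x_e₁.symm)
    · exact φ.x_e₂.trans (h₂ ▸ ψ.x_e₂.symm)
  have hy : φ.y = ψ.y := φ.isBasis.dual_ext le_rfl fun i => by
    rw [res_refl]
    fin_cases i
    · exact φ.y_e₁.trans (h₁ ▸ ψ.y_e₁.symm)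
    · exact φ.y_e₂.trans (h₂ ▸ ψ.y_e₂.symm)
  cases φ
  cases ψ
  simp only at h₁ h₂ hx hy
  subst h₁ h₂ hx hy
  rfl

/-- Restriction of a frame. -/
noncomputable def Frame.res (φ : Frame M W) (h : U ≤ W) : Frame M U where
  e₁ := FlagCohomology.res h φ.e₁
  e₂ := FlagCohomology.res h φ.e₂
  x := FlagCohomology.res h φ.x
  y := FlagCohomology.res h φ.y
  x_e₁ := by rw [← resO_ev, φ.x_e₁, map_one]
  x_e₂ := by rw [← resO_ev, φ.x_e₂, map_zero]
  y_e₁ := by rw [← resO_ev, φ.y_e₁, map_zero]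
  y_e₂ := by rw [← resO_ev, φ.y_e₂, map_one]
  span h' m := by
    rw [res_res, res_res, res_res, res_res]
    exact φ.span (h'.trans h) m

theorem Frame.res_res (φ : Frame M W) (h : U ≤ W) (h' : V ≤ U) :
    (φ.res h).res h' = φ.res (h'.trans h) :=
  Frame.ext_of_eq (FlagCohomology.res_res _ _ _) (FlagCohomology.res_res _ _ _)

theorem Frame.res_refl (φ : Frame M W) : φ.res le_rfl = φ :=
  Frame.ext_of_eq (FlagCohomology.res_refl _ _) (FlagCohomology.res_refl _ _)

theorem Frame.res_monomial (φ : Frame M W) (h : U ≤ W) (n j : ℕ) :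
    FlagCohomology.res h (φ.monomial n j) = (φ.res h).monomial n j := by
  rw [Frame.monomial, res_symMul, Frame.monomial]
  simp only [apply_ite (FlagCohomology.res h)]
  rfl

theorem Frame.resO_ev_monomial (φ : Frame M W) (h : U ≤ W) {n : ℕ} (γ : Γ(divPow M n, W)) (j : ℕ) :
    resO h (ev γ (φ.monomial n j)) = ev (FlagCohomology.res (M := divPow M n) h γ)
      ((φ.res h).monomial n j) := by
  rw [← φ.res_monomial h]
  exact resO_ev h γ _

theorem Frame.isBasis_monomial (φ : Frame M W) (n : ℕ) :
    IsBasis fun j : Fin (n + 1) => φ.monomial n j :=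
  φ.dual_isBasis.mono n

theorem Frame.divPow_ext (φ : Frame M W) {n : ℕ} {γ γ' : Γ(divPow M n, W)}
    (h : ∀ j ≤ n, ev γ (φ.monomial n j) = ev γ' (φ.monomial n j)) : γ = γ' :=
  (φ.isBasis_monomial n).dual_ext le_rfl fun i => by
    simp only [FlagCohomology.res_refl]
    exact h i (Nat.lt_succ_iff.1 i.2)

theorem Frame.exists_divPow (φ : Frame M W) (n : ℕ) (c : ℕ → Γ(X, W)) :
    ∃ γ : Γ(divPow M n, W), ∀ j ≤ n, ev γ (φ.monomial n j) = c j :=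
  ⟨(φ.isBasis_monomial n).form fun j => c j, fun j hj =>
    (φ.isBasis_monomial n).ev_form_self (fun j => c j) ⟨j, Nat.lt_succ_iff.2 hj⟩⟩

/-- Expansion of the monomials of a frame in those of another one. -/
theorem Frame.monomial_eq (φ ψ : Frame M W) {a b c d : Γ(X, W)} (hx : ψ.x = a • φ.x + b • φ.y)
    (hy : ψ.y = c • φ.x + d • φ.y) {n j : ℕ} (hj : j ≤ n) :
    ψ.monomial n j = ∑ i ∈ Finset.range (n + 1), ((Polynomial.C a + Polynomial.C b * Polynomial.X) ^ (n - j) *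
      (Polynomial.C c + Polynomial.C d * Polynomial.X) ^ j).coeff i • φ.monomial n i := by
  have h := symMul_eq φ.dual_isBasis (n := n) (fun k => if (k : ℕ) < j then c else a)
    (fun k => if (k : ℕ) < j then d else b)
  have h₁ : ψ.monomial n j = symMul fun k : Fin n =>
      (if (k : ℕ) < j then c else a) • (![φ.x, φ.y] : Fin 2 → Γ(FlagCohomology.dual M, W)) 0 +
      (if (k : ℕ) < j then d else b) • (![φ.x, φ.y] : Fin 2 → Γ(FlagCohomology.dual M, W)) 1 := by
    rw [Frame.monomial]
    congr 1
    funext k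
    split_ifs
    · exact hy
    · exact hx
  rw [h₁, h]
  refine Eq.trans ?_ (Finset.sum_range fun i => ((Polynomial.C a + Polynomial.C b * Polynomial.X) ^ (n - j) *
      (Polynomial.C c + Polynomial.C d * Polynomial.X) ^ j).coeff i • φ.monomial n i).symm
  refine Finset.sum_congr rfl fun i _ => ?_
  refine congrArg (fun f : Polynomial Γ(X, W) => f.coeff i • φ.monomial n i) ?_
  have h₂ : ∀ k : Fin n, Polynomial.C (if (k : ℕ) < j then c else a) +
      Polynomial.C (if (k : ℕ) < j then d else b) * Polynomial.X =
      if (k : ℕ) < j then Polynomial.C c + Polynomial.C d * Polynomial.X else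
        Polynomial.C a + Polynomial.C b * Polynomial.X := fun k => by split_ifs <;> rfl
  simp only [h₂]
  rw [Finset.prod_ite, Finset.prod_const, Finset.prod_const, mul_comm]
  have h₃ : (Finset.univ.filter fun k : Fin n => (k : ℕ) < j).card = j := by
    rw [Fin.card_filter_val_lt]
    omega
  have h₄ : (Finset.univ.filter fun k : Fin n => ¬ (k : ℕ) < j).card = n - j := by
    have := Finset.card_filter_add_card_filter_not (s := (Finset.univ : Finset (Fin n)))
      (fun k : Fin n => (k : ℕ) < j)
    rw [h₃, Finset.card_univ, Fintype.card_fin] at this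
    omega
  rw [h₃, h₄]

theorem Frame.isBasis_wedge (φ : Frame M W) : IsBasis fun _ : Unit => wedge ![φ.e₁, φ.e₂] :=
  φ.isBasis.wedge

theorem Frame.exists_det (φ : Frame M W) :
    ∃ d : Γ(dual (extPow M 2), W), ev d (wedge ![φ.e₁, φ.e₂]) = 1 :=
  ⟨_, φ.isBasis_wedge.ev_form_self (fun _ => 1) ()⟩

theorem Frame.det_isBasis (φ : Frame M W) {d : Γ(dual (extPow M 2), W)}
    (hd : ev d (wedge ![φ.e₁, φ.e₂]) = 1) : IsBasis fun _ : Unit => d :=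
  φ.isBasis_wedge.dual fun _ _ => hd

theorem Frame.det_unique (φ : Frame M W) {d d' : Γ(dual (extPow M 2), W)}
    (hd : ev d (wedge ![φ.e₁, φ.e₂]) = 1) (hd' : ev d' (wedge ![φ.e₁, φ.e₂]) = 1) : d = d' :=
  φ.isBasis_wedge.dual_ext le_rfl fun _ => by
    simp only [FlagCohomology.res_refl]
    rw [hd, hd']

theorem Frame.res_det (φ : Frame M W) (h : U ≤ W) {d : Γ(dual (extPow M 2), W)}
    (hd : ev d (wedge ![φ.e₁, φ.e₂]) = 1) :
    ev (FlagCohomology.res h d) (wedge ![(φ.res h).e₁, (φ.res h).e₂]) = 1 := by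
  have h₁ : wedge ![(φ.res h).e₁, (φ.res h).e₂] = FlagCohomology.res h (wedge ![φ.e₁, φ.e₂]) := by
    rw [res_wedge, res_vec2]
    rfl
  rw [h₁, ← resO_ev, hd, map_one]

variable (M) in
/-- The bundle `Γ^n(M) ⊗ det^(-b)(M)`. -/
noncomputable abbrev gammaDetOf (n b : ℕ) : X.Modules :=
  tensor (divPow M n) (negPow (extPow M 2) b)

theorem bijective_tmul {ι : Type*} [Fintype ι] {e : ι → Γ(M, W)} (he : IsBasis e) {L : X.Modules}
    {f : Γ(L, W)} (hf : IsBasis fun _ : Unit => f) :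
    Function.Bijective fun m : Γ(M, W) => tmul m f := by
  classical
  have ht := he.tmul hf
  have h0 : (tmul (0 : Γ(M, W)) f : Γ(tensor M L, W)) = 0 := by
    have := smul_tmul (0 : Γ(X, W)) (0 : Γ(M, W)) f
    rwa [zero_smul, zero_smul] at this
  have h₁ : ∀ (a : ι → Γ(X, W)) (s : Finset ι), tmul (∑ i ∈ s, a i • FlagCohomology.res le_rfl (e i)) f =
      ∑ i ∈ s, a i • FlagCohomology.res le_rfl (tmul (e i) f) := by
    intro a s
    induction s using Finset.induction_on with
    | empty => rw [Finset.sum_empty, Finset.sum_empty, h0]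
    | insert i s hi hs =>
      rw [Finset.sum_insert hi, Finset.sum_insert hi, add_tmul, hs, smul_tmul,
        FlagCohomology.res_refl, FlagCohomology.res_refl]
  have key : ∀ a : ι → Γ(X, W), linComb (fun i => tmul (e i) f) le_rfl a =
      tmul (linComb e le_rfl a) f := fun a => (h₁ a Finset.univ).symm
  constructor
  · intro m m' h
    obtain ⟨a, rfl⟩ := (he W le_rfl).2 m
    obtain ⟨a', rfl⟩ := (he W le_rfl).2 m'
    rw [(ht W le_rfl).1 ((key a).trans (h.trans (key a').symm))]
  · intro s
    obtain ⟨a, ha⟩ := (ht W le_rfl).2 s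
    exact ⟨_, (key a).symm.trans ha⟩

/-- The sections `γ ⊗ d^b` exhaust `Γ^n(M) ⊗ det^(-b)(M)`. -/
theorem Frame.bijective_tmul (φ : Frame M W) {d : Γ(dual (extPow M 2), W)}
    (hd : ev d (wedge ![φ.e₁, φ.e₂]) = 1) (n b : ℕ) : Function.Bijective fun γ : Γ(divPow M n, W) =>
      (tmul γ (tpowSec d b) : Γ(gammaDetOf M n b, W)) := by
  have hL : IsBasis fun _ : Unit => tpowSec d b := (φ.det_isBasis hd).tpow b
  have hb := φ.isBasis_monomial n
  have hγ : IsBasis (M := divPow M n) fun i => hb.dualVec i :=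
    hb.dual fun i j => by simp [IsBasis.dualVec, IsBasis.ev_form_self, Pi.single_apply, eq_comm]
  exact FlagCohomology.bijective_tmul hγ hL

end frames

/-! ### The tautological line and the quotient of the plane by it -/

section cokernels
variable {X : Scheme.{u}} {M N : X.Modules} {W : X.Opens} {ι κ : Type*} [Fintype ι] [Fintype κ]

/-- A basis of a module, the first part of which comes from a submodule containing no combination of
the second part, induces a basis of the quotient. -/
theorem isBasis_cokernel {φ : M ⟶ N} [Mono φ] {e : ι ⊕ κ → Γ(N, W)} (he : IsBasis e)
    (hi : ∀ i, ∃ m, Hom.app φ W m = e (Sum.inl i))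
    (H : ∀ (U : X.Opens) (h : U ≤ W) (m : Γ(M, U)) (k : κ),
      he.coord h (Hom.app φ U m) (Sum.inr k) = 0) :
    IsBasis fun k => Hom.app (cokernel.π φ) W (e (Sum.inr k)) := by
  have h0 : ∀ (U : X.Opens) (m : Γ(M, U)), Hom.app (cokernel.π φ) U (Hom.app φ U m) = 0 :=
    fun U m => congrArg (fun k => Hom.app k U m) (cokernel.condition φ)
  have h1 : ∀ (U : X.Opens) (s : Γ(N, U)), Hom.app (cokernel.π φ) U s = 0 →
      ∃ m, Hom.app φ U m = s := fun U s hs =>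
    exists_of_kernel (cokernel.condition φ) (Abelian.monoIsKernelOfCokernel _ (colimit.isColimit _)) s hs
  have key : ∀ (U : X.Opens) (h : U ≤ W) (a : ι ⊕ κ → Γ(X, U)),
      Hom.app (cokernel.π φ) U (linComb e h a) =
      linComb (fun k => Hom.app (cokernel.π φ) W (e (Sum.inr k))) h fun k => a (Sum.inr k) := by
    intro U h a
    rw [app_linComb, linComb, linComb, Fintype.sum_sum_type]
    have : ∀ i, Hom.app (cokernel.π φ) W (e (Sum.inl i)) = 0 := fun i => by
      obtain ⟨m, hm⟩ := hi i
      rw [← hm, h0]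
    simp [this]
  refine IsBasis.of_locally_surjective _ (fun U h a b hab => ?_) fun U h s x hx => ?_
  · have h2 : Hom.app (cokernel.π φ) U (linComb e h (Sum.elim 0 (a - b))) = 0 := by
      rw [key U h]
      simp only [Sum.elim_inr]
      have := linComb_add (fun k => Hom.app (cokernel.π φ) W (e (Sum.inr k))) h (a - b) b
      rw [sub_add_cancel, hab] at this
      exact add_eq_right.1 this.symm
    obtain ⟨m, hm⟩ := h1 _ _ h2
    funext k
    have := H U h m k
    rw [hm, he.coord_linComb] at this
    exact sub_eq_zero.1 this
  · obtain ⟨V, h', m, hxV, hm⟩ := exists_of_epi (cokernel.π φ) s hx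
    refine ⟨V, h', hxV, fun k => he.coord (h'.trans h) m (Sum.inr k), ?_⟩
    rw [← key, he.linComb_coord, hm]
end cokernels

section frameCharts
variable {S : Scheme.{u}} {V : S.Modules} {Fl : FlagScheme V ![1, 2, 3]} {P : FlagScheme V ![2]}
  {W W' : P.X.Opens} {U : Fl.X.Opens}

variable (P) in
/-- The inclusion of the tautological plane. -/
noncomputable def tautTwoι : tautTwo P ⟶ (Scheme.Modules.pullback P.π).obj V := (P.taut 0).arrow

variable (Fl) in
/-- The inclusion of the tautological line in the tautological plane. -/
noncomputable def lineOneι : lineOne Fl ⟶ (Fl.taut 1 : Fl.X.Modules) :=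
  Subobject.ofLE (Fl.taut 0) (Fl.taut 1) (Fl.isFlag.monotone (by decide))

instance : Mono (tautTwoι P) := inferInstanceAs (Mono (P.taut 0).arrow)

instance : Mono (lineOneι Fl) := inferInstanceAs (Mono (Subobject.ofLE _ _ _))

theorem lineOneι_arrow (m : Γ(lineOne Fl, U)) :
    Hom.app (Fl.taut 1).arrow U (Hom.app (lineOneι Fl) U m) = Hom.app (Fl.taut 0).arrow U m :=
  congrArg (fun k => Hom.app k U m) (Subobject.ofLE_arrow _)

theorem pullTaut_eq (s : Γ(tautTwo P, W)) :
    pullTaut Fl P s = pullSec (forgetFlag_comp Fl P) (Hom.app (tautTwoι P) W s) := rfl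

theorem pullTaut_add (s t : Γ(tautTwo P, W)) :
    pullTaut Fl P (s + t) = pullTaut Fl P s + pullTaut Fl P t := by
  rw [pullTaut_eq, map_add, pullSec_add]
  rfl

theorem pullTaut_smul (a : Γ(P.X, W)) (s : Γ(tautTwo P, W)) :
    pullTaut Fl P (a • s) = (forgetFlag Fl P).app W a • pullTaut Fl P s := by
  rw [pullTaut_eq, Hom.app_smul, pullSec_smul]
  rfl

theorem pullTaut_res (h : W' ≤ W) (s : Γ(tautTwo P, W)) :
    pullTaut Fl P (res h s) = res (Scheme.Hom.preimage_mono _ h) (pullTaut Fl P s) := by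
  rw [pullTaut_eq, app_res, pullSec_res]
  rfl

theorem mem_pullTaut (s : Γ(tautTwo P, W)) : Mem (Fl.taut 1) (pullTaut Fl P s) := by
  rw [← pullSub_tautTwo Fl P]
  exact mem_pullSub _ (mem_arrow s)

/-- Local bases of `V` extending a given frame of the tautological plane. -/
theorem exists_adapted_frame (hV : HasRank V 3) (φ : Frame (tautTwo P) W) {x : P.X} (hx : x ∈ W) :
    ∃ (W' : P.X.Opens) (h : W' ≤ W) (e : Fin 2 ⊕ Fin 1 → Γ((Scheme.Modules.pullback P.π).obj V, W')),
      x ∈ W' ∧ IsAffineOpen W' ∧ Adapted (P.taut 0) e ∧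
      e (Sum.inl 0) = Hom.app (tautTwoι P) W' (φ.res h).e₁ ∧
      e (Sum.inl 1) = Hom.app (tautTwoι P) W' (φ.res h).e₂ := by
  obtain ⟨W₁, e, hxW, he⟩ := exists_adapted_of_rank (n := 2) (m := 1) (hV.pullback P.π)
    P.hasRank_taut (P.isFlag.quotient 0) x
  obtain ⟨_, ⟨W', hW', rfl⟩, hxW', hle⟩ := P.X.isBasis_affineOpens.exists_subset_of_mem_open
    (⟨hxW, hx⟩ : x ∈ W₁ ⊓ W) (W₁ ⊓ W).2
  have h₁ : W' ≤ W₁ := fun y hy => (hle hy).1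
  have h₂ : W' ≤ W := fun y hy => (hle hy).2
  have he' := he.res h₁
  let ψ := φ.res h₂
  let e' : Fin 2 ⊕ Fin 1 → Γ((Scheme.Modules.pullback P.π).obj V, W') :=
    Sum.elim (fun i => Hom.app (tautTwoι P) W' (![ψ.e₁, ψ.e₂] i))
      fun k => res h₁ (e (Sum.inr k))
  have hlin : ∀ {O : P.X.Opens} (h : O ≤ W') (a : Fin 2 ⊕ Fin 1 → Γ(P.X, O)), linComb e' h a =
      Hom.app (tautTwoι P) O (linComb ![ψ.e₁, ψ.e₂] h fun i => a (Sum.inl i)) +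
        a (Sum.inr 0) • res h (res h₁ (e (Sum.inr 0))) := by
    intro O h a
    rw [app_linComb, linComb, linComb, Fintype.sum_sum_type]
    simp [e']
  have hcoord : ∀ {O : P.X.Opens} (h : O ≤ W') (a : Fin 2 ⊕ Fin 1 → Γ(P.X, O)) (k : Fin 1),
      he'.basis.coord h (linComb e' h a) (Sum.inr k) = a (Sum.inr k) := by
    intro O h a k
    rw [hlin, map_add, LinearMap.map_smul]
    have h₃ := (he'.mem_iff h (Hom.app (tautTwoι P) O (linComb ![ψ.e₁, ψ.e₂] h
      fun i => a (Sum.inl i)))).1 (mem_arrow (Z := P.taut 0) (linComb (M := tautTwo P)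
      ![ψ.e₁, ψ.e₂] h fun i => a (Sum.inl i))) k
    have h₄ := he'.basis.coord_self h (Sum.inr 0)
    rw [h₄, Pi.add_apply, h₃, Subsingleton.elim k 0]
    simp
  have hb : IsBasis e' := by
    intro O h
    constructor
    · intro a b hab
      have h₃ : ∀ k, a (Sum.inr k) = b (Sum.inr k) := fun k => by
        rw [← hcoord h a k, hab, hcoord h b k]
      rw [hlin, hlin, h₃, add_left_inj] at hab
      have h₄ := (ψ.isBasis O h).1 (app_injective_of_mono (tautTwoι P) O hab)
      funext j
      rcases j with i | k
      · exact congrFun h₄ i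
      · exact h₃ k
    · intro s
      let k := he'.basis.coord h s (Sum.inr 0)
      obtain ⟨z, hz⟩ := (he'.mem_iff h (s - k • res h (res h₁ (e (Sum.inr 0))))).2 (fun j => by
        rw [map_sub, LinearMap.map_smul]
        have h₄ := he'.basis.coord_self h (Sum.inr 0)
        rw [h₄, Subsingleton.elim j 0]
        simp [k])
      change Γ(tautTwo P, O) at z
      obtain ⟨a, ha⟩ := (ψ.isBasis O h).2 z
      refine ⟨Sum.elim a fun _ => k, ?_⟩
      rw [hlin]
      simp only [Sum.elim_inl, Sum.elim_inr]
      have hz₂ : Hom.app (tautTwoι P) O z = s - k • res h (res h₁ (e (Sum.inr 0))) := hz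
      rw [ha, hz₂, sub_add_cancel]
  refine ⟨W', h₂, e', hxW', hW', Adapted.of_mem hb (fun i => mem_arrow _) fun O h s hs k => ?_, rfl, rfl⟩
  rw [← hcoord h (hb.coord h s), hb.linComb_coord]
  exact (he'.mem_iff h s).1 hs k

/-- A line given as a graph over the first basis vector. -/
theorem isBasis_line {e : Fin 2 ⊕ Fin 1 → Γ((Scheme.Modules.pullback P.π).obj V, W)}
    (he : Adapted (P.taut 0) e) (hU : U ≤ forgetFlag Fl P ⁻¹ᵁ W) {u : Γ(Fl.X, U)}
    {ℓ : Γ(lineOne Fl, U)} (hℓ : Hom.app (Fl.taut 0).arrow U ℓ =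
      res hU (toFl (e (Sum.inl 0))) + u • res hU (toFl (e (Sum.inl 1)))) :
    IsBasis fun _ : Unit => ℓ := by
  have he' : Adapted (Fl.taut 1) fun j => toFl (Fl := Fl) (e j) := by
    rw [← pullSub_tautTwo Fl P]; exact he.pull _
  have hb : IsBasis fun j => toFl (Fl := Fl) (e (lineEquiv j)) := he'.basis.reindex lineEquiv
  have h0 := graphVec_line hU (fun j => toFl (Fl := Fl) (e j)) fun _ => ![u, 0]
  simp only [Matrix.cons_val_zero, Matrix.cons_val_one, zero_smul, add_zero] at h0
  obtain ⟨z, hz, hz'⟩ := (adapted_graph Fl.hasRank_line (hb.res hU) (u := fun _ => ![u, 0])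
    (fun i => by rw [Subsingleton.elim i 0, h0, ← hℓ]; exact mem_arrow _)).exists_basis
  have hzℓ : z 0 = ℓ := app_injective_of_mono (Fl.taut 0).arrow U
    ((hz' 0).trans (h0.trans hℓ.symm))
  have := hz.reindex (Equiv.ofUnique Unit (Fin 1))
  have hc : (fun k : Unit => z (Equiv.ofUnique Unit (Fin 1) k)) = fun _ => ℓ := by
    funext k
    rw [← hzℓ]
    congr 1
  rwa [hc] at this

/-- The second basis vector generates the quotient of the plane by such a line. -/
theorem isBasis_projTwo {e : Fin 2 ⊕ Fin 1 → Γ((Scheme.Modules.pullback P.π).obj V, W)}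
    (he : Adapted (P.taut 0) e) (hU : U ≤ forgetFlag Fl P ⁻¹ᵁ W) {u : Γ(Fl.X, U)}
    {ℓ : Γ(lineOne Fl, U)} (hℓ : Hom.app (Fl.taut 0).arrow U ℓ =
      res hU (toFl (e (Sum.inl 0))) + u • res hU (toFl (e (Sum.inl 1))))
    {ε : Γ((Fl.taut 1 : Fl.X.Modules), U)}
    (hε : Hom.app (Fl.taut 1).arrow U ε = res hU (toFl (e (Sum.inl 1)))) :
    IsBasis fun _ : Unit => Hom.app (projTwo Fl) U ε := by
  have he' : Adapted (Fl.taut 1) fun j => toFl (Fl := Fl) (e j) := by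
    rw [← pullSub_tautTwo Fl P]; exact he.pull _
  obtain ⟨z, hz, hz'⟩ := (he'.res hU).exists_basis
  have hz1 : z 1 = ε := app_injective_of_mono (Fl.taut 1).arrow U ((hz' 1).trans hε.symm)
  have hb : IsBasis fun j : Fin 1 ⊕ Unit => z (Sum.elim (fun _ => 0) (fun _ => 1) j) :=
    hz.reindex ⟨Sum.elim (fun _ => 0) (fun _ => 1), ![Sum.inl 0, Sum.inr ()],
      by rintro (i | i) <;> simp [Subsingleton.elim i 0], by intro i; fin_cases i <;> rfl⟩
  have hg := hb.graph fun _ _ => u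
  have hgv : graphVec (n := 1) (fun j : Fin 1 ⊕ Unit => z (Sum.elim (fun _ => 0) (fun _ => 1) j))
      (fun _ _ => u) 0 = Hom.app (lineOneι Fl) U ℓ := by
    apply app_injective_of_mono (Fl.taut 1).arrow U
    refine Eq.trans ?_ (lineOneι_arrow ℓ).symm
    rw [hℓ, graphVec]
    simp only [Sum.elim_inl, Finset.univ_unique, Sum.elim_inr, Finset.sum_singleton, map_add,
      Hom.app_smul, hz']
  have hl := isBasis_line he hU hℓ
  have := isBasis_cokernel (φ := lineOneι Fl) hg (fun i => ⟨ℓ, by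
      rw [Subsingleton.elim i 0]
      exact hgv.symm⟩) (fun O h m k => by
    obtain ⟨a, ha⟩ := (hl O h).2 m
    rw [linComb_unit] at ha
    have h₁ := hg.coord_self h (Sum.inl 0)
    rw [Sum.elim_inl, hgv] at h₁
    have h₂ : m = a () • res (M := lineOne Fl) h ℓ := ha.symm
    have h₃ : Hom.app (lineOneι Fl) O m = a () • res h (Hom.app (lineOneι Fl) U ℓ) := by
      rw [h₂, ← app_res, Hom.app_smul]
    rw [h₃, LinearMap.map_smul, h₁]
    simp)
  simp only [Sum.elim_inr] at this
  rw [hz1] at this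
  exact this

end frameCharts

/-! ### The cocycle attached to a frame and a covering -/

section frames
variable {X : Scheme.{u}} {M : X.Modules} {W : X.Opens}

/-- The frame `(e₂, e₁)`. -/
def Frame.swap (φ : Frame M W) : Frame M W where
  e₁ := φ.e₂
  e₂ := φ.e₁
  x := φ.y
  y := φ.x
  x_e₁ := φ.y_e₂
  x_e₂ := φ.y_e₁
  y_e₁ := φ.x_e₂
  y_e₂ := φ.x_e₁
  span h m := (φ.span h m).trans (add_comm _ _)

theorem res_tmul_tpowSec {L₁ L₂ L₃ : X.Modules} {U : X.Opens} (h : U ≤ W) (a : Γ(L₁, W))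
    (b : Γ(L₂, W)) (c : Γ(L₃, W)) (m n k : ℕ) :
    FlagCohomology.res h (tmul (tpowSec a m) (tmul (tpowSec b n) (tpowSec c k))) =
      tmul (tpowSec (FlagCohomology.res h a) m) (tmul (tpowSec (FlagCohomology.res h b) n)
        (tpowSec (FlagCohomology.res h c) k)) := by
  rw [res_tmul, res_tpowSec, res_tmul, res_tpowSec, res_tpowSec]

theorem bijective_eval₂ {R T : Type u} [CommRing R] [CommRing T] (σ : R →+* T) (t : T)
    (h : Function.Bijective (MvPolynomial.eval₂Hom σ fun _ : PUnit.{u + 1} => t)) :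
    Function.Bijective (Polynomial.eval₂RingHom σ t) := by
  have : MvPolynomial.eval₂Hom σ (fun _ : PUnit.{u + 1} => t) =
      (Polynomial.eval₂RingHom σ t).comp (MvPolynomial.uniqueAlgEquiv R PUnit.{u + 1}).toRingHom := by
    refine MvPolynomial.ringHom_ext (fun r => ?_) fun i => ?_
    · simp
    · simp
  rw [this, RingHom.coe_comp] at h
  exact (Function.Bijective.of_comp_iff _ (MvPolynomial.uniqueAlgEquiv R PUnit.{u + 1}).bijective).1 h

end frames
section charts
variable {S : Scheme.{u}} {V : S.Modules} {Fl : FlagScheme V ![1, 2, 3]} {P : FlagScheme V ![2]}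
  {W W' : P.X.Opens} {U U' A B : Fl.X.Opens}

/-- The section `e₁ + u e₂`. -/
noncomputable def lineVec (φ : Frame (tautTwo P) W) (hU : U ≤ forgetFlag Fl P ⁻¹ᵁ W)
    (u : Γ(Fl.X, U)) : Γ((Scheme.Modules.pullback Fl.π).obj V, U) :=
  res hU (pullTaut Fl P φ.e₁) + u • res hU (pullTaut Fl P φ.e₂)

theorem res_lineVec (φ : Frame (tautTwo P) W) (hU : U ≤ forgetFlag Fl P ⁻¹ᵁ W) (h : U' ≤ U)
    (u : Γ(Fl.X, U)) : res h (lineVec φ hU u) = lineVec φ (h.trans hU) (resO h u) := by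
  rw [lineVec, lineVec, map_add, map_smulₛₗ, res_res, res_res]

theorem lineVec_res (φ : Frame (tautTwo P) W) (h : W' ≤ W) (hU : U ≤ forgetFlag Fl P ⁻¹ᵁ W')
    (u : Γ(Fl.X, U)) :
    lineVec (φ.res h) hU u = lineVec φ (hU.trans (Scheme.Hom.preimage_mono _ h)) u := by
  rw [lineVec, lineVec]
  simp only [Frame.res, pullTaut_res, res_res]

/-- Near every point, a frame is part of a local basis of `V`. -/
theorem exists_adapted_lineVec (hV : HasRank V 3) (φ : Frame (tautTwo P) W) {x : Fl.X}
    (hx : x ∈ forgetFlag Fl P ⁻¹ᵁ W) : ∃ (W' : P.X.Opens) (_ : W' ≤ W)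
      (e : Fin 2 ⊕ Fin 1 → Γ((Scheme.Modules.pullback P.π).obj V, W')),
      x ∈ forgetFlag Fl P ⁻¹ᵁ W' ∧ Adapted (P.taut 0) e ∧
      (∀ (U : Fl.X.Opens) (hU : U ≤ forgetFlag Fl P ⁻¹ᵁ W) (hU' : U ≤ forgetFlag Fl P ⁻¹ᵁ W')
        (u : Γ(Fl.X, U)), lineVec φ hU u =
          res hU' (toFl (e (Sum.inl 0))) + u • res hU' (toFl (e (Sum.inl 1)))) ∧
      (∀ (U : Fl.X.Opens) (hU : U ≤ forgetFlag Fl P ⁻¹ᵁ W) (hU' : U ≤ forgetFlag Fl P ⁻¹ᵁ W'),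
        res hU (pullTaut Fl P φ.e₁) = res hU' (toFl (e (Sum.inl 0))) ∧
        res hU (pullTaut Fl P φ.e₂) = res hU' (toFl (e (Sum.inl 1)))) := by
  obtain ⟨W', h, e, hx', -, he, h₁, h₂⟩ := exists_adapted_frame hV φ hx
  have key : ∀ (U : Fl.X.Opens) (hU : U ≤ forgetFlag Fl P ⁻¹ᵁ W)
      (hU' : U ≤ forgetFlag Fl P ⁻¹ᵁ W'),
        res hU (pullTaut Fl P φ.e₁) = res hU' (toFl (e (Sum.inl 0))) ∧
        res hU (pullTaut Fl P φ.e₂) = res hU' (toFl (e (Sum.inl 1))) := by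
    intro U hU hU'
    rw [h₁, h₂]
    have h₃ := congrArg (res hU') (pullTaut_res (Fl := Fl) h φ.e₁)
    have h₄ := congrArg (res hU') (pullTaut_res (Fl := Fl) h φ.e₂)
    rw [res_res] at h₃ h₄
    exact ⟨h₃.symm, h₄.symm⟩
  refine ⟨W', h, e, hx', he, fun U hU hU' u => ?_, key⟩
  rw [lineVec, (key U hU hU').1, (key U hU hU').2]

theorem isBasis_lineOne (hV : HasRank V 3) (φ : Frame (tautTwo P) W)
    (hU : U ≤ forgetFlag Fl P ⁻¹ᵁ W) {u : Γ(Fl.X, U)} {ℓ : Γ(lineOne Fl, U)}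
    (hℓ : Hom.app (Fl.taut 0).arrow U ℓ = lineVec φ hU u) : IsBasis fun _ : Unit => ℓ := by
  refine IsBasis.of_locally _ fun x hx => ?_
  obtain ⟨W', h, e, hx', he, hl, -⟩ := exists_adapted_lineVec hV φ (hU hx)
  refine ⟨U ⊓ forgetFlag Fl P ⁻¹ᵁ W', inf_le_left, ⟨hx, hx'⟩, ?_⟩
  refine isBasis_line he inf_le_right (u := resO inf_le_left u) ?_
  refine (app_res (Fl.taut 0).arrow _ _).trans ?_
  rw [hℓ, res_lineVec, hl]

theorem isBasis_lineTwo (hV : HasRank V 3) (φ : Frame (tautTwo P) W)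
    (hU : U ≤ forgetFlag Fl P ⁻¹ᵁ W) {u : Γ(Fl.X, U)} (hu : Mem (Fl.taut 0) (lineVec φ hU u))
    {ε : Γ((Fl.taut 1 : Fl.X.Modules), U)}
    (hε : Hom.app (Fl.taut 1).arrow U ε = res hU (pullTaut Fl P φ.e₂)) :
    IsBasis fun _ : Unit => Hom.app (projTwo Fl) U ε := by
  obtain ⟨ℓ, hℓ⟩ := hu
  refine IsBasis.of_locally _ fun x hx => ?_
  obtain ⟨W', h, e, hx', he, hl, hl'⟩ := exists_adapted_lineVec hV φ (hU hx)
  refine ⟨U ⊓ forgetFlag Fl P ⁻¹ᵁ W', inf_le_left, ⟨hx, hx'⟩, ?_⟩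
  simp only [← app_res]
  refine isBasis_projTwo he inf_le_right (u := resO inf_le_left u) (ℓ := res inf_le_left ℓ) ?_ ?_
  · refine (app_res (Fl.taut 0).arrow _ _).trans ?_
    rw [hℓ, res_lineVec, hl]
  · rw [app_res, hε, res_res, (hl' _ _ inf_le_right).2]

theorem lineVec_unique (hV : HasRank V 3) (φ : Frame (tautTwo P) W)
    (hU : U ≤ forgetFlag Fl P ⁻¹ᵁ W) {u u' : Γ(Fl.X, U)} (hu : Mem (Fl.taut 0) (lineVec φ hU u))
    (hu' : Mem (Fl.taut 0) (lineVec φ hU u')) : u = u' := by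
  refine resO_eq_of_locally fun x hx => ?_
  obtain ⟨W', h, e, hx', he, hl, -⟩ := exists_adapted_lineVec hV φ (hU hx)
  have hU' : U ⊓ forgetFlag Fl P ⁻¹ᵁ W' ≤ forgetFlag Fl P ⁻¹ᵁ W' := inf_le_right
  refine ⟨U ⊓ forgetFlag Fl P ⁻¹ᵁ W', inf_le_left, ⟨hx, hx'⟩, ?_⟩
  have he' : Adapted (Fl.taut 1) fun j => toFl (Fl := Fl) (e j) := by
    rw [← pullSub_tautTwo Fl P]; exact he.pull _
  have hb : IsBasis fun j => toFl (Fl := Fl) (e (lineEquiv j)) := he'.basis.reindex lineEquiv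
  have key : ∀ v : Γ(Fl.X, U), Mem (Fl.taut 0) (lineVec φ hU v) →
      ∀ i : Fin 1, Mem (Fl.taut 0) (graphVec (fun j => res hU' (toFl (Fl := Fl) (e (lineEquiv j))))
        (fun _ => ![resO inf_le_left v, 0]) i) := by
    intro v hv i
    have h0 := graphVec_line hU' (fun j => toFl (Fl := Fl) (e j))
      fun _ => ![resO inf_le_left v, 0]
    simp only [Matrix.cons_val_zero, Matrix.cons_val_one, zero_smul, add_zero] at h0
    rw [Subsingleton.elim i 0, h0]
    have := hv.res (inf_le_left : U ⊓ forgetFlag Fl P ⁻¹ᵁ W' ≤ U)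
    rwa [res_lineVec, hl _ _ hU'] at this
  have := graph_unique Fl.hasRank_line (hb.res hU') (key u hu) (key u' hu')
  exact congrFun (congrFun this 0) 0

theorem mul_eq_one_of_lineVec (hV : HasRank V 3) (φ : Frame (tautTwo P) W)
    (hU : U ≤ forgetFlag Fl P ⁻¹ᵁ W) {u w : Γ(Fl.X, U)} (hu : Mem (Fl.taut 0) (lineVec φ hU u))
    (hw : Mem (Fl.taut 0) (lineVec φ.swap hU w)) : w * u = 1 := by
  refine resO_eq_of_locally fun x hx => ?_
  obtain ⟨W', h, e, hx', he, hl, hl'⟩ := exists_adapted_lineVec hV φ (hU hx)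
  have hU' : U ⊓ forgetFlag Fl P ⁻¹ᵁ W' ≤ forgetFlag Fl P ⁻¹ᵁ W' := inf_le_right
  refine ⟨U ⊓ forgetFlag Fl P ⁻¹ᵁ W', inf_le_left, ⟨hx, hx'⟩, ?_⟩
  rw [map_mul, map_one]
  have h₁ := hu.res (inf_le_left : U ⊓ forgetFlag Fl P ⁻¹ᵁ W' ≤ U)
  have h₂ := hw.res (inf_le_left : U ⊓ forgetFlag Fl P ⁻¹ᵁ W' ≤ U)
  rw [res_lineVec, hl _ _ hU'] at h₁
  rw [res_lineVec, lineVec, add_comm] at h₂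
  refine mul_eq_one_of_line he hU' h₁ ?_
  have h₃ := hl' _ (inf_le_left.trans hU) hU'
  rw [← h₃.1, ← h₃.2]
  exact h₂

/-- The data of a chart, given the two charts of the projective line bundle. -/
theorem exists_lam (hV : HasRank V 3) (φ : Frame (tautTwo P) W)
    (hU : U ≤ forgetFlag Fl P ⁻¹ᵁ W) {u : Γ(Fl.X, U)} (hu : Mem (Fl.taut 0) (lineVec φ hU u)) :
    ∃ (ε : Γ((Fl.taut 1 : Fl.X.Modules), U)) (lam : Γ(dual (lineTwo Fl), U)),
      Hom.app (Fl.taut 1).arrow U ε = res hU (pullTaut Fl P φ.e₂) ∧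
      ev lam (Hom.app (projTwo Fl) U ε) = 1 := by
  obtain ⟨ε, hε⟩ := (mem_pullTaut (Fl := Fl) φ.e₂).res hU
  exact ⟨ε, _, hε, (isBasis_lineTwo hV φ hU hu hε).ev_form_self (fun _ => 1) ()⟩

/-- The chart attached to a covering by two open sets over which the line is a graph. -/
noncomputable def mkChart (hV : HasRank V 3) (φ : Frame (tautTwo P) W)
    (hAB : A ⊔ B = forgetFlag Fl P ⁻¹ᵁ W) (u : Γ(Fl.X, A)) (w : Γ(Fl.X, B))
    (hu : Mem (Fl.taut 0) (lineVec φ (hAB ▸ le_sup_left) u))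
    (hw : Mem (Fl.taut 0) (lineVec φ.swap (hAB ▸ le_sup_right) w)) : FrameChart Fl P φ where
  A := A
  B := B
  cover := hAB
  u := u
  w := w
  ℓA := hu.choose
  ℓB := hw.choose
  ε := (exists_lam hV φ _ hu).choose
  lam := (exists_lam hV φ _ hu).choose_spec.choose
  ℓA_eq := hu.choose_spec
  ℓB_eq := hw.choose_spec.trans (add_comm _ _)
  ε_eq := (exists_lam hV φ _ hu).choose_spec.choose_spec.1
  lam_ε := (exists_lam hV φ _ hu).choose_spec.choose_spec.2

namespace FrameChart
variable {φ : Frame (tautTwo P) W} (c : FrameChart Fl P φ)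

theorem le_A : c.A ≤ forgetFlag Fl P ⁻¹ᵁ W := c.cover ▸ le_sup_left
theorem le_B : c.B ≤ forgetFlag Fl P ⁻¹ᵁ W := c.cover ▸ le_sup_right

theorem mem_A : Mem (Fl.taut 0) (lineVec φ c.le_A c.u) := ⟨c.ℓA, c.ℓA_eq⟩
theorem mem_B : Mem (Fl.taut 0) (lineVec φ.swap c.le_B c.w) :=
  ⟨c.ℓB, c.ℓB_eq.trans (add_comm _ _)⟩

theorem isBasis_ℓA (hV : HasRank V 3) : IsBasis fun _ : Unit => c.ℓA :=
  isBasis_lineOne hV φ c.le_A c.ℓA_eq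

theorem isBasis_ε (hV : HasRank V 3) : IsBasis fun _ : Unit => Hom.app (projTwo Fl) c.A c.ε :=
  isBasis_lineTwo hV φ c.le_A c.mem_A c.ε_eq

theorem isBasis_lam (hV : HasRank V 3) : IsBasis fun _ : Unit => c.lam :=
  (c.isBasis_ε hV).dual fun _ _ => c.lam_ε

theorem w_mul_u (hV : HasRank V 3) :
    resO (inf_le_right : c.A ⊓ c.B ≤ c.B) c.w * resO inf_le_left c.u = 1 := by
  have h₁ := c.mem_A.res (inf_le_left : c.A ⊓ c.B ≤ c.A)
  have h₂ := c.mem_B.res (inf_le_right : c.A ⊓ c.B ≤ c.B)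
  rw [res_lineVec] at h₁ h₂
  exact mul_eq_one_of_lineVec hV φ _ h₁ h₂

/-- The chart for the frame `(e₂, e₁)`. -/
noncomputable def swap (hV : HasRank V 3) : FrameChart Fl P φ.swap :=
  mkChart hV φ.swap ((sup_comm _ _).trans c.cover) c.w c.u c.mem_B c.mem_A

/-- The generator `ℓA ^ m ⊗ lam ^ n` of `𝒪(m, -n, 0)` over `A`. -/
noncomputable def gen (m n : ℕ) : Γ(flagLine Fl m n 0, c.A) :=
  tmul (tpowSec c.ℓA m) (tmul (tpowSec c.lam n) (tpowSec (0 : Γ(lineThree Fl, c.A)) 0))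

theorem isBasis_gen (hV : HasRank V 3) (m n : ℕ) : IsBasis fun _ : Unit => c.gen m n := by
  have h₀ : IsBasis fun _ : Unit => tpowSec (0 : Γ(lineThree Fl, c.A)) 0 := isBasis_one
  exact ((c.isBasis_ℓA hV).tpow m).tmul (((c.isBasis_lam hV).tpow n).tmul h₀)

/-- The coefficient of the cocycle. -/
noncomputable def coeff (b : ℕ) (γ : Γ(divPow (tautTwo P) (2 * b), W)) : Γ(Fl.X, c.A ⊓ c.B) :=
  ∑ j ∈ Finset.range (2 * b + 1),
    resO c.inf_le ((forgetFlag Fl P).app W (ev γ (φ.monomial (2 * b) j))) *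
      resO inf_le_right c.w ^ (j + 1)

theorem cocycle_eq (b : ℕ) (γ : Γ(divPow (tautTwo P) (2 * b), W)) :
    c.cocycle b γ = c.coeff b γ • res inf_le_left (c.gen (b + 1) (b + 1)) := by
  rw [cocycle, coeff, gen]
  congr 1
  have h := res_tmul_tpowSec (inf_le_left : c.A ⊓ c.B ≤ c.A) c.ℓA c.lam
    (0 : Γ(lineThree Fl, c.A)) (b + 1) (b + 1) 0
  rw [map_zero] at h
  exact h.symm

end FrameChart

/-- The canonical sections attached to a chart are compatible with restriction. -/
theorem FrameChart.res_gen (hV : HasRank V 3) {φ : Frame (tautTwo P) W} (c : FrameChart Fl P φ)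
    {h : W' ≤ W} (c' : FrameChart Fl P (φ.res h)) (hA : c'.A ≤ c.A) (m n : ℕ) :
    c'.gen m n = res hA (c.gen m n) := by
  have hu : c'.u = resO hA c.u := by
    refine lineVec_unique hV φ (c'.le_A.trans (Scheme.Hom.preimage_mono _ h)) ?_ ?_
    · rw [← lineVec_res φ h c'.le_A]
      exact c'.mem_A
    · rw [← res_lineVec φ c.le_A hA]
      exact c.mem_A.res hA
  have hℓ : c'.ℓA = res hA c.ℓA := by
    refine app_injective_of_mono (Fl.taut 0).arrow _ ?_
    have h₁ : Hom.app (Fl.taut 0).arrow c'.A c'.ℓA = lineVec (φ.res h) c'.le_A c'.u := c'.ℓA_eq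
    have h₂ : Hom.app (Fl.taut 0).arrow c.A c.ℓA = lineVec φ c.le_A c.u := c.ℓA_eq
    refine h₁.trans (Eq.trans ?_ (app_res (Fl.taut 0).arrow hA c.ℓA).symm)
    rw [h₂, res_lineVec, lineVec_res, hu]
  have hε : c'.ε = res hA c.ε := by
    refine app_injective_of_mono (Fl.taut 1).arrow _ ?_
    refine c'.ε_eq.trans (Eq.trans ?_ (app_res (Fl.taut 1).arrow hA c.ε).symm)
    rw [c.ε_eq]
    simp only [Frame.res, pullTaut_res, res_res]
  have hlam : c'.lam = res hA c.lam := by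
    refine (c'.isBasis_ε hV).dual_ext le_rfl fun _ => ?_
    simp only [res_refl]
    rw [c'.lam_ε, hε, app_res, ← resO_ev, c.lam_ε, map_one]
  have h₀ := res_tmul_tpowSec hA c.ℓA c.lam (0 : Γ(lineThree Fl, c.A)) m n 0
  rw [map_zero, ← hℓ, ← hlam] at h₀
  exact h₀.symm

end charts

/-! ### The class attached to a frame -/

section charts
variable {S : Scheme.{u}} {V : S.Modules} {Fl : FlagScheme V ![1, 2, 3]} {P : FlagScheme V ![2]}
  {W W' : P.X.Opens}

namespace FrameChart

theorem coeff_res (hV : HasRank V 3) {φ : Frame (tautTwo P) W} (c : FrameChart Fl P φ)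
    {h : W' ≤ W} (c' : FrameChart Fl P (φ.res h)) (hA : c'.A ≤ c.A) (hB : c'.B ≤ c.B) (b : ℕ)
    (γ : Γ(divPow (tautTwo P) (2 * b), W)) :
    c'.coeff b (res (M := divPow (tautTwo P) (2 * b)) h γ) =
      resO (inf_le_inf hA hB) (c.coeff b γ) := by
  have hw : c'.w = resO hB c.w := by
    refine lineVec_unique hV φ.swap (c'.le_B.trans (Scheme.Hom.preimage_mono _ h)) ?_ ?_
    · have : Mem (Fl.taut 0) (lineVec (φ.swap.res h) c'.le_B c'.w) := c'.mem_B
      rwa [lineVec_res φ.swap h c'.le_B] at this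
    · rw [← res_lineVec φ.swap c.le_B hB]
      exact c.mem_B.res hB
  rw [coeff, coeff, map_sum]
  refine Finset.sum_congr rfl fun j _ => ?_
  rw [map_mul, map_pow, resO_resO, resO_resO, ← φ.resO_ev_monomial h, hw, resO_resO, ← resO_app h,
    resO_resO]

theorem cocycle_res (hV : HasRank V 3) {φ : Frame (tautTwo P) W} (c : FrameChart Fl P φ)
    {h : W' ≤ W} {ψ : Frame (tautTwo P) W'} (hψ : ψ = φ.res h) (c' : FrameChart Fl P ψ)
    (hA : c'.A ≤ c.A) (hB : c'.B ≤ c.B) (b : ℕ) (γ : Γ(divPow (tautTwo P) (2 * b), W)) :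
    c'.cocycle b (res (M := divPow (tautTwo P) (2 * b)) h γ) =
      res (inf_le_inf hA hB) (c.cocycle b γ) := by
  subst hψ
  rw [cocycle_eq, cocycle_eq, map_smulₛₗ, c.coeff_res hV c' hA hB, c.res_gen hV c' hA, res_res,
    res_res]

/-- Restriction of a chart. -/
noncomputable def restrict (hV : HasRank V 3) {φ : Frame (tautTwo P) W} (c : FrameChart Fl P φ)
    (h : W' ≤ W) {ψ : Frame (tautTwo P) W'} (hψ : ψ = φ.res h) : FrameChart Fl P ψ :=
  mkChart hV ψ (A := c.A ⊓ forgetFlag Fl P ⁻¹ᵁ W') (B := c.B ⊓ forgetFlag Fl P ⁻¹ᵁ W')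
    (by
      rw [← inf_sup_right, c.cover]
      exact inf_eq_right.2 (Scheme.Hom.preimage_mono _ h))
    (resO inf_le_left c.u) (resO inf_le_left c.w)
    (by
      subst hψ
      rw [lineVec_res, ← res_lineVec φ c.le_A]
      exact c.mem_A.res _)
    (by
      subst hψ
      change Mem _ (lineVec (φ.swap.res h) _ _)
      rw [lineVec_res, ← res_lineVec φ.swap c.le_B]
      exact c.mem_B.res _)

/-- A chart is full if its two members are as large as possible. -/
structure Full {φ : Frame (tautTwo P) W} (c : FrameChart Fl P φ) : Prop where
  le_left (U : Fl.X.Opens) (hU : U ≤ forgetFlag Fl P ⁻¹ᵁ W) (u : Γ(Fl.X, U)) :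
    Mem (Fl.taut 0) (lineVec φ hU u) → U ≤ c.A
  le_right (U : Fl.X.Opens) (hU : U ≤ forgetFlag Fl P ⁻¹ᵁ W) (w : Γ(Fl.X, U)) :
    Mem (Fl.taut 0) (lineVec φ.swap hU w) → U ≤ c.B

/-- Over a full chart `A ∩ B` is the locus in `A` where `u` is invertible. -/
theorem Full.inf_eq (hV : HasRank V 3) {φ : Frame (tautTwo P) W} {c : FrameChart Fl P φ}
    (hc : c.Full) : c.A ⊓ c.B = Fl.X.basicOpen c.u := by
  refine le_antisymm ?_ (le_inf (Fl.X.basicOpen_le _) ?_)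
  · have h₁ : IsUnit (resO (inf_le_left : c.A ⊓ c.B ≤ c.A) c.u) :=
      IsUnit.of_mul_eq_one _ ((mul_comm _ _).trans (c.w_mul_u hV))
    have h₂ := Scheme.basicOpen_of_isUnit Fl.X h₁
    have h₃ : Fl.X.basicOpen (resO (inf_le_left : c.A ⊓ c.B ≤ c.A) c.u) =
        (c.A ⊓ c.B) ⊓ Fl.X.basicOpen c.u :=
      Fl.X.basicOpen_res c.u (homOfLE (inf_le_left : c.A ⊓ c.B ≤ c.A)).op
    rw [h₂] at h₃
    exact h₃.le.trans inf_le_right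
  · have hle := Fl.X.basicOpen_le c.u
    obtain ⟨r, hr⟩ := isUnit_iff_exists_inv'.1 (isUnit_resO_basicOpen c.u)
    refine hc.le_right _ (hle.trans c.le_A) r ?_
    have h₁ := (c.mem_A.res hle).smul r
    rw [res_lineVec, lineVec, smul_add, smul_smul, hr, one_smul, add_comm] at h₁
    exact h₁

end FrameChart

/-- Every frame has, near every point, a full chart; its two members are affine, with rings of
functions polynomial over the ring of functions of the base. -/
theorem exists_full_chart (hV : HasRank V 3) (φ : Frame (tautTwo P) W) {x : P.X} (hx : x ∈ W) :
    ∃ (W' : P.X.Opens) (h : W' ≤ W) (c : FrameChart Fl P (φ.res h)), x ∈ W' ∧ c.Full ∧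
      IsAffineOpen c.A ∧ IsAffineOpen c.B ∧
      Function.Bijective (Polynomial.eval₂RingHom
        ((resO c.le_A).comp ((forgetFlag Fl P).app W').hom) c.u) ∧
      Function.Bijective (Polynomial.eval₂RingHom
        ((resO c.le_B).comp ((forgetFlag Fl P).app W').hom) c.w) := by
  obtain ⟨W', h, e, hx', hW', he, h₁, h₂⟩ := exists_adapted_frame hV φ hx
  have he' := he.reindex (Equiv.swap 0 1) (Equiv.refl (Fin 1))
  obtain ⟨A, hA, u, hu, hAmax, hAaff, hAbij⟩ := exists_line_chart Fl hV hW' he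
  obtain ⟨B, hB, w, hw, hBmax, hBaff, hBbij⟩ := exists_line_chart Fl hV hW' he'
  have hcover : A ⊔ B = forgetFlag Fl P ⁻¹ᵁ W' := by
    refine le_antisymm (sup_le hA hB) fun y hy => ?_
    refine mem_or_mem_of_line he hAmax (fun U hU u' hu' => hBmax U hU u' ?_) hy
    rw [add_comm] at hu'
    exact hu'
  have e₁ : ∀ (U : Fl.X.Opens) (hU : U ≤ forgetFlag Fl P ⁻¹ᵁ W') (u : Γ(Fl.X, U)),
      lineVec (φ.res h) hU u =
        res hU (toFl (e (Sum.inl 0))) + u • res hU (toFl (e (Sum.inl 1))) := fun U hU u => by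
    rw [h₁, h₂]
    rfl
  have e₂ : ∀ (U : Fl.X.Opens) (hU : U ≤ forgetFlag Fl P ⁻¹ᵁ W') (u : Γ(Fl.X, U)),
      lineVec (φ.res h).swap hU u =
        res hU (toFl (e (Sum.inl 1))) + u • res hU (toFl (e (Sum.inl 0))) := fun U hU u => by
    rw [h₁, h₂]
    rfl
  refine ⟨W', h, mkChart hV _ hcover u w (by rw [e₁]; exact hu) (by rw [e₂]; exact hw), hx',
    ⟨fun U hU u hu => hAmax U hU u (by rw [← e₁]; exact hu),
      fun U hU w hw => hBmax U hU w (by rw [e₂] at hw; exact hw)⟩, hAaff, hBaff,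
    bijective_eval₂ _ _ hAbij, bijective_eval₂ _ _ hBbij⟩

namespace FrameChart

theorem Full.le_A {φ : Frame (tautTwo P) W} {c₀ : FrameChart Fl P φ} (h₀ : c₀.Full)
    (c : FrameChart Fl P φ) : c.A ≤ c₀.A := h₀.le_left _ c.le_A _ c.mem_A

theorem Full.le_B {φ : Frame (tautTwo P) W} {c₀ : FrameChart Fl P φ} (h₀ : c₀.Full)
    (c : FrameChart Fl P φ) : c.B ≤ c₀.B := h₀.le_right _ c.le_B _ c.mem_B

theorem isCechClass_restrict (hV : HasRank V 3) {φ : Frame (tautTwo P) W} (c : FrameChart Fl P φ)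
    (h : W' ≤ W) {ψ : Frame (tautTwo P) W'} (hψ : ψ = φ.res h) (c' : FrameChart Fl P ψ)
    (hA : c'.A ≤ c.A) (hB : c'.B ≤ c.B) {b : ℕ} {γ : Γ(divPow (tautTwo P) (2 * b), W)}
    {ξ : Γ((R1 (forgetFlag Fl P)).obj (flagLine Fl (b + 1) (b + 1) 0), W)}
    (hξ : IsCechClass (forgetFlag Fl P) c.cover (c.cocycle b γ) ξ) :
    IsCechClass (forgetFlag Fl P) c'.cover
      (c'.cocycle b (FlagCohomology.res (M := divPow (tautTwo P) (2 * b)) h γ))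
      (FlagCohomology.res h ξ) := by
  rw [c.cocycle_res hV hψ c' hA hB]
  exact hξ.res h hA hB c'.cover

/-- The class does not depend on the chart. -/
theorem isCechClass_unique (hV : HasRank V 3) {φ : Frame (tautTwo P) W} (c c' : FrameChart Fl P φ)
    {b : ℕ} {γ : Γ(divPow (tautTwo P) (2 * b), W)}
    {ξ ξ' : Γ((R1 (forgetFlag Fl P)).obj (flagLine Fl (b + 1) (b + 1) 0), W)}
    (hξ : IsCechClass (forgetFlag Fl P) c.cover (c.cocycle b γ) ξ)
    (hξ' : IsCechClass (forgetFlag Fl P) c'.cover (c'.cocycle b γ) ξ') : ξ = ξ' := by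
  refine eq_of_locally fun x hx => ?_
  obtain ⟨W₁, h, c₀, hx₁, h₀, -⟩ := exists_full_chart (Fl := Fl) hV φ hx
  refine ⟨W₁, h, hx₁, ?_⟩
  obtain ⟨ξ₀, hξ₀⟩ := exists_isCechClass (f := forgetFlag Fl P) c₀.cover
    (c₀.cocycle b (FlagCohomology.res (M := divPow (tautTwo P) (2 * b)) h γ))
  have key : ∀ (c : FrameChart Fl P φ)
      (ξ : Γ((R1 (forgetFlag Fl P)).obj (flagLine Fl (b + 1) (b + 1) 0), W)),
      IsCechClass (forgetFlag Fl P) c.cover (c.cocycle b γ) ξ → FlagCohomology.res h ξ = ξ₀ := by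
    intro c ξ hξ
    let c₁ : FrameChart Fl P (φ.res h) := c.restrict hV h rfl
    have h₁ := c.isCechClass_restrict hV h rfl c₁ inf_le_left inf_le_left hξ
    have h₂ := c₀.isCechClass_restrict hV le_rfl (Frame.res_refl _).symm c₁ (h₀.le_A c₁)
      (h₀.le_B c₁) hξ₀
    rw [FlagCohomology.res_refl, FlagCohomology.res_refl] at h₂
    exact h₁.unique h₂
  rw [key c ξ hξ, key c' ξ' hξ']

end FrameChart

/-- `ξ` is the class attached to the section `s` of `Γ^(2b)(𝒱₂) ⊗ det^(-b)(𝒱₂)` by means of the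
frame `φ`. -/
def FrameClass (Fl : FlagScheme V ![1, 2, 3]) (φ : Frame (tautTwo P) W) (b : ℕ)
    (s : Γ(gammaDet P (2 * b) b, W))
    (ξ : Γ((R1 (forgetFlag Fl P)).obj (flagLine Fl (b + 1) (b + 1) 0), W)) : Prop :=
  ∀ (W' : P.X.Opens) (h : W' ≤ W) (d : Γ(dual (extPow (tautTwo P) 2), W')),
    ev d (wedge ![(φ.res h).e₁, (φ.res h).e₂]) = 1 →
    ∀ γ : Γ(divPow (tautTwo P) (2 * b), W'), tmul γ (tpowSec d b) = res h s →
    ∀ c : FrameChart Fl P (φ.res h),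
      IsCechClass (forgetFlag Fl P) c.cover (c.cocycle b γ) (res h ξ)

theorem res_tmul_tpowSec_det {X : Scheme.{u}} {N L : X.Modules} {U U' : X.Opens} (h : U' ≤ U)
    (γ : Γ(N, U)) (d : Γ(dual L, U)) (b : ℕ) :
    res (M := tensor N (negPow L b)) h (tmul (N := negPow L b) γ (tpowSec d b)) =
      tmul (N := negPow L b) (res h γ) (tpowSec (res h d) b) :=
  (res_tmul h γ (tpowSec d b)).trans (by rw [res_tpowSec]; rfl)

variable {φ : Frame (tautTwo P) W} {b : ℕ} {s : Γ(gammaDet P (2 * b) b, W)}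
  {ξ : Γ((R1 (forgetFlag Fl P)).obj (flagLine Fl (b + 1) (b + 1) 0), W)}

/-- The class can be computed on a single chart. -/
theorem FrameClass.of_chart (hV : HasRank V 3) {d : Γ(dual (extPow (tautTwo P) 2), W)}
    (hd : ev d (wedge ![φ.e₁, φ.e₂]) = 1) {γ : Γ(divPow (tautTwo P) (2 * b), W)}
    (hs : tmul γ (tpowSec d b) = s) (c : FrameChart Fl P φ)
    (h : IsCechClass (forgetFlag Fl P) c.cover (c.cocycle b γ) ξ) : FrameClass Fl φ b s ξ := by
  intro W' hW d' hd' γ' hs' c'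
  have hdd : d' = res hW d := (φ.res hW).det_unique hd' (φ.res_det hW hd)
  have hγ : γ' = res (M := divPow (tautTwo P) (2 * b)) hW γ := by
    refine ((φ.res hW).bijective_tmul hd' (2 * b) b).1 (hs'.trans ?_)
    rw [← hs, hdd]
    exact res_tmul_tpowSec_det hW γ d b
  obtain ⟨ξ', hξ'⟩ := exists_isCechClass (f := forgetFlag Fl P) c'.cover (c'.cocycle b γ')
  let c₁ : FrameChart Fl P (φ.res hW) := c.restrict hV hW rfl
  have h₁ := c.isCechClass_restrict hV hW rfl c₁ inf_le_left inf_le_left h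
  rw [← hγ] at h₁
  rwa [c₁.isCechClass_unique hV c' h₁ hξ']

theorem FrameClass.res (h : FrameClass Fl φ b s ξ) (hW : W' ≤ W) :
    FrameClass Fl (φ.res hW) b (FlagCohomology.res hW s) (FlagCohomology.res hW ξ) := by
  intro W₁ h₁ d hd γ hs c
  rw [FlagCohomology.res_res] at hs ⊢
  have key : ∀ ψ : Frame (tautTwo P) W₁, ψ = φ.res (h₁.trans hW) →
      ev d (wedge ![ψ.e₁, ψ.e₂]) = 1 → ∀ c : FrameChart Fl P ψ,
      IsCechClass (forgetFlag Fl P) c.cover (c.cocycle b γ)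
        (FlagCohomology.res (h₁.trans hW) ξ) := by
    rintro ψ rfl hd c
    exact h W₁ _ d hd γ hs c
  exact key _ (φ.res_res hW h₁) hd c

/-- The compatibility of a class with a frame is a local condition on the base. -/
theorem FrameClass.of_locally (hV : HasRank V 3) (H : ∀ x ∈ W, ∃ (W' : P.X.Opens) (h : W' ≤ W),
    x ∈ W' ∧ FrameClass Fl (φ.res h) b (FlagCohomology.res h s) (FlagCohomology.res h ξ)) :
    FrameClass Fl φ b s ξ := by
  intro W₁ h₁ d hd γ hs c
  obtain ⟨ξ', hξ'⟩ := exists_isCechClass (f := forgetFlag Fl P) c.cover (c.cocycle b γ)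
  suffices h : FlagCohomology.res h₁ ξ = ξ' by rwa [h]
  refine eq_of_locally fun x hx => ?_
  obtain ⟨W₂, h₂, hx₂, hc⟩ := H x (h₁ hx)
  let O := W₁ ⊓ W₂
  have hO₁ : O ≤ W₁ := inf_le_left
  have hO₂ : O ≤ W₂ := inf_le_right
  refine ⟨O, hO₁, ⟨hx, hx₂⟩, ?_⟩
  have hψ : (φ.res h₂).res hO₂ = (φ.res h₁).res hO₁ := by rw [Frame.res_res, Frame.res_res]
  let c₁ : FrameChart Fl P ((φ.res h₂).res hO₂) := c.restrict hV hO₁ hψ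
  have k₁ := c.isCechClass_restrict hV hO₁ hψ c₁ inf_le_left inf_le_left hξ'
  have k₂ := hc O hO₂ (FlagCohomology.res hO₁ d) (by
      rw [hψ]
      exact (φ.res h₁).res_det hO₁ hd) (FlagCohomology.res (M := divPow (tautTwo P) (2 * b)) hO₁ γ) (by
      rw [FlagCohomology.res_res]
      refine (res_tmul_tpowSec_det hO₁ γ d b).symm.trans ?_
      rw [← FlagCohomology.res_res hO₁ h₁, ← hs]
      rfl) c₁
  rw [FlagCohomology.res_res] at k₂ ⊢
  exact k₂.unique k₁

theorem FrameClass.exists_of_point (hV : HasRank V 3) (φ : Frame (tautTwo P) W) (b : ℕ)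
    (s : Γ(gammaDet P (2 * b) b, W)) {x : P.X} (hx : x ∈ W) :
    ∃ (W' : P.X.Opens) (h : W' ≤ W) (ξ : Γ((R1 (forgetFlag Fl P)).obj
      (flagLine Fl (b + 1) (b + 1) 0), W')), x ∈ W' ∧
        FrameClass Fl (φ.res h) b (FlagCohomology.res h s) ξ := by
  obtain ⟨W', h, c, hx', -⟩ := exists_full_chart (Fl := Fl) hV φ hx
  obtain ⟨d, hd⟩ := (φ.res h).exists_det
  obtain ⟨γ, hγ⟩ := ((φ.res h).bijective_tmul hd (2 * b) b).2 (FlagCohomology.res h s)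
  obtain ⟨ξ, hξ⟩ := exists_isCechClass (f := forgetFlag Fl P) c.cover (c.cocycle b γ)
  exact ⟨W', h, ξ, hx', FrameClass.of_chart hV hd hγ c hξ⟩

end charts

/-! ### Change of frame -/

section changeOfFrame
variable {X : Scheme.{u}} {M N L : X.Modules} {U V W : X.Opens}

/-- The frame `(e₁, β (e₂ + κ e₁))`, for a unit `β` with inverse `β'`. -/
noncomputable def Frame.shear (φ : Frame M W) (κ : Γ(X, W)) {β β' : Γ(X, W)} (h : β * β' = 1) :
    Frame M W where
  e₁ := φ.e₁
  e₂ := β • (φ.e₂ + κ • φ.e₁)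
  x := φ.x + (-κ) • φ.y
  y := β' • φ.y
  x_e₁ := by rw [add_ev, smul_ev, φ.x_e₁, φ.y_e₁]; ring
  x_e₂ := by
    rw [add_ev, smul_ev, ev_smul, ev_smul, ev_add, ev_add, ev_smul, ev_smul, φ.x_e₁, φ.y_e₁,
      φ.x_e₂, φ.y_e₂]
    ring
  y_e₁ := by rw [smul_ev, φ.y_e₁, mul_zero]
  y_e₂ := by
    rw [smul_ev, ev_smul, ev_add, ev_smul, φ.y_e₁, φ.y_e₂]
    linear_combination h
  span {U} hU m := by
    have h' := congrArg (resO hU) h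
    rw [map_mul, map_one] at h'
    have hm := φ.span hU m
    simp only [map_add, map_smulₛₗ, map_neg, add_ev, smul_ev, smul_add, smul_smul]
    set a := ev (FlagCohomology.res hU φ.x) m
    set b := ev (FlagCohomology.res hU φ.y) m
    have e₁ : resO hU β' * b * resO hU β = b := by linear_combination b * h'
    have e₂ : resO hU β' * b * resO hU (β * κ) = b * resO hU κ := by
      rw [map_mul]
      linear_combination b * resO hU κ * h'
    rw [e₁, e₂]
    conv_lhs => rw [hm]
    module

theorem Frame.res_shear (φ : Frame M W) (κ : Γ(X, W)) {β β' : Γ(X, W)} (h : β * β' = 1)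
    (hU : U ≤ W) : (φ.shear κ h).res hU = (φ.res hU).shear (resO hU κ)
      (show resO hU β * resO hU β' = 1 by rw [← map_mul, h, map_one]) := by
  refine Frame.ext_of_eq rfl ?_
  change FlagCohomology.res hU (β • (φ.e₂ + κ • φ.e₁)) = resO hU β • (_ + resO hU κ • _)
  rw [map_smulₛₗ, map_add, map_smulₛₗ]
  rfl

theorem Frame.e₁_eq (φ ψ : Frame M W) : ψ.e₁ = ev φ.x ψ.e₁ • φ.e₁ + ev φ.y ψ.e₁ • φ.e₂ := by
  have := φ.span le_rfl ψ.e₁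
  rwa [FlagCohomology.res_refl, FlagCohomology.res_refl, FlagCohomology.res_refl,
    FlagCohomology.res_refl] at this

/-- Locally, any two frames are connected by exchanges of the two vectors and by shears: a relation
between frames which is local, transitive and contains these holds between any two frames. -/
theorem Frame.rel_of_swap_shear (R : ∀ {U : X.Opens}, Frame M U → Frame M U → Prop)
    (hloc : ∀ {U : X.Opens} (φ ψ : Frame M U), (∀ x ∈ U, ∃ (V : X.Opens) (h : V ≤ U), x ∈ V ∧
      R (φ.res h) (ψ.res h)) → R φ ψ)
    (htrans : ∀ {U : X.Opens} {φ ψ χ : Frame M U}, R φ ψ → R ψ χ → R φ χ)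
    (hswap : ∀ {U : X.Opens} (φ : Frame M U), R φ φ.swap)
    (hshear : ∀ {U : X.Opens} (φ : Frame M U) (κ : Γ(X, U)) {β β' : Γ(X, U)} (h : β * β' = 1),
      R φ (φ.shear κ h)) (φ ψ : Frame M W) : R φ ψ := by
  have key : ∀ {U : X.Opens} (φ ψ : Frame M U), IsUnit (ev φ.y ψ.e₁) → R φ ψ := by
    intro U φ ψ hq
    obtain ⟨q', hq'⟩ := hq.exists_right_inv
    set q := ev φ.y ψ.e₁ with hqdef
    set p := ev φ.x ψ.e₁
    have h₁ := φ.e₁_eq ψ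
    let χ := (φ.shear (p * q') hq').swap
    have hχ₁ : χ.e₁ = ψ.e₁ := by
      change q • (φ.e₂ + (p * q') • φ.e₁) = _
      rw [h₁, smul_add, smul_smul, show q * (p * q') = p by linear_combination p * hq', add_comm]
    have hχ₂ : χ.e₂ = φ.e₁ := rfl
    have h₂ := χ.swap.e₁_eq ψ.swap
    change ψ.e₂ = ev χ.y ψ.e₂ • χ.e₂ + ev χ.x ψ.e₂ • χ.e₁ at h₂
    set c := ev χ.x ψ.e₂
    set t := ev χ.y ψ.e₂
    have ht : t * ev ψ.y φ.e₁ = 1 := by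
      have h₃ := congrArg (ev ψ.y) h₂
      rwa [ψ.y_e₂, ev_add, ev_smul, ev_smul, hχ₁, ψ.y_e₁, hχ₂, mul_zero, add_zero, eq_comm] at h₃
    have hψ : χ.shear (c * ev ψ.y φ.e₁) ht = ψ := by
      refine Frame.ext_of_eq hχ₁ ?_
      change t • (χ.e₂ + (c * ev ψ.y φ.e₁) • χ.e₁) = ψ.e₂
      rw [h₂, smul_add, smul_smul, show t * (c * ev ψ.y φ.e₁) = c by linear_combination c * ht]
    rw [← hψ]
    exact htrans (htrans (hshear φ _ hq') (hswap _)) (hshear _ _ ht)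
  refine hloc φ ψ fun x hx => ?_
  have h₁ := φ.e₁_eq ψ
  have h₂ := congrArg (ev ψ.x) h₁
  rw [ψ.x_e₁, ev_add, ev_smul, ev_smul] at h₂
  have hunit : ∀ (φ : Frame M W), IsUnit (ev ((φ.res (X.basicOpen_le (ev φ.y ψ.e₁))).y)
      (ψ.res (X.basicOpen_le (ev φ.y ψ.e₁))).e₁) := fun φ => by
    have := isUnit_resO_basicOpen (ev φ.y ψ.e₁)
    rw [resO_ev] at this
    exact this
  rcases mem_basicOpen_or (a := ev φ.x ψ.e₁) (b := ev φ.y ψ.e₁) (p := ev ψ.x φ.e₁)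
    (q := ev ψ.x φ.e₂) (by rw [h₂]; ring) hx with h | h
  · exact ⟨_, X.basicOpen_le _, h, htrans (hswap _) (key _ _ (hunit φ.swap))⟩
  · exact ⟨_, X.basicOpen_le _, h, key _ _ (hunit φ)⟩

theorem Frame.swap_monomial (φ : Frame M W) {n j : ℕ} (hj : j ≤ n) :
    φ.swap.monomial n j = φ.monomial n (n - j) := by
  rw [φ.monomial_eq φ.swap (a := 0) (b := 1) (c := 1) (d := 0)
    (by rw [zero_smul, one_smul, zero_add]; rfl) (by rw [zero_smul, one_smul, add_zero]; rfl) hj]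
  simp only [map_zero, map_one, zero_add, one_mul, zero_mul, add_zero, one_pow, mul_one,
    Polynomial.coeff_X_pow]
  simp

theorem Frame.shear_monomial (φ : Frame M W) (κ : Γ(X, W)) {β β' : Γ(X, W)} (h : β * β' = 1)
    {n j : ℕ} (hj : j ≤ n) : (φ.shear κ h).monomial n j = ∑ i ∈ Finset.range (n + 1),
      ((1 - Polynomial.C κ * Polynomial.X) ^ (n - j) * (Polynomial.C β' * Polynomial.X) ^ j).coeff i •
        φ.monomial n i := by
  rw [φ.monomial_eq (φ.shear κ h) (a := 1) (b := -κ) (c := 0) (d := β')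
    (by rw [one_smul]; rfl) (by rw [zero_smul, zero_add]; rfl) hj]
  simp only [map_zero, map_one, zero_add, map_neg, neg_mul, ← sub_eq_add_neg]

theorem Frame.swap_det (φ : Frame M W) {d : Γ(dual (extPow M 2), W)}
    (hd : ev d (wedge ![φ.e₁, φ.e₂]) = 1) :
    ev ((-1 : Γ(X, W)) • d) (wedge ![φ.swap.e₁, φ.swap.e₂]) = 1 := by
  have h := wedge_two φ.e₁ φ.e₂ 0 1 1 0
  rw [zero_smul, zero_smul, one_smul, one_smul, zero_add, add_zero] at h
  change ev _ (wedge ![φ.e₂, φ.e₁]) = 1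
  rw [h, smul_ev, ev_smul, hd]
  ring

theorem Frame.shear_det (φ : Frame M W) (κ : Γ(X, W)) {β β' : Γ(X, W)} (h : β * β' = 1)
    {d : Γ(dual (extPow M 2), W)} (hd : ev d (wedge ![φ.e₁, φ.e₂]) = 1) :
    ev (β' • d) (wedge ![(φ.shear κ h).e₁, (φ.shear κ h).e₂]) = 1 := by
  have h₁ := wedge_two φ.e₁ φ.e₂ 1 0 (β * κ) β
  rw [zero_smul, one_smul, add_zero] at h₁
  have h₂ : (φ.shear κ h).e₂ = (β * κ) • φ.e₁ + β • φ.e₂ := by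
    change β • (φ.e₂ + κ • φ.e₁) = _
    rw [smul_add, smul_smul, add_comm]
  rw [h₂]
  change ev _ (wedge ![φ.e₁, _]) = 1
  rw [h₁, smul_ev, ev_smul, hd]
  linear_combination h

theorem smul_tmul_tpowSec_smul {a a' : Γ(X, W)} (h : a * a' = 1) (m : Γ(N, W)) (d : Γ(L, W))
    (b : ℕ) : (tmul (a ^ b • m) (tpowSec (a' • d) b) : Γ(tensor N (tpow L b), W)) =
      tmul m (tpowSec d b) := by
  rw [tpowSec_smul, smul_tmul, tmul_smul, smul_smul, ← mul_pow, h, one_pow, one_smul]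

theorem smul_tmul_tpowSec_tmul {L₁ L₂ L₃ : X.Modules} (α r : Γ(X, W)) (x : Γ(L₁, W))
    (y : Γ(L₂, W)) (z : Γ(L₃, W)) (m n : ℕ) :
    r ^ n • tmul (tpowSec (α • x) m) (tmul (tpowSec y n) z) =
      α ^ m • tmul (tpowSec x m) (tmul (tpowSec (r • y) n) z) := by
  rw [tpowSec_smul, tpowSec_smul, smul_tmul, smul_tmul, tmul_smul, smul_smul, smul_smul, mul_comm]

end changeOfFrame
section classes
variable {S : Scheme.{u}} {V : S.Modules} {Fl : FlagScheme V ![1, 2, 3]} {P : FlagScheme V ![2]}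
  {W W' : P.X.Opens} {U : Fl.X.Opens} {b : ℕ}

theorem projTwo_lineOneι (m : Γ(lineOne Fl, U)) :
    Hom.app (projTwo Fl) U (Hom.app (lineOneι Fl) U m) = 0 := by
  have h : lineOneι Fl ≫ projTwo Fl = 0 := cokernel.condition _
  have h₁ : Hom.app (lineOneι Fl ≫ projTwo Fl) U m = 0 := by rw [h]; rfl
  exact h₁

theorem FrameChart.res_gen_eq {φ : Frame (tautTwo P) W} (c : FrameChart Fl P φ) (h : U ≤ c.A)
    (m n : ℕ) : res h (c.gen m n) = tmul (tpowSec (res h c.ℓA) m)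
      (tmul (tpowSec (res h c.lam) n) (tpowSec (0 : Γ(lineThree Fl, U)) 0)) :=
  (res_tmul_tpowSec h c.ℓA c.lam (0 : Γ(lineThree Fl, c.A)) m n 0).trans (by rw [map_zero])

/-- Comparison of the generators of `𝒪(m, -n, 0)` attached to two charts: if the line vectors
differ by the factor `α`, and the second vectors of the frames by the factor `r` modulo the line,
the generators differ by `α ^ m / r ^ n`. -/
theorem FrameChart.gen_relation (hV : HasRank V 3) {φ ψ : Frame (tautTwo P) W}
    (c : FrameChart Fl P φ) (c' : FrameChart Fl P ψ) (h : U ≤ c.A) (h' : U ≤ c'.A)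
    {α r s : Γ(Fl.X, U)} (hℓ : lineVec ψ (h'.trans c'.le_A) (resO h' c'.u) =
      α • lineVec φ (h.trans c.le_A) (resO h c.u))
    (hε : FlagCohomology.res (h'.trans c'.le_A) (pullTaut Fl P ψ.e₂) =
      r • FlagCohomology.res (h.trans c.le_A) (pullTaut Fl P φ.e₂) +
        s • lineVec φ (h.trans c.le_A) (resO h c.u)) (m n : ℕ) :
    r ^ n • res h' (c'.gen m n) = α ^ m • res h (c.gen m n) := by
  have hA : Hom.app (Fl.taut 0).arrow U (res h c.ℓA) = lineVec φ (h.trans c.le_A) (resO h c.u) := by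
    refine (app_res (Fl.taut 0).arrow h c.ℓA).trans ?_
    rw [show Hom.app (Fl.taut 0).arrow c.A c.ℓA = lineVec φ c.le_A c.u from c.ℓA_eq, res_lineVec]
  have hA' : Hom.app (Fl.taut 0).arrow U (res h' c'.ℓA) =
      lineVec ψ (h'.trans c'.le_A) (resO h' c'.u) := by
    refine (app_res (Fl.taut 0).arrow h' c'.ℓA).trans ?_
    rw [show Hom.app (Fl.taut 0).arrow c'.A c'.ℓA = lineVec ψ c'.le_A c'.u from c'.ℓA_eq, res_lineVec]
  have e₁ : res h' c'.ℓA = α • res h c.ℓA := by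
    refine app_injective_of_mono (Fl.taut 0).arrow U ?_
    exact hA'.trans (hℓ.trans ((congrArg (α • ·) hA.symm).trans
      (Hom.app_smul (Fl.taut 0).arrow α _).symm))
  have e₂ : res h' c'.ε = r • res h c.ε + s • Hom.app (lineOneι Fl) U (res h c.ℓA) := by
    refine app_injective_of_mono (Fl.taut 1).arrow U ?_
    rw [map_add, Hom.app_smul, Hom.app_smul, lineOneι_arrow, app_res, app_res, c'.ε_eq, c.ε_eq,
      res_res, res_res, hε]
    exact congrArg (fun t => _ + s • t) hA.symm
  have e₃ : Hom.app (projTwo Fl) U (res h' c'.ε) = r • Hom.app (projTwo Fl) U (res h c.ε) := by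
    rw [e₂, map_add, Hom.app_smul, Hom.app_smul, projTwo_lineOneι, smul_zero, add_zero]
  have e₄ : r • res h' c'.lam = res h c.lam := by
    refine ((c.isBasis_ε hV).res h).dual_ext le_rfl fun _ => ?_
    simp only [res_refl]
    rw [smul_ev, ← ev_smul, ← app_res, ← e₃, app_res, app_res, ← resO_ev, ← resO_ev, c.lam_ε,
      c'.lam_ε, map_one, map_one]
  rw [c'.res_gen_eq h', c.res_gen_eq h, e₁, ← e₄]
  exact smul_tmul_tpowSec_tmul α r _ _ _ m n

end classes

/-! ### The divided difference identity -/

section identities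
open Polynomial

/-- The second divided difference of `X ^ (n + 1)` at `p, q, s` is symmetric. -/
theorem exists_divided_difference {T : Type*} [CommRing T] (p q s : T) (n : ℕ) : ∃ H : T,
    (∑ i ∈ Finset.range (n + 1), p ^ i * s ^ (n - i)) -
      (∑ i ∈ Finset.range (n + 1), q ^ i * s ^ (n - i)) = (p - q) * H ∧
    (∑ i ∈ Finset.range (n + 1), p ^ i * q ^ (n - i)) -
      (∑ i ∈ Finset.range (n + 1), q ^ i * s ^ (n - i)) = (p - s) * H := by
  induction n with
  | zero => exact ⟨0, by simp, by simp⟩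
  | succ n ih =>
    obtain ⟨H, h₁, h₂⟩ := ih
    have e : ∀ x y : T, ∑ i ∈ Finset.range (n + 1 + 1), x ^ i * y ^ (n + 1 - i) =
        x ^ (n + 1) + y * ∑ i ∈ Finset.range (n + 1), x ^ i * y ^ (n - i) := fun x y =>
      geom_sum₂_succ_eq x y
    have h₃ := Commute.geom_sum₂_mul (Commute.all p q) (n + 1)
    simp only [Nat.succ_sub_one] at h₃
    refine ⟨(∑ i ∈ Finset.range (n + 1), p ^ i * q ^ (n - i)) + s * H, ?_, ?_⟩
    · rw [e, e]
      linear_combination s * h₁ - h₃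
    · rw [e, e]
      linear_combination s * h₂ - h₃

/-- The identity which makes the class independent of the frame: under a shear, the cocycle changes
by a function without `w`. -/
theorem shear_identity {R T : Type*} [CommRing R] [CommRing T] (σ : R →+* T) (κ : R) {β β' : R}
    (hβ : β * β' = 1) {u w v' : T} (hwu : w * u = 1) (hv : (1 - σ κ * u) * v' = 1) (b : ℕ)
    (c : ℕ → R) :
    (∑ j ∈ Finset.range (2 * b + 1), σ (β ^ b * ∑ i ∈ Finset.range (2 * b + 1),
      ((1 - C κ * X) ^ (2 * b - j) * (C β' * X) ^ j).coeff i * c i) * (σ β * (w - σ κ)) ^ (j + 1)) *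
        (σ β' ^ (b + 1) * v' ^ (2 * b + 2)) =
    (∑ j ∈ Finset.range (2 * b + 1), σ (c j) * w ^ (j + 1)) +
      σ κ * v' * ∑ k ∈ Finset.range (2 * b + 1), v' ^ k * ∑ i ∈ Finset.range (2 * b + 1),
        σ (((1 - C κ * X) ^ k).coeff i * c i) := by
  set n := 2 * b with hn
  let Λ : T[X] →ₗ[T] T := ∑ i ∈ Finset.range (n + 1), σ (c i) • Polynomial.lcoeff T i
  have hΛ : ∀ f, Λ f = ∑ i ∈ Finset.range (n + 1), σ (c i) * f.coeff i := fun f => by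
    simp [Λ, LinearMap.sum_apply]
  have hΛσ : ∀ f : R[X], ∑ i ∈ Finset.range (n + 1), σ (f.coeff i * c i) = Λ (f.map σ) := fun f => by
    rw [hΛ]
    exact Finset.sum_congr rfl fun i _ => by rw [map_mul, Polynomial.coeff_map, mul_comm]
  have hβ' : σ β * σ β' = 1 := by rw [← map_mul, hβ, map_one]
  -- With `p = v' (1 - κ X)` and `s = w X`, the two cocycles are the values of a linear form at the
  -- homogeneous sums of `(p, s)` and `(1, s)`; the divided differences reduce the claim to `hP`.
  set p : T[X] := C v' * (1 - C (σ κ) * X) with hp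
  set s : T[X] := C w * X with hs
  have hP : C w * (p - 1) = C (σ κ) * (p - s) := by
    have h₁ : w * (v' - 1) = σ κ * v' := by
      linear_combination w * hv + (σ κ * v') * hwu
    have h₂ : w * (v' * σ κ) = σ κ * (v' * σ κ + w) := by linear_combination σ κ * h₁
    have h₁' : C w * (C v' - 1) = C (σ κ) * C v' := by
      rw [← C_1, ← C_sub, ← C_mul, ← C_mul, h₁]
    have h₂' : C w * (C v' * C (σ κ)) = C (σ κ) * (C v' * C (σ κ) + C w) := by
      simpa only [C_mul, C_add] using congrArg C h₂
    rw [hp, hs]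
    linear_combination h₁' - X * h₂'
  obtain ⟨H, h₁, h₂⟩ := exists_divided_difference p 1 s n
  have key : C w * C v' * (∑ i ∈ Finset.range (n + 1), p ^ i * s ^ (n - i)) =
      C w * (∑ i ∈ Finset.range (n + 1), 1 ^ i * s ^ (n - i)) +
        C (σ κ) * C v' * (∑ i ∈ Finset.range (n + 1), p ^ i * 1 ^ (n - i)) := by
    have h₃ : C w = C w * C v' - C (σ κ) * C v' := by
      rw [← C_mul, ← C_mul, ← C_sub]
      congr 1
      linear_combination (-w) * hv - σ κ * v' * hwu
    linear_combination C v' * (C w * h₁ - C (σ κ) * h₂ + H * hP) +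
      (- ∑ i ∈ Finset.range (n + 1), 1 ^ i * s ^ (n - i)) * h₃
  have key' := congrArg Λ key
  rw [map_add] at key'
  have hΛC : ∀ (a : T) f, Λ (C a * f) = a * Λ f := fun a f => by
    rw [← Polynomial.smul_eq_C_mul, LinearMap.map_smul, smul_eq_mul]
  refine Eq.trans ?_ (key'.trans ?_)
  · rw [← Finset.sum_flip fun i => p ^ i * s ^ (n - i), Finset.mul_sum, map_sum, Finset.sum_mul]
    refine Finset.sum_congr rfl fun j hj => ?_
    have hj' : j ≤ n := Nat.lt_succ_iff.1 (Finset.mem_range.1 hj)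
    have hwκ : (w - σ κ) * v' = w := by linear_combination w * hv + σ κ * v' * hwu
    rw [map_mul, map_sum, hΛσ, Nat.sub_sub_self hj']
    simp only [Polynomial.map_mul, Polynomial.map_pow, Polynomial.map_sub, Polynomial.map_one,
      Polynomial.map_X, Polynomial.map_C]
    set Q : T[X] := (1 - C (σ κ) * X) ^ (n - j) * X ^ j with hQ
    have e₁ : (1 - C (σ κ) * X) ^ (n - j) * (C (σ β') * X) ^ j = C (σ β' ^ j) * Q := by
      rw [mul_pow, C_pow, hQ]
      ring
    have e₂ : C w * C v' * (p ^ (n - j) * s ^ j) = C (w ^ (j + 1) * v' ^ (n - j + 1)) * Q := by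
      rw [hp, hs, hQ, mul_pow, mul_pow, C_mul, C_pow, C_pow]
      ring
    rw [e₁, e₂, hΛC, hΛC, map_pow]
    have e₃ : (σ β * (w - σ κ)) ^ (j + 1) * v' ^ (2 * b + 2) =
        σ β ^ (j + 1) * (w ^ (j + 1) * v' ^ (n - j + 1)) := by
      have : 2 * b + 2 = (j + 1) + (n - j + 1) := by omega
      rw [this, pow_add v', mul_pow]
      have h₅ : (w - σ κ) ^ (j + 1) * v' ^ (j + 1) = w ^ (j + 1) := by rw [← mul_pow, hwκ]
      linear_combination σ β ^ (j + 1) * v' ^ (n - j + 1) * h₅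
    have e₄ : σ β ^ b * σ β' ^ j * σ β ^ (j + 1) * σ β' ^ (b + 1) = 1 := by
      have : σ β ^ b * σ β' ^ j * σ β ^ (j + 1) * σ β' ^ (b + 1) = (σ β * σ β') ^ (b + (j + 1)) := by
        ring
      rw [this, hβ', one_pow]
    linear_combination σ β ^ b * σ β' ^ j * σ β' ^ (b + 1) * Λ Q * e₃ +
      w ^ (j + 1) * v' ^ (n - j + 1) * Λ Q * e₄
  · congr 1
    · rw [← Finset.sum_flip, Finset.mul_sum, map_sum]
      refine Finset.sum_congr rfl fun j hj => ?_
      have hj' : j ≤ n := Nat.lt_succ_iff.1 (Finset.mem_range.1 hj)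
      have e₁ : C w * (1 ^ (n - j) * s ^ (n - (n - j))) = C (w ^ (j + 1)) * X ^ j := by
        rw [hs, Nat.sub_sub_self hj', one_pow, mul_pow, C_pow]
        ring
      rw [e₁, hΛC, hΛ, mul_comm]
      simp only [Polynomial.coeff_X_pow, mul_ite, mul_one, mul_zero]
      rw [Finset.sum_ite_eq' (Finset.range (n + 1)) j, if_pos hj]
    · rw [mul_assoc, hΛC, hΛC, map_sum, ← mul_assoc]
      congr 1
      refine Finset.sum_congr rfl fun k _ => ?_
      rw [hΛσ, ← hΛC]
      congr 1
      simp only [Polynomial.map_pow, Polynomial.map_sub, Polynomial.map_one, Polynomial.map_mul,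
      Polynomial.map_X, Polynomial.map_C]
      rw [one_pow, mul_one, hp, mul_pow, C_pow]
end identities

/-! ### Independence of the class from the frame -/

section independence
variable {S : Scheme.{u}} {V : S.Modules} {Fl : FlagScheme V ![1, 2, 3]} {P : FlagScheme V ![2]}
  {W W' : P.X.Opens} {U : Fl.X.Opens} {b : ℕ} {φ ψ : Frame (tautTwo P) W}
  {s : Γ(gammaDet P (2 * b) b, W)}
  {ξ : Γ((R1 (forgetFlag Fl P)).obj (flagLine Fl (b + 1) (b + 1) 0), W)}

theorem smul_divPow_ev {X : Scheme.{u}} {M : X.Modules} {U : X.Opens} {n : ℕ} (a : Γ(X, U))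
    (γ : Γ(divPow M n, U)) (m : Γ(symPow (dual M) n, U)) : ev (a • γ) m = a * ev γ m :=
  smul_ev (M := symPow (dual M) n) a γ m

theorem Frame.res_swap {X : Scheme.{u}} {M : X.Modules} {U V : X.Opens} (φ : Frame M V)
    (h : U ≤ V) : φ.swap.res h = (φ.res h).swap := rfl

theorem Frame.ev_shear_monomial {X : Scheme.{u}} {M : X.Modules} {U : X.Opens} (φ : Frame M U)
    (κ : Γ(X, U)) {β β' : Γ(X, U)} (h : β * β' = 1) {n j : ℕ} (γ : Γ(divPow M n, U)) (hj : j ≤ n) :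
    ev γ ((φ.shear κ h).monomial n j) = ∑ i ∈ Finset.range (n + 1),
      ((1 - Polynomial.C κ * Polynomial.X) ^ (n - j) *
        (Polynomial.C β' * Polynomial.X) ^ j).coeff i * ev γ (φ.monomial n i) := by
  rw [φ.shear_monomial κ h hj]
  refine (ev_sum (M := symPow (dual M) n) γ _ _).trans (Finset.sum_congr rfl fun i _ => ?_)
  exact ev_smul (M := symPow (dual M) n) γ _ _

theorem FrameClass.isCechClass (h : FrameClass Fl φ b s ξ) {d : Γ(dual (extPow (tautTwo P) 2), W)}
    (hd : ev d (wedge ![φ.e₁, φ.e₂]) = 1) {γ : Γ(divPow (tautTwo P) (2 * b), W)}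
    (hs : tmul γ (tpowSec d b) = s) (c : FrameChart Fl P φ) :
    IsCechClass (forgetFlag Fl P) c.cover (c.cocycle b γ) ξ := by
  have key : ∀ ψ : Frame (tautTwo P) W, ψ = φ.res le_rfl → ev d (wedge ![ψ.e₁, ψ.e₂]) = 1 →
      ∀ c : FrameChart Fl P ψ, IsCechClass (forgetFlag Fl P) c.cover (c.cocycle b γ) ξ := by
    rintro ψ rfl hd c
    have := h W le_rfl d hd γ (hs.trans (res_refl _ _).symm) c
    rwa [res_refl] at this
  exact key φ φ.res_refl.symm hd c

/-- The class is computed by any cocycle which differs from that of a chart by a section over the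
first member of the covering. -/
theorem FrameClass.of_sub_eq (hV : HasRank V 3) {d : Γ(dual (extPow (tautTwo P) 2), W)}
    (hd : ev d (wedge ![ψ.e₁, ψ.e₂]) = 1) {γ : Γ(divPow (tautTwo P) (2 * b), W)}
    (hs : tmul γ (tpowSec d b) = s) (c : FrameChart Fl P ψ)
    {t : Γ(flagLine Fl (b + 1) (b + 1) 0, c.A ⊓ c.B)}
    (ht : IsCechClass (forgetFlag Fl P) c.cover t ξ) (m : Γ(flagLine Fl (b + 1) (b + 1) 0, c.A))
    (hm : c.cocycle b γ - t = FlagCohomology.res inf_le_left m) : FrameClass Fl ψ b s ξ := by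
  refine FrameClass.of_chart hV hd hs c ?_
  obtain ⟨ξ', hξ'⟩ := exists_isCechClass (f := forgetFlag Fl P) c.cover (c.cocycle b γ)
  rwa [← hξ'.eq_of_coboundary ht m 0 (by rw [hm, map_zero, sub_zero])]

/-- For the frame `(e₂, e₁)` the generator is `ℓ_B ^ (b + 1) ⊗ μ ^ (b + 1)`, with `μ` dual to the
image of `e₁`. Here `ℓ_B = w ℓ_A`, and `e₂` maps to `-w` times the image of `e₁`. -/
theorem FrameChart.gen_swap (hV : HasRank V 3) (c : FrameChart Fl P φ) (b : ℕ) :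
    res (inf_le_left : (c.swap hV).A ⊓ (c.swap hV).B ≤ _) ((c.swap hV).gen (b + 1) (b + 1)) =
      ((-1) ^ (b + 1) * resO (inf_le_left : (c.swap hV).A ⊓ (c.swap hV).B ≤ c.B) c.w ^ (2 * b + 2)) •
        res (inf_le_right : (c.swap hV).A ⊓ (c.swap hV).B ≤ c.A) (c.gen (b + 1) (b + 1)) := by
  have hA : (c.swap hV).A ⊓ (c.swap hV).B ≤ c.A := inf_le_right
  have hB : (c.swap hV).A ⊓ (c.swap hV).B ≤ c.B := inf_le_left
  have hwu : resO hB c.w * resO hA c.u = 1 := by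
    have := congrArg (resO (le_inf hA hB)) (c.w_mul_u hV)
    rwa [map_mul, map_one, resO_resO, resO_resO] at this
  have h := c.gen_relation hV (c.swap hV) hA hB (α := resO hB c.w) (r := -resO hA c.u) (s := 1) (by
      change lineVec φ.swap _ (resO hB c.w) = _
      rw [lineVec, lineVec, smul_add, smul_smul, hwu, one_smul, add_comm]
      rfl) (by
      rw [lineVec, one_smul]
      change res _ (pullTaut Fl P φ.e₁) = _
      module) (b + 1) (b + 1)
  have h' := congrArg (((-1) ^ (b + 1) * resO hB c.w ^ (b + 1)) • ·) h
  simp only [smul_smul] at h'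
  have e : (-1) ^ (b + 1) * resO hB c.w ^ (b + 1) * (-resO hA c.u) ^ (b + 1) = 1 := by
    rw [← mul_pow, ← mul_pow, show -1 * resO hB c.w * -resO hA c.u = 1 by linear_combination hwu,
      one_pow]
  rw [e, one_smul] at h'
  refine h'.trans ?_
  congr 1
  change _ = (-1) ^ (b + 1) * resO hB c.w ^ (2 * b + 2)
  ring

/-- The exchange of the two vectors reverses the order of the covering, which changes the sign of the
class; this sign and those of `δ ^ b` and of the generators cancel. -/
theorem FrameClass.swap (hV : HasRank V 3) (h : FrameClass Fl φ b s ξ) (c : FrameChart Fl P φ) :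
    FrameClass Fl φ.swap b s ξ := by
  obtain ⟨d, hd⟩ := φ.exists_det
  obtain ⟨γ, hγ⟩ := (φ.bijective_tmul hd (2 * b) b).2 s
  have h₁ := (h.isCechClass hd hγ c).symm (c.swap hV).cover
  refine FrameClass.of_chart hV (φ.swap_det hd) (γ := (-1 : Γ(P.X, W)) ^ b • γ)
    ((smul_tmul_tpowSec_smul (L := dual (extPow (tautTwo P) 2)) (by ring) γ d b).trans hγ) (c.swap hV) ?_
  suffices e : (c.swap hV).cocycle b ((-1 : Γ(P.X, W)) ^ b • γ) =
      -FlagCohomology.res (le_of_eq (inf_comm c.B c.A)) (c.cocycle b γ) by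
    rw [e]
    exact h₁
  rw [FrameChart.cocycle_eq, FrameChart.cocycle_eq, c.gen_swap hV, map_smulₛₗ, res_res, smul_smul,
    ← neg_smul]
  congr 1
  have hA : (c.swap hV).A ⊓ (c.swap hV).B ≤ c.A := inf_le_right
  have hB : (c.swap hV).A ⊓ (c.swap hV).B ≤ c.B := inf_le_left
  have hwu : resO hB c.w * resO hA c.u = 1 := by
    have := congrArg (resO (le_inf hA hB)) (c.w_mul_u hV)
    rwa [map_mul, map_one, resO_resO, resO_resO] at this
  rw [FrameChart.coeff, FrameChart.coeff, map_sum, ← Finset.sum_flip, Finset.sum_mul,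
    ← Finset.sum_neg_distrib]
  refine Finset.sum_congr rfl fun j hj => ?_
  have hj' : j ≤ 2 * b := Nat.lt_succ_iff.1 (Finset.mem_range.1 hj)
  rw [φ.swap_monomial (Nat.sub_le _ _), Nat.sub_sub_self hj', smul_divPow_ev, map_mul, map_pow, map_neg,
    map_one, map_mul, map_mul, map_pow, map_pow, map_neg, map_one, resO_resO, resO_resO]
  set a := resO _ (((forgetFlag Fl P).app W) (ev γ (φ.monomial (2 * b) j)))
  change (-1) ^ b * a * resO hA c.u ^ (2 * b - j + 1) * ((-1) ^ (b + 1) * resO hB c.w ^ (2 * b + 2)) =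
    -(a * resO hB c.w ^ (j + 1))
  have e₁ : resO hA c.u ^ (2 * b - j + 1) * resO hB c.w ^ (2 * b + 2) = resO hB c.w ^ (j + 1) := by
    have : 2 * b + 2 = (2 * b - j + 1) + (j + 1) := by omega
    rw [this, pow_add _ (2 * b - j + 1) (j + 1), ← mul_assoc, ← mul_pow, mul_comm (resO hA c.u), hwu,
      one_pow, one_mul]
  have e₂ : ((-1 : Γ(Fl.X, (c.swap hV).A ⊓ (c.swap hV).B)) ^ b) * (-1) ^ b = 1 := by
    rw [← mul_pow]; simp
  linear_combination (-a) * e₁ -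
    a * resO hA c.u ^ (2 * b - j + 1) * resO hB c.w ^ (2 * b + 2) * e₂

theorem pullTaut_shear_e₂ (φ : Frame (tautTwo P) W) (κ : Γ(P.X, W)) {β β' : Γ(P.X, W)}
    (h : β * β' = 1) (hU : U ≤ forgetFlag Fl P ⁻¹ᵁ W) :
    res hU (pullTaut Fl P (φ.shear κ h).e₂) = resO hU ((forgetFlag Fl P).app W β) •
      (res hU (pullTaut Fl P φ.e₂) +
        resO hU ((forgetFlag Fl P).app W κ) • res hU (pullTaut Fl P φ.e₁)) := by
  change res hU (pullTaut Fl P (β • (φ.e₂ + κ • φ.e₁))) = _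
  rw [pullTaut_smul, pullTaut_add, pullTaut_smul, map_smulₛₗ, map_add, map_smulₛₗ]

theorem resO_app_unit {β β' : Γ(P.X, W)} (hβ : β * β' = 1) (hU : U ≤ forgetFlag Fl P ⁻¹ᵁ W) :
    resO hU ((forgetFlag Fl P).app W β) * resO hU ((forgetFlag Fl P).app W β') = 1 := by
  rw [← map_mul, ← map_mul, hβ, map_one, map_one]

/-- The vector `e₁ + u e₂` is a multiple of a vector `e₁ + u' e₂'` of the sheared frame where
`1 - κ u`, with inverse `v'`, is invertible. -/
theorem lineVec_shear (φ : Frame (tautTwo P) W) (κ : Γ(P.X, W)) {β β' : Γ(P.X, W)}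
    (hβ : β * β' = 1) (hU : U ≤ forgetFlag Fl P ⁻¹ᵁ W) {u v' : Γ(Fl.X, U)}
    (hv : (1 - resO hU ((forgetFlag Fl P).app W κ) * u) * v' = 1) :
    lineVec (φ.shear κ hβ) hU (v' * u * resO hU ((forgetFlag Fl P).app W β')) =
      v' • lineVec φ hU u := by
  have h := resO_app_unit hβ hU
  rw [lineVec, lineVec, pullTaut_shear_e₂]
  change res hU (pullTaut Fl P φ.e₁) + _ = _
  generalize res hU (pullTaut Fl P φ.e₁) = x
  generalize res hU (pullTaut Fl P φ.e₂) = y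
  generalize resO hU ((forgetFlag Fl P).app W κ) = k at *
  generalize resO hU ((forgetFlag Fl P).app W β) = β₁ at *
  generalize resO hU ((forgetFlag Fl P).app W β') = β₁' at *
  have k₁ : v' * u * β₁' * β₁ = v' * u := by linear_combination v' * u * h
  have k₂ : 1 + v' * u * k = v' := by linear_combination (-1) * hv
  rw [smul_smul, k₁]
  calc x + (v' * u) • (y + k • x) = (1 + v' * u * k) • x + (v' * u) • y := by module
    _ = v' • (x + u • y) := by rw [k₂]; module

theorem lineVec_shear_swap (φ : Frame (tautTwo P) W) (κ : Γ(P.X, W)) {β β' : Γ(P.X, W)}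
    (hβ : β * β' = 1) (hU : U ≤ forgetFlag Fl P ⁻¹ᵁ W) (w : Γ(Fl.X, U)) :
    lineVec (φ.shear κ hβ).swap hU (resO hU ((forgetFlag Fl P).app W β) *
      (w - resO hU ((forgetFlag Fl P).app W κ))) =
      resO hU ((forgetFlag Fl P).app W β) • lineVec φ.swap hU w := by
  rw [lineVec, lineVec]
  change res hU (pullTaut Fl P (φ.shear κ hβ).e₂) + _ • res hU (pullTaut Fl P φ.e₁) =
    _ • (res hU (pullTaut Fl P φ.e₂) + _ • res hU (pullTaut Fl P φ.e₁))
  rw [pullTaut_shear_e₂]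
  module

theorem FrameChart.gen_shear (hV : HasRank V 3) (c : FrameChart Fl P φ) (κ : Γ(P.X, W))
    {β β' : Γ(P.X, W)} (hβ : β * β' = 1) (c' : FrameChart Fl P (φ.shear κ hβ)) (hA : c'.A ≤ c.A)
    {v' : Γ(Fl.X, c'.A)}
    (hv : (1 - resO c'.le_A ((forgetFlag Fl P).app W κ) * resO hA c.u) * v' = 1)
    (hu : c'.u = v' * resO hA c.u * resO c'.le_A ((forgetFlag Fl P).app W β')) (b : ℕ) :
    c'.gen (b + 1) (b + 1) =
      (resO c'.le_A ((forgetFlag Fl P).app W β') ^ (b + 1) * v' ^ (2 * b + 2)) •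
        FlagCohomology.res hA (c.gen (b + 1) (b + 1)) := by
  have hβ₁ := resO_app_unit hβ c'.le_A
  set κ₁ := resO c'.le_A ((forgetFlag Fl P).app W κ) with hκ₁
  set β₁ := resO c'.le_A ((forgetFlag Fl P).app W β) with hβ₁def
  set β₁' := resO c'.le_A ((forgetFlag Fl P).app W β')
  set u₁ := resO hA c.u
  have hr := c.gen_relation hV c' hA le_rfl (α := v') (r := β₁ * (1 - κ₁ * u₁)) (s := β₁ * κ₁)
    (by rw [resO_refl, hu]; exact lineVec_shear φ κ hβ c'.le_A hv) (by
      rw [pullTaut_shear_e₂, lineVec, ← hκ₁, ← hβ₁def]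
      module) (b + 1) (b + 1)
  rw [res_refl] at hr
  have := congrArg ((β₁' ^ (b + 1) * v' ^ (b + 1)) • ·) hr
  simp only [smul_smul] at this
  have e : β₁' ^ (b + 1) * v' ^ (b + 1) * (β₁ * (1 - κ₁ * u₁)) ^ (b + 1) = 1 := by
    rw [← mul_pow, ← mul_pow, show β₁' * v' * (β₁ * (1 - κ₁ * u₁)) = 1 by
      linear_combination hβ₁ + β₁ * β₁' * hv, one_pow]
  rw [e, one_smul] at this
  refine this.trans ?_
  congr 1
  ring

/-- The shear is first treated on a pair of charts with related coordinates, where `shear_identity`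
shows that the two cocycles differ by a section over `A`. -/
theorem FrameClass.of_shear_chart (hV : HasRank V 3) (h : FrameClass Fl φ b s ξ)
    (c : FrameChart Fl P φ) (κ : Γ(P.X, W)) {β β' : Γ(P.X, W)} (hβ : β * β' = 1)
    (c' : FrameChart Fl P (φ.shear κ hβ)) (hA : c'.A ≤ c.A) (hB : c'.B ≤ c.B) {v' : Γ(Fl.X, c'.A)}
    (hv : (1 - resO c'.le_A ((forgetFlag Fl P).app W κ) * resO hA c.u) * v' = 1)
    (hu : c'.u = v' * resO hA c.u * resO c'.le_A ((forgetFlag Fl P).app W β'))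
    (hw : c'.w = resO c'.le_B ((forgetFlag Fl P).app W β) *
      (resO hB c.w - resO c'.le_B ((forgetFlag Fl P).app W κ))) :
    FrameClass Fl (φ.shear κ hβ) b s ξ := by
  obtain ⟨d, hd⟩ := φ.exists_det
  obtain ⟨γ, hγ⟩ := (φ.bijective_tmul hd (2 * b) b).2 s
  have h₁ := (h.isCechClass hd hγ c).res le_rfl hA hB c'.cover
  rw [res_refl] at h₁
  refine FrameClass.of_sub_eq hV (φ.shear_det κ hβ hd) (γ := β ^ b • γ)
    ((smul_tmul_tpowSec_smul (L := dual (extPow (tautTwo P) 2)) hβ γ d b).trans hγ) c' h₁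
    ((resO c'.le_A ((forgetFlag Fl P).app W κ) * v' * ∑ k ∈ Finset.range (2 * b + 1), v' ^ k *
      ∑ i ∈ Finset.range (2 * b + 1), resO c'.le_A ((forgetFlag Fl P).app W
        (((1 - Polynomial.C κ * Polynomial.X) ^ k).coeff i * ev γ (φ.monomial (2 * b) i)))) •
        FlagCohomology.res hA (c.gen (b + 1) (b + 1))) ?_
  rw [sub_eq_iff_eq_add, FrameChart.cocycle_eq, FrameChart.cocycle_eq,
    c.gen_shear hV κ hβ c' hA hv hu, map_smulₛₗ, map_smulₛₗ, map_smulₛₗ, res_res, res_res,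
    smul_smul, ← add_smul]
  congr 1
  have hAB : c'.A ⊓ c'.B ≤ c'.A := inf_le_left
  have hBB : c'.A ⊓ c'.B ≤ c'.B := inf_le_right
  have hwu : resO hBB (resO hB c.w) * resO hAB (resO hA c.u) = 1 := by
    have := congrArg (resO (inf_le_inf hA hB)) (c.w_mul_u hV)
    rw [map_mul, map_one, resO_resO, resO_resO] at this
    rwa [resO_resO, resO_resO]
  have hid := shear_identity ((resO c'.inf_le).comp ((forgetFlag Fl P).app W).hom) κ hβ hwu
    (v' := resO hAB v') (by
      have := congrArg (resO hAB) hv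
      rw [map_mul, map_sub, map_mul, map_one, resO_resO] at this
      exact this) b (fun j => ev γ (φ.monomial (2 * b) j))
  refine Eq.trans ?_ (hid.trans ?_)
  · rw [map_mul, map_pow, map_pow, resO_resO]
    refine congrArg (· * (resO c'.inf_le ((forgetFlag Fl P).app W β') ^ (b + 1) *
      resO hAB v' ^ (2 * b + 2))) ?_
    refine Finset.sum_congr rfl fun j hj => ?_
    rw [smul_divPow_ev, φ.ev_shear_monomial κ hβ γ (Nat.lt_succ_iff.1 (Finset.mem_range.1 hj)), hw,
      map_mul (resO hBB), map_sub (resO hBB), resO_resO hBB c'.le_B, resO_resO hBB c'.le_B]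
    rfl
  · rw [add_comm]
    congr 1
    · rw [map_mul, map_mul, map_sum, resO_resO]
      refine congrArg (_ * ·) (Finset.sum_congr rfl fun k _ => ?_)
      rw [map_mul, map_pow, map_sum]
      refine congrArg (_ * ·) (Finset.sum_congr rfl fun i _ => ?_)
      rw [resO_resO]
      rfl
    · rw [FrameChart.coeff, map_sum]
      refine Finset.sum_congr rfl fun j _ => ?_
      rw [map_mul, map_pow, resO_resO, resO_resO, resO_resO]
      rfl

theorem FrameClass.shear (hV : HasRank V 3) (h : FrameClass Fl φ b s ξ) (c : FrameChart Fl P φ)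
    (hc : c.Full) (κ : Γ(P.X, W)) {β β' : Γ(P.X, W)} (hβ : β * β' = 1) :
    FrameClass Fl (φ.shear κ hβ) b s ξ := by
  -- the line is spanned by a vector `e₁ + u' e₂'` where `1 - κ u` is invertible
  have hA' : Fl.X.basicOpen (1 - resO c.le_A ((forgetFlag Fl P).app W κ) * c.u) ≤ c.A := Fl.X.basicOpen_le _
  obtain ⟨v', hv'⟩ := (isUnit_resO_basicOpen (1 - resO c.le_A ((forgetFlag Fl P).app W κ) * c.u)).exists_right_inv
  rw [map_sub, map_mul, map_one, resO_resO] at hv'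
  have hcov : Fl.X.basicOpen (1 - resO c.le_A ((forgetFlag Fl P).app W κ) * c.u) ⊔ c.B = forgetFlag Fl P ⁻¹ᵁ W := by
    refine le_antisymm (sup_le (hA'.trans c.le_A) c.le_B) fun x hx => ?_
    rw [← c.cover] at hx
    rcases hx with hx | hx
    · rcases mem_basicOpen_or (a := 1 - resO c.le_A ((forgetFlag Fl P).app W κ) * c.u) (b := c.u) (p := 1) (q := resO c.le_A ((forgetFlag Fl P).app W κ)) (by ring) hx with
        h | h
      · exact Or.inl h
      -- where `1 - κ u` vanishes `u` is invertible, so that the point lies in `B`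
      · rw [← FrameChart.Full.inf_eq hV hc] at h
        exact Or.inr h.2
    · exact Or.inr hx
  refine h.of_shear_chart hV c κ hβ (mkChart hV _ hcov
    (v' * resO hA' c.u * resO (hA'.trans c.le_A) ((forgetFlag Fl P).app W β'))
    (resO c.le_B ((forgetFlag Fl P).app W β) * (c.w - resO c.le_B ((forgetFlag Fl P).app W κ)))
    ?_ ?_) hA' le_rfl hv' rfl ?_
  · rw [lineVec_shear φ κ hβ _ hv', ← res_lineVec φ c.le_A hA']
    exact (c.mem_A.res hA').smul v'
  · rw [lineVec_shear_swap]
    exact c.mem_B.smul _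
  · exact congrArg (fun t => resO c.le_B ((forgetFlag Fl P).app W β) *
      (t - resO c.le_B ((forgetFlag Fl P).app W κ))) (resO_refl _ c.w).symm

/-- The class attached to a section does not depend on the frame. -/
theorem FrameClass.of_frame (hV : HasRank V 3) (h : FrameClass Fl φ b s ξ)
    (ψ : Frame (tautTwo P) W) : FrameClass Fl ψ b s ξ := by
  refine Frame.rel_of_swap_shear (M := tautTwo P) (fun {U} φ ψ => ∀ s ξ, FrameClass Fl φ b s ξ →
    FrameClass Fl ψ b s ξ) ?_ ?_ ?_ ?_ φ ψ s ξ h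
  · intro U φ ψ H s ξ h
    refine FrameClass.of_locally hV fun x hx => ?_
    obtain ⟨W', hW, hx', H⟩ := H x hx
    exact ⟨W', hW, hx', H _ _ (h.res hW)⟩
  · intro U φ ψ χ h₁ h₂ s ξ h
    exact h₂ _ _ (h₁ _ _ h)
  · intro U φ s ξ h
    refine FrameClass.of_locally hV fun x hx => ?_
    obtain ⟨W', hW, c, hx', -⟩ := exists_full_chart (Fl := Fl) hV φ hx
    exact ⟨W', hW, hx', by rw [φ.res_swap hW]; exact (h.res hW).swap hV c⟩
  · intro U φ κ β β' hβ s ξ h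
    refine FrameClass.of_locally hV fun x hx => ?_
    obtain ⟨W', hW, c, hx', hc, -⟩ := exists_full_chart (Fl := Fl) hV φ hx
    exact ⟨W', hW, hx', by rw [φ.res_shear κ hβ hW]; exact (h.res hW).shear hV c hc _ _⟩

end independence

/-! ### Laurent polynomials -/

section laurent
open Polynomial
variable {R T : Type*} [CommRing R] [CommRing T] (σ : R →+* T) {u w : T}

/-- In the Laurent polynomial ring, the span of `w, …, w ^ (n + 1)` meets the sum of `R[u]` and
`w ^ (n + 2) R[w]` in zero only. -/
theorem laurent_eq_zero (hwu : w * u = 1) (hinj : Function.Injective (eval₂RingHom σ u)) {n : ℕ}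
    {c : ℕ → R} {p q : R[X]} (h : ∑ j ∈ Finset.range (n + 1), σ (c j) * w ^ (j + 1) =
      eval₂ σ u p + w ^ (n + 2) * eval₂ σ w q) {j : ℕ} (hj : j ≤ n) : c j = 0 := by
  -- multiplication by a power of `u` turns the equation into one between polynomials in `u`
  set N := n + 2 + q.natDegree with hN
  have hpow : ∀ i ≤ N, u ^ N * w ^ i = u ^ (N - i) := fun i hi => by
    obtain ⟨k, hk⟩ : ∃ k, N = k + i := ⟨N - i, by omega⟩
    rw [hk, Nat.add_sub_cancel, pow_add, mul_assoc, ← mul_pow, mul_comm u, hwu, one_pow, mul_one]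
  have key : (∑ j ∈ Finset.range (n + 1), C (c j) * X ^ (N - (j + 1))) =
      X ^ N * p + ∑ k ∈ Finset.range (q.natDegree + 1), C (q.coeff k) * X ^ (N - (n + 2 + k)) := by
    apply hinj
    have h' := congrArg (u ^ N * ·) h
    simp only [mul_add, Finset.mul_sum] at h'
    simp only [coe_eval₂RingHom, eval₂_add, eval₂_mul, eval₂_finsetSum, eval₂_C, eval₂_X_pow]
    refine Eq.trans ?_ (h'.trans ?_)
    · refine Finset.sum_congr rfl fun j hj => ?_
      have := hpow (j + 1) (by have := Finset.mem_range.1 hj; omega)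
      linear_combination (-σ (c j)) * this
    · congr 1
      rw [eval₂_eq_sum_range, Finset.mul_sum, Finset.mul_sum]
      refine Finset.sum_congr rfl fun k hk => ?_
      have := hpow (n + 2 + k) (by have := Finset.mem_range.1 hk; omega)
      rw [pow_add w] at this
      linear_combination (σ (q.coeff k)) * this
  have hc := congrArg (fun f => coeff f (N - (j + 1))) key
  simp only [coeff_add, finsetSum_coeff, coeff_C_mul, coeff_X_pow, coeff_X_pow_mul'] at hc
  rw [if_neg (by omega), zero_add, Finset.sum_eq_single j, Finset.sum_eq_zero] at hc
  · simpa using hc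
  · intro k hk
    rw [if_neg (by have := Finset.mem_range.1 hk; omega), mul_zero]
  · intro i hi hij
    rw [if_neg (by have := Finset.mem_range.1 hi; omega), mul_zero]
  · intro h
    exact absurd (Finset.mem_range.2 (by omega)) h

/-- The Laurent polynomial ring is the sum of `R[u]`, the span of `w, …, w ^ (n + 1)` and
`w ^ (n + 2) R[w]`. -/
theorem exists_laurent (hwu : w * u = 1) (hsurj : ∀ t : T, ∃ (N : ℕ) (p : R[X]), eval₂ σ u p = u ^ N * t)
    (n : ℕ) (t : T) : ∃ (c : ℕ → R) (p q : R[X]),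
      t = eval₂ σ u p + ∑ j ∈ Finset.range (n + 1), σ (c j) * w ^ (j + 1) +
        w ^ (n + 2) * eval₂ σ w q := by
  have hpow : ∀ N k, u ^ k * w ^ (N + k) = w ^ N := fun N k => by
    rw [pow_add, mul_left_comm, ← mul_pow, mul_comm u, hwu, one_pow, mul_one]
  have hpow' : ∀ N k, u ^ (N + k) * w ^ k = u ^ N := fun N k => by
    rw [pow_add, mul_assoc, ← mul_pow, mul_comm u, hwu, one_pow, mul_one]
  obtain ⟨N, f, hf⟩ := hsurj t
  have ht : t = eval₂ σ u f * w ^ N := by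
    rw [hf, mul_right_comm, ← mul_pow, mul_comm u, hwu, one_pow, one_mul]
  rw [ht]
  clear ht hf
  induction f using Polynomial.induction_on' with
  | add f g hf hg =>
    obtain ⟨c, p, q, h⟩ := hf
    obtain ⟨c', p', q', h'⟩ := hg
    refine ⟨c + c', p + p', q + q', ?_⟩
    simp only [eval₂_add, Pi.add_apply, map_add, add_mul, Finset.sum_add_distrib, h, h']
    ring
  -- the monomial `a w ^ (N - k)` belongs to one of the three summands, according to its degree
  | monomial k a =>
    rw [eval₂_monomial]
    rcases le_or_gt N k with hk | hk
    · obtain ⟨i, rfl⟩ : ∃ i, k = i + N := ⟨k - N, by omega⟩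
      refine ⟨0, C a * X ^ i, 0, ?_⟩
      rw [mul_assoc, hpow']
      simp
    · rcases le_or_gt (N - k) (n + 1) with hk' | hk'
      · obtain ⟨i, rfl⟩ : ∃ i, N = (i + 1) + k := ⟨N - k - 1, by omega⟩
        refine ⟨fun j => if j = i then a else 0, 0, 0, ?_⟩
        rw [mul_assoc, hpow]
        simp only [eval₂_zero, mul_zero, add_zero, zero_add]
        rw [Finset.sum_eq_single i]
        · simp
        · intro j _ hj
          rw [if_neg hj, map_zero, zero_mul]
        · intro h
          exact absurd (Finset.mem_range.2 (by omega)) h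
      · obtain ⟨i, rfl⟩ : ∃ i, N = (n + 2 + i) + k := ⟨N - k - (n + 2), by omega⟩
        refine ⟨0, 0, C a * X ^ i, ?_⟩
        rw [mul_assoc, hpow]
        simp [pow_add]
        ring
end laurent

/-! ### The canonical homomorphism to the first direct image -/

section canonicalMap
variable {S : Scheme.{u}} {V : S.Modules} {Fl : FlagScheme V ![1, 2, 3]} {P : FlagScheme V ![2]}
  {W W' : P.X.Opens} {U : Fl.X.Opens} {b : ℕ} {φ ψ : Frame (tautTwo P) W}
  {s s' : Γ(gammaDet P (2 * b) b, W)}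
  {ξ ξ' : Γ((R1 (forgetFlag Fl P)).obj (flagLine Fl (b + 1) (b + 1) 0), W)}

theorem exists_frame {x : P.X} (hx : x ∈ W) :
    ∃ W' ≤ W, x ∈ W' ∧ Nonempty (Frame (tautTwo P) W') := by
  obtain ⟨W', hx', e, he⟩ := hasRank_iff.1 P.hasRank_taut x
  exact ⟨W ⊓ W', inf_le_left, ⟨hx, hx'⟩, ⟨(he.frame).res inf_le_right⟩⟩

theorem FrameChart.cocycle_add (c : FrameChart Fl P φ) (γ γ' : Γ(divPow (tautTwo P) (2 * b), W)) :
    c.cocycle b (γ + γ') = c.cocycle b γ + c.cocycle b γ' := by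
  rw [cocycle_eq, cocycle_eq, cocycle_eq, ← add_smul]
  congr 1
  rw [coeff, coeff, coeff, ← Finset.sum_add_distrib]
  refine Finset.sum_congr rfl fun j _ => ?_
  rw [show ev (γ + γ') (φ.monomial (2 * b) j) = ev γ (φ.monomial (2 * b) j) +
    ev γ' (φ.monomial (2 * b) j) from add_ev (M := symPow (dual (tautTwo P)) (2 * b)) γ γ' _,
    map_add, map_add, add_mul]

theorem FrameChart.cocycle_smul (c : FrameChart Fl P φ) (a : Γ(P.X, W))
    (γ : Γ(divPow (tautTwo P) (2 * b), W)) :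
    c.cocycle b (a • γ) = resO c.inf_le ((forgetFlag Fl P).app W a) • c.cocycle b γ := by
  rw [cocycle_eq, cocycle_eq, smul_smul]
  congr 1
  rw [coeff, coeff, Finset.mul_sum]
  refine Finset.sum_congr rfl fun j _ => ?_
  rw [smul_divPow_ev, map_mul, map_mul, mul_assoc]

theorem FrameClass.of_forall_chart (hV : HasRank V 3)
    (H : ∀ (W' : P.X.Opens) (h : W' ≤ W) (_ : FrameChart Fl P (φ.res h)),
      FrameClass Fl (φ.res h) b (FlagCohomology.res h s) (FlagCohomology.res h ξ)) :
    FrameClass Fl φ b s ξ :=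
  FrameClass.of_locally hV fun x hx => by
    obtain ⟨W', h, c, hx', -⟩ := exists_full_chart (Fl := Fl) hV φ hx
    exact ⟨W', h, hx', H W' h c⟩

theorem FrameClass.add (hV : HasRank V 3) (h : FrameClass Fl φ b s ξ)
    (h' : FrameClass Fl φ b s' ξ') : FrameClass Fl φ b (s + s') (ξ + ξ') := by
  refine FrameClass.of_forall_chart hV fun W' hW c => ?_
  obtain ⟨d, hd⟩ := (φ.res hW).exists_det
  obtain ⟨γ, hγ⟩ := ((φ.res hW).bijective_tmul hd (2 * b) b).2 (FlagCohomology.res hW s)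
  obtain ⟨γ', hγ'⟩ := ((φ.res hW).bijective_tmul hd (2 * b) b).2 (FlagCohomology.res hW s')
  refine FrameClass.of_chart hV hd (γ := γ + γ') ?_ c ?_
  · rw [map_add]
    exact (add_tmul γ γ' (tpowSec d b)).trans (congrArg₂ (· + ·) hγ hγ')
  · rw [c.cocycle_add, map_add]
    exact ((h.res hW).isCechClass hd hγ c).add ((h'.res hW).isCechClass hd hγ' c)

theorem FrameClass.smul (hV : HasRank V 3) (h : FrameClass Fl φ b s ξ) (a : Γ(P.X, W)) :
    FrameClass Fl φ b (a • s) (a • ξ) := by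
  refine FrameClass.of_forall_chart hV fun W' hW c => ?_
  obtain ⟨d, hd⟩ := (φ.res hW).exists_det
  obtain ⟨γ, hγ⟩ := ((φ.res hW).bijective_tmul hd (2 * b) b).2 (FlagCohomology.res hW s)
  refine FrameClass.of_chart hV hd (γ := resO hW a • γ) ?_ c ?_
  · rw [map_smulₛₗ]
    exact (smul_tmul (resO hW a) γ (tpowSec d b)).trans (congrArg (resO hW a • ·) hγ)
  · rw [c.cocycle_smul, map_smulₛₗ]
    exact ((h.res hW).isCechClass hd hγ c).smul _ c.inf_le

theorem FrameClass.unique (hV : HasRank V 3) (h : FrameClass Fl φ b s ξ)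
    (h' : FrameClass Fl φ b s ξ') : ξ = ξ' :=
  eq_of_locally fun x hx => by
    obtain ⟨W', hW, c, hx', -⟩ := exists_full_chart (Fl := Fl) hV φ hx
    obtain ⟨d, hd⟩ := (φ.res hW).exists_det
    obtain ⟨γ, hγ⟩ := ((φ.res hW).bijective_tmul hd (2 * b) b).2 (FlagCohomology.res hW s)
    exact ⟨W', hW, hx', ((h.res hW).isCechClass hd hγ c).unique ((h'.res hW).isCechClass hd hγ c)⟩

/-- There is a homomorphism given by the class of the cocycle, for every frame. -/
theorem exists_classHom (Fl : FlagScheme V ![1, 2, 3]) (P : FlagScheme V ![2]) (hV : HasRank V 3)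
    (b : ℕ) : ∃ θ : gammaDet P (2 * b) b ⟶
      (R1 (forgetFlag Fl P)).obj (flagLine Fl (b + 1) (b + 1) 0),
      ∀ (W : P.X.Opens) (φ : Frame (tautTwo P) W) (s : Γ(gammaDet P (2 * b) b, W)),
        FrameClass Fl φ b s (Hom.app θ W s) := by
  suffices H : ∃ θ : gammaDet P (2 * b) b ⟶
      (R1 (forgetFlag Fl P)).obj (flagLine Fl (b + 1) (b + 1) 0),
      ∀ (W : P.X.Opens) (s : Γ(gammaDet P (2 * b) b, W)) (W' : P.X.Opens) (h : W' ≤ W)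
        (φ : Frame (tautTwo P) W'), FrameClass Fl φ b (res h s) (res h (Hom.app θ W s)) by
    obtain ⟨θ, hθ⟩ := H
    refine ⟨θ, fun W φ s => ?_⟩
    have := hθ W s W le_rfl φ
    rwa [res_refl, res_refl] at this
  refine exists_hom_of_rel (fun W s ξ => ∀ (W' : P.X.Opens) (h : W' ≤ W)
    (φ : Frame (tautTwo P) W'), FrameClass Fl φ b (res h s) (res h ξ)) ?_ ?_ ?_ ?_ ?_ ?_
  · intro W' W hW s ξ H W₁ h φ
    rw [res_res, res_res]
    exact H _ _ φ
  · intro W s ξ H W₁ h φ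
    refine FrameClass.of_locally hV fun x hx => ?_
    obtain ⟨W₂, h₂, hx₂, H⟩ := H x (h hx)
    refine ⟨W₁ ⊓ W₂, inf_le_left, ⟨hx, hx₂⟩, ?_⟩
    have := H (W₁ ⊓ W₂) inf_le_right (φ.res inf_le_left)
    rwa [res_res, res_res] at this ⊢
  · intro W s ξ ξ' h h'
    refine eq_of_locally fun x hx => ?_
    obtain ⟨W', hW, hx', ⟨φ⟩⟩ := exists_frame hx
    exact ⟨W', hW, hx', (h W' hW φ).unique hV (h' W' hW φ)⟩
  · intro W s x hx
    obtain ⟨W', hW, hx', ⟨φ⟩⟩ := exists_frame hx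
    obtain ⟨W₁, h₁, ξ, hx₁, h⟩ := FrameClass.exists_of_point (Fl := Fl) hV φ b (res hW s) hx'
    refine ⟨W₁, h₁.trans hW, hx₁, ξ, fun W₂ h₂ ψ => ?_⟩
    rw [res_res] at h
    exact (h.res h₂).of_frame hV ψ
  · intro W s ξ s' ξ' h h' W₁ h₁ φ
    rw [map_add, map_add]
    exact (h W₁ h₁ φ).add hV (h' W₁ h₁ φ)
  · intro W a s ξ h W₁ h₁ φ
    rw [map_smulₛₗ, map_smulₛₗ]
    exact (h W₁ h₁ φ).smul hV _

end canonicalMap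

/-! ### The cocycles of the standard covering modulo coboundaries -/

section localization
variable {X : Scheme.{u}} {A D : X.Opens}

theorem exists_pow_mul_eq_zero (hA : IsAffineOpen A) (g : Γ(X, A)) (hD : D = X.basicOpen g)
    (hDA : D ≤ A) {m : Γ(X, A)} (hm : resO hDA m = 0) : ∃ n : ℕ, g ^ n * m = 0 := by
  subst hD
  exact exists_pow_smul_eq_zero isBasis_one hA le_top g (funSec m) hm

theorem exists_pow_mul_extension (hA : IsAffineOpen A) (g : Γ(X, A)) (hD : D = X.basicOpen g)
    (hDA : D ≤ A) (t : Γ(X, D)) : ∃ (n : ℕ) (s : Γ(X, A)), resO hDA s = resO hDA g ^ n * t := by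
  subst hD
  exact exists_pow_smul_extension isBasis_one hA le_top g (funSec t)

end localization
section isomorphism
variable {S : Scheme.{u}} {V : S.Modules} {Fl : FlagScheme V ![1, 2, 3]} {P : FlagScheme V ![2]}
  {W W' : P.X.Opens} {U : Fl.X.Opens} {b : ℕ} {φ : Frame (tautTwo P) W}
  {s : Γ(gammaDet P (2 * b) b, W)}
  {ξ : Γ((R1 (forgetFlag Fl P)).obj (flagLine Fl (b + 1) (b + 1) 0), W)}

namespace FrameChart

theorem Full.le_A_of_res {c : FrameChart Fl P φ} (hc : c.Full) (h : W' ≤ W)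
    (c' : FrameChart Fl P (φ.res h)) : c'.A ≤ c.A :=
  hc.le_left _ (c'.le_A.trans (Scheme.Hom.preimage_mono _ h)) c'.u (by
    rw [← lineVec_res φ h c'.le_A]
    exact c'.mem_A)

theorem Full.le_B_of_res {c : FrameChart Fl P φ} (hc : c.Full) (h : W' ≤ W)
    (c' : FrameChart Fl P (φ.res h)) : c'.B ≤ c.B :=
  hc.le_right _ (c'.le_B.trans (Scheme.Hom.preimage_mono _ h)) c'.w (by
    rw [← lineVec_res φ.swap h c'.le_B]
    exact c'.mem_B)

/-- The generator of `𝒪(b + 1, -b - 1, 0)` over the second member of a chart. -/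
noncomputable def genB (hV : HasRank V 3) (c : FrameChart Fl P φ) (b : ℕ) :
    Γ(flagLine Fl (b + 1) (b + 1) 0, c.B) := (c.swap hV).gen (b + 1) (b + 1)

theorem isBasis_genB (hV : HasRank V 3) (c : FrameChart Fl P φ) (b : ℕ) :
    IsBasis fun _ : Unit => c.genB hV b := (c.swap hV).isBasis_gen hV _ _

theorem res_genB (hV : HasRank V 3) (c : FrameChart Fl P φ) (b : ℕ) :
    res (inf_le_right : c.A ⊓ c.B ≤ _) (c.genB hV b) =
      ((-1) ^ (b + 1) * resO (inf_le_right : c.A ⊓ c.B ≤ c.B) c.w ^ (2 * b + 2)) •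
        res inf_le_left (c.gen (b + 1) (b + 1)) := by
  have h₀ : res (inf_le_left : c.B ⊓ c.A ≤ c.B) (c.genB hV b) =
      ((-1) ^ (b + 1) * resO (inf_le_left : c.B ⊓ c.A ≤ c.B) c.w ^ (2 * b + 2)) •
        res (inf_le_right : c.B ⊓ c.A ≤ c.A) (c.gen (b + 1) (b + 1)) := c.gen_swap hV b
  have h := congrArg (res (inf_comm c.A c.B).le) h₀
  rw [map_smulₛₗ, map_mul, map_pow, map_pow, map_neg, map_one] at h
  have e := fun (m : Γ(flagLine Fl (b + 1) (b + 1) 0, c.A)) =>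
    res_res (inf_comm c.A c.B).le (inf_le_right : c.B ⊓ c.A ≤ c.A) m
  have e' := fun (m : Γ(flagLine Fl (b + 1) (b + 1) 0, c.B)) =>
    res_res (inf_comm c.A c.B).le (inf_le_left : c.B ⊓ c.A ≤ c.B) m
  have e'' := resO_resO (inf_comm c.A c.B).le (inf_le_left : c.B ⊓ c.A ≤ c.B) c.w
  refine (e' _).symm.trans (h.trans ?_)
  refine congrArg₂ (fun x y => ((-1) ^ (b + 1) * x ^ (2 * b + 2)) • y) e'' (e _)

/-- The functions of the base, as functions on `A ∩ B`. -/
noncomputable abbrev baseHom (c : FrameChart Fl P φ) : Γ(P.X, W) →+* Γ(Fl.X, c.A ⊓ c.B) :=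
  (resO c.inf_le).comp ((forgetFlag Fl P).app W).hom

/-- The functions of the base, as functions on `A`. -/
noncomputable abbrev baseHomA (c : FrameChart Fl P φ) : Γ(P.X, W) →+* Γ(Fl.X, c.A) :=
  (resO c.le_A).comp ((forgetFlag Fl P).app W).hom

/-- The functions of the base, as functions on `B`. -/
noncomputable abbrev baseHomB (c : FrameChart Fl P φ) : Γ(P.X, W) →+* Γ(Fl.X, c.B) :=
  (resO c.le_B).comp ((forgetFlag Fl P).app W).hom

theorem eval₂_u (c : FrameChart Fl P φ) (p : Polynomial Γ(P.X, W)) :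
    resO inf_le_left (Polynomial.eval₂ c.baseHomA c.u p) =
      Polynomial.eval₂ c.baseHom (resO inf_le_left c.u) p := by
  rw [Polynomial.hom_eval₂]
  congr 1
  ext r
  exact resO_resO _ _ _

theorem eval₂_w (c : FrameChart Fl P φ) (p : Polynomial Γ(P.X, W)) :
    resO inf_le_right (Polynomial.eval₂ c.baseHomB c.w p) =
      Polynomial.eval₂ c.baseHom (resO inf_le_right c.w) p := by
  rw [Polynomial.hom_eval₂]
  congr 1
  ext r
  exact resO_resO _ _ _

/-- There are no relations between powers of `u` on `A ∩ B`. -/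
theorem Full.injective_eval₂ (hV : HasRank V 3) {c : FrameChart Fl P φ} (hc : c.Full)
    (hA : IsAffineOpen c.A)
    (hinj : Function.Injective (Polynomial.eval₂RingHom c.baseHomA c.u)) :
    Function.Injective (Polynomial.eval₂RingHom c.baseHom
      (resO (inf_le_left : c.A ⊓ c.B ≤ _) c.u)) := by
  refine (injective_iff_map_eq_zero _).2 fun p hp => ?_
  rw [Polynomial.coe_eval₂RingHom, ← c.eval₂_u] at hp
  obtain ⟨n, hn⟩ := exists_pow_mul_eq_zero hA c.u (hc.inf_eq hV) inf_le_left hp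
  have : Polynomial.X ^ n * p = 0 := by
    apply hinj
    rw [map_mul, map_pow, map_zero, Polynomial.coe_eval₂RingHom, Polynomial.eval₂_X]
    exact hn
  exact (Polynomial.monic_X_pow n).mul_right_eq_zero_iff.1 this

/-- Every function on `A ∩ B` becomes a polynomial in `u` after multiplication by a power of `u`. -/
theorem Full.exists_eval₂ (hV : HasRank V 3) {c : FrameChart Fl P φ} (hc : c.Full)
    (hA : IsAffineOpen c.A)
    (hsurj : Function.Surjective (Polynomial.eval₂RingHom c.baseHomA c.u))
    (t : Γ(Fl.X, c.A ⊓ c.B)) : ∃ (N : ℕ) (p : Polynomial Γ(P.X, W)),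
      Polynomial.eval₂ c.baseHom (resO inf_le_left c.u) p = resO inf_le_left c.u ^ N * t := by
  obtain ⟨N, s, hs⟩ := exists_pow_mul_extension hA c.u (hc.inf_eq hV) inf_le_left t
  obtain ⟨p, hp⟩ := hsurj s
  refine ⟨N, p, ?_⟩
  rw [← hs, ← hp, ← c.eval₂_u]
  rfl

/-- A cocycle which is a coboundary vanishes. -/
theorem Full.eq_zero_of_coboundary (hV : HasRank V 3) {c : FrameChart Fl P φ} (hc : c.Full)
    (hA : IsAffineOpen c.A) (hbA : Function.Bijective (Polynomial.eval₂RingHom c.baseHomA c.u))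
    (hbB : Function.Bijective (Polynomial.eval₂RingHom c.baseHomB c.w))
    {γ : Γ(divPow (tautTwo P) (2 * b), W)} (mA : Γ(flagLine Fl (b + 1) (b + 1) 0, c.A))
    (mB : Γ(flagLine Fl (b + 1) (b + 1) 0, c.B))
    (h : c.cocycle b γ = res inf_le_left mA - res inf_le_right mB) : γ = 0 := by
  obtain ⟨p, hp⟩ : ∃ p, Polynomial.eval₂ c.baseHomA c.u p • c.gen (b + 1) (b + 1) = mA := by
    obtain ⟨a, ha⟩ := (c.isBasis_gen hV (b + 1) (b + 1) c.A le_rfl).2 mA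
    obtain ⟨p, hp⟩ := hbA.2 (a ())
    refine ⟨p, ?_⟩
    rw [← ha, linComb_unit, ← hp, res_refl]
    rfl
  obtain ⟨q, hq⟩ : ∃ q, Polynomial.eval₂ c.baseHomB c.w q • c.genB hV b = mB := by
    obtain ⟨a, ha⟩ := (c.isBasis_genB hV b c.B le_rfl).2 mB
    obtain ⟨p, hp⟩ := hbB.2 (a ())
    refine ⟨p, ?_⟩
    rw [← ha, linComb_unit, ← hp, res_refl]
    rfl
  rw [← hp, ← hq, cocycle_eq, map_smulₛₗ, map_smulₛₗ, c.res_genB hV, c.eval₂_u, c.eval₂_w, smul_smul,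
    ← sub_smul] at h
  -- the generator over `B` is that over `A` times `(-1) ^ (b + 1) w ^ (2b + 2)`
  have h' : c.coeff b γ = Polynomial.eval₂ c.baseHom (resO inf_le_left c.u) p -
      Polynomial.eval₂ c.baseHom (resO inf_le_right c.w) q *
        ((-1) ^ (b + 1) * resO inf_le_right c.w ^ (2 * b + 2)) := by
    have hinj := (c.isBasis_gen hV (b + 1) (b + 1) (c.A ⊓ c.B) inf_le_left).1
    have := @hinj (fun _ => c.coeff b γ) (fun _ => Polynomial.eval₂ c.baseHom
      (resO inf_le_left c.u) p - Polynomial.eval₂ c.baseHom (resO inf_le_right c.w) q *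
        ((-1) ^ (b + 1) * resO inf_le_right c.w ^ (2 * b + 2))) (by
      rw [linComb_unit, linComb_unit]
      exact h)
    exact congrFun this ()
  refine φ.divPow_ext fun j hj => ?_
  have := laurent_eq_zero c.baseHom (c.w_mul_u hV) (hc.injective_eval₂ hV hA hbA.1)
    (n := 2 * b) (c := fun j => ev γ (φ.monomial (2 * b) j)) (p := p)
    (q := Polynomial.C ((-1) ^ b) * q) (by
      refine Eq.trans (Eq.trans rfl h') ?_
      rw [Polynomial.eval₂_mul, Polynomial.eval₂_C, map_pow, map_neg, map_one]
      ring) hj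
  rw [this]
  rfl

/-- Every cocycle is cohomologous to one of the standard ones. -/
theorem Full.exists_cocycle (hV : HasRank V 3) {c : FrameChart Fl P φ} (hc : c.Full)
    (hA : IsAffineOpen c.A) (hbA : Function.Bijective (Polynomial.eval₂RingHom c.baseHomA c.u))
    (t : Γ(flagLine Fl (b + 1) (b + 1) 0, c.A ⊓ c.B)) :
    ∃ (γ : Γ(divPow (tautTwo P) (2 * b), W)) (mA : Γ(flagLine Fl (b + 1) (b + 1) 0, c.A))
      (mB : Γ(flagLine Fl (b + 1) (b + 1) 0, c.B)),
      t - c.cocycle b γ = res inf_le_left mA - res inf_le_right mB := by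
  obtain ⟨a, ha⟩ := (c.isBasis_gen hV (b + 1) (b + 1) (c.A ⊓ c.B) inf_le_left).2 t
  rw [linComb_unit] at ha
  obtain ⟨κ, p, q, h⟩ := exists_laurent c.baseHom (c.w_mul_u hV) (hc.exists_eval₂ hV hA hbA.2)
    (2 * b) (a ())
  obtain ⟨γ, hγ⟩ := φ.exists_divPow (2 * b) κ
  have hco : c.coeff b γ = ∑ j ∈ Finset.range (2 * b + 1), c.baseHom (κ j) *
      resO inf_le_right c.w ^ (j + 1) :=
    Finset.sum_congr rfl fun j hj => by
      rw [hγ j (Nat.lt_succ_iff.1 (Finset.mem_range.1 hj))]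
      rfl
  refine ⟨γ, Polynomial.eval₂ c.baseHomA c.u p • c.gen (b + 1) (b + 1),
    Polynomial.eval₂ c.baseHomB c.w (Polynomial.C ((-1) ^ b) * q) • c.genB hV b, ?_⟩
  rw [← ha, h, cocycle_eq, hco, map_smulₛₗ, map_smulₛₗ, c.res_genB hV, c.eval₂_u, c.eval₂_w,
    smul_smul, ← sub_smul, ← sub_smul]
  congr 1
  rw [Polynomial.eval₂_mul, Polynomial.eval₂_C, map_pow, map_neg, map_one]
  have : (-1 : Γ(Fl.X, c.A ⊓ c.B)) ^ b * (-1) ^ b = 1 := by rw [← mul_pow]; simp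
  linear_combination (Polynomial.eval₂ c.baseHom (resO inf_le_right c.w) q *
    resO inf_le_right c.w ^ (2 * b + 2)) * (-this)

end FrameChart
end isomorphism

/-! ### The canonical isomorphism onto the first direct image -/

section directImage
variable {S : Scheme.{u}} {V : S.Modules} {Fl : FlagScheme V ![1, 2, 3]} {P : FlagScheme V ![2]}
  {W W' : P.X.Opens} {b : ℕ} {φ : Frame (tautTwo P) W}
  {s : Γ(gammaDet P (2 * b) b, W)}
  {ξ : Γ((R1 (forgetFlag Fl P)).obj (flagLine Fl (b + 1) (b + 1) 0), W)}

/-- A section with class zero vanishes: its cocycle is locally a coboundary, and by the uniqueness of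
the Laurent decomposition its coefficients vanish. -/
theorem FrameClass.eq_zero (hV : HasRank V 3) (h : FrameClass Fl φ b s 0) : s = 0 := by
  refine eq_of_locally fun x hx => ?_
  obtain ⟨W₁, h₁, c, hx₁, hc, -⟩ := exists_full_chart (Fl := Fl) hV φ hx
  obtain ⟨d, hd⟩ := (φ.res h₁).exists_det
  obtain ⟨γ, hγ⟩ := ((φ.res h₁).bijective_tmul hd (2 * b) b).2 (FlagCohomology.res h₁ s)
  have h₀ := (h.res h₁).isCechClass hd hγ c
  rw [map_zero] at h₀
  obtain ⟨W₂, h₂, mA, mB, hx₂, hm⟩ := h₀.exists_coboundary hx₁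
  obtain ⟨W₃, h₃, c₃, hx₃, hc₃, hA, hB, hbA, hbB⟩ :=
    exists_full_chart (Fl := Fl) hV ((φ.res h₁).res h₂) hx₂
  have hψ : ((φ.res h₁).res h₂).res h₃ = (φ.res h₁).res (h₃.trans h₂) := Frame.res_res _ _ _
  generalize ((φ.res h₁).res h₂).res h₃ = ψ at c₃ hc₃ hA hB hbA hbB hψ
  subst hψ
  have hAA := hc.le_A_of_res (h₃.trans h₂) c₃
  have hBB := hc.le_B_of_res (h₃.trans h₂) c₃
  have hf : c₃.A ⊓ c₃.B ≤ forgetFlag Fl P ⁻¹ᵁ W₂ :=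
    c₃.inf_le.trans (Scheme.Hom.preimage_mono _ h₃)
  have hγ0 : FlagCohomology.res (M := divPow (tautTwo P) (2 * b)) (h₃.trans h₂) γ = 0 := by
    refine hc₃.eq_zero_of_coboundary hV hA hbA hbB
      (FlagCohomology.res (le_inf hAA (c₃.le_A.trans (Scheme.Hom.preimage_mono _ h₃))) mA)
      (FlagCohomology.res (le_inf hBB (c₃.le_B.trans (Scheme.Hom.preimage_mono _ h₃))) mB) ?_
    have := congrArg (FlagCohomology.res (le_inf (inf_le_inf hAA hBB) hf)) hm
    rw [map_sub, res_res, res_res, res_res] at this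
    rw [c.cocycle_res hV rfl c₃ hAA hBB, res_res, res_res, this]
  refine ⟨W₃, (h₃.trans h₂).trans h₁, hx₃, ?_⟩
  rw [map_zero, ← res_res (h₃.trans h₂) h₁]
  have e := res_tmul_tpowSec_det (h₃.trans h₂) γ d b
  have e' := smul_tmul (0 : Γ(P.X, W₃)) (0 : Γ(divPow (tautTwo P) (2 * b), W₃))
    (tpowSec (FlagCohomology.res (h₃.trans h₂) d) b)
  rw [zero_smul, zero_smul] at e'
  refine Eq.trans (congrArg (FlagCohomology.res (h₃.trans h₂)) hγ.symm) (e.trans ?_)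
  refine Eq.trans (congrArg (fun t => tmul t _) hγ0) e'

/-- Every class is locally that of a section. -/
theorem exists_frameClass (hV : HasRank V 3)
    (ξ : Γ((R1 (forgetFlag Fl P)).obj (flagLine Fl (b + 1) (b + 1) 0), W)) {x : P.X} (hx : x ∈ W) :
    ∃ (W' : P.X.Opens) (h : W' ≤ W) (φ : Frame (tautTwo P) W') (s : Γ(gammaDet P (2 * b) b, W')),
      x ∈ W' ∧ FrameClass Fl φ b s (res h ξ) := by
  obtain ⟨W₁, h₁, hx₁, ⟨φ⟩⟩ := exists_frame hx
  let I : InjectiveResolution (flagLine Fl (b + 1) (b + 1) 0) := InjectiveResolution.of _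
  obtain ⟨W₂, h₂, z, hx₂, hz⟩ := exists_homologyπ_eq_classIso I (res h₁ ξ) hx₁
  obtain ⟨W₃, h₃, c, hx₃, hc, hA, hB, hbA, hbB⟩ :=
    exists_full_chart (Fl := Fl) hV (φ.res h₂) hx₂
  have hz' := congrArg (res h₃) hz
  rw [← app_res, ← app_res, res_res, res_res] at hz'
  obtain ⟨t, ht⟩ := exists_isCechClass_of_isAffineOpen c.cover hA (c.isBasis_gen hV (b + 1) (b + 1))
    hB (c.isBasis_genB hV b) I hz'
  obtain ⟨γ, mA, mB, hm⟩ := hc.exists_cocycle hV hA hbA t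
  obtain ⟨d, hd⟩ := ((φ.res h₂).res h₃).exists_det
  refine ⟨W₃, h₃.trans (h₂.trans h₁), (φ.res h₂).res h₃, tmul γ (tpowSec d b), hx₃,
    FrameClass.of_chart hV hd rfl c ?_⟩
  obtain ⟨ξ', hξ'⟩ := exists_isCechClass (f := forgetFlag Fl P) c.cover (c.cocycle b γ)
  rwa [ht.eq_of_coboundary hξ' mA mB hm]

/-- The canonical isomorphism onto the first direct image of `𝒪(b + 1, -b - 1, 0)`. -/
theorem existsUnique_isCanonicalR1 (Fl : FlagScheme V ![1, 2, 3]) (P : FlagScheme V ![2])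
    (hV : HasRank V 3) (b : ℕ) : ∃! θ : gammaDet P (2 * b) b ≅
      (R1 (forgetFlag Fl P)).obj (flagLine Fl (b + 1) (b + 1) 0), IsCanonicalR1 b θ := by
  obtain ⟨θ, hθ⟩ := exists_classHom Fl P hV b
  have hinj : ∀ W, Function.Injective (Hom.app θ W) := fun W =>
    (injective_iff_map_eq_zero _).2 fun s hs => eq_of_locally fun x hx => by
      obtain ⟨W', h, hx', ⟨φ⟩⟩ := exists_frame hx
      refine ⟨W', h, hx', ?_⟩
      have := hθ W' φ (res h s)
      rw [app_res, hs, map_zero] at this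
      rw [this.eq_zero hV, map_zero]
  have : IsIso θ := by
    refine isIso_of_bijective θ fun W => ⟨hinj W, fun ξ => ?_⟩
    obtain ⟨s, hs⟩ := exists_of_locally (M := gammaDet P (2 * b) b) (U := W)
      (fun W' s => ∃ h : W' ≤ W, Hom.app θ W' s = res h ξ)
      (fun h s ⟨h', hs⟩ => ⟨h.trans h', by rw [app_res, hs, res_res]⟩)
      (fun s t _ ⟨_, hs⟩ ⟨_, ht⟩ => hinj _ (hs.trans ht.symm)) fun x hx => by
        obtain ⟨W', h, φ, s, hx', hs⟩ := exists_frameClass (b := b) hV ξ hx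
        exact ⟨W', h, hx', s, h, (hθ W' φ s).unique hV hs⟩
    refine ⟨s, eq_of_locally fun x hx => ?_⟩
    obtain ⟨W', h, hx', _, hs⟩ := hs x hx
    exact ⟨W', h, hx', by rw [← app_res, hs]⟩
  refine ⟨asIso θ, fun W φ d hd γ c => (hθ W φ _).isCechClass hd rfl c, fun θ' hθ' => ?_⟩
  ext1
  refine Scheme.Modules.hom_ext _ _ fun W => ?_
  ext s
  refine eq_of_locally fun x hx => ?_
  obtain ⟨W₁, h₁, hx₁, ⟨φ⟩⟩ := exists_frame hx
  obtain ⟨W₂, h₂, c, hx₂, -⟩ := exists_full_chart (Fl := Fl) hV φ hx₁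
  obtain ⟨d, hd⟩ := (φ.res h₂).exists_det
  obtain ⟨γ, hγ⟩ := ((φ.res h₂).bijective_tmul hd (2 * b) b).2 (res (h₂.trans h₁) s)
  refine ⟨W₂, h₂.trans h₁, hx₂, ?_⟩
  rw [← app_res, ← app_res]
  exact (congrArg (Hom.app θ'.hom W₂) hγ.symm).trans
    (((hθ' W₂ _ d hd γ c).unique ((hθ W₂ _ _).isCechClass hd rfl c)).trans
      (congrArg (Hom.app θ W₂) hγ))

end directImage

/-! ### Binomial coefficients modulo a prime -/

section binomials
open Polynomial

/-- If `n` is not a power of `p`, some binomial coefficient `n.choose i`, `0 < i < n`, is prime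
to `p`. -/
theorem exists_not_dvd_choose {p n : ℕ} (hp : p.Prime) (hn : 0 < n) (h : ¬ ∃ s, n = p ^ s) :
    ∃ i, 0 < i ∧ i < n ∧ ¬ p ∣ n.choose i := by
  have := Fact.mk hp
  obtain ⟨v, m, hm, rfl⟩ := Nat.exists_eq_pow_mul_and_not_dvd hn.ne' p hp.ne_one
  have hm1 : 1 < m := by
    rcases Nat.lt_or_ge 1 m with h1 | h1
    · exact h1
    · interval_cases m
      · simp at hn
      · exact absurd ⟨v, by simp⟩ h
  have hq : 0 < p ^ v := pow_pos hp.pos v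
  refine ⟨p ^ v, hq, lt_mul_of_one_lt_right hq hm1, ?_⟩
  -- `(1 + X) ^ (p ^ v * m) = (1 + X ^ (p ^ v)) ^ m` in characteristic `p`
  have key : ((1 + X : (ZMod p)[X]) ^ (p ^ v * m)).coeff (p ^ v) = m := by
    have h₁ := coeff_expand_mul hq ((1 + X : (ZMod p)[X]) ^ m) 1
    rw [one_mul] at h₁
    rw [pow_mul, add_pow_char_pow, one_pow,
      show (1 + X ^ p ^ v : (ZMod p)[X]) ^ m = expand (ZMod p) (p ^ v) ((1 + X) ^ m) by simp, h₁,
      coeff_one_add_X_pow, Nat.choose_one_right]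
  rw [coeff_one_add_X_pow] at key
  rw [← CharP.cast_eq_zero_iff (ZMod p) p, key, CharP.cast_eq_zero_iff (ZMod p) p]
  exact hm

/-- For `b + 1 = p ^ s`, the binomial coefficients `m.choose b` with `b < m ≤ 2 b` vanish
modulo `p`. -/
theorem dvd_choose_of_lt {p s b m : ℕ} (hp : p.Prime) (hb : b + 1 = p ^ s) (h₁ : b < m)
    (h₂ : m ≤ 2 * b) : p ∣ m.choose b := by
  have := Fact.mk hp
  obtain ⟨t, rfl⟩ : ∃ t, m = p ^ s + t := ⟨m - p ^ s, by omega⟩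
  have key : ((1 + X : (ZMod p)[X]) ^ (p ^ s + t)).coeff b = 0 := by
    rw [pow_add, add_pow_char_pow, one_pow, add_mul, one_mul, coeff_add, coeff_one_add_X_pow,
      coeff_X_pow_mul', if_neg (by omega), Nat.choose_eq_zero_of_lt (by omega)]
    simp
  rw [coeff_one_add_X_pow] at key
  exact (CharP.cast_eq_zero_iff (ZMod p) p _).1 key

end binomials

/-! ### The linear relations between the coefficients of a global section -/

section combinatorics
variable {R : Type*} [CommRing R] {b : ℕ}

/-- A function `h` on the vectors of sum `b` bounded by `ω`, such that the values at the vectors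
obtained from a vector of sum `b + 1` by lowering one entry add up to zero. -/
def IsBalanced (b : ℕ) (ω : Fin 3 → ℕ) (h : (Fin 3 → ℕ) → R) : Prop :=
  ∀ β : Fin 3 → ℕ, ∑ i, β i = b + 1 → β ≤ ω →
    ∑ i, (if β i = 0 then 0 else h (β - Pi.single i 1)) = 0

/-- If some `ω i` exceeds `b`, a vector of sum `b` can be raised at `i` without leaving the bound.
The relation at the raised vector expresses `h β` by values at vectors with a larger entry at `i`, and
for `β i = b` there are no such vectors. -/
theorem IsBalanced.eq_zero_of_lt {ω : Fin 3 → ℕ} {h : (Fin 3 → ℕ) → R} (hh : IsBalanced b ω h)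
    {i : Fin 3} (hi : b < ω i) {β : Fin 3 → ℕ} (hβ : ∑ j, β j = b) (hle : β ≤ ω) : h β = 0 := by
  have hβi : β i ≤ b := hβ ▸ Finset.single_le_sum (fun j _ => Nat.zero_le _) (Finset.mem_univ i)
  obtain ⟨n, hn⟩ : ∃ n, n = b - β i := ⟨_, rfl⟩
  induction n generalizing β with
  | zero | succ n ih =>
    have hsum := hh (β + Pi.single i 1) (by
      simp only [Pi.add_apply, Finset.sum_add_distrib, hβ, Finset.sum_pi_single', Finset.mem_univ,
        if_true]) (fun j => by
      rcases eq_or_ne j i with rfl | hj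
      · simp only [Pi.add_apply, Pi.single_eq_same]
        omega
      · simp only [Pi.add_apply, Pi.single_eq_of_ne hj, add_zero]
        exact hle j)
    rw [Finset.sum_eq_single i, if_neg (by simp), add_tsub_cancel_right] at hsum
    · exact hsum
    · intro j _ hj
      split_ifs with h0
      · rfl
      · simp only [Pi.add_apply, Pi.single_eq_of_ne hj, add_zero] at h0
        have e : ∀ k, (β + Pi.single i 1 - Pi.single j 1 : Fin 3 → ℕ) k =
            β k + (Pi.single i 1 : Fin 3 → ℕ) k - (Pi.single j 1 : Fin 3 → ℕ) k := fun k => rfl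
        have hs : ∑ k, (β + Pi.single i 1 - Pi.single j 1 : Fin 3 → ℕ) k = b := by
          have h₁ : ∑ k, ((β + Pi.single i 1 - Pi.single j 1 : Fin 3 → ℕ) k + (Pi.single j 1 : Fin 3 → ℕ) k) =
              ∑ k, (β k + (Pi.single i 1 : Fin 3 → ℕ) k) :=
            Finset.sum_congr rfl fun k _ => by
              rw [e]
              rcases eq_or_ne k j with rfl | hk
              · simp only [Pi.single_eq_same]
                omega
              · simp [Pi.single_eq_of_ne hk]
          rw [Finset.sum_add_distrib, Finset.sum_add_distrib, hβ] at h₁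
          simp at h₁
          simpa using h₁
        have hi' : (β + Pi.single i 1 - Pi.single j 1 : Fin 3 → ℕ) i = β i + 1 := by
          rw [e, Pi.single_eq_same, Pi.single_eq_of_ne (Ne.symm hj), Nat.sub_zero]
        have hb' : β i + 1 ≤ b := by
          rw [← hi', ← hs]
          exact Finset.single_le_sum (fun j _ => Nat.zero_le _) (Finset.mem_univ i)
        first
        | omega
        | exact ih hs (fun k => by
            rw [e]
            rcases eq_or_ne k i with rfl | hk
            · rw [Pi.single_eq_same]
              exact (Nat.sub_le _ _).trans (Nat.succ_le_of_lt (by omega))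
            · rw [Pi.single_eq_of_ne hk, add_zero]
              exact (Nat.sub_le _ _).trans (hle k)) (by omega) (by omega)
    · simp

/-- The relation of `IsBalanced` at the vector `(i, j, k)`. -/
theorem IsBalanced.relation {h : (Fin 3 → ℕ) → R} (hh : IsBalanced b (fun _ => b) h) {i j k : ℕ}
    (hs : i + j + k = b + 1) (hi : i ≤ b) (hj : j ≤ b) (hk : k ≤ b) :
    (if i = 0 then 0 else h ![i - 1, j, k]) + (if j = 0 then 0 else h ![i, j - 1, k]) +
      (if k = 0 then 0 else h ![i, j, k - 1]) = 0 := by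
  have := hh ![i, j, k] (by simp [Fin.sum_univ_three, hs]) (by
    intro l; fin_cases l <;> simpa)
  rw [Fin.sum_univ_three] at this
  have e₀ : (![i, j, k] : Fin 3 → ℕ) - Pi.single 0 1 = ![i - 1, j, k] := by
    ext l; fin_cases l <;> simp
  have e₁ : (![i, j, k] : Fin 3 → ℕ) - Pi.single 1 1 = ![i, j - 1, k] := by
    ext l; fin_cases l <;> simp
  have e₂ : (![i, j, k] : Fin 3 → ℕ) - Pi.single 2 1 = ![i, j, k - 1] := by
    ext l; fin_cases l <;> simp
  rw [e₀, e₁, e₂] at this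
  exact this

/-- For `ω = (b, b, b)` all values are determined by the one at `(0, 0, b)`, by Pascal's rule. -/
theorem IsBalanced.eq_choose {h : (Fin 3 → ℕ) → R} (hh : IsBalanced b (fun _ => b) h) {i j k : ℕ}
    (hs : i + j + k = b) : h ![i, j, k] = (-1) ^ (i + j) * ((i + j).choose i : R) * h ![0, 0, b] := by
  obtain ⟨n, hn⟩ : ∃ n, n = i + j := ⟨_, rfl⟩
  induction n generalizing i j k with
  | zero =>
    obtain rfl : i = 0 := by omega
    obtain rfl : j = 0 := by omega
    obtain rfl : k = b := by omega
    simp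
  | succ n ih =>
    have hr := hh.relation (i := i) (j := j) (k := k + 1) (by omega) (by omega) (by omega) (by omega)
    rw [if_neg (Nat.succ_ne_zero k), Nat.add_sub_cancel] at hr
    rw [eq_neg_of_add_eq_zero_right hr]
    rcases i with _ | i
    · rcases j with _ | j
      · omega
      · rw [if_pos rfl, if_neg (Nat.succ_ne_zero j), Nat.add_sub_cancel,
          ih (i := 0) (j := j) (k := k + 1) (by omega) (by omega)]
        simp only [Nat.zero_add, Nat.choose_zero_right]
        ring
    · rcases j with _ | j
      · rw [if_pos rfl, if_neg (Nat.succ_ne_zero i), Nat.add_sub_cancel,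
          ih (i := i) (j := 0) (k := k + 1) (by omega) (by omega)]
        simp only [Nat.add_zero, Nat.choose_self]
        ring
      · rw [if_neg (Nat.succ_ne_zero i), if_neg (Nat.succ_ne_zero j), Nat.add_sub_cancel,
          Nat.add_sub_cancel, ih (i := i) (j := j + 1) (k := k + 1) (by omega) (by omega),
          ih (i := i + 1) (j := j) (k := k + 1) (by omega) (by omega),
          show i + 1 + (j + 1) = (i + j + 1) + 1 by ring, Nat.choose_succ_succ,
          show i + (j + 1) = i + j + 1 by ring, show i + 1 + j = i + j + 1 by ring]
        push_cast
        ring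

/-- The relations at the vectors `(i, b + 1 - i, 0)`, which are not used to determine the values,
show that a binomial coefficient annihilates the value at `(0, 0, b)`. -/
theorem IsBalanced.choose_mul_eq_zero {h : (Fin 3 → ℕ) → R} (hh : IsBalanced b (fun _ => b) h)
    {i : ℕ} (h₀ : 0 < i) (hi : i < b + 1) : ((b + 1).choose i : R) * h ![0, 0, b] = 0 := by
  obtain ⟨i, rfl⟩ : ∃ k, i = k + 1 := ⟨i - 1, by omega⟩
  obtain ⟨j, hj⟩ : ∃ j, b = i + (j + 1) := ⟨b - i - 1, by omega⟩
  have hr := hh.relation (i := i + 1) (j := j + 1) (k := 0) (by omega) (by omega) (by omega)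
    (by omega)
  rw [if_pos rfl, if_neg (Nat.succ_ne_zero i), if_neg (Nat.succ_ne_zero j), Nat.add_sub_cancel,
    Nat.add_sub_cancel, hh.eq_choose (i := i) (j := j + 1) (k := 0) (by omega),
    hh.eq_choose (i := i + 1) (j := j) (k := 0) (by omega)] at hr
  rw [show i + 1 + j = b by omega, show i + (j + 1) = b by omega] at hr
  rw [Nat.choose_succ_succ]
  push_cast
  have h1 : ((-1 : R) ^ b) * (-1) ^ b = 1 := by rw [← mul_pow]; simp
  linear_combination (-1) ^ b * hr - ((b.choose i : R) + b.choose (i + 1)) * h ![0, 0, b] * h1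

/-- The linear algebra of the global sections. Here `g j k p q` stands for the coefficient of
`a ^ p c ^ q` in the value of a linear form at `x ^ (2b - j - k) y ^ j z ^ k`, where `z = a x + c y`;
the values are polynomials of degree at most `b`. The constant coefficient of the value at
`x ^ b y ^ b` determines all the others, and is annihilated by binomial coefficients. -/
theorem coefficients_eq_zero (g : ℕ → ℕ → ℕ → ℕ → R)
    (hrel : ∀ j k p q, j + k + 1 ≤ 2 * b → g j (k + 1) p q =
      (if p = 0 then 0 else g j k (p - 1) q) + (if q = 0 then 0 else g (j + 1) k p (q - 1)))
    (hdeg : ∀ j k p q, j + k ≤ 2 * b → b < p + q → g j k p q = 0) :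
    (∀ i, 0 < i → i < b + 1 → ((b + 1).choose i : R) * g b 0 0 0 = 0) ∧
    (g b 0 0 0 = 0 → ∀ j k p q, j + k ≤ 2 * b → g j k p q = 0) := by
  -- Up to sign, the coefficient with index `(ω 0 - β 0, ω 1 - β 1, ω 2 - β 2)` and exponents
  -- `β 0`, `β 1` depends on a vector `ω` of sum `3 b` and a vector `β ≤ ω` of sum `b`: the relations
  -- only connect coefficients with the same `ω`.
  let h (ω β : Fin 3 → ℕ) : R := (-1) ^ (β 0 + β 1) * g (ω 1 - β 1) (ω 2 - β 2) (β 0) (β 1)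
  have hh : ∀ ω : Fin 3 → ℕ, ∑ i, ω i = 3 * b → IsBalanced b ω (h ω) := by
    intro ω hω β hβ hle
    rw [Fin.sum_univ_three] at hω hβ
    have h₀ : β 0 ≤ ω 0 := hle 0
    have h₁ : β 1 ≤ ω 1 := hle 1
    have h₂ : β 2 ≤ ω 2 := hle 2
    have hr := hrel (ω 1 - β 1) (ω 2 - β 2) (β 0) (β 1) (by omega)
    rw [Fin.sum_univ_three]
    have t₀ : (if β 0 = 0 then 0 else h ω (β - Pi.single 0 1)) = -(-1) ^ (β 0 + β 1) *
        (if β 0 = 0 then 0 else g (ω 1 - β 1) (ω 2 - β 2) (β 0 - 1) (β 1)) := by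
      split_ifs with h0
      · simp
      · have : β 0 + β 1 = (β 0 - 1 + β 1) + 1 := by omega
        simp only [h, Pi.sub_apply]
        rw [this]
        simp [pow_succ]
    have t₁ : (if β 1 = 0 then 0 else h ω (β - Pi.single 1 1)) = -(-1) ^ (β 0 + β 1) *
        (if β 1 = 0 then 0 else g (ω 1 - β 1 + 1) (ω 2 - β 2) (β 0) (β 1 - 1)) := by
      split_ifs with h0
      · simp
      · have : β 0 + β 1 = (β 0 + (β 1 - 1)) + 1 := by omega
        have h' : ω 1 - (β 1 - 1) = ω 1 - β 1 + 1 := by omega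
        simp only [h, Pi.sub_apply]
        rw [this]
        simp [pow_succ, h']
    have t₂ : (if β 2 = 0 then 0 else h ω (β - Pi.single 2 1)) = (-1) ^ (β 0 + β 1) *
        g (ω 1 - β 1) (ω 2 - β 2 + 1) (β 0) (β 1) := by
      split_ifs with h0
      -- for `β 2 = 0` the exponents have sum `b + 1`, and the degree bound applies
      · rw [hdeg _ _ _ _ (by omega) (by omega), mul_zero]
      · have h' : ω 2 - (β 2 - 1) = ω 2 - β 2 + 1 := by omega
        simp [h, h']
    rw [t₀, t₁, t₂, hr]
    ring
  have hbal := hh (fun _ => b) (by simp)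
  have h0 : h (fun _ => b) ![0, 0, b] = g b 0 0 0 := by simp [h]
  refine ⟨fun i hi hi' => by rw [← h0]; exact hbal.choose_mul_eq_zero hi hi', fun hg j k p q hjk => ?_⟩
  rcases lt_or_ge b (p + q) with hpq | hpq
  · exact hdeg j k p q hjk hpq
  have key : h ![2 * b - j - k + p, j + q, k + (b - p - q)] ![p, q, b - p - q] = 0 := by
    by_cases hω : (![2 * b - j - k + p, j + q, k + (b - p - q)] : Fin 3 → ℕ) = fun _ => b
    · rw [hω, hbal.eq_choose (by omega), h0, hg, mul_zero]
    · have hs : ∑ i, (![2 * b - j - k + p, j + q, k + (b - p - q)] : Fin 3 → ℕ) i = 3 * b := by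
        simp only [Fin.sum_univ_three, Matrix.cons_val]
        omega
      obtain ⟨i, hi⟩ : ∃ i, b < (![2 * b - j - k + p, j + q, k + (b - p - q)] : Fin 3 → ℕ) i := by
        by_contra! hcon
        apply hω
        have c₀ := hcon 0
        have c₁ := hcon 1
        have c₂ := hcon 2
        simp only [Matrix.cons_val] at c₀ c₁ c₂
        ext i
        fin_cases i <;> simp <;> omega
      refine (hh _ hs).eq_zero_of_lt hi ?_ ?_
      · simp only [Fin.sum_univ_three, Matrix.cons_val]
        omega
      · intro l
        fin_cases l <;> simp
  simp only [h, Matrix.cons_val, Nat.add_sub_cancel] at key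
  have h1 : ((-1 : R) ^ (p + q)) * (-1) ^ (p + q) = 1 := by rw [← mul_pow]; simp
  linear_combination (-1) ^ (p + q) * key - g j k p q * h1

end combinatorics

/-! ### Polynomials on two adjacent charts of the plane -/

section planeCoefficients
variable {R T : Type*} [CommRing R] [CommRing T] {σ : R →+* T} {a : Fin 2 → T}
  (h : Function.Bijective (MvPolynomial.eval₂Hom σ fun j : ULift.{u} (Fin 2) => a j.down))

/-- In a polynomial ring over `R` with the two variables `a 0` and `a 1`, the coefficient at
`a 0 ^ i * a 1 ^ j`. -/
noncomputable def planeCoeff (i j : ℕ) (t : T) : R :=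
  MvPolynomial.coeff (Finsupp.single ⟨0⟩ i + Finsupp.single ⟨1⟩ j)
    ((RingEquiv.ofBijective _ h).symm t)

theorem planeCoeff_eval (i j : ℕ) (q : MvPolynomial (ULift.{u} (Fin 2)) R) :
    planeCoeff h i j (MvPolynomial.eval₂Hom σ (fun j : ULift.{u} (Fin 2) => a j.down) q) =
      MvPolynomial.coeff (Finsupp.single ⟨0⟩ i + Finsupp.single ⟨1⟩ j) q := by
  rw [planeCoeff]
  exact congrArg _ ((RingEquiv.ofBijective _ h).symm_apply_apply q)

theorem planeCoeff_add (i j : ℕ) (s t : T) :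
    planeCoeff h i j (s + t) = planeCoeff h i j s + planeCoeff h i j t := by
  rw [planeCoeff, map_add, MvPolynomial.coeff_add]
  rfl

theorem planeCoeff_neg (i j : ℕ) (t : T) : planeCoeff h i j (-t) = -planeCoeff h i j t := by
  rw [planeCoeff, map_neg, MvPolynomial.coeff_neg]
  rfl

theorem planeCoeff_zero (i j : ℕ) : planeCoeff h i j 0 = 0 := by
  rw [planeCoeff, map_zero, MvPolynomial.coeff_zero]

theorem planeCoeff_C (i j : ℕ) (r : R) :
    planeCoeff h i j (σ r) = if i = 0 ∧ j = 0 then r else 0 := by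
  have := planeCoeff_eval h i j (MvPolynomial.C r)
  rw [MvPolynomial.coe_eval₂Hom, MvPolynomial.eval₂_C, MvPolynomial.coeff_C] at this
  rw [this]
  refine if_congr ⟨fun e => ?_, fun e => by simp [e.1, e.2]⟩ rfl rfl
  have e₀ := DFunLike.congr_fun e ⟨0⟩
  have e₁ := DFunLike.congr_fun e ⟨1⟩
  simp at e₀ e₁
  omega

theorem planeCoeff_fst_mul (i j : ℕ) (t : T) :
    planeCoeff h i j (a 0 * t) = if i = 0 then 0 else planeCoeff h (i - 1) j t := by
  obtain ⟨q, rfl⟩ := h.2 t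
  have e := planeCoeff_eval h i j (MvPolynomial.X ⟨0⟩ * q)
  rw [map_mul, MvPolynomial.coe_eval₂Hom, MvPolynomial.eval₂_X, ← MvPolynomial.coe_eval₂Hom] at e
  rw [e]
  split_ifs with h0
  · subst h0
    rw [MvPolynomial.coeff_X_mul', if_neg (by simp)]
  · obtain ⟨i, rfl⟩ := Nat.exists_eq_succ_of_ne_zero h0
    rw [Nat.succ_sub_one, planeCoeff_eval, Nat.succ_eq_add_one, add_comm i 1, Finsupp.single_add,
      add_assoc, MvPolynomial.coeff_X_mul]

theorem planeCoeff_snd_mul (i j : ℕ) (t : T) :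
    planeCoeff h i j (a 1 * t) = if j = 0 then 0 else planeCoeff h i (j - 1) t := by
  obtain ⟨q, rfl⟩ := h.2 t
  have e := planeCoeff_eval h i j (MvPolynomial.X ⟨1⟩ * q)
  rw [map_mul, MvPolynomial.coe_eval₂Hom, MvPolynomial.eval₂_X, ← MvPolynomial.coe_eval₂Hom] at e
  rw [e]
  split_ifs with h0
  · subst h0
    rw [MvPolynomial.coeff_X_mul', if_neg (by simp)]
  · obtain ⟨j, rfl⟩ := Nat.exists_eq_succ_of_ne_zero h0
    rw [Nat.succ_sub_one, planeCoeff_eval, Nat.succ_eq_add_one, add_comm j 1, Finsupp.single_add,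
      add_left_comm, MvPolynomial.coeff_X_mul]

theorem planeCoeff_snd_pow_mul (i j n : ℕ) (t : T) :
    planeCoeff h i (j + n) (a 1 ^ n * t) = planeCoeff h i j t := by
  induction n with
  | zero => rw [pow_zero, one_mul, add_zero]
  | succ n ih => rw [pow_succ', mul_assoc, planeCoeff_snd_mul, if_neg (by omega), ← ih]; rfl

/-- `t` is a polynomial of total degree at most `n`. -/
def PlaneDegreeLE (n : ℕ) (t : T) : Prop := ∀ i j, n < i + j → planeCoeff h i j t = 0

variable {h} in
theorem PlaneDegreeLE.fst_mul {n : ℕ} {t : T} (ht : PlaneDegreeLE h n t) :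
    PlaneDegreeLE h (n + 1) (a 0 * t) := fun i j hij => by
  rw [planeCoeff_fst_mul]
  split_ifs with h0
  · rfl
  · exact ht _ _ (by omega)

variable {h} in
theorem PlaneDegreeLE.snd_pow_mul {n : ℕ} {t : T} (ht : PlaneDegreeLE h n t) (m : ℕ) :
    PlaneDegreeLE h (n + m) (a 1 ^ m * t) := by
  induction m with
  | zero => simpa using ht
  | succ m ih =>
    intro i j hij
    rw [pow_succ', mul_assoc, planeCoeff_snd_mul]
    split_ifs with h0
    · rfl
    · exact ih _ _ (by omega)

theorem eq_zero_of_planeCoeff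
    (h : Function.Bijective (MvPolynomial.eval₂Hom σ fun j : ULift.{u} (Fin 2) => a j.down))
    {t : T} (H : ∀ i j, planeCoeff h i j t = 0) : t = 0 := by
  obtain ⟨q, rfl⟩ := h.2 t
  suffices q = 0 by rw [this, map_zero]
  ext m
  have e : m = Finsupp.single ⟨0⟩ (m ⟨0⟩) + Finsupp.single ⟨1⟩ (m ⟨1⟩) := by
    ext ⟨k⟩
    fin_cases k <;> simp
  rw [e, ← planeCoeff_eval h, H, MvPolynomial.coeff_zero]

theorem eq_zero_of_snd_pow_mul
    (h : Function.Bijective (MvPolynomial.eval₂Hom σ fun j : ULift.{u} (Fin 2) => a j.down))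
    {n : ℕ} {t : T} (H : a 1 ^ n * t = 0) : t = 0 :=
  eq_zero_of_planeCoeff h fun i j => by
    rw [← planeCoeff_snd_pow_mul h i j n t, H, planeCoeff_zero]

/-- A function on one chart of the plane has, over an adjacent chart with variables `a'` such that
`a 1 * a' 0 = - a 0` and `a 1 * a' 1 = 1`, a pole along `a 1 = 0` of order bounded by its degree:
here `ρ` and `ρ'` stand for the restriction maps to the intersection of the two charts. -/
theorem exists_planeDegreeLE {T' T'' : Type*} [CommRing T'] [CommRing T''] {σ' : R →+* T'}
    {a' : Fin 2 → T'} (h' : Function.Surjective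
      (MvPolynomial.eval₂Hom σ' fun j : ULift.{u} (Fin 2) => a' j.down))
    (ρ : T →+* T'') (ρ' : T' →+* T'') (hσ : ∀ r, ρ (σ r) = ρ' (σ' r))
    (h₀ : ρ (a 1) * ρ' (a' 0) = -ρ (a 0)) (h₁ : ρ (a 1) * ρ' (a' 1) = 1) (t : T') :
    ∃ (N : ℕ) (s : T), ρ s = ρ (a 1) ^ N * ρ' t ∧ PlaneDegreeLE h N s := by
  obtain ⟨q, rfl⟩ := h' t
  induction q using MvPolynomial.induction_on with
  | C r =>
    refine ⟨0, σ r, ?_, fun i j hij => ?_⟩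
    · rw [hσ, pow_zero, one_mul, MvPolynomial.coe_eval₂Hom, MvPolynomial.eval₂_C]
    · rw [planeCoeff_C, if_neg (by omega)]
  | add p q hp hq =>
    obtain ⟨N, s, hs, hsd⟩ := hp
    obtain ⟨N', s', hs', hsd'⟩ := hq
    refine ⟨N + N', a 1 ^ N' * s + a 1 ^ N * s', ?_, fun i j hij => ?_⟩
    · simp only [map_add, map_mul, map_pow, hs, hs']
      ring
    · rw [planeCoeff_add, hsd.snd_pow_mul N' i j hij, hsd'.snd_pow_mul N i j (by omega), add_zero]
  | mul_X q k hq =>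
    obtain ⟨N, s, hs, hsd⟩ := hq
    have e : MvPolynomial.eval₂Hom σ' (fun j : ULift.{u} (Fin 2) => a' j.down)
        (q * MvPolynomial.X k) =
        MvPolynomial.eval₂Hom σ' (fun j : ULift.{u} (Fin 2) => a' j.down) q * a' k.down := by
      rw [map_mul]
      exact congrArg _ (MvPolynomial.eval₂_X _ _ _)
    rw [e, map_mul]
    obtain ⟨k⟩ := k
    obtain rfl | rfl : k = 0 ∨ k = 1 := by omega
    · refine ⟨N + 1, -(a 0 * s), ?_, fun i j hij => ?_⟩
      · rw [map_neg, map_mul, hs]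
        linear_combination (-ρ (a 1) ^ N * ρ' (MvPolynomial.eval₂Hom σ' _ q)) * h₀
      · rw [planeCoeff_neg, hsd.fst_mul i j hij, neg_zero]
    · refine ⟨N + 1, s, ?_, fun i j hij => hsd i j (by omega)⟩
      rw [hs]
      linear_combination (-ρ (a 1) ^ N * ρ' (MvPolynomial.eval₂Hom σ' _ q)) * h₁

/-- A function `s` whose restriction is `a 1 ^ b` times a function on the adjacent chart has degree
at most `b`. -/
theorem planeDegreeLE_of_adjacent {T' T'' : Type*} [CommRing T'] [CommRing T''] {σ' : R →+* T'}
    {a' : Fin 2 → T'} (h' : Function.Surjective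
      (MvPolynomial.eval₂Hom σ' fun j : ULift.{u} (Fin 2) => a' j.down))
    (ρ : T →+* T'') (ρ' : T' →+* T'') (hσ : ∀ r, ρ (σ r) = ρ' (σ' r))
    (h₀ : ρ (a 1) * ρ' (a' 0) = -ρ (a 0)) (h₁ : ρ (a 1) * ρ' (a' 1) = 1)
    (hρ : Function.Injective ρ) {b : ℕ} {s : T} {t : T'} (hst : ρ s = ρ (a 1) ^ b * ρ' t) :
    PlaneDegreeLE h b s := by
  obtain ⟨N, s', hs', hd⟩ := exists_planeDegreeLE h h' ρ ρ' hσ h₀ h₁ t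
  have e : a 1 ^ N * s = a 1 ^ b * s' := hρ (by
    rw [map_mul, map_mul, map_pow, map_pow, hst, hs']
    ring)
  intro i j hij
  rw [← planeCoeff_snd_pow_mul h i j N, e]
  exact hd.snd_pow_mul b i (j + N) (by omega)

end planeCoefficients

/-! ### The standard charts of the bundle of planes -/

section planeCharts
variable {S : Scheme.{u}} {V : S.Modules} {P : FlagScheme V ![2]} {O : S.Opens}
  {v v' : Fin 3 → Γ(V, O)} {U : P.X.Opens}

/-- Cramer's rule: the graph form of the span of two vectors with an invertible minor. -/
theorem cramer_smul {R M : Type*} [CommRing R] [AddCommGroup M] [Module R M] (x y z : M)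
    {m₀ m₁ m₂ n₀ n₁ n₂ r : R} (h : (m₀ * n₁ - m₁ * n₀) * r = 1) :
    (r * n₁) • (m₀ • x + m₁ • y + m₂ • z) - (r * m₁) • (n₀ • x + n₁ • y + n₂ • z) =
        x + (r * n₁ * m₂ - r * m₁ * n₂) • z ∧
      (r * m₀) • (n₀ • x + n₁ • y + n₂ • z) - (r * n₀) • (m₀ • x + m₁ • y + m₂ • z) =
        y + (r * m₀ * n₂ - r * n₀ * m₂) • z := by
  constructor <;> match_scalars <;> first | linear_combination h | ring

theorem res_smul_add_three {X : Scheme.{u}} {M : X.Modules} {U W : X.Opens} (h : U ≤ W)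
    (a b c : Γ(X, W)) (x y z : Γ(M, W)) : res h (a • x + b • y + c • z) =
      resO h a • res h x + resO h b • res h y + resO h c • res h z := by
  simp only [map_add, map_smulₛₗ]

theorem app_cramer {X : Scheme.{u}} {M N : X.Modules} {U : X.Opens} (φ : M ⟶ N) {s t : Γ(M, U)}
    {x y z : Γ(N, U)} {m₀ m₁ m₂ n₀ n₁ n₂ r : Γ(X, U)} (h : (m₀ * n₁ - m₁ * n₀) * r = 1)
    (hs : Hom.app φ U s = m₀ • x + m₁ • y + m₂ • z)
    (ht : Hom.app φ U t = n₀ • x + n₁ • y + n₂ • z) :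
    Hom.app φ U ((r * n₁) • s - (r * m₁) • t) = x + (r * n₁ * m₂ - r * m₁ * n₂) • z ∧
      Hom.app φ U ((r * m₀) • t - (r * n₀) • s) = y + (r * m₀ * n₂ - r * n₀ * m₂) • z := by
  constructor
  · rw [map_sub, Hom.app_smul, Hom.app_smul, hs, ht]
    exact (cramer_smul x y z h).1
  · rw [map_sub, Hom.app_smul, Hom.app_smul, hs, ht]
    exact (cramer_smul x y z h).2

variable (P v) in
/-- The standard chart of the bundle of planes, over an open set `O` on which `V` has the basis `v`,
formed by the planes that are graphs over `v 0` and `v 1`. The tautological plane has there the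
frame `v 0 + a 0 • v 2`, `v 1 + a 1 • v 2`, and `a 0`, `a 1` are the coordinates of the chart. -/
structure PlaneChart where
  D : P.X.Opens
  le : D ≤ P.π ⁻¹ᵁ O
  a : Fin 2 → Γ(P.X, D)
  φ : Frame (tautTwo P) D
  e₁_eq : Hom.app (tautTwoι P) D φ.e₁ = res le (unitSec P.π (v 0)) + a 0 • res le (unitSec P.π (v 2))
  e₂_eq : Hom.app (tautTwoι P) D φ.e₂ = res le (unitSec P.π (v 1)) + a 1 • res le (unitSec P.π (v 2))
  maximal : ∀ (U : P.X.Opens) (hU : U ≤ P.π ⁻¹ᵁ O) (s t : Γ(tautTwo P, U)) (r r' : Γ(P.X, U)),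
    Hom.app (tautTwoι P) U s = res hU (unitSec P.π (v 0)) + r • res hU (unitSec P.π (v 2)) →
    Hom.app (tautTwoι P) U t = res hU (unitSec P.π (v 1)) + r' • res hU (unitSec P.π (v 2)) → U ≤ D
  isAffineOpen : IsAffineOpen D
  bijective : Function.Bijective (MvPolynomial.eval₂Hom ((resO le).comp (P.π.app O).hom)
    fun j : ULift.{u} (Fin 2) => a j.down)

theorem isBasis_comp_three (hv : IsBasis v) (σ : Fin 3 ≃ Fin 3) (h : ∀ i, v' i = v (σ i)) :
    IsBasis v' := by
  rw [show v' = fun i => v (σ i) from funext h]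
  exact hv.reindex σ

/-- Over an affine open set the standard charts exist. -/
theorem nonempty_planeChart (hO : IsAffineOpen O) (hv : IsBasis v) : Nonempty (PlaneChart P v) := by
  let w : Fin 2 ⊕ Fin 1 → Γ(V, O) := fun j => v ((finSumFinEquiv : Fin 2 ⊕ Fin 1 ≃ Fin 3) j)
  have hw : IsBasis w := hv.reindex (finSumFinEquiv : Fin 2 ⊕ Fin 1 ≃ Fin 3)
  have w0 : w (Sum.inl 0) = v 0 := rfl
  have w1 : w (Sum.inl 1) = v 1 := rfl
  have w2 : w (Sum.inr 0) = v 2 := rfl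
  obtain ⟨D, hD, a, ha, hmax, haff, hbij⟩ := P.exists_chart hO hw
  have hg := adapted_graph P.hasRank_taut ((hw.unitSec (g := P.π)).res hD) ha
  obtain ⟨z, hz, hze⟩ := hg.exists_basis
  refine ⟨⟨D, hD, a, IsBasis.frame (M := tautTwo P) hz, ?_, ?_, ?_, haff, hbij⟩⟩
  · refine (hze 0).trans ?_
    simp [graphVec, w0, w2]
  · refine (hze 1).trans ?_
    simp [graphVec, w1, w2]
  · intro U hU s t r r' hs ht
    refine hmax U hU (fun i _ => ![r, r'] i) fun i => ?_
    obtain rfl | rfl : i = 0 ∨ i = 1 := by omega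
    · refine ⟨s, hs.trans ?_⟩
      simp [graphVec, w0, w2]
    · refine ⟨t, ht.trans ?_⟩
      simp [graphVec, w1, w2]

namespace PlaneChart
variable (K : PlaneChart P v) (K' : PlaneChart P v')

theorem app_res_e₁ (h : U ≤ K.D) : Hom.app (tautTwoι P) U (res h K.φ.e₁) =
    res (h.trans K.le) (unitSec P.π (v 0)) +
      resO h (K.a 0) • res (h.trans K.le) (unitSec P.π (v 2)) := by
  rw [app_res, K.e₁_eq, map_add, map_smulₛₗ, FlagCohomology.res_res, FlagCohomology.res_res]

theorem app_res_e₂ (h : U ≤ K.D) : Hom.app (tautTwoι P) U (res h K.φ.e₂) =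
    res (h.trans K.le) (unitSec P.π (v 1)) +
      resO h (K.a 1) • res (h.trans K.le) (unitSec P.π (v 2)) := by
  rw [app_res, K.e₂_eq, map_add, map_smulₛₗ, FlagCohomology.res_res, FlagCohomology.res_res]

/-- The tautological plane meets the line spanned by `v 2` trivially. -/
theorem eq_zero_of_app_eq (hv : IsBasis v) (h : U ≤ K.D) {s : Γ(tautTwo P, U)} {r : Γ(P.X, U)}
    (hs : Hom.app (tautTwoι P) U s = r • res (h.trans K.le) (unitSec P.π (v 2))) :
    s = 0 ∧ r = 0 := by
  have he := hv.unitSec (g := P.π)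
  have hU := h.trans K.le
  have hspan := K.φ.span h s
  generalize ev (res h K.φ.x) s = x at hspan
  generalize ev (res h K.φ.y) s = y at hspan
  rw [hspan, map_add, Hom.app_smul, Hom.app_smul, K.app_res_e₁, K.app_res_e₂] at hs
  have key (i) := congrFun (congrArg (he.coord hU) hs) i
  simp only [map_add, LinearMap.map_smul, he.coord_self, Pi.add_apply, Pi.smul_apply, smul_add,
    smul_eq_mul] at key
  have k0 := key 0
  have k1 := key 1
  have k2 := key 2
  simp at k0 k1 k2
  rw [k0, k1] at hspan k2
  simp at hspan k2
  exact ⟨hspan, k2.symm⟩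

section adjacent
/-- Change of the first frame vector, and of the first coordinate, between the charts belonging to
the bases `(v₀, v₁, v₂)` and `(v₀, v₂, v₁)`. -/
theorem adjacent_e₁ (hv : IsBasis v) (hU : U ≤ K.D) (hU' : U ≤ K'.D) (h₀ : v' 0 = v 0)
    (h₂ : v' 2 = v 1) :
    res hU' K'.φ.e₁ = res hU K.φ.e₁ + resO hU' (K'.a 0) • res hU K.φ.e₂ ∧
      resO hU (K.a 1) * resO hU' (K'.a 0) = -resO hU (K.a 0) := by
  have := K.eq_zero_of_app_eq hv hU
    (s := res hU' K'.φ.e₁ - (res hU K.φ.e₁ + resO hU' (K'.a 0) • res hU K.φ.e₂))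
    (r := -(resO hU (K.a 0) + resO hU' (K'.a 0) * resO hU (K.a 1))) (by
      rw [map_sub, map_add, Hom.app_smul, K.app_res_e₁, K.app_res_e₂, K'.app_res_e₁, h₀, h₂]
      module)
  exact ⟨sub_eq_zero.1 this.1, by linear_combination -this.2⟩

/-- Change of the second frame vector, and of the second coordinate, between these charts. -/
theorem adjacent_e₂ (hv : IsBasis v) (hU : U ≤ K.D) (hU' : U ≤ K'.D) (h₁ : v' 1 = v 2)
    (h₂ : v' 2 = v 1) :
    res hU' K'.φ.e₂ = resO hU' (K'.a 1) • res hU K.φ.e₂ ∧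
      resO hU (K.a 1) * resO hU' (K'.a 1) = 1 := by
  have := K.eq_zero_of_app_eq hv hU
    (s := res hU' K'.φ.e₂ - resO hU' (K'.a 1) • res hU K.φ.e₂)
    (r := 1 - resO hU' (K'.a 1) * resO hU (K.a 1)) (by
      rw [map_sub, Hom.app_smul, K.app_res_e₂, K'.app_res_e₂, h₁, h₂]
      module)
  exact ⟨sub_eq_zero.1 this.1, by linear_combination -this.2⟩

/-- The intersection of two adjacent charts is the locus where the second coordinate is
invertible. -/
theorem inf_eq_basicOpen (hv : IsBasis v) (h₀ : v' 0 = v 0) (h₁ : v' 1 = v 2) (h₂ : v' 2 = v 1) :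
    K.D ⊓ K'.D = P.X.basicOpen (K.a 1) := by
  refine le_antisymm ?_ (le_inf (P.X.basicOpen_le _) ?_)
  · have h := (K.adjacent_e₂ K' hv (inf_le_left : K.D ⊓ K'.D ≤ _) inf_le_right h₁ h₂).2
    have h₁ := Scheme.basicOpen_of_isUnit P.X (isUnit_iff_exists_inv.2 ⟨_, h⟩)
    have h₂ : P.X.basicOpen (resO (inf_le_left : K.D ⊓ K'.D ≤ K.D) (K.a 1)) =
        (K.D ⊓ K'.D) ⊓ P.X.basicOpen (K.a 1) :=
      P.X.basicOpen_res (K.a 1) (homOfLE (inf_le_left : K.D ⊓ K'.D ≤ K.D)).op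
    rw [h₁] at h₂
    exact h₂.le.trans inf_le_right
  · have hB := P.X.basicOpen_le (K.a 1)
    obtain ⟨r, hr⟩ := isUnit_iff_exists_inv.1 (isUnit_resO_basicOpen (K.a 1))
    refine K'.maximal _ (hB.trans K.le) (res hB K.φ.e₁ - (r * resO hB (K.a 0)) • res hB K.φ.e₂)
      (r • res hB K.φ.e₂) (-(r * resO hB (K.a 0))) r ?_ ?_
    · rw [map_sub, Hom.app_smul, K.app_res_e₁, K.app_res_e₂, h₀, h₂, smul_add, smul_smul,
        show r * resO hB (K.a 0) * resO hB (K.a 1) = resO hB (K.a 0) by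
          linear_combination resO hB (K.a 0) * hr]
      module
    · rw [Hom.app_smul, K.app_res_e₂, h₁, h₂, smul_add, smul_smul, mul_comm r, hr, one_smul,
        add_comm]

end adjacent

/-- The open set where a minor of a pair of sections of the tautological plane is invertible lies
in the corresponding chart. -/
theorem le_of_minor (hU : U ≤ P.π ⁻¹ᵁ O) (s t : Γ(tautTwo P, U)) (m n : Fin 3 → Γ(P.X, U))
    (hs : Hom.app (tautTwoι P) U s = m 0 • res hU (unitSec P.π (v 0)) +
      m 1 • res hU (unitSec P.π (v 1)) + m 2 • res hU (unitSec P.π (v 2)))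
    (ht : Hom.app (tautTwoι P) U t = n 0 • res hU (unitSec P.π (v 0)) +
      n 1 • res hU (unitSec P.π (v 1)) + n 2 • res hU (unitSec P.π (v 2))) :
    P.X.basicOpen (m 0 * n 1 - m 1 * n 0) ≤ K.D := by
  have hB := P.X.basicOpen_le (m 0 * n 1 - m 1 * n 0)
  obtain ⟨r, hr⟩ := isUnit_iff_exists_inv.1 (isUnit_resO_basicOpen (m 0 * n 1 - m 1 * n 0))
  rw [map_sub, map_mul, map_mul] at hr
  have hres (f : Γ(tautTwo P, U)) (m : Fin 3 → Γ(P.X, U))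
      (hf : Hom.app (tautTwoι P) U f = m 0 • res hU (unitSec P.π (v 0)) +
        m 1 • res hU (unitSec P.π (v 1)) + m 2 • res hU (unitSec P.π (v 2))) :
      Hom.app (tautTwoι P) _ (res hB f) =
        resO hB (m 0) • res (hB.trans hU) (unitSec P.π (v 0)) +
          resO hB (m 1) • res (hB.trans hU) (unitSec P.π (v 1)) +
          resO hB (m 2) • res (hB.trans hU) (unitSec P.π (v 2)) := by
    rw [app_res, hf]
    exact (res_smul_add_three hB _ _ _ _ _ _).trans (by
      rw [FlagCohomology.res_res, FlagCohomology.res_res, FlagCohomology.res_res])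
  have key := app_cramer (tautTwoι P) hr (hres s m hs) (hres t n ht)
  exact K.maximal _ (hB.trans hU) _ _ _ _ key.1 key.2

end PlaneChart

/-- The three standard charts cover the bundle of planes. -/
theorem mem_planeChart (hV : HasRank V 3) (hv : IsBasis v) (K₁ : PlaneChart P v)
    (K₂ : PlaneChart P ![v 0, v 2, v 1]) (K₃ : PlaneChart P ![v 1, v 2, v 0]) {x : P.X}
    (hx : x ∈ P.π ⁻¹ᵁ O) : x ∈ K₁.D ∨ x ∈ K₂.D ∨ x ∈ K₃.D := by
  obtain ⟨W, hW, hxW, ⟨φ⟩⟩ := exists_frame hx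
  obtain ⟨W', hW', e, hxW', -, he, he₁, he₂⟩ := exists_adapted_frame hV φ hxW
  have hU := hW'.trans hW
  have hE := hv.unitSec (g := P.π)
  let m := hE.coord hU (e (Sum.inl 0))
  let n := hE.coord hU (e (Sum.inl 1))
  let c (k : Fin 3) := he.basis.coord le_rfl (res hU (unitSec P.π (v k)))
  have hm : Hom.app (tautTwoι P) W' (φ.res hW').e₁ = m 0 • res hU (unitSec P.π (v 0)) +
      m 1 • res hU (unitSec P.π (v 1)) + m 2 • res hU (unitSec P.π (v 2)) := by
    rw [← he₁, ← hE.linComb_coord hU (e (Sum.inl 0)), linComb, Fin.sum_univ_three]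
  have hn : Hom.app (tautTwoι P) W' (φ.res hW').e₂ = n 0 • res hU (unitSec P.π (v 0)) +
      n 1 • res hU (unitSec P.π (v 1)) + n 2 • res hU (unitSec P.π (v 2)) := by
    rw [← he₂, ← hE.linComb_coord hU (e (Sum.inl 1)), linComb, Fin.sum_univ_three]
  -- the product of the two coordinate matrices is the identity
  have hmc (j) : he.basis.coord le_rfl (e (Sum.inl 0)) j =
      m 0 * c 0 j + m 1 * c 1 j + m 2 * c 2 j := by
    rw [he₁, hm]
    simp only [map_add, LinearMap.map_smul, Pi.add_apply, Pi.smul_apply, smul_eq_mul, c]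
  have hnc (j) : he.basis.coord le_rfl (e (Sum.inl 1)) j =
      n 0 * c 0 j + n 1 * c 1 j + n 2 * c 2 j := by
    rw [he₂, hn]
    simp only [map_add, LinearMap.map_smul, Pi.add_apply, Pi.smul_apply, smul_eq_mul, c]
  have hself (i j) : he.basis.coord le_rfl (e i) j = (Pi.single i 1 : _ → Γ(P.X, W')) j := by
    rw [← he.basis.coord_self le_rfl i, res_refl]
  have h00 := (hmc (Sum.inl 0)).symm.trans (hself _ _)
  have h01 := (hmc (Sum.inl 1)).symm.trans (hself _ _)
  have h10 := (hnc (Sum.inl 0)).symm.trans (hself _ _)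
  have h11 := (hnc (Sum.inl 1)).symm.trans (hself _ _)
  simp only [Pi.single_apply, Sum.inl.injEq, if_true, one_ne_zero, zero_ne_one,
    if_false] at h00 h01 h10 h11
  -- the Cauchy–Binet formula
  have hdet : (c 0 (Sum.inl 0) * c 1 (Sum.inl 1) - c 1 (Sum.inl 0) * c 0 (Sum.inl 1)) *
      (m 0 * n 1 - m 1 * n 0) +
      ((c 0 (Sum.inl 0) * c 2 (Sum.inl 1) - c 2 (Sum.inl 0) * c 0 (Sum.inl 1)) *
        (m 0 * n 2 - m 2 * n 0) +
      (c 1 (Sum.inl 0) * c 2 (Sum.inl 1) - c 2 (Sum.inl 0) * c 1 (Sum.inl 1)) *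
        (m 1 * n 2 - m 2 * n 1)) = 1 := by
    linear_combination (n 0 * c 0 (Sum.inl 1) + n 1 * c 1 (Sum.inl 1) + n 2 * c 2 (Sum.inl 1)) *
      h00 + h11 - (n 0 * c 0 (Sum.inl 0) + n 1 * c 1 (Sum.inl 0) + n 2 * c 2 (Sum.inl 0)) * h01
  by_contra hcon
  push Not at hcon
  have z₁ : x ∉ P.X.basicOpen (m 0 * n 1 - m 1 * n 0) := fun h =>
    hcon.1 (K₁.le_of_minor hU _ _ m n hm hn h)
  have z₂ : x ∉ P.X.basicOpen (m 0 * n 2 - m 2 * n 0) := fun h =>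
    hcon.2.1 (K₂.le_of_minor hU _ _ ![m 0, m 2, m 1] ![n 0, n 2, n 1]
      (hm.trans (add_right_comm _ _ _)) (hn.trans (add_right_comm _ _ _)) h)
  have z₃ : x ∉ P.X.basicOpen (m 1 * n 2 - m 2 * n 1) := fun h =>
    hcon.2.2 (K₃.le_of_minor hU _ _ ![m 1, m 2, m 0] ![n 1, n 2, n 0]
      (hm.trans (by rw [add_assoc, add_comm]; rfl)) (hn.trans (by rw [add_assoc, add_comm]; rfl)) h)
  rw [P.X.mem_basicOpen _ x hxW'] at z₁ z₂ z₃
  have h1 := congrArg (P.X.presheaf.germ W' x hxW') hdet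
  rw [map_add, map_add, map_mul, map_mul (P.X.presheaf.germ W' x hxW').hom (_ - _) (_ - _),
    map_mul (P.X.presheaf.germ W' x hxW').hom (_ - _) (_ - _), map_one] at h1
  rcases IsLocalRing.isUnit_or_isUnit_of_add_one h1 with h | h
  · exact z₁ (isUnit_of_mul_isUnit_right h)
  · rcases IsLocalRing.isUnit_or_isUnit_of_isUnit_add h with h | h
    · exact z₂ (isUnit_of_mul_isUnit_right h)
    · exact z₃ (isUnit_of_mul_isUnit_right h)

end planeCharts

/-! ### Values of a section on monomials -/

section values
open Polynomial
variable {X : Scheme.{u}} {M : X.Modules} {U W : X.Opens} {n : ℕ}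

/-- The value of a linear form `γ` on `Sym^n(M^∨)` at the element `∑ᵢ fᵢ x^(n-i) y^i`, that is at
the homogenization of the polynomial `f`. -/
noncomputable def Frame.polyVal (φ : Frame M W) (γ : Γ(divPow M n, W)) (f : Γ(X, W)[X]) :
    Γ(X, W) :=
  ∑ i ∈ Finset.range (n + 1), f.coeff i * ev γ (φ.monomial n i)

theorem Frame.polyVal_add (φ : Frame M W) (γ : Γ(divPow M n, W)) (f g : Γ(X, W)[X]) :
    φ.polyVal γ (f + g) = φ.polyVal γ f + φ.polyVal γ g := by
  simp only [polyVal, coeff_add, add_mul, Finset.sum_add_distrib]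

theorem Frame.polyVal_C_mul (φ : Frame M W) (γ : Γ(divPow M n, W)) (a : Γ(X, W)) (f : Γ(X, W)[X]) :
    φ.polyVal γ (C a * f) = a * φ.polyVal γ f := by
  simp only [polyVal, coeff_C_mul, Finset.mul_sum, mul_assoc]

theorem Frame.polyVal_X_pow (φ : Frame M W) (γ : Γ(divPow M n, W)) {j : ℕ} (hj : j ≤ n) :
    φ.polyVal γ (Polynomial.X ^ j) = ev γ (φ.monomial n j) := by
  rw [polyVal, Finset.sum_eq_single j]
  · rw [coeff_X_pow_self, one_mul]
  · intro i _ hi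
    rw [coeff_X_pow, if_neg hi, zero_mul]
  · intro h
    exact absurd (Finset.mem_range.2 (Nat.lt_succ_of_le hj)) h

theorem Frame.resO_polyVal (φ : Frame M W) (h : U ≤ W) (γ : Γ(divPow M n, W)) (f : Γ(X, W)[X]) :
    resO h (φ.polyVal γ f) =
      (φ.res h).polyVal (FlagCohomology.res (M := divPow M n) h γ) (f.map (resO h)) := by
  simp only [polyVal, map_sum, map_mul, φ.resO_ev_monomial h, coeff_map]

theorem Frame.polyVal_smul (φ : Frame M W) (a : Γ(X, W)) (γ : Γ(divPow M n, W)) (f : Γ(X, W)[X]) :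
    φ.polyVal (a • γ) f = a * φ.polyVal γ f := by
  simp only [polyVal, smul_divPow_ev, Finset.mul_sum, mul_left_comm]

theorem Frame.dual_eq (φ ψ : Frame M W) {a c : Γ(X, W)} (h₁ : φ.e₁ = ψ.e₁ + a • ψ.e₂)
    (h₂ : φ.e₂ = c • ψ.e₂) : ψ.x = φ.x ∧ ψ.y = a • φ.x + c • φ.y := by
  constructor <;> refine φ.isBasis.dual_ext le_rfl fun i => ?_ <;>
    obtain rfl | rfl : i = 0 ∨ i = 1 := by fin_cases i <;> simp
  all_goals rw [FlagCohomology.res_refl]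
  · change ev _ φ.e₁ = ev _ φ.e₁
    rw [φ.x_e₁, h₁, ev_add, ev_smul, ψ.x_e₁, ψ.x_e₂, mul_zero, add_zero]
  · change ev _ φ.e₂ = ev _ φ.e₂
    rw [φ.x_e₂, h₂, ev_smul, ψ.x_e₂, mul_zero]
  · change ev _ φ.e₁ = ev _ φ.e₁
    rw [add_ev, smul_ev, smul_ev, φ.x_e₁, φ.y_e₁, h₁, ev_add, ev_smul, ψ.y_e₁, ψ.y_e₂]
    ring
  · change ev _ φ.e₂ = ev _ φ.e₂
    rw [add_ev, smul_ev, smul_ev, φ.x_e₂, φ.y_e₂, h₂, ev_smul, ψ.y_e₂]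
    ring

theorem Frame.smul_det (φ ψ : Frame M W) {a c : Γ(X, W)} (h₁ : φ.e₁ = ψ.e₁ + a • ψ.e₂)
    (h₂ : φ.e₂ = c • ψ.e₂) {d : Γ(dual (extPow M 2), W)} (hd : ev d (wedge ![φ.e₁, φ.e₂]) = 1) :
    ev (c • d) (wedge ![ψ.e₁, ψ.e₂]) = 1 := by
  have h := wedge_two ψ.e₁ ψ.e₂ 1 a 0 c
  rw [zero_smul, one_smul, zero_add, ← h₁, ← h₂] at h
  rw [h, ev_smul] at hd
  rw [smul_ev, ← hd]
  ring

/-- The effect on the values of a change of the frame that fixes `x`. -/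
theorem Frame.polyVal_comp (φ ψ : Frame M W) {a c : Γ(X, W)} (h₁ : φ.e₁ = ψ.e₁ + a • ψ.e₂)
    (h₂ : φ.e₂ = c • ψ.e₂) (γ : Γ(divPow M n, W)) {f : Γ(X, W)[X]} (hf : f.natDegree ≤ n) :
    ψ.polyVal γ f = φ.polyVal γ (f.comp (C a + C c * Polynomial.X)) := by
  obtain ⟨hx, hy⟩ := φ.dual_eq ψ h₁ h₂
  have hmono (j : ℕ) (hj : j ∈ Finset.range (n + 1)) : ev γ (ψ.monomial n j) =
      φ.polyVal γ ((C a + C c * Polynomial.X) ^ j) := by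
    rw [φ.monomial_eq ψ (a := 1) (b := 0) (by rw [hx, one_smul, zero_smul, add_zero]) hy
      (Nat.lt_succ_iff.1 (Finset.mem_range.1 hj)), polyVal]
    refine (ev_sum (M := symPow (dual M) n) γ _ _).trans (Finset.sum_congr rfl fun i _ => ?_)
    refine (ev_smul (M := symPow (dual M) n) γ _ _).trans ?_
    rw [C_1, C_0, zero_mul, add_zero, one_pow, one_mul]
  rw [polyVal, Finset.sum_congr rfl fun j hj => congrArg _ (hmono j hj)]
  conv_rhs => rw [f.as_sum_range_C_mul_X_pow' (Nat.lt_succ_of_le hf)]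
  rw [sum_comp]
  simp only [polyVal, finsetSum_coeff, Finset.sum_mul, Finset.mul_sum]
  rw [Finset.sum_comm]
  refine Finset.sum_congr rfl fun i _ => Finset.sum_congr rfl fun j _ => ?_
  rw [mul_comp, C_comp, pow_comp, X_comp, coeff_C_mul, mul_assoc]

theorem zero_tmul {N L : X.Modules} (m : Γ(L, W)) : tmul (0 : Γ(N, W)) m = 0 := by
  have h := add_tmul (0 : Γ(N, W)) 0 m
  rwa [add_zero, left_eq_add] at h

theorem tmul_tpowSec_smul {N L : X.Modules} (c : Γ(X, W)) (m : Γ(N, W)) (d : Γ(L, W)) (b : ℕ) :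
    (tmul m (tpowSec (c • d) b) : Γ(tensor N (tpow L b), W)) = tmul (c ^ b • m) (tpowSec d b) := by
  rw [tpowSec_smul, tmul_smul, smul_tmul]

/-- Restriction to an open set is injective on the sections of `Γ^n(M) ⊗ det^(-b)(M)` if it is so
on functions, when `M` has a frame. -/
theorem Frame.eq_zero_of_res (φ : Frame M W) (h : U ≤ W) (hinj : Function.Injective (resO h)) {b : ℕ}
    {s : Γ(gammaDetOf M n b, W)} (hs : FlagCohomology.res h s = 0) : s = 0 := by
  obtain ⟨d, hd⟩ := φ.exists_det
  obtain ⟨γ, rfl⟩ := (φ.bijective_tmul hd n b).2 s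
  have h₁ := (res_tmul_tpowSec_det h γ d b).symm.trans hs
  have h₂ := ((φ.res h).bijective_tmul (φ.res_det h hd) n b).1
    (a₁ := FlagCohomology.res (M := divPow M n) h γ) (a₂ := 0)
    (h₁.trans (zero_tmul _).symm)
  have h₃ : γ = 0 := φ.divPow_ext fun j _ => hinj (by
    rw [φ.resO_ev_monomial h, h₂, ← φ.res_monomial h]
    exact (map_zero (resO h)).symm)
  rw [h₃]
  exact zero_tmul _

end values

/-! ### Global sections on two adjacent charts -/

section planeSections
variable {S : Scheme.{u}} {V : S.Modules} {P : FlagScheme V ![2]} {O : S.Opens}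
  {v v' : Fin 3 → Γ(V, O)} {b : ℕ}
namespace PlaneChart

/-- The value of `γ` at `x^(2b-j-k) y^j z^k`, where `z = a 0 x + a 1 y` is the coordinate on the
tautological plane given by the third basis vector of `V`. -/
noncomputable def value (K : PlaneChart P v) (γ : Γ(divPow (tautTwo P) (2 * b), K.D)) (j k : ℕ) :
    Γ(P.X, K.D) :=
  K.φ.polyVal γ (Polynomial.X ^ j *
    (Polynomial.C (K.a 0) + Polynomial.C (K.a 1) * Polynomial.X) ^ k)

theorem value_succ (K : PlaneChart P v) (γ : Γ(divPow (tautTwo P) (2 * b), K.D)) (j k : ℕ) :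
    K.value γ j (k + 1) = K.a 0 * K.value γ j k + K.a 1 * K.value γ (j + 1) k := by
  simp only [value]
  rw [← K.φ.polyVal_C_mul, ← K.φ.polyVal_C_mul, ← K.φ.polyVal_add]
  congr 1
  ring

theorem value_zero (K : PlaneChart P v) (γ : Γ(divPow (tautTwo P) (2 * b), K.D)) {j : ℕ}
    (hj : j ≤ 2 * b) : K.value γ j 0 = ev γ (K.φ.monomial (2 * b) j) := by
  rw [value, pow_zero, mul_one, K.φ.polyVal_X_pow γ hj]

variable (K : PlaneChart P v) (K' : PlaneChart P v')

theorem injective_resO (hv : IsBasis v) (h₀ : v' 0 = v 0) (h₁ : v' 1 = v 2) (h₂ : v' 2 = v 1) :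
    Function.Injective (resO (inf_le_left : K.D ⊓ K'.D ≤ K.D)) := by
  refine (injective_iff_map_eq_zero _).2 fun t ht => ?_
  obtain ⟨n, hn⟩ := exists_pow_mul_eq_zero K.isAffineOpen (K.a 1)
    (K.inf_eq_basicOpen K' hv h₀ h₁ h₂) inf_le_left ht
  exact eq_zero_of_snd_pow_mul K.bijective hn

/-- The exchange of the roles of `y` and `z` between two adjacent charts. -/
theorem resO_value (hv : IsBasis v) (hv' : IsBasis v') (h₀ : v' 0 = v 0) (h₁ : v' 1 = v 2)
    (h₂ : v' 2 = v 1) {s : Γ(gammaDet P (2 * b) b, P.π ⁻¹ᵁ O)}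
    {γ : Γ(divPow (tautTwo P) (2 * b), K.D)} {γ' : Γ(divPow (tautTwo P) (2 * b), K'.D)}
    {d : Γ(dual (extPow (tautTwo P) 2), K.D)} {d' : Γ(dual (extPow (tautTwo P) 2), K'.D)}
    (hd : ev d (wedge ![K.φ.e₁, K.φ.e₂]) = 1) (hd' : ev d' (wedge ![K'.φ.e₁, K'.φ.e₂]) = 1)
    (hγ : res (M := gammaDet P (2 * b) b) K.le s = tmul γ (tpowSec d b))
    (hγ' : res (M := gammaDet P (2 * b) b) K'.le s = tmul γ' (tpowSec d' b)) {j k : ℕ}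
    (hjk : j + k ≤ 2 * b) :
    resO (inf_le_left : K.D ⊓ K'.D ≤ K.D) (K.value γ j k) =
      resO (inf_le_left : K.D ⊓ K'.D ≤ K.D) (K.a 1) ^ b *
        resO (inf_le_right : K.D ⊓ K'.D ≤ K'.D) (K'.value γ' k j) := by
  have hU : K.D ⊓ K'.D ≤ K.D := inf_le_left
  have hU' : K.D ⊓ K'.D ≤ K'.D := inf_le_right
  obtain ⟨he₁, -⟩ := K'.adjacent_e₁ K hv' hU' hU h₀.symm h₁.symm
  obtain ⟨he₂, hmul⟩ := K'.adjacent_e₂ K hv' hU' hU h₂.symm h₁.symm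
  obtain ⟨-, hneg⟩ := K.adjacent_e₁ K' hv hU hU' h₀ h₂
  set a₀ := resO hU (K.a 0)
  set a₁ := resO hU (K.a 1)
  set a₀' := resO hU' (K'.a 0)
  set a₁' := resO hU' (K'.a 1)
  -- `δ' = a₁ δ`, which accounts for the factor `a₁ ^ b`
  have hd₁ := (K.φ.res hU).smul_det (K'.φ.res hU') he₁ he₂ (K.φ.res_det hU hd)
  have hdd := (K'.φ.res hU').det_unique (K'.φ.res_det hU' hd') hd₁
  have hγγ : res (M := divPow (tautTwo P) (2 * b)) hU γ =
      a₁ ^ b • res (M := divPow (tautTwo P) (2 * b)) hU' γ' := by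
    refine ((K.φ.res hU).bijective_tmul (K.φ.res_det hU hd) (2 * b) b).1 ?_
    have e₁ := congrArg (res (M := gammaDet P (2 * b) b) hU) hγ
    have e₂ := congrArg (res (M := gammaDet P (2 * b) b) hU') hγ'
    rw [FlagCohomology.res_res] at e₁ e₂
    have e₃ := ((res_tmul_tpowSec_det hU _ _ b).symm.trans (e₁.symm.trans e₂)).trans
      (res_tmul_tpowSec_det hU' _ _ b)
    rw [hdd] at e₃
    exact e₃.trans (tmul_tpowSec_smul _ _ _ b)
  -- the substitution taking `y` to `z` and back
  have hX : Polynomial.C a₀' + Polynomial.C a₁' * (Polynomial.C a₀ + Polynomial.C a₁ *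
      Polynomial.X) = Polynomial.X := by
    have e₁ : Polynomial.C a₀' + Polynomial.C a₁' * Polynomial.C a₀ = 0 := by
      rw [← Polynomial.C_mul, ← Polynomial.C_add, Polynomial.C_eq_zero]
      linear_combination a₁' * hneg - a₀' * hmul
    have e₂ : Polynomial.C a₁' * Polynomial.C a₁ = 1 := by
      rw [← Polynomial.C_mul, hmul, Polynomial.C_1]
    linear_combination e₁ + Polynomial.X * e₂
  rw [value, value, K.φ.resO_polyVal hU, K'.φ.resO_polyVal hU', hγγ, Frame.polyVal_smul,
    (K.φ.res hU).polyVal_comp (K'.φ.res hU') he₁ he₂]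
  · simp only [Polynomial.map_mul, Polynomial.map_pow, Polynomial.map_add, Polynomial.map_X,
      Polynomial.map_C, Polynomial.mul_comp, Polynomial.pow_comp, Polynomial.add_comp,
      Polynomial.X_comp, Polynomial.C_comp]
    rw [hX, mul_comm (Polynomial.X ^ j)]
  · refine Polynomial.natDegree_map_le.trans ((Polynomial.natDegree_mul_le_of_le
      (Polynomial.natDegree_X_pow_le k)
      (Polynomial.natDegree_pow_le_of_le j (m := 1) ?_)).trans (by omega))
    refine (Polynomial.natDegree_C_add).trans_le ((Polynomial.natDegree_C_mul_le _ _).trans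
      Polynomial.natDegree_X_le)

/-- The coefficients of the values of a section over two adjacent charts satisfy the hypotheses of
`coefficients_eq_zero`. -/
theorem constant_coeff (K : PlaneChart P v) (K' : PlaneChart P v') (hv : IsBasis v) (hv' : IsBasis v') (h₀ : v' 0 = v 0) (h₁ : v' 1 = v 2)
    (h₂ : v' 2 = v 1) {s : Γ(gammaDet P (2 * b) b, P.π ⁻¹ᵁ O)}
    {γ : Γ(divPow (tautTwo P) (2 * b), K.D)} {d : Γ(dual (extPow (tautTwo P) 2), K.D)}
    (hd : ev d (wedge ![K.φ.e₁, K.φ.e₂]) = 1)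
    (hγ : res (M := gammaDet P (2 * b) b) K.le s = tmul γ (tpowSec d b)) :
    (∀ i, 0 < i → i < b + 1 → ((b + 1).choose i : Γ(S, O)) *
      planeCoeff K.bijective 0 0 (ev γ (K.φ.monomial (2 * b) b)) = 0) ∧
    (planeCoeff K.bijective 0 0 (ev γ (K.φ.monomial (2 * b) b)) = 0 → γ = 0) := by
  obtain ⟨d', hd'⟩ := K'.φ.exists_det
  obtain ⟨γ', hγ'⟩ := (K'.φ.bijective_tmul hd' (2 * b) b).2
    (res (M := gammaDet P (2 * b) b) K'.le s)
  have key := coefficients_eq_zero (b := b)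
    (fun j k p q => planeCoeff K.bijective p q (K.value γ j k)) (fun j k p q _ => by
      rw [K.value_succ, planeCoeff_add, planeCoeff_fst_mul, planeCoeff_snd_mul])
    (fun j k p q hjk hpq => by
      refine planeDegreeLE_of_adjacent K.bijective K'.bijective.2
        (resO (inf_le_left : K.D ⊓ K'.D ≤ K.D)) (resO (inf_le_right : K.D ⊓ K'.D ≤ K'.D))
        (fun r => ?_) (K.adjacent_e₁ K' hv inf_le_left inf_le_right h₀ h₂).2
        (K.adjacent_e₂ K' hv inf_le_left inf_le_right h₁ h₂).2
        (K.injective_resO K' hv h₀ h₁ h₂)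
        (K.resO_value K' hv hv' h₀ h₁ h₂ hd hd' hγ hγ'.symm hjk) p q hpq
      exact (resO_resO _ _ _).trans (resO_resO _ _ _).symm)
  simp only [K.value_zero γ (show b ≤ 2 * b by omega)] at key
  refine ⟨key.1, fun h => K.φ.divPow_ext fun j hj => ?_⟩
  have h₃ : ev γ (K.φ.monomial (2 * b) j) = 0 :=
    eq_zero_of_planeCoeff K.bijective fun p q => by
      rw [← K.value_zero γ hj]
      exact key.2 h j 0 p q hj
  refine h₃.trans ?_
  rfl

/-- A section that vanishes on a chart vanishes on the adjacent one. -/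
theorem eq_zero_of_adjacent (hv' : IsBasis v') (h₀ : v' 0 = v 0) (h₁ : v' 1 = v 2)
    (h₂ : v' 2 = v 1) {s : Γ(gammaDet P (2 * b) b, P.π ⁻¹ᵁ O)}
    (hs : res (M := gammaDet P (2 * b) b) K.le s = 0) :
    res (M := gammaDet P (2 * b) b) K'.le s = 0 := by
  refine K'.φ.eq_zero_of_res (b := b) inf_le_left (K'.injective_resO K hv' h₀.symm h₂.symm h₁.symm) ?_
  refine Eq.trans ?_ ((congrArg (res (M := gammaDet P (2 * b) b) inf_le_right) hs).trans (map_zero _))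
  exact (FlagCohomology.res_res _ _ _).trans (FlagCohomology.res_res _ _ _).symm

end PlaneChart
end planeSections

/-! ### Vanishing of the direct image -/

section vanishing
variable {S : Scheme.{u}} {V : S.Modules} {P : FlagScheme V ![2]} {O : S.Opens}
  {v : Fin 3 → Γ(V, O)} {b : ℕ}

/-- The basis obtained by exchanging the last two vectors. -/
theorem IsBasis.exchange (hv : IsBasis v) : IsBasis ![v 0, v 2, v 1] :=
  isBasis_comp_three hv (Equiv.swap 1 2) fun i => by fin_cases i <;> rfl

/-- The basis obtained by exchanging the first two vectors. -/
theorem IsBasis.exchange_left (hv : IsBasis v) : IsBasis ![v 1, v 0, v 2] :=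
  isBasis_comp_three hv (Equiv.swap 0 1) fun i => by fin_cases i <;> rfl

/-- A section that vanishes on one chart vanishes. -/
theorem PlaneChart.eq_zero_of_res (hV : HasRank V 3) (hO : IsAffineOpen O) (hv : IsBasis v)
    (K : PlaneChart P v) {s : Γ(gammaDet P (2 * b) b, P.π ⁻¹ᵁ O)}
    (hs : res (M := gammaDet P (2 * b) b) K.le s = 0) : s = 0 := by
  obtain ⟨K₂⟩ := nonempty_planeChart (P := P) hO hv.exchange
  obtain ⟨K'⟩ := nonempty_planeChart (P := P) hO hv.exchange_left
  obtain ⟨K₃⟩ := nonempty_planeChart (P := P) hO hv.exchange_left.exchange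
  have h₂ := K.eq_zero_of_adjacent K₂ hv.exchange rfl rfl rfl hs
  -- the charts of `(v 0, v 1, v 2)` and `(v 1, v 0, v 2)` coincide; the neighbour of the latter is
  -- the third chart of the covering
  have hle : K'.D ≤ K.D := K.maximal _ K'.le _ _ _ _ K'.e₂_eq K'.e₁_eq
  have h' : res (M := gammaDet P (2 * b) b) K'.le s = 0 := by
    have := congrArg (res (M := gammaDet P (2 * b) b) hle) hs
    rwa [FlagCohomology.res_res, map_zero] at this
  have h₃ := K'.eq_zero_of_adjacent K₃ hv.exchange_left.exchange rfl rfl rfl h'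
  refine eq_of_locally fun x hx => ?_
  rcases mem_planeChart hV hv K K₂ K₃ hx with h | h | h
  · exact ⟨K.D, K.le, h, hs.trans (map_zero _).symm⟩
  · exact ⟨K₂.D, K₂.le, h, h₂.trans (map_zero _).symm⟩
  · exact ⟨K₃.D, K₃.le, h, h₃.trans (map_zero _).symm⟩

theorem natCast_eq_zero {p : ℕ} {X : Scheme.{u}} (hX : (p : Γ(X, ⊤)) = 0) (U : X.Opens) :
    (p : Γ(X, U)) = 0 := by
  have := congrArg (resO (le_top : U ≤ ⊤)) hX
  rwa [map_natCast, map_zero] at this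

/-- If `b + 1` is not a power of `p`, some binomial coefficient `(b + 1).choose i` with
`0 < i < b + 1` is invertible, and there are no sections over the chosen open sets. -/
theorem eq_zero_of_not_pow {p : ℕ} (hp : p.Prime) (hS : (p : Γ(S, ⊤)) = 0) (hV : HasRank V 3)
    (hb : ¬ ∃ s, b + 1 = p ^ s) (hO : IsAffineOpen O) (hv : IsBasis v)
    (s : Γ(gammaDet P (2 * b) b, P.π ⁻¹ᵁ O)) : s = 0 := by
  obtain ⟨K⟩ := nonempty_planeChart (P := P) hO hv
  obtain ⟨K₂⟩ := nonempty_planeChart (P := P) hO hv.exchange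
  obtain ⟨d, hd⟩ := K.φ.exists_det
  obtain ⟨γ, hγ⟩ := (K.φ.bijective_tmul hd (2 * b) b).2 (res (M := gammaDet P (2 * b) b) K.le s)
  obtain ⟨h₁, h₂⟩ := K.constant_coeff K₂ hv hv.exchange rfl rfl rfl hd hγ.symm
  obtain ⟨i, hi, hi', hdvd⟩ := exists_not_dvd_choose hp (Nat.succ_pos b) hb
  have hc := Int.isCoprime_iff_gcd_eq_one.2 (show Int.gcd (p : ℤ) ((b + 1).choose i : ℤ) = 1 from
    (Nat.Prime.coprime_iff_not_dvd hp).2 hdvd)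
  obtain ⟨y, z, hyz⟩ := hc
  have hyz' := congrArg (Int.cast : ℤ → Γ(S, O)) hyz
  push_cast at hyz'
  rw [natCast_eq_zero hS O, mul_zero, zero_add] at hyz'
  have hz := h₂ (by
    rw [← one_mul (planeCoeff _ _ _ _), ← hyz', mul_assoc, h₁ i hi hi', mul_zero])
  refine K.eq_zero_of_res hV hO hv ?_
  rw [← hγ, hz]
  exact zero_tmul _

/-- The affine open sets over which `V` has a basis form a basis of the topology. -/
theorem exists_affine_basis (hV : HasRank V 3) {W : S.Opens} {x : S} (hx : x ∈ W) :
    ∃ O ≤ W, x ∈ O ∧ IsAffineOpen O ∧ ∃ v : Fin 3 → Γ(V, O), IsBasis v := by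
  obtain ⟨U, hxU, e, he⟩ := hasRank_iff.1 hV x
  obtain ⟨O, hO, hxO, hle⟩ := exists_isAffineOpen_mem_and_subset (U := W ⊓ U) ⟨hx, hxU⟩
  exact ⟨O, hle.trans inf_le_left, hxO, hO, _, he.res (hle.trans inf_le_right)⟩

/-- The direct image vanishes if `b + 1` is not a power of `p`. -/
theorem isZero_pushforward (P : FlagScheme V ![2]) {p : ℕ} (hp : p.Prime) (hS : (p : Γ(S, ⊤)) = 0)
    (hV : HasRank V 3) (hb : ¬ ∃ s, b + 1 = p ^ s) :
    IsZero ((pushforward P.π).obj (gammaDet P (2 * b) b)) := by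
  have key (W : S.Opens) (s : Γ(gammaDet P (2 * b) b, P.π ⁻¹ᵁ W)) : s = 0 := by
    refine eq_of_locally fun x hx => ?_
    obtain ⟨O, hO, hxO, hOaff, v, hv⟩ := exists_affine_basis hV (W := W) (x := P.π x) hx
    refine ⟨P.π ⁻¹ᵁ O, Scheme.Hom.preimage_mono _ hO, hxO, ?_⟩
    rw [eq_zero_of_not_pow hp hS hV hb hOaff hv (res _ s), map_zero]
  rw [IsZero.iff_id_eq_zero]
  refine Scheme.Modules.hom_ext _ _ fun W => ?_
  ext s
  exact (key W _).trans (key W _).symm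

end vanishing

/-! ### The section given by the coefficient of the middle monomial -/

section unitVector
variable {X : Scheme.{u}} {M : X.Modules} {U W : X.Opens} {b : ℕ}

/-- The section `γ ⊗ (e₁ ∧ e₂)^(-b)` attached to a frame `(e₁, e₂)`, where `γ` extracts the
coefficient of `x^b y^b`. -/
noncomputable def Frame.unitVec (φ : Frame M W) (b : ℕ) : Γ(gammaDetOf M (2 * b) b, W) :=
  tmul (φ.exists_divPow (2 * b) fun j => if j = b then 1 else 0).choose
    (tpowSec φ.exists_det.choose b)

theorem Frame.unitVec_eq (φ : Frame M W) {d : Γ(dual (extPow M 2), W)}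
    (hd : ev d (wedge ![φ.e₁, φ.e₂]) = 1) {γ : Γ(divPow M (2 * b), W)}
    (hγ : ∀ j ≤ 2 * b, ev γ (φ.monomial (2 * b) j) = if j = b then 1 else 0) :
    φ.unitVec b = tmul γ (tpowSec d b) := by
  have h := (φ.exists_divPow (2 * b) fun j => if j = b then 1 else 0).choose_spec
  rw [unitVec, φ.det_unique φ.exists_det.choose_spec hd,
    φ.divPow_ext fun j hj => (h j hj).trans (hγ j hj).symm]
  rfl

theorem Frame.exists_unitVec (φ : Frame M W) (b : ℕ) :
    ∃ (d : Γ(dual (extPow M 2), W)) (γ : Γ(divPow M (2 * b), W)),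
      ev d (wedge ![φ.e₁, φ.e₂]) = 1 ∧
      (∀ j ≤ 2 * b, ev γ (φ.monomial (2 * b) j) = if j = b then 1 else 0) ∧
      φ.unitVec b = tmul γ (tpowSec d b) :=
  ⟨_, _, φ.exists_det.choose_spec,
    (φ.exists_divPow (2 * b) fun j => if j = b then 1 else 0).choose_spec, rfl⟩

theorem Frame.res_unitVec (φ : Frame M W) (h : U ≤ W) (b : ℕ) :
    FlagCohomology.res h (φ.unitVec b) = (φ.res h).unitVec b := by
  obtain ⟨d, γ, hd, hγ, e⟩ := φ.exists_unitVec b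
  rw [e, (φ.res h).unitVec_eq (φ.res_det h hd) (γ := FlagCohomology.res (M := divPow M (2 * b)) h γ)]
  · exact res_tmul_tpowSec_det h γ d b
  · intro j hj
    rw [← φ.resO_ev_monomial h, hγ j hj]
    split_ifs
    · exact map_one _
    · exact map_zero _

/-- The exchange of the two vectors replaces `δ` by `-δ` and preserves the middle monomial. -/
theorem Frame.swap_unitVec (φ : Frame M W) (hb : (-1 : Γ(X, W)) ^ b = 1) :
    φ.unitVec b = φ.swap.unitVec b := by
  obtain ⟨d, γ, hd, hγ, e⟩ := φ.exists_unitVec b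
  rw [e, φ.swap.unitVec_eq (φ.swap_det hd) (γ := γ)]
  · refine Eq.trans ?_ (tmul_tpowSec_smul _ _ _ b).symm
    rw [hb, one_smul]
  · intro j hj
    rw [φ.swap_monomial hj, hγ _ (Nat.sub_le _ _)]
    exact if_congr (by omega) rfl rfl

/-- The coefficient of `X^b` in `(1 - κ X)^(2b-j) (β X)^j` for `j ≤ 2b`. -/
theorem coeff_shear {R : Type*} [CommRing R] (hb : ∀ m, b < m → m ≤ 2 * b → (m.choose b : R) = 0)
    (κ β : R) {j : ℕ} (hj : j ≤ 2 * b) :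
    ((1 - Polynomial.C κ * Polynomial.X) ^ (2 * b - j) *
      (Polynomial.C β * Polynomial.X) ^ j).coeff b = if j = b then β ^ b else 0 := by
  have e : (1 - Polynomial.C κ * Polynomial.X) ^ (2 * b - j) =
      ((1 + Polynomial.X) ^ (2 * b - j)).comp (Polynomial.C (-κ) * Polynomial.X) := by
    simp [sub_eq_add_neg]
  rw [mul_pow, ← Polynomial.C_pow, ← mul_assoc, mul_comm _ (Polynomial.C _), mul_assoc,
    Polynomial.coeff_C_mul, Polynomial.coeff_mul_X_pow', e]
  rcases lt_trichotomy j b with h | h | h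
  · rw [if_pos h.le, if_neg h.ne, Polynomial.comp_C_mul_X_coeff, Polynomial.coeff_one_add_X_pow,
      Nat.choose_symm_of_eq_add (show 2 * b - j = (b - j) + b by omega), hb _ (by omega) (by omega),
      zero_mul, mul_zero]
  · subst h
    rw [if_pos le_rfl, if_pos rfl, Nat.sub_self, Polynomial.comp_C_mul_X_coeff,
      Polynomial.coeff_one_add_X_pow]
    simp
  · rw [if_neg (by omega), if_neg h.ne', mul_zero]

theorem Frame.shear_unitVec (φ : Frame M W)
    (hb : ∀ m, b < m → m ≤ 2 * b → (m.choose b : Γ(X, W)) = 0) (κ : Γ(X, W)) {β β' : Γ(X, W)}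
    (h : β * β' = 1) : φ.unitVec b = (φ.shear κ h).unitVec b := by
  obtain ⟨d, γ, hd, hγ, e⟩ := φ.exists_unitVec b
  rw [e, (φ.shear κ h).unitVec_eq (φ.shear_det κ h hd) (γ := β ^ b • γ)]
  · exact (smul_tmul_tpowSec_smul h γ d b).symm
  · intro j hj
    rw [smul_divPow_ev, φ.ev_shear_monomial κ h γ hj, Finset.sum_eq_single b]
    · rw [coeff_shear hb κ β' hj, hγ b (by omega), if_pos rfl, mul_one]
      split_ifs
      · rw [← mul_pow, h, one_pow]
      · exact mul_zero _
    · intro i hi hib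
      rw [hγ i (Nat.lt_succ_iff.1 (Finset.mem_range.1 hi)), if_neg hib, mul_zero]
    · intro hn
      exact absurd (Finset.mem_range.2 (by omega)) hn

/-- If `p` is odd, `b = p ^ s - 1` is even; if `p = 2`, the sign is trivial. -/
theorem neg_one_pow_eq_one {p s : ℕ} (hp : p.Prime) {R : Type*} [CommRing R] (hR : (p : R) = 0)
    (hb : b + 1 = p ^ s) : (-1 : R) ^ b = 1 := by
  rcases hp.eq_two_or_odd' with rfl | hodd
  · have h : (-1 : R) = 1 := by
      have : (2 : R) = 0 := by exact_mod_cast hR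
      linear_combination -this
    rw [h, one_pow]
  · exact Even.neg_one_pow (by
      have := hodd.pow (n := s)
      rw [← hb] at this
      exact (Nat.even_add_one.not_left.1 (Nat.not_even_iff_odd.2 this)))

/-- In characteristic `p`, for `b + 1 = p ^ s`, the section `unitVec` does not depend on the
frame. -/
theorem Frame.unitVec_eq_unitVec {p s : ℕ} (hp : p.Prime) (hX : (p : Γ(X, ⊤)) = 0)
    (hb : b + 1 = p ^ s) (φ ψ : Frame M W) : φ.unitVec b = ψ.unitVec b := by
  refine Frame.rel_of_swap_shear (fun φ ψ => φ.unitVec b = ψ.unitVec b) ?_ Eq.trans ?_ ?_ φ ψ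
  · intro U φ ψ H
    refine eq_of_locally fun x hx => ?_
    obtain ⟨V, h, hxV, e⟩ := H x hx
    exact ⟨V, h, hxV, by rw [φ.res_unitVec, ψ.res_unitVec, e]⟩
  · intro U φ
    exact φ.swap_unitVec (neg_one_pow_eq_one hp (natCast_eq_zero hX U) hb)
  · intro U φ κ β β' h
    refine φ.shear_unitVec (fun m h₁ h₂ => ?_) κ h
    obtain ⟨k, hk⟩ := dvd_choose_of_lt hp hb h₁ h₂
    rw [hk, Nat.cast_mul, natCast_eq_zero hX U, zero_mul]

end unitVector

/-! ### The direct image for `b + 1` a power of `p` -/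

section unitHomomorphism
variable {T S : Scheme.{u}} (g : T ⟶ S) {N : T.Modules}

/-- The homomorphism from the structure sheaf to a direct image that sends `1` to a given global
section. -/
noncomputable def unitHom (σ : Γ(N, ⊤)) : unitModule S ⟶ (pushforward g).obj N :=
  mkHom (M := unitModule S) (N := (pushforward g).obj N)
    (fun W a => (g.app W (show Γ(S, W) from a) • res (le_top : g ⁻¹ᵁ W ≤ ⊤) σ : Γ(N, g ⁻¹ᵁ W)))
    (fun W a a' => (congrArg (· • res (le_top : g ⁻¹ᵁ W ≤ ⊤) σ)
      (map_add (g.app W).hom (show Γ(S, W) from a) a')).trans (add_smul _ _ _))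
    (fun W a a' => (congrArg (· • res (le_top : g ⁻¹ᵁ W ≤ ⊤) σ)
      (map_mul (g.app W).hom a (show Γ(S, W) from a'))).trans (mul_smul _ _ _))
    (fun {W W'} h a => by
      refine Eq.trans ?_ (map_smulₛₗ (res (M := N) (Scheme.Hom.preimage_mono g h)) _ _).symm
      rw [resO_app, FlagCohomology.res_res]
      rfl)

theorem unitHom_app (σ : Γ(N, ⊤)) (W : S.Opens) (a : Γ(S, W)) :
    Hom.app (unitHom g σ) W (funSec a) = (g.app W a • res le_top σ : Γ(N, g ⁻¹ᵁ W)) := rfl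

theorem unitModule_hom_ext {E : S.Modules} {f f' : unitModule S ⟶ E}
    (h : Hom.app f ⊤ (funSec 1) = Hom.app f' ⊤ (funSec 1)) : f = f' := by
  refine Scheme.Modules.hom_ext _ _ fun W => ?_
  ext a
  exact (isBasis_one (X := S) (W := ⊤)).ext_app f f' (fun _ => h) le_top a

end unitHomomorphism

section unitSections
variable {S : Scheme.{u}} {V : S.Modules} {P : FlagScheme V ![2]} {O : S.Opens}
  {v : Fin 3 → Γ(V, O)} {b : ℕ}

/-- The sections `unitVec` of all frames glue to a global section. -/
theorem exists_unitSection (P : FlagScheme V ![2]) {p s : ℕ} (hp : p.Prime)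
    (hS : (p : Γ(S, ⊤)) = 0) (hb : b + 1 = p ^ s) :
    ∃ σ : Γ(gammaDet P (2 * b) b, ⊤), ∀ (W : P.X.Opens) (φ : Frame (tautTwo P) W),
      res (M := gammaDet P (2 * b) b) le_top σ = φ.unitVec b := by
  have hX : (p : Γ(P.X, ⊤)) = 0 := by
    have := congrArg (P.π.app ⊤) hS
    rw [map_natCast, map_zero] at this
    exact this
  obtain ⟨σ, hσ⟩ := exists_of_locally (M := gammaDet P (2 * b) b) (U := ⊤)
    (fun W t => ∃ φ : Frame (tautTwo P) W, φ.unitVec b = t)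
    (by
      rintro W W' h _ ⟨φ, rfl⟩
      exact ⟨φ.res h, (φ.res_unitVec h b).symm⟩)
    (by
      rintro W _ _ - ⟨φ, rfl⟩ ⟨ψ, rfl⟩
      exact φ.unitVec_eq_unitVec hp hX hb ψ)
    (fun x hx => by
      obtain ⟨W, hW, hxW, ⟨φ⟩⟩ := exists_frame (P := P) hx
      exact ⟨W, hW, hxW, _, φ, rfl⟩)
  refine ⟨σ, fun W φ => eq_of_locally fun x hx => ?_⟩
  obtain ⟨W', h, hxW', ψ, hψ⟩ := hσ x trivial
  refine ⟨W ⊓ W', inf_le_left, ⟨hx, hxW'⟩, ?_⟩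
  have e₁ := congrArg (res (M := gammaDet P (2 * b) b) (inf_le_right : W ⊓ W' ≤ W')) hψ
  rw [FlagCohomology.res_res] at e₁ ⊢
  refine e₁.symm.trans ?_
  refine (ψ.res_unitVec inf_le_right b).trans (Eq.trans ?_ (φ.res_unitVec inf_le_left b).symm)
  exact (ψ.res inf_le_right).unitVec_eq_unitVec hp hX hb (φ.res inf_le_left)

/-- Functions of the base are their own constant coefficients. -/
theorem PlaneChart.planeCoeff_app (K : PlaneChart P v) (r : Γ(S, O)) :
    planeCoeff K.bijective 0 0 (resO K.le (P.π.app O r)) = r :=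
  (planeCoeff_C K.bijective 0 0 r).trans (if_pos ⟨rfl, rfl⟩)

/-- The section `unitVec` has no annihilator among the functions of the base. -/
theorem PlaneChart.eq_zero_of_smul (K : PlaneChart P v) {t : Γ(gammaDet P (2 * b) b, P.π ⁻¹ᵁ O)}
    (ht : res (M := gammaDet P (2 * b) b) K.le t = K.φ.unitVec b) {r : Γ(S, O)}
    (h : P.π.app O r • t = 0) : r = 0 := by
  obtain ⟨d, γ, hd, hγ, e⟩ := K.φ.exists_unitVec b
  have h₁ := congrArg (res (M := gammaDet P (2 * b) b) K.le) h
  rw [map_smulₛₗ, map_zero, ht, e] at h₁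
  have h₂ := (K.φ.bijective_tmul hd (2 * b) b).1 (a₁ := resO K.le (P.π.app O r) • γ) (a₂ := 0)
    ((smul_tmul _ _ _).trans (h₁.trans (zero_tmul _).symm))
  have h₃ := congrArg (fun γ => ev γ (K.φ.monomial (2 * b) b)) h₂
  have h₄ : resO K.le (P.π.app O r) = 0 := by
    refine Eq.trans ?_ ((smul_divPow_ev _ _ _).symm.trans h₃)
    rw [hγ b (by omega), if_pos rfl, mul_one]
  rw [← K.planeCoeff_app r, h₄, planeCoeff_zero]

/-- Every section is the multiple of `unitVec` by the constant coefficient of its value on the middle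
monomial, because the difference has constant coefficient zero. -/
theorem PlaneChart.exists_eq_smul (hV : HasRank V 3) (hO : IsAffineOpen O) (hv : IsBasis v)
    (K : PlaneChart P v) {t : Γ(gammaDet P (2 * b) b, P.π ⁻¹ᵁ O)}
    (ht : res (M := gammaDet P (2 * b) b) K.le t = K.φ.unitVec b)
    (s : Γ(gammaDet P (2 * b) b, P.π ⁻¹ᵁ O)) : ∃ r : Γ(S, O), P.π.app O r • t = s := by
  obtain ⟨K₂⟩ := nonempty_planeChart (P := P) hO hv.exchange
  obtain ⟨d, γ, hd, hγ, e⟩ := K.φ.exists_unitVec b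
  obtain ⟨γ', hγ'⟩ := (K.φ.bijective_tmul hd (2 * b) b).2 (res (M := gammaDet P (2 * b) b) K.le s)
  let r := planeCoeff K.bijective 0 0 (ev γ' (K.φ.monomial (2 * b) b))
  -- the section `s - r t` has constant coefficient zero
  have hs : res (M := gammaDet P (2 * b) b) K.le (s + (-P.π.app O r) • t) =
      tmul (γ' + (-resO K.le (P.π.app O r)) • γ) (tpowSec d b) := by
    rw [map_add, map_smulₛₗ, map_neg, ht, e, ← hγ']
    refine Eq.trans ?_ (add_tmul _ _ _).symm
    exact congrArg _ (smul_tmul _ _ _).symm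
  have hz := (K.constant_coeff K₂ hv hv.exchange rfl rfl rfl hd hs).2 (by
    rw [show ev (γ' + (-resO K.le (P.π.app O r)) • γ) (K.φ.monomial (2 * b) b) =
      ev γ' (K.φ.monomial (2 * b) b) + ev ((-resO K.le (P.π.app O r)) • γ)
        (K.φ.monomial (2 * b) b) from add_ev (M := symPow (dual (tautTwo P)) (2 * b)) _ _ _,
      smul_divPow_ev, hγ b (by omega), if_pos rfl, mul_one, planeCoeff_add, planeCoeff_neg,
      K.planeCoeff_app]
    exact add_neg_cancel _)
  rw [hz] at hs
  have h := K.eq_zero_of_res hV hO hv (hs.trans (zero_tmul _))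
  refine ⟨r, ?_⟩
  rw [neg_smul, add_neg_eq_zero] at h
  exact h.symm

/-- The global section `σ` which restricts to `unitVec` for all frames freely generates the direct
image. -/
theorem bijective_unitHom (hV : HasRank V 3) {σ : Γ(gammaDet P (2 * b) b, ⊤)}
    (hσ : ∀ (W : P.X.Opens) (φ : Frame (tautTwo P) W),
      res (M := gammaDet P (2 * b) b) le_top σ = φ.unitVec b) (W : S.Opens) :
    Function.Bijective (Hom.app (unitHom P.π σ) W) := by
  have hinj (W : S.Opens) : Function.Injective (Hom.app (unitHom P.π σ) W) := by
    refine (injective_iff_map_eq_zero _).2 fun a ha => ?_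
    refine eq_of_locally fun x hx => ?_
    obtain ⟨O, hO, hxO, hOaff, v, hv⟩ := exists_affine_basis hV hx
    obtain ⟨K⟩ := nonempty_planeChart (P := P) hOaff hv
    refine ⟨O, hO, hxO, ?_⟩
    rw [map_zero]
    refine K.eq_zero_of_smul (b := b) (t := res (M := gammaDet P (2 * b) b) le_top σ)
      (by rw [FlagCohomology.res_res]; exact hσ _ _) ?_
    refine (app_res (unitHom P.π σ) hO a).trans ?_
    rw [ha, map_zero]
    rfl
  refine ⟨hinj W, fun s => ?_⟩
  obtain ⟨a, ha⟩ := exists_of_locally (M := unitModule S) (U := W)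
    (fun O a => ∃ h : O ≤ W, Hom.app (unitHom P.π σ) O a =
      res (M := (pushforward P.π).obj (gammaDet P (2 * b) b)) h s)
    (by
      rintro O O' h a ⟨hO, e⟩
      exact ⟨h.trans hO, by rw [app_res, e, FlagCohomology.res_res]⟩)
    (by
      rintro O a a' - ⟨hO, e⟩ ⟨_, e'⟩
      exact hinj O (e.trans e'.symm))
    (fun x hx => by
      obtain ⟨O, hO, hxO, hOaff, v, hv⟩ := exists_affine_basis hV hx
      obtain ⟨K⟩ := nonempty_planeChart (P := P) hOaff hv
      obtain ⟨r, hr⟩ := K.exists_eq_smul (b := b) hV hOaff hv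
        (t := res (M := gammaDet P (2 * b) b) le_top σ)
        (by rw [FlagCohomology.res_res]; exact hσ _ _)
        (res (M := (pushforward P.π).obj (gammaDet P (2 * b) b)) hO s)
      exact ⟨O, hO, hxO, funSec r, hO, hr⟩)
  refine ⟨a, eq_of_locally fun x hx => ?_⟩
  obtain ⟨O, hO, hxO, _, e⟩ := ha x hx
  exact ⟨O, hO, hxO, by rw [← app_res, e]⟩

/-- The canonical isomorphism from the structure sheaf onto the direct image, for `b + 1 = p ^ s`. -/
theorem existsUnique_isCanonicalUnit (P : FlagScheme V ![2]) {p s : ℕ} (hp : p.Prime)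
    (hS : (p : Γ(S, ⊤)) = 0) (hV : HasRank V 3) (hb : b + 1 = p ^ s) :
    ∃! η : unitModule S ≅ (pushforward P.π).obj (gammaDet P (2 * b) b), IsCanonicalUnit b η := by
  obtain ⟨σ, hσ⟩ := exists_unitSection P hp hS hb
  have := isIso_of_bijective (unitHom P.π σ) (bijective_unitHom hV hσ)
  have h₁ : Hom.app (unitHom P.π σ) ⊤ (funSec 1) = σ := by
    refine (unitHom_app P.π σ ⊤ 1).trans ?_
    rw [map_one, one_smul]
    exact res_refl _ _
  refine ⟨asIso (unitHom P.π σ), fun W φ d hd γ hγ => ?_, fun η hη => ?_⟩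
  · refine (congrArg (res (M := gammaDet P (2 * b) b) le_top) h₁).trans ?_
    exact (hσ W φ).trans (φ.unitVec_eq hd hγ)
  · ext1
    refine unitModule_hom_ext (Eq.trans ?_ h₁.symm)
    refine eq_of_locally (M := gammaDet P (2 * b) b) (U := P.π ⁻¹ᵁ ⊤) fun x hx => ?_
    obtain ⟨W, hW, hxW, ⟨φ⟩⟩ := exists_frame (P := P) hx
    obtain ⟨d, γ, hd, hγ, e⟩ := φ.exists_unitVec b
    exact ⟨W, hW, hxW, ((hη W φ d hd γ hγ).trans e.symm).trans (hσ W φ).symm⟩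

end unitSections

end FlagCohomology

theorem mainTheorem11 (p : ℕ) [Fact p.Prime] (S : Scheme.{u}) (hS : (p : Γ(S, ⊤)) = 0)
    (V : S.Modules) (hV : HasRank V 3) (Fl : FlagScheme V ![1, 2, 3]) (P : FlagScheme V ![2])
    (b : ℕ) :
    (∃! θ : gammaDet P (2 * b) b ≅
        (R1 (forgetFlag Fl P)).obj (flagLine Fl (b + 1) (b + 1) 0), IsCanonicalR1 b θ) ∧
    ((¬ ∃ s : ℕ, b + 1 = p ^ s) →
      IsZero ((Scheme.Modules.pushforward P.π).obj (gammaDet P (2 * b) b))) ∧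
    (∀ s : ℕ, b + 1 = p ^ s →
      ∃! η : unitModule S ≅ (Scheme.Modules.pushforward P.π).obj (gammaDet P (2 * b) b),
        IsCanonicalUnit b η) := by
  have hp : p.Prime := Fact.out
  exact ⟨existsUnique_isCanonicalR1 Fl P hV b, isZero_pushforward P hp hS hV,
    fun _ hb => existsUnique_isCanonicalUnit P hp hS hV hb⟩
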